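/- **Setting.** Fix $A\ge 0$ and, for $\alpha\ge 0$, consider the two-user channel $Y=\alpha X^{[1]}+A\alpha X^{[2]}+N$ with $X^{[1]},X^{[2]}\in\{\pm1\}$ and $N\sim\mathcal N(0,1)$. For $x=(\pi_1(x),\pi_2(x))\in\mathcal X=\{\pm1\}^2$ let $p(y|x)$ be the density of $Y$ given $x$. For a nonnegative vector $\mathbf u=(u[x])_{x\in\mathcal X}$ let $$\kappa_x(\mathbf u)=\int \frac{\partial}{\partial\alpha}p(y|x)\,\log_2\frac{\sum_{x'}u[x']\,p(y|x')}{u[x]\,p(y|x)}\,dy ,$$ and for log-likelihood ratios $u,v\in[-\infty,\infty]$ put $\kappa_x(u,v)=\kappa_x(\mathbf u)$ with $\mathbf u[x']=q_{\pi_1(x')}(u)\,q_{\pi_2(x')}(v)$, where $q_{+1}(u)=e^u/(1+e^u)$ and $q_{-1}=1-q_{+1}$. **Density evolution.** Let $\lambda(z)=\sum_i\lambda_iz^{i-1}$ and $\rho(z)=\sum_j\rho_jz^{j-1}$ be polynomial degree distributions from the edge perspective, with $\rho_1=0$, and let $L_i=(\lambda_i/i)/\sum_j(\lambda_j/j)$.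 Densities are probability measures on $[-\infty,\infty]$, of messages conditioned on the symbol $+1$; $\mathsf a(su)$, $s=\pm1$, is the image of $\mathsf a$ under $u\mapsto su$. With $\circledast$ the law of a sum and $\boxast$ the law of $2\,\mathrm{artanh}(\tanh\frac u2\tanh\frac v2)$ of independent messages, let $\lambda(\mathsf a)=\sum_i\lambda_i\mathsf a^{\circledast(i-1)}$, $L(\mathsf a)=\sum_iL_i\mathsf a^{\circledast i}$, $\rho(\mathsf a)=\sum_j\rho_j\mathsf a^{\boxast(j-1)}$. Let $f_{2\to1}(\mathsf b)$ be the law of $X^{[1]}m^{[1]}$, where $(X^{[1]},X^{[2]})$ is uniform on $\mathcal X$, $m^{[2]}$ given the inputs has density $\mathsf b(X^{[2]}u)$ and is independent of $Y$, and $$m^{[1]}=\log\frac{p(Y|{+}{+})e^{m^{[2]}}+p(Y|{+}{-})}{p(Y|{-}{+})e^{m^{[2]}}+p(Y|{-}{-})};$$ $f_{1\to2}$ is the same with the users exchanged. Density evolution is $$\mathsf a_{\ell+1}=f_{2\to1}(L(\rho(\mathsf b_\ell)))\circledast\lambda(\rho(\mathsf a_\ell)),\qquad \mathsf b_{\ell+1}=f_{1\to2}(L(\rho(\mathsf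 a_\ell)))\circledast\lambda(\rho(\mathsf b_\ell)),$$ started from $\mathsf a_0=\mathsf b_0=\Delta_0$ (the point mass at $0$); a fixed point is a pair $(\mathsf a,\mathsf b)$ with $\mathsf a=f_{2\to1}(L(\rho(\mathsf b)))\circledast\lambda(\rho(\mathsf a))$ and $\mathsf b=f_{1\to2}(L(\rho(\mathsf a)))\circledast\lambda(\rho(\mathsf b))$. For $x\in\mathcal X$ let $$\mathsf F_x[\mathsf a,\mathsf b](u,v)=\mathsf a'(\pi_1(x)u)\,\mathsf b'(\pi_2(x)v),\qquad \mathsf a'=L(\rho(\mathsf a)),\ \mathsf b'=L(\rho(\mathsf b)),$$ (a product measure; $\mathsf a',\mathsf b'$ are the densities of the messages from the variable nodes into the function node) and $$\mathsf G^{\mathrm{BP}}(\alpha,\mathsf a,\mathsf b)=\sum_{x\in\mathcal X}\tfrac14\int \mathsf F_x[\mathsf a,\mathsf b](u,v)\,\kappa_x(u,v)\,du\,dv .$$ **Transmission and decoding.** Take any sequence of socket-permutation LDPC ensembles of block lengths $n\to\infty$ with bounded node degrees and check degrees at least $2$, in which the fractions of variable nodes of degree $i$ and of edges at checks of degree $j$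 tend to $L_i$ and $\rho_j$. Both users use the same ensemble. User $j$ transmits a word $\mathbf x^{[j]}\in\{\pm1\}^n$ of type one-half: it is a codeword of at least one graph of the ensemble, and the fraction of $+1$ among the variable nodes of each degree $i$ with $L_i>0$ tends to $1/2$. Independently, each user's Tanner graph is uniform among the graphs of the ensemble which have $\mathbf x^{[j]}$ as a codeword, the two users' variable nodes are matched through the function nodes by a uniform permutation, and the noise is i.i.d. The joint decoder is belief propagation for this graph with all variable-to-check messages initially $0$; in each iteration the variable-to-check messages of both users are updated from the previous ones (check nodes by the $\tanh$ rule, function nodes by the rule above). Let $\Phi^{\mathrm{BP},\ell,n}=(U,V)$ be the pair of messages, after $\ell$ iterations, from its two variable nodes into a uniformly random function node, $X$ the channel input there, and $$\mathsf g^{\mathrm{BP},\ell,n}(\alpha)=\sum_{x}P(X=x)\,\mathbb E\bigl[\kappa_x(\Phi^{\mathrm{BP},\ell,n})\,\big|\,X=x\bigr],\qquad \mathsf g^{\mathrm{BP}}(\alpha)=\lim_{\ell\to\infty}\lim_{n\to\infty}\mathsf g^{\mathrm{BP},\ell,n}(\alpha).$$ **Lemma 2.** Let $\alpha\ge0$.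 Density evolution started from $(\Delta_0,\Delta_0)$ converges weakly to a pair of probability measures which is a fixed point. Let $(\mathsf a,\mathsf b)$ be this fixed point. Then: 1. for every $\ell$ and $x$, the law of $\Phi^{\mathrm{BP},\ell,n}$ given $X=x$ converges weakly to the product $\mathsf F_x[\mathsf a_\ell,\mathsf b_\ell]$ as $n\to\infty$, and $\mathsf F_x[\mathsf a_\ell,\mathsf b_\ell]$ converges weakly to $\mathsf F_x[\mathsf a,\mathsf b]$ as $\ell\to\infty$; 2. $\kappa_x$ is integrable with respect to $\mathsf F_x[\mathsf a,\mathsf b]$ and to the laws of $\Phi^{\mathrm{BP},\ell,n}$ given $X=x$, the limits defining $\mathsf g^{\mathrm{BP}}(\alpha)$ exist, and $$\mathsf g^{\mathrm{BP}}(\alpha)=\mathsf G^{\mathrm{BP}}(\alpha,\mathsf a,\mathsf b).$$ That is, the asymptotic BP-GEXIT curve is given in parametric form by $(\alpha,\mathsf G^{\mathrm{BP}}(\alpha,\mathsf a,\mathsf b))$. -/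

import Mathlib

open MeasureTheory ProbabilityTheory Filter Topology
open scoped NNReal ENNReal

noncomputable section

namespace GMAC

/-! ### The two-user binary-input Gaussian multiple-access channel -/

/-- A symbol `±1`, seen as a real number. -/
def bit (s : ℤˣ) : ℝ := ((s : ℤ) : ℝ)

/-- A pair of channel inputs `x = (x₁, x₂) ∈ {±1}²`; the projections `π₁, π₂` are `x.1, x.2`. -/
abbrev Input : Type := ℤˣ × ℤˣ

/-- The noiseless output `h₁ x₁ + h₂ x₂` with gains `h₁ = α` and `h₂ = A α`. -/
def chMean (A α : ℝ) (x : Input) : ℝ := α * bit x.1 + A * α * bit x.2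

/-- The channel density `p(y | x)`: Gaussian noise of variance one. -/
def chDensity (A α : ℝ) (x : Input) (y : ℝ) : ℝ := gaussianPDFReal (chMean A α x) 1 y

/-- The law of the channel output `Y` given the input `x`. -/
def chLaw (A α : ℝ) (x : Input) : Measure ℝ := gaussianReal (chMean A α x) 1

/-! ### Log-likelihood ratios in `[-∞, +∞]` -/

/-- `e^m / (1 + e^m)`, the probability of `+1` under the log-likelihood ratio `m`. -/
def logistic (m : EReal) : ℝ :=
  if m = ⊤ then 1 else if m = ⊥ then 0 else Real.exp m.toReal / (1 + Real.exp m.toReal)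

/-- The probability of the symbol `s` under the log-likelihood ratio `m`. -/
def symProb (s : ℤˣ) (m : EReal) : ℝ := if s = 1 then logistic m else 1 - logistic m

/-- `tanh (m / 2)`, with values in `[-1, 1]`. -/
def tanhHalf (m : EReal) : ℝ :=
  if m = ⊤ then 1 else if m = ⊥ then -1 else Real.tanh (m.toReal / 2)

/-- `2 artanh t = log ((1 + t) / (1 - t))` for `t ∈ [-1, 1]`, the inverse of `tanhHalf`. -/
def twoArtanh (t : ℝ) : EReal :=
  if 1 ≤ t then ⊤ else if t ≤ -1 then ⊥ else ((Real.log ((1 + t) / (1 - t)) : ℝ) : EReal)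

/-- Multiplication of a log-likelihood ratio by a sign. -/
def signMul (s : ℤˣ) (m : EReal) : EReal := if s = 1 then m else -m

/-- Message from the function node to the variable node of user 1, given the message `m` of user 2
and the channel output `y`: `log ((ν₍₊₊₎ e^m + ν₍₊₋₎) / (ν₍₋₊₎ e^m + ν₍₋₋₎))`, where numerator and
denominator have been divided by `1 + e^m` so that `m = ±∞` makes sense. -/
def funMsg1 (A α : ℝ) (m : EReal) (y : ℝ) : EReal :=
  ((Real.log
    ((chDensity A α (1, 1) y * logistic m + chDensity A α (1, -1) y * (1 - logistic m)) /
     (chDensity A α (-1, 1) y * logistic m + chDensity A α (-1, -1) y * (1 - logistic m))) : ℝ) :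
    EReal)

/-- Message from the function node to the variable node of user 2, given the message `m` of user 1
and the channel output `y`: `log ((ν₍₊₊₎ e^m + ν₍₋₊₎) / (ν₍₊₋₎ e^m + ν₍₋₋₎))`. -/
def funMsg2 (A α : ℝ) (m : EReal) (y : ℝ) : EReal :=
  ((Real.log
    ((chDensity A α (1, 1) y * logistic m + chDensity A α (-1, 1) y * (1 - logistic m)) /
     (chDensity A α (1, -1) y * logistic m + chDensity A α (-1, -1) y * (1 - logistic m))) : ℝ) :
    EReal)

/-! ### GEXIT kernel -/

/-- The GEXIT kernel `κ_x(u)` at a vector `u` indexed by the four inputs. -/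
def kernelVec (A α : ℝ) (x : Input) (u : Input → ℝ) : ℝ :=
  ∫ y : ℝ, deriv (fun t => chDensity A t x y) α *
    Real.logb 2 ((∑ x' : Input, u x' * chDensity A α x' y) / (u x * chDensity A α x y))

/-- The product estimate of the input pair which the log-likelihood ratios `(u, v)` define. -/
def estimate (p : EReal × EReal) : Input → ℝ := fun x => symProb x.1 p.1 * symProb x.2 p.2

/-- The GEXIT kernel `κ_x(u, v)` as a function of two log-likelihood ratios. -/
def kernel (A α : ℝ) (x : Input) (p : EReal × EReal) : ℝ := kernelVec A α x (estimate p)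

/-! ### Density evolution

A density of log-likelihood ratios (an `L`-density) is a measure on `[-∞, +∞]`; it describes a
message conditioned on the transmission of `+1`. -/

/-- The density `a(s u)`: the image of `a` under multiplication by the sign `s`. -/
def reflect (s : ℤˣ) (a : Measure EReal) : Measure EReal := a.map (signMul s)

/-- Variable-node convolution. -/
def varConv (a b : Measure EReal) : Measure EReal :=
  (a.prod b).map (fun p => p.1 + p.2)

/-- Powers of the variable-node convolution; the zeroth power is the point mass at `0`. -/
def varPow (a : Measure EReal) : ℕ → Measure EReal
  | 0 => Measure.dirac 0
  | k + 1 => varConv (varPow a k) a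

/-- Check-node convolution. -/
def chkConv (a b : Measure EReal) : Measure EReal :=
  (a.prod b).map (fun p => twoArtanh (tanhHalf p.1 * tanhHalf p.2))

/-- Powers of the check-node convolution; the zeroth power is the point mass at `+∞`. -/
def chkPow (a : Measure EReal) : ℕ → Measure EReal
  | 0 => Measure.dirac ⊤
  | k + 1 => chkConv (chkPow a k) a

/-- The fraction `L_i = (λ_i / i) / ∑_j (λ_j / j)` of variable nodes of degree `i`. -/
def nodeFrac (lam : ℕ →₀ ℝ≥0) (i : ℕ) : ℝ≥0 :=
  (lam i / i) / lam.sum (fun j w => w / j)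

/-- `λ(a) = ∑_i λ_i a^{⊛(i-1)}`. -/
def lamOp (lam : ℕ →₀ ℝ≥0) (a : Measure EReal) : Measure EReal :=
  ∑ i ∈ lam.support, lam i • varPow a (i - 1)

/-- `L(a) = ∑_i L_i a^{⊛ i}`: all checks of a variable node feed its message to the function
node. -/
def nodeOp (lam : ℕ →₀ ℝ≥0) (a : Measure EReal) : Measure EReal :=
  ∑ i ∈ lam.support, nodeFrac lam i • varPow a i

/-- `ρ(a) = ∑_j ρ_j a^{⊞(j-1)}`. -/
def rhoOp (rho : ℕ →₀ ℝ≥0) (a : Measure EReal) : Measure EReal :=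
  ∑ j ∈ rho.support, rho j • chkPow a (j - 1)

/-- `L(ρ(a))`: the density of the messages from the variable nodes to the function nodes, when `a`
is the density of the messages from the variable nodes to the check nodes. -/
def varToFun (lam rho : ℕ →₀ ℝ≥0) (a : Measure EReal) : Measure EReal := nodeOp lam (rhoOp rho a)

/-- `f_{2→1}`: from the density of the messages of user 2 into the function node, the density of
the messages from the function node to user 1, with `p(x) = 1/4`. -/
def f21 (A α : ℝ) (b : Measure EReal) : Measure EReal :=
  ∑ x : Input, (1 / 4 : ℝ≥0) •
    ((reflect x.2 b).prod (chLaw A α x)).map (fun p => signMul x.1 (funMsg1 A α p.1 p.2))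

/-- `f_{1→2}`: from the density of the messages of user 1 into the function node, the density of
the messages from the function node to user 2, with `p(x) = 1/4`. -/
def f12 (A α : ℝ) (a : Measure EReal) : Measure EReal :=
  ∑ x : Input, (1 / 4 : ℝ≥0) •
    ((reflect x.1 a).prod (chLaw A α x)).map (fun p => signMul x.2 (funMsg2 A α p.1 p.2))

/-- One step of density evolution for the joint decoder. -/
def deStep (A α : ℝ) (lam rho : ℕ →₀ ℝ≥0) (ab : Measure EReal × Measure EReal) :
    Measure EReal × Measure EReal :=
  (varConv (f21 A α (varToFun lam rho ab.2)) (lamOp lam (rhoOp rho ab.1)),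
   varConv (f12 A α (varToFun lam rho ab.1)) (lamOp lam (rhoOp rho ab.2)))

/-- Density evolution `(a_ℓ, b_ℓ)`, started from uninformative messages (the point mass at `0`). -/
def deIter (A α : ℝ) (lam rho : ℕ →₀ ℝ≥0) : ℕ → Measure EReal × Measure EReal
  | 0 => (Measure.dirac 0, Measure.dirac 0)
  | l + 1 => deStep A α lam rho (deIter A α lam rho l)

/-- Weak convergence of measures on a compact space. -/
def WeakTendsto {S : Type*} [TopologicalSpace S] [MeasurableSpace S]
    (μ : ℕ → Measure S) (ν : Measure S) : Prop :=
  ∀ f : C(S, ℝ), Tendsto (fun k => ∫ s, f s ∂(μ k)) atTop (𝓝 (∫ s, f s ∂ν))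

/-- `(a, b)` solves the fixed-point equations of density evolution at the channel parameter `α`. -/
def IsFixedPoint (A α : ℝ) (lam rho : ℕ →₀ ℝ≥0) (a b : Measure EReal) : Prop :=
  a = varConv (f21 A α (varToFun lam rho b)) (lamOp lam (rhoOp rho a)) ∧
  b = varConv (f12 A α (varToFun lam rho a)) (lamOp lam (rhoOp rho b))

/-- `(a, b)` is a fixed point of density evolution, and density evolution reaches it from
uninformative messages. -/
def IsReachedFixedPoint (A α : ℝ) (lam rho : ℕ →₀ ℝ≥0) (a b : Measure EReal) : Prop :=
  IsFixedPoint A α lam rho a b ∧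
  WeakTendsto (fun l => (deIter A α lam rho l).1) a ∧
  WeakTendsto (fun l => (deIter A α lam rho l).2) b

/-- `F_x[a, b]`: the law of two independent log-likelihood ratios `(u, v)` with densities
`a'(x₁ u)` and `b'(x₂ v)`, where `a' = L(ρ(a))` and `b' = L(ρ(b))` are the densities of the
messages from the variable nodes into the function node. -/
def F (lam rho : ℕ →₀ ℝ≥0) (x : Input) (a b : Measure EReal) : Measure (EReal × EReal) :=
  (reflect x.1 (varToFun lam rho a)).prod (reflect x.2 (varToFun lam rho b))

/-- The BP-GEXIT value `∑_x p(x) ∫ F_x[a, b] κ_x` of `(a, b)`, with `p(x) = 1/4`. -/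
def gexitValue (A α : ℝ) (lam rho : ℕ →₀ ℝ≥0) (a b : Measure EReal) : ℝ :=
  ∑ x : Input, (1 / 4 : ℝ) * ∫ p, kernel A α x p ∂(F lam rho x a b)

/-! ### The code ensemble, transmission and the joint iterative decoder -/

/-- The node degrees of an LDPC ensemble of block length `n` with `m` checks. -/
structure Degrees where
  /-- block length -/
  n : ℕ
  /-- number of checks -/
  m : ℕ
  /-- degrees of the variable nodes -/
  vdeg : Fin n → ℕ
  /-- degrees of the check nodes -/
  cdeg : Fin m → ℕ

namespace Degrees

variable (E : Degrees)

/-- Variable-node sockets; they also serve as names of the edges. -/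
abbrev VSock : Type := Σ v : Fin E.n, Fin (E.vdeg v)

/-- Check-node sockets. -/
abbrev CSock : Type := Σ c : Fin E.m, Fin (E.cdeg c)

/-- A Tanner graph of the ensemble: a matching of variable sockets to check sockets. -/
abbrev Tanner : Type := E.VSock ≃ E.CSock

variable {E}

/-- The word `x ∈ {±1}ⁿ` satisfies every check of the Tanner graph `σ`. -/
def IsCodeword (σ : E.Tanner) (x : Fin E.n → ℤˣ) : Prop :=
  ∀ c : Fin E.m, ∏ j : Fin (E.cdeg c), x (σ.symm ⟨c, j⟩).1 = 1

/-- The message from the check node to the variable node along the edge `e`, when `μ` are the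
messages from the variable nodes to the check nodes. -/
def checkMsg (σ : E.Tanner) (μ : E.VSock → EReal) (e : E.VSock) : EReal :=
  twoArtanh (∏ e' ∈ Finset.univ.filter (fun e' => (σ e').1 = (σ e).1 ∧ e' ≠ e), tanhHalf (μ e'))

/-- The message from the variable node `v` to its function node. -/
def toFunMsg (σ : E.Tanner) (μ : E.VSock → EReal) (v : Fin E.n) : EReal :=
  ∑ j : Fin (E.vdeg v), checkMsg σ μ ⟨v, j⟩

/-- The message from a variable node to a check node along the edge `e`, when `r` is the message
from the function node to that variable node. -/
def varMsg (σ : E.Tanner) (μ : E.VSock → EReal) (r : EReal) (e : E.VSock) : EReal :=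
  r + ∑ j ∈ Finset.univ.filter (fun j => j ≠ e.2), checkMsg σ μ ⟨e.1, j⟩

/-- The variable-to-check messages of both users after `l` iterations of the joint decoder. The
`i`th function node joins variable node `i` of user 1 to variable node `τ i` of user 2 and has the
channel output `y i`. -/
def bpMsg (A α : ℝ) (σ₁ σ₂ : E.Tanner) (τ : Equiv.Perm (Fin E.n)) (y : Fin E.n → ℝ) :
    ℕ → (E.VSock → EReal) × (E.VSock → EReal)
  | 0 => (fun _ => 0, fun _ => 0)
  | l + 1 =>
    let μ := bpMsg A α σ₁ σ₂ τ y l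
    (fun e => varMsg σ₁ μ.1 (funMsg1 A α (toFunMsg σ₂ μ.2 (τ e.1)) (y e.1)) e,
     fun e => varMsg σ₂ μ.2
       (funMsg2 A α (toFunMsg σ₁ μ.1 (τ.symm e.1)) (y (τ.symm e.1))) e)

/-- The extrinsic BP estimate at function node `i` after `l` iterations, as a pair of
log-likelihood ratios. -/
def extrinsic (A α : ℝ) (σ₁ σ₂ : E.Tanner) (τ : Equiv.Perm (Fin E.n)) (y : Fin E.n → ℝ)
    (l : ℕ) (i : Fin E.n) : EReal × EReal :=
  (toFunMsg σ₁ (bpMsg A α σ₁ σ₂ τ y l).1 i, toFunMsg σ₂ (bpMsg A α σ₁ σ₂ τ y l).2 (τ i))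

/-- The uniformly chosen discrete data: a Tanner graph for each user among those which have the
transmitted word as a codeword, the matching of the variable nodes, and a function node. -/
abbrev Sample (x₁ x₂ : Fin E.n → ℤˣ) : Type :=
  {σ : E.Tanner // IsCodeword σ x₁} × {σ : E.Tanner // IsCodeword σ x₂} ×
    Equiv.Perm (Fin E.n) × Fin E.n

/-- The inputs `X_i` of the channel at function node `i` under the matching `τ`. -/
def inputAt (x₁ x₂ : Fin E.n → ℤˣ) (τ : Equiv.Perm (Fin E.n)) (i : Fin E.n) : Input :=
  (x₁ i, x₂ (τ i))

/-- The channel outputs when the noise is `z`. -/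
def received (A α : ℝ) (x₁ x₂ : Fin E.n → ℤˣ) (τ : Equiv.Perm (Fin E.n)) (z : Fin E.n → ℝ) :
    Fin E.n → ℝ :=
  fun i => chMean A α (inputAt x₁ x₂ τ i) + z i

/-- Independent standard Gaussian noise. -/
def noise (n : ℕ) : Measure (Fin n → ℝ) := Measure.pi (fun _ => gaussianReal 0 1)

open Classical in
/-- The samples for which the channel input at the chosen function node is `x`. -/
def samplesWith (x₁ x₂ : Fin E.n → ℤˣ) (x : Input) : Finset (Sample x₁ x₂) :=
  Finset.univ.filter (fun s => inputAt x₁ x₂ s.2.2.1 s.2.2.2 = x)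

open Classical in
/-- The probability `p(x)` that the channel input at a random function node is `x`. -/
def inputProb (x₁ x₂ : Fin E.n → ℤˣ) (x : Input) : ℝ :=
  ((samplesWith x₁ x₂ x).card : ℝ) / (Fintype.card (Sample x₁ x₂) : ℝ)

/-- The law of the extrinsic BP estimate after `l` iterations at a random function node, given that
the channel input there is `x`, for random Tanner graphs, matching and noise. -/
def extrinsicLaw (A α : ℝ) (x₁ x₂ : Fin E.n → ℤˣ) (l : ℕ) (x : Input) :
    Measure (EReal × EReal) :=
  ((samplesWith x₁ x₂ x).card : ℝ≥0∞)⁻¹ • ∑ s ∈ samplesWith x₁ x₂ x,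
    (noise E.n).map (fun z =>
      extrinsic A α s.1.1 s.2.1.1 s.2.2.1 (received A α x₁ x₂ s.2.2.1 z) l s.2.2.2)

/-- The BP-GEXIT function at iteration `l`, averaged over the ensemble: the extrinsic MAP estimate
in `∑_x p(x) ∫ a_x κ_x` is replaced by the extrinsic BP estimate. -/
def bpGexit (A α : ℝ) (x₁ x₂ : Fin E.n → ℤˣ) (l : ℕ) : ℝ :=
  ∑ x : Input, inputProb x₁ x₂ x * ∫ p, kernel A α x p ∂(extrinsicLaw A α x₁ x₂ l x)

end Degrees

/-- The sequence `E` of ensembles realizes the degree distributions `(λ, ρ)` (edge perspective):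
the block length tends to infinity, degrees stay bounded, checks have degree at least two, and the
fractions of variable nodes (of edges, for the checks) of each degree tend to `L_i` (to `ρ_j`). -/
structure Realizes (E : ℕ → Degrees) (lam rho : ℕ →₀ ℝ≥0) : Prop where
  length : Tendsto (fun k => (E k).n) atTop atTop
  bounded : ∃ D : ℕ, ∀ k, (∀ v, (E k).vdeg v ≤ D) ∧ (∀ c, (E k).cdeg c ≤ D)
  two_le : ∀ k c, 2 ≤ (E k).cdeg c
  vfrac : ∀ i : ℕ, Tendsto
    (fun k => ((Finset.univ.filter (fun v => (E k).vdeg v = i)).card : ℝ) / ((E k).n : ℝ))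
    atTop (𝓝 (nodeFrac lam i : ℝ))
  cfrac : ∀ j : ℕ, Tendsto
    (fun k => ((j * (Finset.univ.filter (fun c => (E k).cdeg c = j)).card : ℕ) : ℝ) /
      ((∑ c, (E k).cdeg c : ℕ) : ℝ))
    atTop (𝓝 (rho j : ℝ))

/-- `x k` is a sequence of codewords of type one-half: it is a codeword of some Tanner graph of
the ensemble, and asymptotically half of the variable nodes of each degree carry the symbol `+1`. -/
structure TypeOneHalf (E : ℕ → Degrees) (lam : ℕ →₀ ℝ≥0) (x : ∀ k, Fin (E k).n → ℤˣ) : Prop where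
  codeword : ∀ k, ∃ σ : (E k).Tanner, Degrees.IsCodeword σ (x k)
  half : ∀ i : ℕ, Tendsto
    (fun k => ((Finset.univ.filter (fun v => (E k).vdeg v = i ∧ x k v = 1)).card : ℝ) /
      ((E k).n : ℝ))
    atTop (𝓝 ((nodeFrac lam i : ℝ) / 2))

/-- `g` is the value at `α` of the asymptotic BP-GEXIT function,
`g = lim_{l → ∞} lim_{n → ∞} g^{BP,l,n}(α)`, all limits existing. -/
def HasAsymptoticBPGexit (A α : ℝ) (E : ℕ → Degrees) (x₁ x₂ : ∀ k, Fin (E k).n → ℤˣ)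
    (g : ℝ) : Prop :=
  ∃ γ : ℕ → ℝ,
    (∀ l, Tendsto (fun k => Degrees.bpGexit A α (x₁ k) (x₂ k) l) atTop (𝓝 (γ l))) ∧
    Tendsto γ atTop (𝓝 g)

end GMAC

end

noncomputable section

namespace GMAC

/-! ### Hyperbolic tangent coordinates on `[-∞, ∞]` -/

/-! The proof has three nearly independent pieces.

Density evolution. In the coordinate t = tanh(u/2) a symmetric density is (1 + t)η, where η is the
even law of a message about a uniform symbol (`dens`, `evenPart`, `IsSymm`). All operators preserve
this form, and on even parts they share one shape: the weight of the output, and this weight times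
the output t, are affine in the input t (`integral_evenPart_kernel`). Since averages of perspectives
of convex functions are convex (`ConvTest.perspective`), the operators are monotone for the convex
order of t under η (`Degraded`). By Jensen the point mass at 0 is least, so density evolution
increases. Even moments of t then increase and are bounded, odd ones vanish, and Stone–Weierstrass
with compactness of [-∞, ∞] gives weak limits. Addition of log-likelihood ratios is discontinuous at
(∞, -∞), but the weight (1 + t)(1 + t') vanishes there; hence the operators are weakly continuous on
symmetric densities and the limit is a fixed point (`exists_isReachedFixedPoint`).

The kernel. The α-derivative of p(y|x) integrates to zero over y, so the factor u[x] drops out of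
the logarithm. What remains, `kernelExt`, is continuous on the compact square. It differs from
`kernel` only where the true input has estimated probability zero, a null set for symmetric
densities (`kernel_eq`, `integral_kernel_F`).

Finite length. Neither concentration nor an estimate for tree-like neighbourhoods is used. It
suffices that for every η < 1 and all large n the joint law of the input x and the estimate is at
least (η/4) F_x: the four measures F_x / 4 already have total mass one, so nothing else can survive
(`tendsto_mul_integral`). This yields convergence for all bounded measurable functions, which covers
the discontinuous kernel. For a lower bound unfavourable outcomes may simply be discarded: an
exploration keeps only outcomes that meet unseen nodes, and each step costs a factor θ close to 1,
the number of steps being bounded for fixed ℓ (`Sim`, `simIntoVar`, `lintegral_F_le`).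

The probabilities of single steps come from counting. Partners of sockets are treated by
transpositions (`card_le_of_swap`). The symbols at an unseen check require that all even patterns be
nearly equally likely given the codeword (`card_patternClass_ge`). The number of completions of a
pattern is, up to a common factor, a coefficient of a product P of enumerators ∑ C(d, 2v) Xᵛ, at an
index close to V/4 because the word has type one-half, V being the number of remaining sockets.
These coefficients are log-concave without gaps. Were two nearby ones to differ by a fixed factor,
log-concavity would bound P at a tilted point w by (V + 1) wᵃ P(1); but checks of degree at least
two make P(w) exponentially larger (`evenPoly_coeff_ratio`). -/

@[simp] lemma tanhHalf_top : tanhHalf ⊤ = 1 := by simp [tanhHalf]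

@[simp] lemma tanhHalf_bot : tanhHalf ⊥ = -1 := by simp [tanhHalf]

@[simp] lemma tanhHalf_coe (r : ℝ) : tanhHalf (r : EReal) = Real.tanh (r / 2) := by
  simp [tanhHalf]

@[simp] lemma tanhHalf_zero : tanhHalf 0 = 0 := by
  have := tanhHalf_coe 0
  simpa using this

lemma tanh_half_mem (r : ℝ) : -1 < Real.tanh (r / 2) ∧ Real.tanh (r / 2) < 1 :=
  Real.tanh_bijOn.mapsTo (Set.mem_univ (r / 2))

lemma tanh_half_eq (r : ℝ) : Real.tanh (r / 2) = (Real.exp r - 1) / (Real.exp r + 1) := by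
  have h : Real.exp r = Real.exp (r / 2) * Real.exp (r / 2) := by
    rw [← Real.exp_add]; ring_nf
  have h2 : Real.exp (-(r / 2)) * Real.exp (r / 2) = 1 := by
    rw [← Real.exp_add]; simp
  have h1 := Real.exp_pos (r / 2)
  have h3 := Real.exp_pos (-(r / 2))
  rw [Real.tanh_eq, h, div_eq_div_iff (by positivity) (by positivity)]
  linear_combination -2 * Real.exp (r / 2) * h2

lemma tanhHalf_mem (u : EReal) : tanhHalf u ∈ Set.Icc (-1 : ℝ) 1 := by
  induction u with
  | bot => simp
  | top => simp
  | coe r => rw [tanhHalf_coe]; exact ⟨(tanh_half_mem r).1.le, (tanh_half_mem r).2.le⟩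

lemma abs_tanhHalf_le (u : EReal) : |tanhHalf u| ≤ 1 := abs_le.2 (tanhHalf_mem u)

lemma tanhHalf_strictMono : StrictMono tanhHalf := by
  intro u v h
  induction u with
  | top => simp at h
  | bot =>
    induction v with
    | bot => simp at h
    | top => norm_num
    | coe s => simpa using (tanh_half_mem s).1
  | coe r =>
    induction v with
    | bot => simp at h
    | top => simpa using (tanh_half_mem r).2
    | coe s =>
      have h' : r < s := by exact_mod_cast h
      have := Real.exp_lt_exp.2 h'
      have h1 := Real.exp_pos r
      have h2 := Real.exp_pos s
      rw [tanhHalf_coe, tanhHalf_coe, tanh_half_eq, tanh_half_eq,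
        div_lt_div_iff₀ (by positivity) (by positivity)]
      nlinarith

lemma tanhHalf_log_div {P M : ℝ} (hP : 0 < P) (hM : 0 < M) :
    tanhHalf ((Real.log (P / M) : ℝ) : EReal) = (P - M) / (P + M) := by
  rw [tanhHalf_coe, tanh_half_eq, Real.exp_log (by positivity)]
  field_simp

lemma tanhHalf_twoArtanh {t : ℝ} (ht : t ∈ Set.Icc (-1 : ℝ) 1) : tanhHalf (twoArtanh t) = t := by
  unfold twoArtanh
  split_ifs with h1 h2
  · simp; linarith [ht.2]
  · simp; linarith [ht.1]
  · push Not at h1 h2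
    rw [tanhHalf_log_div (by linarith) (by linarith)]
    ring_nf

/-- The order isomorphism between log-likelihood ratios and soft bits. -/
def tanhIso : EReal ≃o Set.Icc (-1 : ℝ) 1 :=
  StrictMono.orderIsoOfSurjective (fun u => ⟨tanhHalf u, tanhHalf_mem u⟩)
    (fun _ _ h => tanhHalf_strictMono h)
    (fun t => ⟨twoArtanh t, Subtype.ext (tanhHalf_twoArtanh t.2)⟩)

lemma continuous_tanhHalf : Continuous tanhHalf :=
  continuous_subtype_val.comp tanhIso.toHomeomorph.continuous

lemma tanhIso_symm_apply (t : Set.Icc (-1 : ℝ) 1) : tanhIso.symm t = twoArtanh t := by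
  rw [OrderIso.symm_apply_eq]
  exact Subtype.ext (tanhHalf_twoArtanh t.2).symm

lemma continuous_twoArtanh : Continuous twoArtanh := by
  -- The default values outside [-1, 1] amount to clamping the argument, so continuity comes from
  -- the inverse of the order isomorphism.
  have h : twoArtanh = fun t => tanhIso.symm (Set.projIcc (-1 : ℝ) 1 (by norm_num) t) := by
    funext t
    rw [tanhIso_symm_apply]
    rcases le_total t (-1) with h | h
    · rw [Set.projIcc_of_le_left _ h]
      simp [twoArtanh, h, (by linarith : ¬ (1 : ℝ) ≤ t), (by norm_num : ¬ (1 : ℝ) ≤ -1)]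
    · rcases le_total 1 t with h' | h'
      · rw [Set.projIcc_of_right_le _ h']
        simp [twoArtanh, h']
      · rw [Set.projIcc_of_mem _ ⟨h, h'⟩]
  rw [h]
  exact tanhIso.symm.toHomeomorph.continuous.comp continuous_projIcc

@[simp] lemma tanhHalf_neg (u : EReal) : tanhHalf (-u) = -tanhHalf u := by
  induction u with
  | bot => simp
  | top => simp
  | coe r =>
    rw [← EReal.coe_neg, tanhHalf_coe, tanhHalf_coe, neg_div, Real.tanh_neg]

/-! ### Signs, symbol probabilities and the addition theorem -/

@[simp] lemma bit_one : bit 1 = 1 := by simp [bit]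

@[simp] lemma bit_neg_one : bit (-1) = -1 := by simp [bit]

lemma bit_neg (s : ℤˣ) : bit (-s) = -bit s := by simp [bit]

lemma bit_mul (s t : ℤˣ) : bit (s * t) = bit s * bit t := by simp [bit]

lemma bit_cases (s : ℤˣ) : bit s = 1 ∨ bit s = -1 := by
  rcases Int.units_eq_one_or s with rfl | rfl <;> simp

lemma sum_units {M : Type*} [AddCommMonoid M] (f : ℤˣ → M) : ∑ s, f s = f 1 + f (-1) := by
  rw [show (Finset.univ : Finset ℤˣ) = {1, -1} from rfl, Finset.sum_pair (by decide)]

@[simp] lemma signMul_one (u : EReal) : signMul 1 u = u := by simp [signMul]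

@[simp] lemma signMul_neg_one (u : EReal) : signMul (-1) u = -u := by
  simp [signMul, (by decide : ¬ ((-1 : ℤˣ) = 1))]

@[simp] lemma tanhHalf_signMul (s : ℤˣ) (u : EReal) :
    tanhHalf (signMul s u) = bit s * tanhHalf u := by
  rcases Int.units_eq_one_or s with rfl | rfl <;> simp

lemma signMul_signMul (s t : ℤˣ) (u : EReal) : signMul s (signMul t u) = signMul (s * t) u := by
  apply tanhHalf_strictMono.injective
  simp [bit_mul, mul_assoc]

@[simp] lemma signMul_zero (s : ℤˣ) : signMul s 0 = 0 := by
  rcases Int.units_eq_one_or s with rfl | rfl <;> simp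

lemma continuous_signMul (s : ℤˣ) : Continuous (signMul s) := by
  rcases Int.units_eq_one_or s with rfl | rfl
  · rw [funext signMul_one]; exact continuous_id
  · rw [funext signMul_neg_one]; exact continuous_neg

lemma logistic_eq (u : EReal) : logistic u = (1 + tanhHalf u) / 2 := by
  induction u with
  | bot => simp [logistic]
  | top => simp [logistic]
  | coe r =>
    have := Real.exp_pos r
    simp only [logistic, EReal.coe_ne_top, EReal.coe_ne_bot, if_false, EReal.toReal_coe,
      tanhHalf_coe, tanh_half_eq]
    field_simp
    ring

lemma symProb_eq (s : ℤˣ) (u : EReal) : symProb s u = (1 + bit s * tanhHalf u) / 2 := by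
  rcases Int.units_eq_one_or s with rfl | rfl
  · simp [symProb, logistic_eq]
  · simp [symProb, logistic_eq, (by decide : ¬ ((-1 : ℤˣ) = 1))]
    ring

lemma continuous_symProb (s : ℤˣ) : Continuous (symProb s) := by
  have := continuous_tanhHalf
  rw [funext (symProb_eq s)]
  fun_prop

lemma symProb_nonneg (s : ℤˣ) (u : EReal) : 0 ≤ symProb s u := by
  have := abs_le.1 (abs_tanhHalf_le u)
  rw [symProb_eq]
  rcases bit_cases s with h | h <;> rw [h] <;> linarith

lemma symProb_add (u : EReal) : symProb 1 u + symProb (-1) u = 1 := by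
  rw [symProb_eq, symProb_eq]; simp; ring

lemma symProb_signMul (s r : ℤˣ) (u : EReal) : symProb s (signMul r u) = symProb (s * r) u := by
  simp [symProb_eq, bit_mul, mul_assoc]

/-- Multiplied out, the addition theorem of tanh survives the indeterminate sums of ⊤ and ⊥: there
the factor on the left vanishes, and so does the right side. This is the algebra behind symmetry and
monotonicity at variable nodes. -/
lemma tanhHalf_add_mul (u v : EReal) :
    tanhHalf (u + v) * (1 + tanhHalf u * tanhHalf v) = tanhHalf u + tanhHalf v := by
  induction u with
  | bot => simp [add_comm]
  | top =>
    induction v with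
    | bot => simp
    | top => simp
    | coe s => rw [EReal.top_add_coe]; simp
  | coe r =>
    induction v with
    | bot => simp [add_comm]
    | top => rw [EReal.coe_add_top]; simp [add_comm]
    | coe s =>
      rw [← EReal.coe_add]
      simp only [tanhHalf_coe, tanh_half_eq, Real.exp_add]
      have h1 := Real.exp_pos r
      have h2 := Real.exp_pos s
      field_simp
      ring

lemma one_add_tanhHalf_mul_nonneg (u v : EReal) : 0 ≤ 1 + tanhHalf u * tanhHalf v := by
  have h : |tanhHalf u * tanhHalf v| ≤ 1 := by
    rw [abs_mul]
    exact mul_le_one₀ (abs_tanhHalf_le u) (abs_nonneg _) (abs_tanhHalf_le v)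
  linarith [(abs_le.1 h).1]

lemma tanhHalf_eq_neg_one {u : EReal} : tanhHalf u = -1 ↔ u = ⊥ := by
  rw [← tanhHalf_bot, tanhHalf_strictMono.injective.eq_iff]

lemma tanhHalf_mul_mem (u v : EReal) : tanhHalf u * tanhHalf v ∈ Set.Icc (-1 : ℝ) 1 := by
  rw [Set.mem_Icc, ← abs_le, abs_mul]
  exact mul_le_one₀ (abs_tanhHalf_le u) (abs_nonneg _) (abs_tanhHalf_le v)

@[fun_prop] lemma measurable_tanhHalf : Measurable tanhHalf := continuous_tanhHalf.measurable

@[fun_prop] lemma measurable_twoArtanh : Measurable twoArtanh := continuous_twoArtanh.measurable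

@[fun_prop] lemma measurable_signMul (s : ℤˣ) : Measurable (signMul s) :=
  (continuous_signMul s).measurable

@[fun_prop] lemma measurable_symProb (s : ℤˣ) : Measurable (symProb s) :=
  (continuous_symProb s).measurable

/-! ### The channel, uniformly in the two users -/

lemma chDensity_pos (A α : ℝ) (x : Input) (y : ℝ) : 0 < chDensity A α x y :=
  gaussianPDFReal_pos _ _ _ one_ne_zero

lemma continuous_chDensity (A α : ℝ) (x : Input) : Continuous (chDensity A α x) := by
  unfold chDensity
  rw [gaussianPDFReal_def]
  fun_prop

lemma chDensity_neg (A α : ℝ) (x : Input) (y : ℝ) :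
    chDensity A α (-x) (-y) = chDensity A α x y := by
  simp only [chDensity, gaussianPDFReal, chMean, Prod.fst_neg, Prod.snd_neg, bit_neg]
  ring_nf

/-- The input pair in which the user `b` sends `s` and the other user sends `r`; the first user
is `true`. -/
def inp (b : Bool) (s r : ℤˣ) : Input := if b then (s, r) else (r, s)

/-- The message from a function node to the user `b`. -/
def funMsg (A α : ℝ) (b : Bool) (m : EReal) (y : ℝ) : EReal :=
  if b then funMsg1 A α m y else funMsg2 A α m y

lemma inp_neg (b : Bool) (s r : ℤˣ) : inp b (-s) (-r) = -inp b s r := by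
  cases b <;> rfl

/-- The joint weight of the output `y`, of the symbol `s` of user `b` and of the message `m`. -/
def mixDensity (A α : ℝ) (b : Bool) (s : ℤˣ) (m : EReal) (y : ℝ) : ℝ :=
  ∑ r, chDensity A α (inp b s r) y * symProb r m

lemma mixDensity_pos (A α : ℝ) (b : Bool) (s : ℤˣ) (m : EReal) (y : ℝ) :
    0 < mixDensity A α b s m y := by
  have h1 := chDensity_pos A α (inp b s 1) y
  have h2 := chDensity_pos A α (inp b s (-1)) y
  have h3 := symProb_nonneg 1 m
  have h4 := symProb_nonneg (-1) m
  have h5 := symProb_add m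
  rw [mixDensity, sum_units]
  rcases h3.eq_or_lt with h | h
  · rw [← h] at h5 ⊢
    rw [zero_add] at h5
    rw [h5]; linarith
  · have := mul_pos h1 h
    have := mul_nonneg h2.le h4
    linarith

/-- With both message rules expressed by `mixDensity`, every later argument treats the two users at
once. -/
lemma funMsg_eq (A α : ℝ) (b : Bool) (m : EReal) (y : ℝ) :
    funMsg A α b m y =
      ((Real.log (mixDensity A α b 1 m y / mixDensity A α b (-1) m y) : ℝ) : EReal) := by
  cases b <;> simp [funMsg, funMsg1, funMsg2, mixDensity, inp, symProb,
    (by decide : ¬ ((-1 : ℤˣ) = 1))]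

lemma mixDensity_neg (A α : ℝ) (b : Bool) (s : ℤˣ) (m : EReal) (y : ℝ) :
    mixDensity A α b (-s) (-m) (-y) = mixDensity A α b s m y := by
  simp only [mixDensity, sum_units]
  rw [add_comm, ← chDensity_neg A α (inp b s 1), ← chDensity_neg A α (inp b s (-1)),
    ← inp_neg, ← inp_neg, neg_neg]
  simp [symProb_eq]

/-- Flipping both inputs and the output is a symmetry of the channel; it exchanges numerator and
denominator of the message. -/
lemma funMsg_neg (A α : ℝ) (b : Bool) (m : EReal) (y : ℝ) :
    funMsg A α b (-m) (-y) = -funMsg A α b m y := by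
  have h1 := mixDensity_neg A α b 1 m y
  have h2 := mixDensity_neg A α b (-1) m y
  rw [neg_neg] at h2
  rw [funMsg_eq, funMsg_eq, h1, h2, ← EReal.coe_neg, ← Real.log_inv, inv_div]

lemma tanhHalf_funMsg (A α : ℝ) (b : Bool) (m : EReal) (y : ℝ) :
    tanhHalf (funMsg A α b m y) = (mixDensity A α b 1 m y - mixDensity A α b (-1) m y) /
      (mixDensity A α b 1 m y + mixDensity A α b (-1) m y) := by
  rw [funMsg_eq, tanhHalf_log_div (mixDensity_pos ..) (mixDensity_pos ..)]

lemma continuous_mixDensity (A α : ℝ) (b : Bool) (s : ℤˣ) :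
    Continuous (fun p : EReal × ℝ => mixDensity A α b s p.1 p.2) := by
  unfold mixDensity
  refine continuous_finsetSum _ fun r _ => ?_
  exact ((continuous_chDensity A α _).comp continuous_snd).mul
    ((continuous_symProb r).comp continuous_fst)

lemma continuous_funMsg (A α : ℝ) (b : Bool) :
    Continuous (fun p : EReal × ℝ => funMsg A α b p.1 p.2) := by
  simp only [funMsg_eq]
  refine continuous_coe_real_ereal.comp (Continuous.log ?_ fun p => ?_)
  · exact (continuous_mixDensity A α b 1).div (continuous_mixDensity A α b (-1))
      fun p => (mixDensity_pos ..).ne'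
  · exact (div_pos (mixDensity_pos ..) (mixDensity_pos ..)).ne'

@[fun_prop] lemma measurable_funMsg (A α : ℝ) (b : Bool) :
    Measurable (fun p : EReal × ℝ => funMsg A α b p.1 p.2) :=
  (continuous_funMsg A α b).measurable

instance (A α : ℝ) (x : Input) : IsProbabilityMeasure (chLaw A α x) := by
  unfold chLaw; infer_instance

lemma chLaw_neg (A α : ℝ) (x : Input) : chLaw A α (-x) = (chLaw A α x).map (fun y => -y) := by
  have h := gaussianReal_map_neg (μ := chMean A α x) (v := 1)
  rw [chLaw, chLaw, h]
  congr 1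
  simp only [chMean, Prod.fst_neg, Prod.snd_neg, bit_neg]
  ring

lemma chLaw_eq_map (A α : ℝ) (x : Input) :
    chLaw A α x = (gaussianReal 0 1).map (fun z => chMean A α x + z) := by
  have h := gaussianReal_map_const_add (μ := 0) (v := 1) (chMean A α x)
  rw [chLaw, h, zero_add]

/-! ### Elementary facts about the operators of density evolution -/

instance (s : ℤˣ) (a : Measure EReal) [IsProbabilityMeasure a] :
    IsProbabilityMeasure (reflect s a) :=
  Measure.isProbabilityMeasure_map (measurable_signMul s).aemeasurable

instance (s : ℤˣ) (a : Measure EReal) [IsFiniteMeasure a] :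
    IsFiniteMeasure (reflect s a) := by unfold reflect; infer_instance

lemma measurable_chkMap :
    Measurable (fun p : EReal × EReal => twoArtanh (tanhHalf p.1 * tanhHalf p.2)) := by
  fun_prop

instance (a b : Measure EReal) [IsProbabilityMeasure a] [IsProbabilityMeasure b] :
    IsProbabilityMeasure (varConv a b) :=
  Measure.isProbabilityMeasure_map (by fun_prop)

instance (a b : Measure EReal) [IsProbabilityMeasure a] [IsProbabilityMeasure b] :
    IsProbabilityMeasure (chkConv a b) :=
  Measure.isProbabilityMeasure_map measurable_chkMap.aemeasurable

instance (a : Measure EReal) [IsProbabilityMeasure a] (k : ℕ) :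
    IsProbabilityMeasure (varPow a k) := by
  induction k with
  | zero => unfold varPow; infer_instance
  | succ k ih => unfold varPow; infer_instance

instance (a : Measure EReal) [IsProbabilityMeasure a] (k : ℕ) :
    IsProbabilityMeasure (chkPow a k) := by
  induction k with
  | zero => unfold chkPow; infer_instance
  | succ k ih => unfold chkPow; infer_instance

lemma isProbabilityMeasure_sum {ι S : Type*} [MeasurableSpace S] (s : Finset ι) (w : ι → ℝ≥0)
    (μ : ι → Measure S) (hw : ∑ i ∈ s, w i = 1) (hμ : ∀ i ∈ s, IsProbabilityMeasure (μ i)) :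
    IsProbabilityMeasure (∑ i ∈ s, w i • μ i) := by
  constructor
  simp only [Measure.coe_finsetSum, Finset.sum_apply, Measure.smul_apply]
  rw [Finset.sum_congr rfl (g := fun i => (w i : ℝ≥0∞)) fun i hi => by
    have := hμ i hi
    rw [measure_univ, ENNReal.smul_def, smul_eq_mul, mul_one]]
  exact_mod_cast hw

lemma lintegral_reflect (s : ℤˣ) (a : Measure EReal) {f : EReal → ℝ≥0∞} (hf : Measurable f) :
    ∫⁻ u, f u ∂(reflect s a) = ∫⁻ u, f (signMul s u) ∂a :=
  lintegral_map hf (measurable_signMul s)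

lemma lintegral_varConv (a b : Measure EReal) [SFinite b] {f : EReal → ℝ≥0∞}
    (hf : Measurable f) :
    ∫⁻ u, f u ∂(varConv a b) = ∫⁻ u, ∫⁻ v, f (u + v) ∂b ∂a := by
  rw [varConv, lintegral_map hf (by fun_prop), lintegral_prod]
  fun_prop

lemma lintegral_chkConv (a b : Measure EReal) [SFinite b] {f : EReal → ℝ≥0∞}
    (hf : Measurable f) :
    ∫⁻ u, f u ∂(chkConv a b) =
      ∫⁻ u, ∫⁻ v, f (twoArtanh (tanhHalf u * tanhHalf v)) ∂b ∂a := by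
  rw [chkConv, lintegral_map hf (by fun_prop), lintegral_prod]
  fun_prop

lemma reflect_one (a : Measure EReal) : reflect 1 a = a := by
  rw [reflect, funext signMul_one]; exact Measure.map_id'

lemma reflect_reflect (s t : ℤˣ) (a : Measure EReal) :
    reflect s (reflect t a) = reflect (s * t) a := by
  rw [reflect, reflect, Measure.map_map (measurable_signMul s) (measurable_signMul t)]
  congr 1
  funext u
  exact signMul_signMul s t u

lemma reflect_add (s : ℤˣ) (a b : Measure EReal) :
    reflect s (a + b) = reflect s a + reflect s b :=
  Measure.map_add _ _ (measurable_signMul s)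

lemma reflect_smul (s : ℤˣ) (c : ℝ≥0) (a : Measure EReal) :
    reflect s (c • a) = c • reflect s a := by
  simp [reflect, Measure.map_smul]

lemma reflect_sum {ι : Type*} (s : ℤˣ) (t : Finset ι) (μ : ι → Measure EReal) :
    reflect s (∑ i ∈ t, μ i) = ∑ i ∈ t, reflect s (μ i) := by
  classical
  induction t using Finset.induction_on with
  | empty => simp [reflect]
  | insert i t hi ih => rw [Finset.sum_insert hi, Finset.sum_insert hi, reflect_add, ih]

lemma varConv_comm (a b : Measure EReal) [SFinite a] [SFinite b] :
    varConv a b = varConv b a := by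
  rw [varConv, varConv, ← Measure.prod_swap, Measure.map_map (by fun_prop) measurable_swap]
  congr 1
  funext p
  exact add_comm _ _

lemma chkConv_comm (a b : Measure EReal) [SFinite a] [SFinite b] :
    chkConv a b = chkConv b a := by
  rw [chkConv, chkConv, ← Measure.prod_swap, Measure.map_map (by fun_prop) measurable_swap]
  congr 1
  funext p
  simp [mul_comm]

/-- After exchanging the two integrals, the mass of a set is a single integral against the second
argument, hence additive in it. -/
lemma varConv_sum {ι : Type*} (a : Measure EReal) [SFinite a] (t : Finset ι) (w : ι → ℝ≥0)
    (μ : ι → Measure EReal) (hμ : ∀ i ∈ t, SFinite (μ i)) :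
    varConv a (∑ i ∈ t, w i • μ i) = ∑ i ∈ t, w i • varConv a (μ i) := by
  have hs : SFinite (∑ i ∈ t, w i • μ i) := by
    rw [← Measure.sum_coe_finset]
    have : ∀ i : t, SFinite (w i • μ i) := fun i => by
      have := hμ i i.2; infer_instance
    infer_instance
  ext B hB
  have hm : Measurable (B.indicator (1 : EReal → ℝ≥0∞)) := measurable_one.indicator hB
  have key : ∀ ν : Measure EReal, SFinite ν →
      varConv a ν B = ∫⁻ v, ∫⁻ u, B.indicator (1 : EReal → ℝ≥0∞) (u + v) ∂a ∂ν := by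
    intro ν hν
    rw [← lintegral_indicator_one hB, lintegral_varConv a ν hm, lintegral_lintegral_swap]
    fun_prop
  rw [key _ hs, lintegral_finsetSum_measure, Measure.coe_finsetSum, Finset.sum_apply]
  refine Finset.sum_congr rfl fun i hi => ?_
  rw [Measure.smul_apply, key _ (hμ i hi), lintegral_smul_measure]

/-! ### Even and symmetric densities -/

/-- An even probability measure: the law of a log-likelihood ratio of a uniform symbol. -/
structure EvenProb (η : Measure EReal) : Prop where
  prob : IsProbabilityMeasure η
  even : reflect (-1) η = η

/-- The law of the log-likelihood ratio given the symbol `+1`, when its unconditional law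
is `η`. -/
def dens (η : Measure EReal) : Measure EReal :=
  η.withDensity fun u => ENNReal.ofReal (1 + tanhHalf u)

/-- The unconditional law of the log-likelihood ratio of a uniform symbol. -/
def evenPart (a : Measure EReal) : Measure EReal := (1 / 2 : ℝ≥0) • (a + reflect (-1) a)

/-- A symmetric density. -/
def IsSymm (a : Measure EReal) : Prop := EvenProb (evenPart a) ∧ a = dens (evenPart a)

lemma one_add_tanhHalf_nonneg (u : EReal) : 0 ≤ 1 + tanhHalf u := by
  linarith [(tanhHalf_mem u).1]

lemma one_sub_tanhHalf_nonneg (u : EReal) : 0 ≤ 1 - tanhHalf u := by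
  linarith [(tanhHalf_mem u).2]

lemma lintegral_dens (η : Measure EReal) {f : EReal → ℝ≥0∞} (hf : Measurable f) :
    ∫⁻ u, f u ∂(dens η) = ∫⁻ u, ENNReal.ofReal (1 + tanhHalf u) * f u ∂η :=
  lintegral_withDensity_eq_lintegral_mul _ (by fun_prop) hf

lemma EvenProb.reflect_eq {η : Measure EReal} (h : EvenProb η) (s : ℤˣ) : reflect s η = η := by
  rcases Int.units_eq_one_or s with rfl | rfl
  · exact reflect_one η
  · exact h.even

lemma EvenProb.lintegral_signMul {η : Measure EReal} (h : EvenProb η) (s : ℤˣ)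
    {f : EReal → ℝ≥0∞} (hf : Measurable f) :
    ∫⁻ u, f (signMul s u) ∂η = ∫⁻ u, f u ∂η := by
  rw [← lintegral_reflect s η hf, h.reflect_eq]

lemma EvenProb.lintegral_neg {η : Measure EReal} (h : EvenProb η)
    {f : EReal → ℝ≥0∞} (hf : Measurable f) :
    ∫⁻ u, f (-u) ∂η = ∫⁻ u, f u ∂η := by
  simpa using h.lintegral_signMul (-1) hf

/-- Evenness of η moves the reflection from the measure to its weight: these are the two conditional
laws of a message, given the symbol. -/
lemma reflect_dens {η : Measure EReal} (h : EvenProb η) (s : ℤˣ) :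
    reflect s (dens η) = η.withDensity fun u => ENNReal.ofReal (1 + bit s * tanhHalf u) := by
  refine Measure.ext_of_lintegral _ fun f hf => ?_
  rw [lintegral_reflect s _ hf, lintegral_dens η (by fun_prop),
    lintegral_withDensity_eq_lintegral_mul _ (by fun_prop) hf,
    ← h.lintegral_signMul s (by fun_prop)]
  simp [signMul_signMul, Int.units_mul_self]

/-- The weights 1 + t and 1 - t add up to 2: the two conditional laws average to the unconditional
one. -/
lemma dens_one_neg (η : Measure EReal) :
    dens η + η.withDensity (fun u => ENNReal.ofReal (1 + bit (-1) * tanhHalf u)) =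
      (2 : ℝ≥0∞) • η := by
  rw [dens, ← withDensity_add_left (by fun_prop), ← withDensity_const]
  congr 1
  funext u
  rw [Pi.add_apply, ← ENNReal.ofReal_add (one_add_tanhHalf_nonneg u)
    (by simpa [← sub_eq_add_neg] using one_sub_tanhHalf_nonneg u)]
  rw [bit_neg_one, ← ENNReal.ofReal_ofNat]
  congr 1; ring

lemma evenPart_dens {η : Measure EReal} (h : EvenProb η) : evenPart (dens η) = η := by
  rw [evenPart, reflect_dens h, dens_one_neg]
  ext B _
  simp only [Measure.smul_apply, smul_eq_mul, ENNReal.smul_def]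
  rw [← mul_assoc]
  norm_num
  rw [ENNReal.inv_mul_cancel (by norm_num) (by norm_num), one_mul]

/-- Together with the second clause of `IsSymm`, this identifies the symmetric densities with the
images of even laws under `dens`. -/
lemma isSymm_dens {η : Measure EReal} (h : EvenProb η) : IsSymm (dens η) := by
  rw [IsSymm, evenPart_dens h]; exact ⟨h, rfl⟩

lemma IsSymm.reflect_eq {a : Measure EReal} (h : IsSymm a) (s : ℤˣ) : reflect s a =
    (evenPart a).withDensity fun u => ENNReal.ofReal (1 + bit s * tanhHalf u) := by
  conv_lhs => rw [h.2]
  exact reflect_dens h.1 s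

lemma integrable_of_abs_le {S : Type*} [MeasurableSpace S] {μ : Measure S} [IsFiniteMeasure μ]
    {f : S → ℝ} (hf : Measurable f) {C : ℝ} (hC : ∀ x, |f x| ≤ C) : Integrable f μ :=
  Integrable.of_bound hf.aestronglyMeasurable C (ae_of_all _ hC)

lemma EvenProb.integral_neg {η : Measure EReal} (h : EvenProb η) {f : EReal → ℝ}
    (hf : Measurable f) : ∫ u, f (-u) ∂η = ∫ u, f u ∂η := by
  conv_rhs => rw [← h.even, reflect, integral_map (by fun_prop) hf.aestronglyMeasurable]
  simp

lemma EvenProb.integral_tanhHalf {η : Measure EReal} (h : EvenProb η) :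
    ∫ u, tanhHalf u ∂η = 0 := by
  have := h.integral_neg measurable_tanhHalf
  simp only [tanhHalf_neg, MeasureTheory.integral_neg] at this
  linarith

lemma integral_dens (η : Measure EReal) (f : EReal → ℝ) :
    ∫ u, f u ∂(dens η) = ∫ u, (1 + tanhHalf u) * f u ∂η := by
  rw [dens, integral_withDensity_eq_integral_toReal_smul (by fun_prop) (by simp)]
  simp [ENNReal.toReal_ofReal (one_add_tanhHalf_nonneg _)]

lemma isProbabilityMeasure_dens {η : Measure EReal} (h : EvenProb η) :
    IsProbabilityMeasure (dens η) := by
  have := h.prob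
  constructor
  rw [dens, withDensity_apply _ MeasurableSet.univ, Measure.restrict_univ,
    ← ofReal_integral_eq_lintegral_ofReal _ (ae_of_all _ one_add_tanhHalf_nonneg)]
  · rw [integral_add (integrable_const _) (integrable_of_abs_le measurable_tanhHalf
      abs_tanhHalf_le), h.integral_tanhHalf]
    simp
  · exact (integrable_const _).add (integrable_of_abs_le measurable_tanhHalf abs_tanhHalf_le)

lemma IsSymm.prob {a : Measure EReal} (h : IsSymm a) : IsProbabilityMeasure a := by
  rw [h.2]; exact isProbabilityMeasure_dens h.1

/-- The weight 1 + t vanishes at ⊥: a message about +1 is never certain of -1. Almost surely this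
excludes indeterminate sums and zero estimates of the true input. -/
lemma IsSymm.bot {a : Measure EReal} (h : IsSymm a) : a {⊥} = 0 := by
  rw [h.2, dens, withDensity_apply _ (measurableSet_singleton _), lintegral_singleton]
  simp

/-! ### The operators preserve symmetry -/

/-- The unconditional law of the sum of two messages on one symbol. -/
def varEven (η₁ η₂ : Measure EReal) : Measure EReal :=
  ((η₁.prod η₂).withDensity
    fun p => ENNReal.ofReal (1 + tanhHalf p.1 * tanhHalf p.2)).map (fun p => p.1 + p.2)

lemma lintegral_varEven (η₁ η₂ : Measure EReal) [SFinite η₂]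
    {f : EReal → ℝ≥0∞} (hf : Measurable f) :
    ∫⁻ u, f u ∂(varEven η₁ η₂) =
      ∫⁻ u, ∫⁻ v, ENNReal.ofReal (1 + tanhHalf u * tanhHalf v) * f (u + v) ∂η₂ ∂η₁ := by
  rw [varEven, lintegral_map hf (by fun_prop),
    lintegral_withDensity_eq_lintegral_mul _ (by fun_prop) (by fun_prop), lintegral_prod]
  · rfl
  · fun_prop

/-- With t, t' the tanh coordinates of u, v and s that of u + v, one has (1 + s)(1 + tt') = (1 +
t)(1 + t'). Two messages about the same uniform symbol have unconditional density 1 + tt' relative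
to the product of their laws. -/
lemma dens_varEven {η₁ η₂ : Measure EReal} (h₁ : EvenProb η₁) (h₂ : EvenProb η₂) :
    dens (varEven η₁ η₂) = varConv (dens η₁) (dens η₂) := by
  have := h₁.prob
  have := h₂.prob
  have := isProbabilityMeasure_dens h₂
  refine Measure.ext_of_lintegral _ fun f hf => ?_
  rw [lintegral_dens _ hf, lintegral_varEven _ _ (by fun_prop), lintegral_varConv _ _ hf,
    lintegral_dens]
  · refine lintegral_congr fun u => ?_
    rw [lintegral_dens _ (by fun_prop), ← lintegral_const_mul _ (by fun_prop)]
    refine lintegral_congr fun v => ?_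
    rw [← mul_assoc, ← mul_assoc, ← ENNReal.ofReal_mul (one_add_tanhHalf_mul_nonneg u v),
      ← ENNReal.ofReal_mul (one_add_tanhHalf_nonneg u)]
    congr 2
    linear_combination tanhHalf_add_mul u v
  · exact Measurable.lintegral_prod_right' (f := fun p : EReal × EReal => f (p.1 + p.2))
      (by fun_prop)

lemma evenProb_varEven {η₁ η₂ : Measure EReal} (h₁ : EvenProb η₁) (h₂ : EvenProb η₂) :
    EvenProb (varEven η₁ η₂) := by
  have := h₁.prob
  have := h₂.prob
  constructor
  · constructor
    rw [varEven, Measure.map_apply (by fun_prop) MeasurableSet.univ, Set.preimage_univ,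
      withDensity_apply _ MeasurableSet.univ, Measure.restrict_univ,
      ← ofReal_integral_eq_lintegral_ofReal
        (f := fun p : EReal × EReal => 1 + tanhHalf p.1 * tanhHalf p.2) ?_
        (ae_of_all _ fun p => one_add_tanhHalf_mul_nonneg p.1 p.2)]
    · rw [integral_add (integrable_const _) (integrable_of_abs_le (by fun_prop)
        fun p : EReal × EReal => abs_le.2 (tanhHalf_mul_mem p.1 p.2)), integral_prod_mul,
      h₁.integral_tanhHalf]
      simp
    · exact (integrable_const _).add (integrable_of_abs_le (by fun_prop)
        fun p : EReal × EReal => abs_le.2 (tanhHalf_mul_mem p.1 p.2))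
  · refine Measure.ext_of_lintegral _ fun f hf => ?_
    rw [lintegral_reflect _ _ hf, lintegral_varEven _ _ (by fun_prop), lintegral_varEven _ _ hf,
      ← h₁.lintegral_neg]
    · refine lintegral_congr fun u => ?_
      rw [← h₂.lintegral_neg (by fun_prop)]
      refine lintegral_congr fun v => ?_
      simp only [tanhHalf_neg, neg_mul_neg, signMul_neg_one]
      -- The sums -(u + v) and (-u) + (-v) disagree only for infinite u = -v, where the weight is
      -- zero.
      by_cases h : 1 + tanhHalf u * tanhHalf v = 0
      · simp [h]
      congr 2
      apply tanhHalf_strictMono.injective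
      have e1 := tanhHalf_add_mul u v
      have e2 := tanhHalf_add_mul (-u) (-v)
      simp only [tanhHalf_neg, neg_mul_neg] at e2 ⊢
      apply mul_right_cancel₀ h
      linarith
    · exact Measurable.lintegral_prod_right' (f := fun p : EReal × EReal =>
        ENNReal.ofReal (1 + tanhHalf p.1 * tanhHalf p.2) * f (signMul (-1) (p.1 + p.2)))
        (by fun_prop)

/-- Changing both signs preserves the product of the tanh coordinates, so (1 + t)(1 + t') may be
averaged with (1 - t)(1 - t'). The average is 1 + tt', the weight of the output. -/
lemma dens_chkConv {η₁ η₂ : Measure EReal} (h₁ : EvenProb η₁) (h₂ : EvenProb η₂) :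
    dens (chkConv η₁ η₂) = chkConv (dens η₁) (dens η₂) := by
  have := h₁.prob
  have := h₂.prob
  have := isProbabilityMeasure_dens h₂
  refine Measure.ext_of_lintegral _ fun f hf => ?_
  have hm : Measurable fun p : EReal × EReal =>
      f (twoArtanh (tanhHalf p.1 * tanhHalf p.2)) := by fun_prop
  rw [lintegral_dens _ hf, lintegral_chkConv _ _ (by fun_prop), lintegral_chkConv _ _ hf,
    lintegral_dens _ (Measurable.lintegral_prod_right' hm)]
  have e1 : ∫⁻ u, ENNReal.ofReal (1 + tanhHalf u) *
      ∫⁻ v, f (twoArtanh (tanhHalf u * tanhHalf v)) ∂(dens η₂) ∂η₁ =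
      ∫⁻ u, ∫⁻ v, ENNReal.ofReal ((1 + tanhHalf u) * (1 + tanhHalf v)) *
        f (twoArtanh (tanhHalf u * tanhHalf v)) ∂η₂ ∂η₁ := by
    refine lintegral_congr fun u => ?_
    rw [lintegral_dens _ (by fun_prop), ← lintegral_const_mul _ (by fun_prop)]
    refine lintegral_congr fun v => ?_
    rw [← mul_assoc, ENNReal.ofReal_mul (one_add_tanhHalf_nonneg u)]
  have e2 : ∫⁻ u, ∫⁻ v, ENNReal.ofReal ((1 + tanhHalf u) * (1 + tanhHalf v)) *
        f (twoArtanh (tanhHalf u * tanhHalf v)) ∂η₂ ∂η₁ =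
      ∫⁻ u, ∫⁻ v, ENNReal.ofReal ((1 - tanhHalf u) * (1 - tanhHalf v)) *
        f (twoArtanh (tanhHalf u * tanhHalf v)) ∂η₂ ∂η₁ := by
    rw [← h₁.lintegral_neg (Measurable.lintegral_prod_right' (f := fun p : EReal × EReal =>
        ENNReal.ofReal ((1 + tanhHalf p.1) * (1 + tanhHalf p.2)) *
        f (twoArtanh (tanhHalf p.1 * tanhHalf p.2))) (by fun_prop))]
    refine lintegral_congr fun u => ?_
    rw [← h₂.lintegral_neg (by fun_prop)]
    refine lintegral_congr fun v => ?_
    simp [sub_eq_add_neg]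
  have e3 : (2 : ℝ≥0∞) * ∫⁻ u, ∫⁻ v, ENNReal.ofReal ((1 + tanhHalf u) * (1 + tanhHalf v)) *
        f (twoArtanh (tanhHalf u * tanhHalf v)) ∂η₂ ∂η₁ =
      2 * ∫⁻ u, ∫⁻ v, ENNReal.ofReal (1 + tanhHalf u * tanhHalf v) *
        f (twoArtanh (tanhHalf u * tanhHalf v)) ∂η₂ ∂η₁ := by
    conv_lhs => rw [two_mul]
    conv_lhs => enter [2]; rw [e2]
    rw [← lintegral_add_left (Measurable.lintegral_prod_right' (f := fun p : EReal × EReal =>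
        ENNReal.ofReal ((1 + tanhHalf p.1) * (1 + tanhHalf p.2)) *
        f (twoArtanh (tanhHalf p.1 * tanhHalf p.2))) (by fun_prop)),
      ← lintegral_const_mul _ (Measurable.lintegral_prod_right' (f := fun p : EReal × EReal =>
        ENNReal.ofReal (1 + tanhHalf p.1 * tanhHalf p.2) *
        f (twoArtanh (tanhHalf p.1 * tanhHalf p.2))) (by fun_prop))]
    refine lintegral_congr fun u => ?_
    rw [← lintegral_add_left (by fun_prop), ← lintegral_const_mul _ (by fun_prop)]
    refine lintegral_congr fun v => ?_
    rw [← add_mul, ← ENNReal.ofReal_add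
      (mul_nonneg (one_add_tanhHalf_nonneg u) (one_add_tanhHalf_nonneg v))
      (mul_nonneg (one_sub_tanhHalf_nonneg u) (one_sub_tanhHalf_nonneg v)), ← mul_assoc,
      ← ENNReal.ofReal_ofNat, ← ENNReal.ofReal_mul (by norm_num)]
    congr 2; ring
  rw [e1]
  rw [ENNReal.mul_right_inj (by norm_num) (by norm_num)] at e3
  rw [e3]
  refine lintegral_congr fun u => lintegral_congr fun v => ?_
  rw [tanhHalf_twoArtanh (tanhHalf_mul_mem u v)]

lemma reflect_chkConv (s t : ℤˣ) (a b : Measure EReal) [SFinite a] [SFinite b] :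
    reflect (s * t) (chkConv a b) = chkConv (reflect s a) (reflect t b) := by
  rw [reflect, reflect, reflect, chkConv, chkConv, Measure.map_prod_map _ _
    (measurable_signMul s) (measurable_signMul t), Measure.map_map (by fun_prop) (by fun_prop),
    Measure.map_map (by fun_prop) (by fun_prop)]
  congr 1
  funext p
  apply tanhHalf_strictMono.injective
  have := tanhHalf_mul_mem (signMul s p.1) (signMul t p.2)
  simp only [Function.comp, tanhHalf_signMul, Prod.map_fst, Prod.map_snd] at this ⊢
  rw [tanhHalf_twoArtanh (tanhHalf_mul_mem _ _), tanhHalf_twoArtanh this, bit_mul]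
  ring

lemma evenProb_chkConv {η₁ η₂ : Measure EReal} (h₁ : EvenProb η₁) (h₂ : EvenProb η₂) :
    EvenProb (chkConv η₁ η₂) := by
  have := h₁.prob
  have := h₂.prob
  refine ⟨inferInstance, ?_⟩
  have := reflect_chkConv (-1) 1 η₁ η₂
  rwa [mul_one, h₁.even, reflect_one] at this

lemma IsSymm.varConv {a b : Measure EReal} (ha : IsSymm a) (hb : IsSymm b) :
    IsSymm (varConv a b) := by
  have := isSymm_dens (evenProb_varEven ha.1 hb.1)
  rwa [dens_varEven ha.1 hb.1, ← ha.2, ← hb.2] at this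

lemma evenPart_varConv {a b : Measure EReal} (ha : IsSymm a) (hb : IsSymm b) :
    evenPart (GMAC.varConv a b) = varEven (evenPart a) (evenPart b) := by
  conv_lhs => rw [ha.2, hb.2, ← dens_varEven ha.1 hb.1]
  exact evenPart_dens (evenProb_varEven ha.1 hb.1)

lemma IsSymm.chkConv {a b : Measure EReal} (ha : IsSymm a) (hb : IsSymm b) :
    IsSymm (chkConv a b) := by
  have := isSymm_dens (evenProb_chkConv ha.1 hb.1)
  rwa [dens_chkConv ha.1 hb.1, ← ha.2, ← hb.2] at this

lemma evenPart_chkConv {a b : Measure EReal} (ha : IsSymm a) (hb : IsSymm b) :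
    evenPart (GMAC.chkConv a b) = GMAC.chkConv (evenPart a) (evenPart b) := by
  conv_lhs => rw [ha.2, hb.2, ← dens_chkConv ha.1 hb.1]
  exact evenPart_dens (evenProb_chkConv ha.1 hb.1)

lemma isSymm_dirac_zero : IsSymm (Measure.dirac 0) := by
  have h : EvenProb (Measure.dirac (0 : EReal)) :=
    ⟨inferInstance, by rw [reflect, Measure.map_dirac' (measurable_signMul _), signMul_zero]⟩
  convert isSymm_dens h
  refine Measure.ext_of_lintegral _ fun f hf => ?_
  rw [lintegral_dens _ hf, lintegral_dirac' _ hf, lintegral_dirac' _ (by fun_prop)]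
  simp

lemma isSymm_dirac_top : IsSymm (Measure.dirac ⊤) := by
  have e : evenPart (Measure.dirac (⊤ : EReal)) =
      (1 / 2 : ℝ≥0) • (Measure.dirac ⊤ + Measure.dirac ⊥) := by
    rw [evenPart, reflect, Measure.map_dirac' (measurable_signMul _)]
    simp
  refine ⟨⟨?_, ?_⟩, ?_⟩
  · rw [e]
    constructor
    simp only [Measure.smul_apply, Measure.add_apply, measure_univ, ENNReal.smul_def]
    norm_num
    rw [ENNReal.inv_mul_cancel (by norm_num) (by norm_num)]
  · rw [evenPart, reflect_smul, reflect_add, reflect_reflect, neg_mul_neg, mul_one, reflect_one,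
      add_comm]
  · rw [e]
    refine Measure.ext_of_lintegral _ fun f hf => ?_
    rw [lintegral_dens _ hf, lintegral_smul_measure, lintegral_add_measure,
      lintegral_dirac' _ hf, lintegral_dirac' _ (by fun_prop), lintegral_dirac' _ (by fun_prop)]
    simp only [tanhHalf_top, tanhHalf_bot, ENNReal.smul_def]
    norm_num
    rw [← mul_assoc, ENNReal.inv_mul_cancel (by norm_num) (by norm_num), one_mul]

lemma IsSymm.varPow {a : Measure EReal} (ha : IsSymm a) (k : ℕ) : IsSymm (varPow a k) := by
  induction k with
  | zero => exact isSymm_dirac_zero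
  | succ k ih => exact ih.varConv ha

lemma IsSymm.chkPow {a : Measure EReal} (ha : IsSymm a) (k : ℕ) : IsSymm (chkPow a k) := by
  induction k with
  | zero => exact isSymm_dirac_top
  | succ k ih => exact ih.chkConv ha

lemma evenPart_sum {ι : Type*} (t : Finset ι) (w : ι → ℝ≥0) (μ : ι → Measure EReal) :
    evenPart (∑ i ∈ t, w i • μ i) = ∑ i ∈ t, w i • evenPart (μ i) := by
  simp only [evenPart, reflect_sum, reflect_smul, ← Finset.sum_add_distrib, Finset.smul_sum,
    ← smul_add]
  exact Finset.sum_congr rfl fun i _ => smul_comm _ _ _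

lemma dens_sum {ι : Type*} (t : Finset ι) (w : ι → ℝ≥0) (μ : ι → Measure EReal) :
    dens (∑ i ∈ t, w i • μ i) = ∑ i ∈ t, w i • dens (μ i) := by
  refine Measure.ext_of_lintegral _ fun f hf => ?_
  rw [lintegral_dens _ hf, lintegral_finsetSum_measure, lintegral_finsetSum_measure]
  refine Finset.sum_congr rfl fun i _ => ?_
  rw [lintegral_smul_measure, lintegral_smul_measure, lintegral_dens _ hf]

lemma isSymm_sum {ι : Type*} (t : Finset ι) (w : ι → ℝ≥0) (μ : ι → Measure EReal)
    (hw : ∑ i ∈ t, w i = 1) (hμ : ∀ i ∈ t, IsSymm (μ i)) : IsSymm (∑ i ∈ t, w i • μ i) := by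
  rw [IsSymm, evenPart_sum, dens_sum]
  refine ⟨⟨isProbabilityMeasure_sum _ _ _ hw fun i hi => (hμ i hi).1.prob, ?_⟩, ?_⟩
  · rw [reflect_sum]
    exact Finset.sum_congr rfl fun i hi => by rw [reflect_smul, (hμ i hi).1.even]
  · exact Finset.sum_congr rfl fun i hi => by rw [← (hμ i hi).2]

/-! ### The channel operator, uniformly in the two users -/

/-- The law of the message from a function node to the user `b`, given that the user `b` sends `s`
and the other user sends a uniform symbol about which a message of density `ν` is known. -/
def fLaw (A α : ℝ) (b : Bool) (s : ℤˣ) (ν : Measure EReal) : Measure EReal :=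
  ∑ r : ℤˣ, (1 / 2 : ℝ≥0) •
    ((reflect r ν).prod (chLaw A α (inp b s r))).map (fun p => funMsg A α b p.1 p.2)

instance (A α : ℝ) (b : Bool) (s : ℤˣ) (ν : Measure EReal) [IsProbabilityMeasure ν] :
    IsProbabilityMeasure (fLaw A α b s ν) := by
  refine isProbabilityMeasure_sum _ _ _ (by simp) fun r _ => ?_
  exact Measure.isProbabilityMeasure_map (by fun_prop)

lemma reflect_neg_one_fLaw (A α : ℝ) (b : Bool) (s : ℤˣ) (ν : Measure EReal)
    [IsProbabilityMeasure ν] : reflect (-1) (fLaw A α b s ν) = fLaw A α b (-s) ν := by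
  rw [fLaw, fLaw, reflect_sum, ← Equiv.sum_comp (Equiv.neg ℤˣ)]
  refine Finset.sum_congr rfl fun r _ => ?_
  rw [reflect_smul, reflect, Measure.map_map (by fun_prop) (by fun_prop)]
  congr 1
  have h1 : reflect r ν = (reflect (-r) ν).map (fun m => -m) := by
    rw [← funext signMul_neg_one]
    change _ = reflect (-1) (reflect (-r) ν)
    rw [reflect_reflect]; simp
  have h2 : chLaw A α (inp b (-s) r) = (chLaw A α (inp b s (-r))).map (fun y => -y) := by
    rw [← chLaw_neg, ← inp_neg, neg_neg]
  rw [h1, h2, Measure.map_prod_map _ _ (by fun_prop) (by fun_prop),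
    Measure.map_map (by fun_prop) (by fun_prop)]
  congr 1
  funext p
  simp [funMsg_neg]

lemma reflect_fLaw (A α : ℝ) (b : Bool) (s : ℤˣ) (ν : Measure EReal)
    [IsProbabilityMeasure ν] : reflect s (fLaw A α b 1 ν) = fLaw A α b s ν := by
  rcases Int.units_eq_one_or s with rfl | rfl
  · exact reflect_one _
  · exact reflect_neg_one_fLaw A α b 1 ν

/-- The operator `f_{2→1}` (for `b = true`) or `f_{1→2}` (for `b = false`). -/
def fOp (A α : ℝ) (b : Bool) (ν : Measure EReal) : Measure EReal :=
  if b then f21 A α ν else f12 A α ν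

/-- By the channel symmetry both symbols of the receiving user contribute the same law after the
sign correction, so conditioning on +1 loses nothing. -/
lemma fOp_eq (A α : ℝ) (b : Bool) (ν : Measure EReal) [IsProbabilityMeasure ν] :
    fOp A α b ν = fLaw A α b 1 ν := by
  have h : fOp A α b ν = ∑ s : ℤˣ, (1 / 2 : ℝ≥0) • reflect s (fLaw A α b s ν) := by
    have key : ∀ s r : ℤˣ, (1 / 4 : ℝ≥0) • ((reflect r ν).prod (chLaw A α (inp b s r))).map
          (fun p => signMul s (funMsg A α b p.1 p.2)) =
        (1 / 2 : ℝ≥0) • reflect s ((1 / 2 : ℝ≥0) •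
          ((reflect r ν).prod (chLaw A α (inp b s r))).map (fun p => funMsg A α b p.1 p.2)) := by
      intro s r
      have e : reflect s (((reflect r ν).prod (chLaw A α (inp b s r))).map
          (fun p => funMsg A α b p.1 p.2)) = ((reflect r ν).prod (chLaw A α (inp b s r))).map
          (signMul s ∘ fun p => funMsg A α b p.1 p.2) :=
        Measure.map_map (by fun_prop) (by fun_prop)
      rw [reflect_smul, e, smul_smul]
      norm_num
      rfl
    simp only [fLaw, reflect_sum, Finset.smul_sum, ← key]
    cases b
    · rw [Finset.sum_comm, ← Fintype.sum_prod_type']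
      rfl
    · rw [← Fintype.sum_prod_type']
      rfl
  rw [h, sum_units, reflect_neg_one_fLaw, neg_neg, reflect_one, ← add_smul]
  norm_num

lemma measurable_mixDensity (A α : ℝ) (b : Bool) (s : ℤˣ) :
    Measurable (fun p : EReal × ℝ => mixDensity A α b s p.1 p.2) :=
  (continuous_mixDensity A α b s).measurable

/-- For symmetric ν the message given the other symbol r has density twice `symProb r` relative to
the even part. Summing over r makes `mixDensity` the joint density of message and output. -/
lemma fLaw_eq_map {ν : Measure EReal} (hν : IsSymm ν) (A α : ℝ) (b : Bool) (s : ℤˣ) :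
    fLaw A α b s ν = (((evenPart ν).prod volume).withDensity
      fun p => ENNReal.ofReal (mixDensity A α b s p.1 p.2)).map
        (fun p => funMsg A α b p.1 p.2) := by
  have := hν.prob
  have := hν.1.prob
  have hm := measurable_mixDensity A α b s
  refine Measure.ext_of_lintegral _ fun f hf => ?_
  have hfm : Measurable fun p : EReal × ℝ => f (funMsg A α b p.1 p.2) := by fun_prop
  rw [lintegral_map hf (by fun_prop), lintegral_withDensity_eq_lintegral_mul _ (by fun_prop) hfm,
    fLaw, lintegral_finsetSum_measure]
  have key : ∀ r : ℤˣ, ∫⁻ u, f u ∂((1 / 2 : ℝ≥0) •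
      ((reflect r ν).prod (chLaw A α (inp b s r))).map (fun p => funMsg A α b p.1 p.2)) =
      ∫⁻ p, ENNReal.ofReal (chDensity A α (inp b s r) p.2 * symProb r p.1) *
        f (funMsg A α b p.1 p.2) ∂((evenPart ν).prod volume) := by
    intro r
    have hd := (continuous_chDensity A α (inp b s r)).measurable
    have hg : Measurable (gaussianPDF (chMean A α (inp b s r)) 1) :=
      measurable_gaussianPDF _ _
    rw [lintegral_smul_measure, lintegral_map hf (by fun_prop), hν.reflect_eq, chLaw,
      gaussianReal_of_var_ne_zero _ one_ne_zero, prod_withDensity (by fun_prop) (by fun_prop),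
      lintegral_withDensity_eq_lintegral_mul _ (by fun_prop) hfm, ENNReal.smul_def, smul_eq_mul,
      ← lintegral_const_mul _ (by fun_prop)]
    refine lintegral_congr fun p => ?_
    rw [Pi.mul_apply, ← mul_assoc, symProb_eq]
    congr 1
    rw [gaussianPDF, ← ENNReal.ofReal_mul (by
      have := symProb_nonneg r p.1
      rw [symProb_eq] at this; linarith), chDensity]
    rw [show (((1 / 2 : ℝ≥0) : ℝ≥0∞)) = ENNReal.ofReal (1 / 2) by
      rw [← ENNReal.ofReal_coe_nnreal]; norm_num, ← ENNReal.ofReal_mul (by norm_num)]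
    congr 1
    ring
  rw [Finset.sum_congr rfl fun r _ => key r, ← lintegral_finsetSum]
  · refine lintegral_congr fun p => ?_
    rw [← Finset.sum_mul, ← ENNReal.ofReal_sum_of_nonneg fun r _ =>
      mul_nonneg (chDensity_pos ..).le (symProb_nonneg ..)]
    rfl
  · intro r _
    have hd := (continuous_chDensity A α (inp b s r)).measurable
    fun_prop

lemma evenProb_evenPart (a : Measure EReal) [IsProbabilityMeasure a] : EvenProb (evenPart a) := by
  constructor
  · constructor
    rw [evenPart, Measure.smul_apply, Measure.add_apply, measure_univ, measure_univ,
      ENNReal.smul_def]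
    norm_num
    rw [ENNReal.inv_mul_cancel (by norm_num) (by norm_num)]
  · rw [evenPart, reflect_smul, reflect_add, reflect_reflect, neg_mul_neg, mul_one, reflect_one,
      add_comm]

/-- The unconditional density of the channel output and the other user's message. -/
def totDensity (A α : ℝ) (b : Bool) (u : EReal) (y : ℝ) : ℝ :=
  (mixDensity A α b 1 u y + mixDensity A α b (-1) u y) / 2

lemma totDensity_nonneg (A α : ℝ) (b : Bool) (u : EReal) (y : ℝ) : 0 ≤ totDensity A α b u y := by
  have := mixDensity_pos A α b 1 u y
  have := mixDensity_pos A α b (-1) u y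
  unfold totDensity
  linarith

lemma measurable_totDensity (A α : ℝ) (b : Bool) :
    Measurable (fun p : EReal × ℝ => totDensity A α b p.1 p.2) :=
  ((measurable_mixDensity A α b 1).add (measurable_mixDensity A α b (-1))).div_const _

lemma evenPart_fLaw {ν : Measure EReal} (hν : IsSymm ν) (A α : ℝ) (b : Bool) :
    evenPart (fLaw A α b 1 ν) = (((evenPart ν).prod volume).withDensity
      fun p => ENNReal.ofReal (totDensity A α b p.1 p.2)).map
        (fun p => funMsg A α b p.1 p.2) := by
  have := hν.prob
  have := hν.1.prob
  have h1 := measurable_mixDensity A α b 1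
  have h2 := measurable_mixDensity A α b (-1)
  have h3 := measurable_totDensity A α b
  rw [evenPart, reflect_neg_one_fLaw, fLaw_eq_map hν, fLaw_eq_map hν,
    ← Measure.map_add _ _ (by fun_prop), ← withDensity_add_left (by fun_prop), ← Measure.map_smul]
  congr 1
  rw [show ((1 / 2 : ℝ≥0) • ((evenPart ν).prod volume).withDensity
    ((fun p => ENNReal.ofReal (mixDensity A α b 1 p.1 p.2)) +
      fun p => ENNReal.ofReal (mixDensity A α b (-1) p.1 p.2))) =
      (((1 / 2 : ℝ≥0) : ℝ≥0∞) • ((evenPart ν).prod volume).withDensity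
    ((fun p => ENNReal.ofReal (mixDensity A α b 1 p.1 p.2)) +
      fun p => ENNReal.ofReal (mixDensity A α b (-1) p.1 p.2))) from rfl,
    ← withDensity_smul _ (by fun_prop)]
  congr 1
  funext p
  simp only [Pi.smul_apply, Pi.add_apply, smul_eq_mul]
  rw [← ENNReal.ofReal_add (mixDensity_pos ..).le (mixDensity_pos ..).le,
    show (((1 / 2 : ℝ≥0) : ℝ≥0∞)) = ENNReal.ofReal (1 / 2) by
      rw [← ENNReal.ofReal_coe_nnreal]; norm_num, ← ENNReal.ofReal_mul (by norm_num), totDensity]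
  congr 1; ring

/-- The tanh coordinate of the message is (P - M)/(P + M), with P and M the joint weights of the
symbols +1 and -1. Thus the weight 1 + t turns the unconditional density (P + M)/2 into P. -/
lemma IsSymm.fLaw {ν : Measure EReal} (hν : IsSymm ν) (A α : ℝ) (b : Bool) :
    IsSymm (fLaw A α b 1 ν) := by
  have := hν.prob
  have h1 := measurable_mixDensity A α b 1
  have h3 := measurable_totDensity A α b
  refine ⟨evenProb_evenPart _, Measure.ext_of_lintegral _ fun f hf => ?_⟩
  have hfm : Measurable fun p : EReal × ℝ => f (funMsg A α b p.1 p.2) := by fun_prop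
  rw [lintegral_dens _ hf, evenPart_fLaw hν, fLaw_eq_map hν, lintegral_map hf (by fun_prop),
    lintegral_map (by fun_prop) (by fun_prop),
    lintegral_withDensity_eq_lintegral_mul _ (by fun_prop) hfm,
    lintegral_withDensity_eq_lintegral_mul _ (by fun_prop) (by fun_prop)]
  refine lintegral_congr fun p => ?_
  simp only [Pi.mul_apply]
  rw [← mul_assoc, ← ENNReal.ofReal_mul (totDensity_nonneg ..), tanhHalf_funMsg, totDensity]
  congr 2
  have := mixDensity_pos A α b 1 p.1 p.2
  have := mixDensity_pos A α b (-1) p.1 p.2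
  field_simp
  ring

/-! ### Degradation: the convex order of even parts -/

/-- Bounded measurable functions on the line, convex on `[-1, 1]`. -/
structure ConvTest (φ : ℝ → ℝ) : Prop where
  meas : Measurable φ
  bdd : ∃ C, ∀ t ∈ Set.Icc (-1 : ℝ) 1, |φ t| ≤ C
  conv : ConvexOn ℝ (Set.Icc (-1 : ℝ) 1) φ

/-- The density `a` is degraded with respect to `a'`. -/
def Degraded (a a' : Measure EReal) : Prop :=
  ∀ φ, ConvTest φ →
    ∫ u, φ (tanhHalf u) ∂(evenPart a) ≤ ∫ u, φ (tanhHalf u) ∂(evenPart a')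

lemma div_mem_Icc_of_abs_le {n w : ℝ} (h : |n| ≤ w) : n / w ∈ Set.Icc (-1 : ℝ) 1 := by
  have hw : 0 ≤ w := (abs_nonneg n).trans h
  rw [Set.mem_Icc, ← abs_le, abs_div, abs_of_nonneg hw]
  exact div_le_one_of_le₀ h hw

/-- The perspective (n, w) ↦ w φ(n/w) is jointly convex on |n| ≤ w: apply convexity of φ to n₁/w₁
and n₂/w₂ with weights proportional to a w₁ and b w₂. -/
lemma perspective_le {φ : ℝ → ℝ} (hφ : ConvexOn ℝ (Set.Icc (-1 : ℝ) 1) φ) {a b n₁ w₁ n₂ w₂ : ℝ}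
    (ha : 0 ≤ a) (hb : 0 ≤ b) (h₁ : |n₁| ≤ w₁) (h₂ : |n₂| ≤ w₂) :
    (a * w₁ + b * w₂) * φ ((a * n₁ + b * n₂) / (a * w₁ + b * w₂)) ≤
      a * (w₁ * φ (n₁ / w₁)) + b * (w₂ * φ (n₂ / w₂)) := by
  have hw₁ : 0 ≤ w₁ := (abs_nonneg _).trans h₁
  have hw₂ : 0 ≤ w₂ := (abs_nonneg _).trans h₂
  rcases (add_nonneg (mul_nonneg ha hw₁) (mul_nonneg hb hw₂)).eq_or_lt with h | h
  -- If the total weight vanishes, both products a w₁ and b w₂ do, and all terms are zero whatever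
  -- the quotients are.
  · have e1 : a * w₁ = 0 := by nlinarith [mul_nonneg ha hw₁, mul_nonneg hb hw₂]
    have e2 : b * w₂ = 0 := by nlinarith [mul_nonneg ha hw₁, mul_nonneg hb hw₂]
    rw [← h, ← mul_assoc, ← mul_assoc, e1, e2]
    simp
  · set W := a * w₁ + b * w₂
    have hn₁ : w₁ * (n₁ / w₁) = n₁ := by
      rcases eq_or_ne w₁ 0 with h0 | h0
      · rw [h0, abs_nonpos_iff] at h₁; simp [h₁]
      · field_simp
    have hn₂ : w₂ * (n₂ / w₂) = n₂ := by
      rcases eq_or_ne w₂ 0 with h0 | h0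
      · rw [h0, abs_nonpos_iff] at h₂; simp [h₂]
      · field_simp
    have := hφ.2 (div_mem_Icc_of_abs_le h₁) (div_mem_Icc_of_abs_le h₂)
      (div_nonneg (mul_nonneg ha hw₁) h.le) (div_nonneg (mul_nonneg hb hw₂) h.le)
      (by rw [← add_div]; exact div_self h.ne')
    simp only [smul_eq_mul] at this
    have e : a * w₁ / W * (n₁ / w₁) + b * w₂ / W * (n₂ / w₂) = (a * n₁ + b * n₂) / W := by
      calc _ = (a * (w₁ * (n₁ / w₁)) + b * (w₂ * (n₂ / w₂))) / W := by ring
        _ = _ := by rw [hn₁, hn₂]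
    rw [e] at this
    calc _ ≤ W * (a * w₁ / W * φ (n₁ / w₁) + b * w₂ / W * φ (n₂ / w₂)) :=
          mul_le_mul_of_nonneg_left this h.le
      _ = _ := by field_simp

/-- Averages of perspectives of convex functions along affine functions are convex. -/
lemma ConvTest.perspective {φ : ℝ → ℝ} (hφ : ConvTest φ) {S : Type*} [MeasurableSpace S]
    {κ : Measure S} [SFinite κ] {w₀ w₁ n₀ n₁ : S → ℝ} (hw₀ : Measurable w₀) (hw₁ : Measurable w₁)
    (hn₀ : Measurable n₀) (hn₁ : Measurable n₁) (iw₀ : Integrable w₀ κ) (iw₁ : Integrable w₁ κ)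
    (h : ∀ s, ∀ t ∈ Set.Icc (-1 : ℝ) 1, |n₀ s + n₁ s * t| ≤ w₀ s + w₁ s * t) :
    ConvTest (fun t => ∫ s, (w₀ s + w₁ s * t) *
      φ ((n₀ s + n₁ s * t) / (w₀ s + w₁ s * t)) ∂κ) := by
  obtain ⟨C, hC⟩ := hφ.bdd
  have hφm := hφ.meas
  have hC0 : 0 ≤ C := (abs_nonneg _).trans (hC 0 (by simp))
  have hb : ∀ t ∈ Set.Icc (-1 : ℝ) 1, ∀ s, ‖(w₀ s + w₁ s * t) *
      φ ((n₀ s + n₁ s * t) / (w₀ s + w₁ s * t))‖ ≤ C * (|w₀ s| + |w₁ s|) := by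
    intro t ht s
    have hw := (abs_nonneg _).trans (h s t ht)
    rw [norm_mul, Real.norm_eq_abs, Real.norm_eq_abs, abs_of_nonneg hw, mul_comm]
    refine mul_le_mul (hC _ (div_mem_Icc_of_abs_le (h s t ht))) ?_ hw hC0
    have : |w₁ s * t| ≤ |w₁ s| := by
      rw [abs_mul]; exact mul_le_of_le_one_right (abs_nonneg _) (abs_le.2 ht)
    linarith [le_abs_self (w₀ s), le_abs_self (w₁ s * t)]
  have hbi : Integrable (fun s => C * (|w₀ s| + |w₁ s|)) κ := (iw₀.abs.add iw₁.abs).const_mul C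
  have hi : ∀ t ∈ Set.Icc (-1 : ℝ) 1, Integrable (fun s => (w₀ s + w₁ s * t) *
      φ ((n₀ s + n₁ s * t) / (w₀ s + w₁ s * t))) κ := by
    intro t ht
    refine hbi.mono' (by fun_prop) (ae_of_all _ (hb t ht))
  refine ⟨?_, ⟨∫ s, C * (|w₀ s| + |w₁ s|) ∂κ, fun t ht => ?_⟩, convex_Icc _ _, ?_⟩
  · have : StronglyMeasurable (fun t => ∫ s, (w₀ s + w₁ s * t) *
        φ ((n₀ s + n₁ s * t) / (w₀ s + w₁ s * t)) ∂κ) := by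
      refine StronglyMeasurable.integral_prod_right
        (f := fun t s => (w₀ s + w₁ s * t) *
        φ ((n₀ s + n₁ s * t) / (w₀ s + w₁ s * t))) ?_
      refine Measurable.stronglyMeasurable ?_
      unfold Function.uncurry
      fun_prop
    exact this.measurable
  · exact norm_integral_le_of_norm_le hbi (ae_of_all _ (hb t ht))
  · intro t ht t' ht' a b ha hb' hab
    simp only [smul_eq_mul]
    have hmem : a * t + b * t' ∈ Set.Icc (-1 : ℝ) 1 :=
      (convex_Icc (-1 : ℝ) 1) ht ht' ha hb' hab
    rw [← integral_const_mul, ← integral_const_mul, ← integral_add ((hi t ht).const_mul a)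
      ((hi t' ht').const_mul b)]
    refine integral_mono (hi _ hmem) (((hi t ht).const_mul a).add ((hi t' ht').const_mul b)) ?_
    intro s
    have := perspective_le hφ.conv ha hb' (h s t ht) (h s t' ht')
    have e1 : a * (w₀ s + w₁ s * t) + b * (w₀ s + w₁ s * t') = w₀ s + w₁ s * (a * t + b * t') := by
      linear_combination w₀ s * hab
    have e2 : a * (n₀ s + n₁ s * t) + b * (n₀ s + n₁ s * t') = n₀ s + n₁ s * (a * t + b * t') := by
      linear_combination n₀ s * hab
    rw [e1, e2] at this
    exact this

lemma Degraded.refl (a : Measure EReal) : Degraded a a := fun _ _ => le_rfl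

lemma Degraded.trans {a b c : Measure EReal} (h : Degraded a b) (h' : Degraded b c) :
    Degraded a c := fun φ hφ => (h φ hφ).trans (h' φ hφ)

/-- The law of `m(u, s)` under the density `w(u, s)` with respect to a product measure. -/
lemma integral_map_withDensity_prod {S : Type*} [MeasurableSpace S] {η : Measure EReal}
    {κ : Measure S} [SFinite η] [SFinite κ] {w : EReal → S → ℝ} {m : EReal → S → EReal}
    (hw : Measurable (Function.uncurry w)) (hm : Measurable (Function.uncurry m))
    (hw0 : ∀ u s, 0 ≤ w u s)
    [IsFiniteMeasure (((η.prod κ).withDensity fun p => ENNReal.ofReal (w p.1 p.2)).map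
      (fun p => m p.1 p.2))] {f : EReal → ℝ} (hf : Measurable f) {C : ℝ} (hC : ∀ u, |f u| ≤ C) :
    ∫ u, f u ∂(((η.prod κ).withDensity fun p => ENNReal.ofReal (w p.1 p.2)).map
      (fun p => m p.1 p.2)) = ∫ u, ∫ s, w u s * f (m u s) ∂κ ∂η := by
  have hm' : Measurable fun p : EReal × S => m p.1 p.2 := hm
  have hw' : Measurable fun p : EReal × S => w p.1 p.2 := hw
  have hi : Integrable f (((η.prod κ).withDensity fun p => ENNReal.ofReal (w p.1 p.2)).map
      (fun p => m p.1 p.2)) := integrable_of_abs_le hf hC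
  rw [integrable_map_measure hf.aestronglyMeasurable hm'.aemeasurable,
    integrable_withDensity_iff_integrable_smul' (by fun_prop) (by simp)] at hi
  rw [integral_map hm'.aemeasurable hf.aestronglyMeasurable,
    integral_withDensity_eq_integral_toReal_smul (by fun_prop) (by simp), integral_prod]
  · simp [ENNReal.toReal_ofReal (hw0 _ _)]
  · exact hi

/-- The common form of variable, check and channel operators. If w and w · tanh(m/2) are affine in
tanh(u/2), testing the output by φ is testing the input by an averaged perspective of φ, which is
again a convex test function. Monotonicity of each operator reduces to this. -/
lemma integral_evenPart_kernel {φ : ℝ → ℝ} (hφ : ConvTest φ) {S : Type*} [MeasurableSpace S]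
    {η : Measure EReal} {κ : Measure S} [SFinite η] [SFinite κ]
    {w : EReal → S → ℝ} {m : EReal → S → EReal}
    (hw : Measurable (Function.uncurry w)) (hm : Measurable (Function.uncurry m))
    (hw0 : ∀ u s, 0 ≤ w u s)
    [IsFiniteMeasure (((η.prod κ).withDensity fun p => ENNReal.ofReal (w p.1 p.2)).map
      (fun p => m p.1 p.2))] {w₀ w₁ n₀ n₁ : S → ℝ}
    (hwe : ∀ u s, w u s = w₀ s + w₁ s * tanhHalf u)
    (hme : ∀ u s, tanhHalf (m u s) * w u s = n₀ s + n₁ s * tanhHalf u) :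
    ∫ u, φ (tanhHalf u) ∂(((η.prod κ).withDensity fun p => ENNReal.ofReal (w p.1 p.2)).map
      (fun p => m p.1 p.2)) = ∫ u, (fun t => ∫ s, (w₀ s + w₁ s * t) *
      φ ((n₀ s + n₁ s * t) / (w₀ s + w₁ s * t)) ∂κ) (tanhHalf u) ∂η := by
  obtain ⟨C, hC⟩ := hφ.bdd
  have hφm := hφ.meas
  rw [integral_map_withDensity_prod hw hm hw0 (by fun_prop) fun u => hC _ (tanhHalf_mem u)]
  refine integral_congr_ae (ae_of_all _ fun u => integral_congr_ae (ae_of_all _ fun s => ?_))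
  simp only
  rw [← hwe, ← hme]
  rcases eq_or_ne (w u s) 0 with h | h
  · simp [h]
  · rw [mul_div_cancel_right₀ _ h]

lemma abs_le_of_tanhHalf {w n : ℝ → ℝ} (h : ∀ u : EReal, |n (tanhHalf u)| ≤ w (tanhHalf u)) :
    ∀ t ∈ Set.Icc (-1 : ℝ) 1, |n t| ≤ w t := by
  intro t ht
  have := h (twoArtanh t)
  rwa [tanhHalf_twoArtanh ht] at this

lemma abs_mul_tanhHalf_le {w : ℝ} (hw : 0 ≤ w) (u : EReal) : |tanhHalf u * w| ≤ w := by
  rw [abs_mul, abs_of_nonneg hw]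
  exact mul_le_of_le_one_left hw (abs_tanhHalf_le u)

lemma Degraded.varConv_left {a a' c : Measure EReal} (ha : IsSymm a) (ha' : IsSymm a')
    (hc : IsSymm c) (h : Degraded a a') : Degraded (varConv a c) (varConv a' c) := by
  intro φ hφ
  rw [evenPart_varConv ha hc, evenPart_varConv ha' hc]
  have := ha.1.prob
  have := ha'.1.prob
  have := hc.1.prob
  have i1 := (evenProb_varEven ha.1 hc.1).prob
  have i2 := (evenProb_varEven ha'.1 hc.1).prob
  unfold varEven at i1 i2 ⊢
  -- Here the weight is 1 + t't and the numerator t' + t, both affine in t; the latter is the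
  -- addition theorem.
  have hw : ∀ u v : EReal, 1 + tanhHalf u * tanhHalf v = 1 + tanhHalf v * tanhHalf u := by
    intro u v; ring
  have hm : ∀ u v : EReal, tanhHalf (u + v) * (1 + tanhHalf u * tanhHalf v) =
      tanhHalf v + 1 * tanhHalf u := by
    intro u v; rw [tanhHalf_add_mul]; ring
  have mw : Measurable (Function.uncurry fun u v : EReal => 1 + tanhHalf u * tanhHalf v) := by
    unfold Function.uncurry; fun_prop
  have mm : Measurable (Function.uncurry fun u v : EReal => u + v) := by
    unfold Function.uncurry; fun_prop
  rw [integral_evenPart_kernel hφ (w := fun u v => 1 + tanhHalf u * tanhHalf v)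
      (m := fun u v => u + v) mw mm one_add_tanhHalf_mul_nonneg (w₀ := fun _ => 1)
      (w₁ := tanhHalf) (n₀ := tanhHalf) (n₁ := fun _ => 1) hw hm,
    integral_evenPart_kernel hφ (w := fun u v => 1 + tanhHalf u * tanhHalf v)
      (m := fun u v => u + v) mw mm one_add_tanhHalf_mul_nonneg (w₀ := fun _ => 1)
      (w₁ := tanhHalf) (n₀ := tanhHalf) (n₁ := fun _ => 1) hw hm]
  refine h _ (hφ.perspective (by fun_prop) (by fun_prop) (by fun_prop) (by fun_prop)
    (integrable_const _) (integrable_of_abs_le measurable_tanhHalf abs_tanhHalf_le) ?_)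
  intro v
  refine abs_le_of_tanhHalf (w := fun t => 1 + tanhHalf v * t)
    (n := fun t => tanhHalf v + 1 * t) fun u => ?_
  rw [← hm, ← hw u v]
  exact abs_mul_tanhHalf_le (one_add_tanhHalf_mul_nonneg u v) _

lemma Degraded.chkConv_left {a a' c : Measure EReal} (ha : IsSymm a) (ha' : IsSymm a')
    (hc : IsSymm c) (h : Degraded a a') : Degraded (chkConv a c) (chkConv a' c) := by
  intro φ hφ
  rw [evenPart_chkConv ha hc, evenPart_chkConv ha' hc]
  have := ha.1.prob
  have := ha'.1.prob
  have := hc.1.prob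
  have hd : ∀ η : Measure EReal, chkConv η (evenPart c) =
      ((η.prod (evenPart c)).withDensity fun p => ENNReal.ofReal ((fun _ _ => 1) p.1 p.2)).map
        (fun p => (fun u v => twoArtanh (tanhHalf u * tanhHalf v)) p.1 p.2) := by
    intro η
    simp only [ENNReal.ofReal_one]
    rw [show (fun _ : EReal × EReal => (1 : ℝ≥0∞)) = 1 from rfl, withDensity_one]
    rfl
  have i1 := (evenProb_chkConv ha.1 hc.1).prob
  have i2 := (evenProb_chkConv ha'.1 hc.1).prob
  rw [hd] at i1 i2 ⊢
  rw [hd]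
  have mm : Measurable (Function.uncurry fun u v : EReal =>
      twoArtanh (tanhHalf u * tanhHalf v)) := by
    unfold Function.uncurry; fun_prop
  have hm : ∀ u v : EReal, tanhHalf (twoArtanh (tanhHalf u * tanhHalf v)) * 1 =
      0 + tanhHalf v * tanhHalf u := by
    intro u v; rw [tanhHalf_twoArtanh (tanhHalf_mul_mem u v)]; ring
  rw [integral_evenPart_kernel hφ (w := fun _ _ => 1) (by exact measurable_const) mm
      (fun _ _ => zero_le_one) (w₀ := fun _ => 1)
      (w₁ := fun _ => 0) (n₀ := fun _ => 0) (n₁ := tanhHalf) (by simp) hm,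
    integral_evenPart_kernel hφ (w := fun _ _ => 1) (by exact measurable_const) mm
      (fun _ _ => zero_le_one) (w₀ := fun _ => 1)
      (w₁ := fun _ => 0) (n₀ := fun _ => 0) (n₁ := tanhHalf) (by simp) hm]
  refine h _ (hφ.perspective (by fun_prop) (by fun_prop) (by fun_prop) (by fun_prop)
    (integrable_const _) (integrable_const _) ?_)
  intro v
  refine abs_le_of_tanhHalf (w := fun t => 1 + 0 * t)
    (n := fun t => 0 + tanhHalf v * t) fun u => ?_
  rw [← hm]
  simpa using abs_tanhHalf_le _

lemma integrable_chDensity (A α : ℝ) (x : Input) : Integrable (chDensity A α x) :=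
  integrable_gaussianPDFReal _ _

lemma Degraded.fLaw {a a' : Measure EReal} (ha : IsSymm a) (ha' : IsSymm a')
    (h : Degraded a a') (A α : ℝ) (b : Bool) :
    Degraded (fLaw A α b 1 a) (fLaw A α b 1 a') := by
  intro φ hφ
  have := ha.1.prob
  have := ha'.1.prob
  have i1 := (ha.fLaw A α b).1.prob
  have i2 := (ha'.fLaw A α b).1.prob
  rw [evenPart_fLaw ha] at i1 ⊢
  rw [evenPart_fLaw ha'] at i2 ⊢
  have mw : Measurable (Function.uncurry fun (u : EReal) (y : ℝ) => totDensity A α b u y) :=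
    measurable_totDensity A α b
  have mm : Measurable (Function.uncurry fun (u : EReal) (y : ℝ) => funMsg A α b u y) :=
    measurable_funMsg A α b
  -- The 1/4 collects the halves in `totDensity` and in `symProb`. Affinity in t holds because each
  -- symbol probability is affine in t.
  let p : ℤˣ → ℤˣ → ℝ → ℝ := fun s r y => chDensity A α (inp b s r) y / 4
  have hpm : ∀ s r, Measurable (p s r) := fun s r =>
    (continuous_chDensity A α _).measurable.div_const _
  have hpi : ∀ s r, Integrable (p s r) := fun s r => (integrable_chDensity A α _).div_const _
  have hw : ∀ (u : EReal) (y : ℝ), totDensity A α b u y =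
      (p 1 1 y + p 1 (-1) y + p (-1) 1 y + p (-1) (-1) y) +
      (p 1 1 y - p 1 (-1) y + p (-1) 1 y - p (-1) (-1) y) * tanhHalf u := by
    intro u y
    simp only [totDensity, mixDensity, sum_units, symProb_eq, bit_one, bit_neg_one, p]
    ring
  have hm : ∀ (u : EReal) (y : ℝ), tanhHalf (funMsg A α b u y) * totDensity A α b u y =
      (p 1 1 y + p 1 (-1) y - p (-1) 1 y - p (-1) (-1) y) +
      (p 1 1 y - p 1 (-1) y - p (-1) 1 y + p (-1) (-1) y) * tanhHalf u := by
    intro u y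
    have h1 := mixDensity_pos A α b 1 u y
    have h2 := mixDensity_pos A α b (-1) u y
    rw [tanhHalf_funMsg, totDensity]
    have : (mixDensity A α b 1 u y - mixDensity A α b (-1) u y) /
        (mixDensity A α b 1 u y + mixDensity A α b (-1) u y) *
        ((mixDensity A α b 1 u y + mixDensity A α b (-1) u y) / 2) =
        (mixDensity A α b 1 u y - mixDensity A α b (-1) u y) / 2 := by
      field_simp
    rw [this]
    simp only [mixDensity, sum_units, symProb_eq, bit_one, bit_neg_one, p]
    ring
  have e := fun η (_ : SFinite η) (_ : IsFiniteMeasure (((η.prod volume).withDensity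
      fun p => ENNReal.ofReal (totDensity A α b p.1 p.2)).map
        (fun p => funMsg A α b p.1 p.2))) => integral_evenPart_kernel hφ (η := η) (κ := volume)
      (w := totDensity A α b)
      (m := funMsg A α b) mw mm (totDensity_nonneg A α b) hw hm
  rw [e _ inferInstance inferInstance, e _ inferInstance inferInstance]
  refine h _ (hφ.perspective (by fun_prop) (by fun_prop) (by fun_prop) (by fun_prop)
    (by fun_prop) (by fun_prop) ?_)
  intro y
  refine abs_le_of_tanhHalf (w := fun t => (p 1 1 y + p 1 (-1) y + p (-1) 1 y + p (-1) (-1) y) +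
      (p 1 1 y - p 1 (-1) y + p (-1) 1 y - p (-1) (-1) y) * t)
    (n := fun t => (p 1 1 y + p 1 (-1) y - p (-1) 1 y - p (-1) (-1) y) +
      (p 1 1 y - p 1 (-1) y - p (-1) 1 y + p (-1) (-1) y) * t) fun u => ?_
  rw [← hm, ← hw]
  exact abs_mul_tanhHalf_le (totDensity_nonneg ..) _

lemma Degraded.varConv {a a' c c' : Measure EReal} (ha : IsSymm a) (ha' : IsSymm a')
    (hc : IsSymm c) (hc' : IsSymm c') (h : Degraded a a') (h' : Degraded c c') :
    Degraded (varConv a c) (varConv a' c') := by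
  have := ha'.prob
  have := hc.prob
  have := hc'.prob
  refine (h.varConv_left ha ha' hc).trans ?_
  rw [varConv_comm a' c, varConv_comm a' c']
  exact h'.varConv_left hc hc' ha'

lemma Degraded.chkConv {a a' c c' : Measure EReal} (ha : IsSymm a) (ha' : IsSymm a')
    (hc : IsSymm c) (hc' : IsSymm c') (h : Degraded a a') (h' : Degraded c c') :
    Degraded (chkConv a c) (chkConv a' c') := by
  have := ha'.prob
  have := hc.prob
  have := hc'.prob
  refine (h.chkConv_left ha ha' hc).trans ?_
  rw [chkConv_comm a' c, chkConv_comm a' c']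
  exact h'.chkConv_left hc hc' ha'

lemma Degraded.varPow {a a' : Measure EReal} (ha : IsSymm a) (ha' : IsSymm a')
    (h : Degraded a a') (k : ℕ) : Degraded (varPow a k) (varPow a' k) := by
  induction k with
  | zero => exact Degraded.refl _
  | succ k ih => exact Degraded.varConv (ha.varPow k) (ha'.varPow k) ha ha' ih h

lemma Degraded.chkPow {a a' : Measure EReal} (ha : IsSymm a) (ha' : IsSymm a')
    (h : Degraded a a') (k : ℕ) : Degraded (chkPow a k) (chkPow a' k) := by
  induction k with
  | zero => exact Degraded.refl _
  | succ k ih => exact Degraded.chkConv (ha.chkPow k) (ha'.chkPow k) ha ha' ih h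

lemma integral_sum_smul {ι S : Type*} [MeasurableSpace S] (t : Finset ι) (w : ι → ℝ≥0)
    (μ : ι → Measure S) {f : S → ℝ} (hf : ∀ i ∈ t, Integrable f (μ i)) :
    ∫ u, f u ∂(∑ i ∈ t, w i • μ i) = ∑ i ∈ t, (w i : ℝ) * ∫ u, f u ∂(μ i) := by
  rw [integral_finsetSum_measure fun i hi => (hf i hi).smul_measure_nnreal]
  exact Finset.sum_congr rfl fun i _ => integral_smul_nnreal_measure f (w i)

lemma Degraded.sum {ι : Type*} (t : Finset ι) (w : ι → ℝ≥0) (μ μ' : ι → Measure EReal)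
    (hs : ∀ i ∈ t, IsSymm (μ i)) (hs' : ∀ i ∈ t, IsSymm (μ' i))
    (h : ∀ i ∈ t, Degraded (μ i) (μ' i)) :
    Degraded (∑ i ∈ t, w i • μ i) (∑ i ∈ t, w i • μ' i) := by
  intro φ hφ
  obtain ⟨C, hC⟩ := hφ.bdd
  have hφm := hφ.meas
  have hi : ∀ ν : Measure EReal, IsSymm ν → Integrable (fun u => φ (tanhHalf u)) (evenPart ν) := by
    intro ν hν
    have := hν.1.prob
    exact integrable_of_abs_le (by fun_prop) fun u => hC _ (tanhHalf_mem u)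
  rw [evenPart_sum, evenPart_sum, integral_sum_smul _ _ _ fun i hit => hi _ (hs i hit),
    integral_sum_smul _ _ _ fun i hit => hi _ (hs' i hit)]
  exact Finset.sum_le_sum fun i hit => mul_le_mul_of_nonneg_left (h i hit φ hφ) (w i).2

/-- Jensen's inequality for a law invariant under t ↦ -t: φ(0) is at most the average of φ(t) and
φ(-t). -/
lemma degraded_dirac_zero {a : Measure EReal} (ha : IsSymm a) :
    Degraded (Measure.dirac 0) a := by
  intro φ hφ
  obtain ⟨C, hC⟩ := hφ.bdd
  have hφm := hφ.meas
  have := ha.1.prob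
  have h0 : evenPart (Measure.dirac (0 : EReal)) = Measure.dirac 0 := by
    rw [evenPart, reflect, Measure.map_dirac' (measurable_signMul _), signMul_zero, ← two_smul ℝ≥0,
      smul_smul]
    norm_num
  have hi : Integrable (fun u => φ (tanhHalf u)) (evenPart a) :=
    integrable_of_abs_le (by fun_prop) fun u => hC _ (tanhHalf_mem u)
  have hi' : Integrable (fun u => φ (tanhHalf (-u))) (evenPart a) :=
    integrable_of_abs_le (by fun_prop) fun u => hC _ (tanhHalf_mem _)
  have e := ha.1.integral_neg (f := fun u => φ (tanhHalf u)) (by fun_prop)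
  rw [h0, integral_dirac, tanhHalf_zero]
  have : ∫ _u : EReal, φ 0 ∂(evenPart a) ≤
      ∫ u, (1 / 2 * φ (tanhHalf u) + 1 / 2 * φ (tanhHalf (-u))) ∂(evenPart a) := by
    refine integral_mono (integrable_const _) ((hi.const_mul _).add (hi'.const_mul _)) fun u => ?_
    have := hφ.conv.2 (tanhHalf_mem u) (tanhHalf_mem (-u)) (by norm_num : (0 : ℝ) ≤ 1 / 2)
      (by norm_num : (0 : ℝ) ≤ 1 / 2) (by norm_num)
    simpa using this
  rw [integral_add (hi.const_mul _) (hi'.const_mul _), integral_const_mul, integral_const_mul,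
    e] at this
  simp at this
  linarith

/-! ### Density evolution, uniformly in the two users -/

/-- `(λ, ρ)` is a pair of degree distributions without checks of degree at most one. -/
structure IsDegreePair (lam rho : ℕ →₀ ℝ≥0) : Prop where
  lam_zero : lam 0 = 0
  lam_sum : lam.sum (fun _ w => w) = 1
  rho_zero : rho 0 = 0
  rho_one : rho 1 = 0
  rho_sum : rho.sum (fun _ w => w) = 1

variable {lam rho : ℕ →₀ ℝ≥0}

lemma IsDegreePair.pos_of_mem (h : IsDegreePair lam rho) {i : ℕ} (hi : i ∈ lam.support) :
    0 < i := by
  rcases Nat.eq_zero_or_pos i with rfl | h'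
  · exact absurd h.lam_zero (Finsupp.mem_support_iff.1 hi)
  · exact h'

lemma IsDegreePair.invMean_pos (h : IsDegreePair lam rho) :
    0 < lam.sum (fun j w => w / j) := by
  have h1 := h.lam_sum
  rw [Finsupp.sum] at h1 ⊢
  have hne : lam.support.Nonempty := by
    by_contra hne
    rw [Finset.not_nonempty_iff_eq_empty] at hne
    simp [hne] at h1
  refine Finset.sum_pos (fun i hi => ?_) hne
  have := h.pos_of_mem hi
  have := Finsupp.mem_support_iff.1 hi
  exact div_pos (pos_iff_ne_zero.2 ‹_›) (by exact_mod_cast ‹0 < i›)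

lemma IsDegreePair.sum_nodeFrac (h : IsDegreePair lam rho) :
    ∑ i ∈ lam.support, nodeFrac lam i = 1 := by
  unfold nodeFrac
  rw [← Finset.sum_div]
  exact div_self h.invMean_pos.ne'

lemma IsSymm.rhoOp (h : IsDegreePair lam rho) {a : Measure EReal} (ha : IsSymm a) :
    IsSymm (rhoOp rho a) :=
  isSymm_sum _ _ _ h.rho_sum fun _ _ => ha.chkPow _

lemma IsSymm.lamOp (h : IsDegreePair lam rho) {a : Measure EReal} (ha : IsSymm a) :
    IsSymm (lamOp lam a) :=
  isSymm_sum _ _ _ h.lam_sum fun _ _ => ha.varPow _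

lemma IsSymm.nodeOp (h : IsDegreePair lam rho) {a : Measure EReal} (ha : IsSymm a) :
    IsSymm (nodeOp lam a) :=
  isSymm_sum _ _ _ h.sum_nodeFrac fun _ _ => ha.varPow _

lemma IsSymm.varToFun (h : IsDegreePair lam rho) {a : Measure EReal} (ha : IsSymm a) :
    IsSymm (varToFun lam rho a) :=
  (ha.rhoOp h).nodeOp h

lemma Degraded.rhoOp {a a' : Measure EReal} (ha : IsSymm a)
    (ha' : IsSymm a') (hd : Degraded a a') : Degraded (rhoOp rho a) (rhoOp rho a') :=
  Degraded.sum _ _ _ _ (fun _ _ => ha.chkPow _) (fun _ _ => ha'.chkPow _)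
    fun _ _ => hd.chkPow ha ha' _

lemma Degraded.lamOp {a a' : Measure EReal} (ha : IsSymm a)
    (ha' : IsSymm a') (hd : Degraded a a') : Degraded (lamOp lam a) (lamOp lam a') :=
  Degraded.sum _ _ _ _ (fun _ _ => ha.varPow _) (fun _ _ => ha'.varPow _)
    fun _ _ => hd.varPow ha ha' _

lemma Degraded.varToFun (h : IsDegreePair lam rho) {a a' : Measure EReal} (ha : IsSymm a)
    (ha' : IsSymm a') (hd : Degraded a a') :
    Degraded (varToFun lam rho a) (varToFun lam rho a') :=
  Degraded.sum _ _ _ _ (fun _ _ => (ha.rhoOp h).varPow _) (fun _ _ => (ha'.rhoOp h).varPow _)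
    fun _ _ => (hd.rhoOp ha ha').varPow (ha.rhoOp h) (ha'.rhoOp h) _

/-- The density of the messages of the user `b` after one step of density evolution. -/
def deNext (A α : ℝ) (lam rho : ℕ →₀ ℝ≥0) (a : Bool → Measure EReal) (b : Bool) :
    Measure EReal :=
  varConv (fLaw A α b 1 (varToFun lam rho (a !b))) (lamOp lam (rhoOp rho (a b)))

/-- Density evolution with the two users as values of an index. -/
def deSeq (A α : ℝ) (lam rho : ℕ →₀ ℝ≥0) : ℕ → Bool → Measure EReal
  | 0 => fun _ => Measure.dirac 0
  | l + 1 => deNext A α lam rho (deSeq A α lam rho l)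

lemma isSymm_deNext (h : IsDegreePair lam rho) (A α : ℝ) {a : Bool → Measure EReal}
    (ha : ∀ b, IsSymm (a b)) (b : Bool) : IsSymm (deNext A α lam rho a b) :=
  (((ha !b).varToFun h).fLaw A α b).varConv (((ha b).rhoOp h).lamOp h)

lemma isSymm_deSeq (h : IsDegreePair lam rho) (A α : ℝ) (l : ℕ) :
    ∀ b, IsSymm (deSeq A α lam rho l b) := by
  induction l with
  | zero => exact fun _ => isSymm_dirac_zero
  | succ l ih => exact isSymm_deNext h A α ih

/-- A monotone iteration started at the least element increases. -/
lemma degraded_deSeq_succ (h : IsDegreePair lam rho) (A α : ℝ) (l : ℕ) :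
    ∀ b, Degraded (deSeq A α lam rho l b) (deSeq A α lam rho (l + 1) b) := by
  induction l with
  | zero => exact fun b => degraded_dirac_zero (isSymm_deSeq h A α 1 b)
  | succ l ih =>
    intro b
    have s := isSymm_deSeq h A α l
    have s' := isSymm_deSeq h A α (l + 1)
    exact Degraded.varConv (((s !b).varToFun h).fLaw A α b) (((s' !b).varToFun h).fLaw A α b)
      (((s b).rhoOp h).lamOp h) (((s' b).rhoOp h).lamOp h)
      (((ih !b).varToFun h (s _) (s' _)).fLaw ((s _).varToFun h) ((s' _).varToFun h) A α b)
      (((ih b).rhoOp (s b) (s' b)).lamOp ((s b).rhoOp h) ((s' b).rhoOp h))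

lemma deIter_eq (h : IsDegreePair lam rho) (A α : ℝ) (l : ℕ) :
    deIter A α lam rho l = (deSeq A α lam rho l true, deSeq A α lam rho l false) := by
  induction l with
  | zero => rfl
  | succ l ih =>
    have s := fun b => ((isSymm_deSeq h A α l b).varToFun h).prob
    have s1 := s true
    have s2 := s false
    rw [deIter, ih, deStep, deSeq, deNext, deNext, ← fOp_eq, ← fOp_eq]
    rfl

/-! ### Convergence of density evolution -/

lemma integral_evenPart (a : Measure EReal) [IsProbabilityMeasure a] {f : EReal → ℝ}
    (hf : Measurable f) {C : ℝ} (hC : ∀ u, |f u| ≤ C) :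
    ∫ u, f u ∂(evenPart a) = (1 / 2) * (∫ u, f u ∂a + ∫ u, f (-u) ∂a) := by
  rw [evenPart, integral_smul_nnreal_measure, integral_add_measure (integrable_of_abs_le hf hC)
    (integrable_of_abs_le hf hC), reflect, integral_map (by fun_prop) hf.aestronglyMeasurable]
  simp only [signMul_neg_one, NNReal.smul_def, smul_eq_mul]
  norm_num

/-- Even powers are convex test functions with values at most 1, so their integrals increase to a
limit; odd powers integrate to zero by evenness. -/
lemma exists_tendsto_moment {a : ℕ → Measure EReal} (hs : ∀ l, IsSymm (a l))
    (hd : ∀ l, Degraded (a l) (a (l + 1))) (k : ℕ) :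
    ∃ L, Tendsto (fun l => ∫ u, tanhHalf u ^ k ∂(evenPart (a l))) atTop (𝓝 L) := by
  rcases Nat.even_or_odd k with hk | hk
  · have hφ : ConvTest (fun t => t ^ k) := by
      refine ⟨by fun_prop, ⟨1, fun t ht => ?_⟩, ?_⟩
      · rw [abs_pow]; exact pow_le_one₀ (abs_nonneg t) (abs_le.2 ht)
      · exact (hk.convexOn_pow).subset (Set.subset_univ _) (convex_Icc _ _)
    refine ⟨_, tendsto_atTop_ciSup (monotone_nat_of_le_succ fun l => hd l _ hφ) ⟨1, ?_⟩⟩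
    rintro _ ⟨l, rfl⟩
    have := (hs l).1.prob
    calc ∫ u, tanhHalf u ^ k ∂(evenPart (a l)) ≤ ∫ _u, (1 : ℝ) ∂(evenPart (a l)) := by
          have hb : ∀ u, |tanhHalf u ^ k| ≤ 1 := fun u => by
            rw [abs_pow]; exact pow_le_one₀ (abs_nonneg _) (abs_tanhHalf_le u)
          exact integral_mono (integrable_of_abs_le (by fun_prop) hb) (integrable_const _)
            fun u => (abs_le.1 (hb u)).2
      _ = 1 := by simp
  · refine ⟨0, ?_⟩
    have : ∀ l, ∫ u, tanhHalf u ^ k ∂(evenPart (a l)) = 0 := by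
      intro l
      have := (hs l).1.integral_neg (f := fun u => tanhHalf u ^ k) (by fun_prop)
      simp only [tanhHalf_neg, hk.neg_pow, integral_neg] at this
      linarith
    simp [this]

/-- The integral of tⁿ under a symmetric density is the sum of the moments n and n + 1 of its even
part, so polynomials in t have convergent integrals. They are uniformly dense, because t separates
the points of the compact space [-∞, ∞]. -/
lemma exists_tendsto_integral {a : ℕ → Measure EReal} (hs : ∀ l, IsSymm (a l))
    (hd : ∀ l, Degraded (a l) (a (l + 1))) (f : C(EReal, ℝ)) :
    ∃ L, Tendsto (fun l => ∫ u, f u ∂(a l)) atTop (𝓝 L) := by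
  have hp : ∀ l, IsProbabilityMeasure (a l) := fun l => (hs l).prob
  have he : ∀ l, IsProbabilityMeasure (evenPart (a l)) := fun l => (hs l).1.prob
  let T : C(EReal, ℝ) := ⟨tanhHalf, continuous_tanhHalf⟩
  have hpoly : ∀ p : Polynomial ℝ,
      ∃ L, Tendsto (fun l => ∫ u, p.eval (tanhHalf u) ∂(a l)) atTop (𝓝 L) := by
    intro p
    induction p using Polynomial.induction_on' with
    | add p q hp' hq' =>
      obtain ⟨L, hL⟩ := hp'
      obtain ⟨L', hL'⟩ := hq'
      refine ⟨L + L', (hL.add hL').congr fun l => ?_⟩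
      have hi : ∀ p : Polynomial ℝ, Integrable (fun u => p.eval (tanhHalf u)) (a l) := fun p =>
        (((p.continuous).comp continuous_tanhHalf).integrable_of_hasCompactSupport
          (HasCompactSupport.of_compactSpace _))
      simp only [Polynomial.eval_add]
      exact (integral_add (hi p) (hi q)).symm
    | monomial n c =>
      obtain ⟨L, hL⟩ := exists_tendsto_moment hs hd n
      obtain ⟨L', hL'⟩ := exists_tendsto_moment hs hd (n + 1)
      refine ⟨c * (L + L'), ((hL.add hL').const_mul c).congr fun l => ?_⟩
      have hi : ∀ n : ℕ, Integrable (fun u => tanhHalf u ^ n) (evenPart (a l)) := fun p =>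
        ((continuous_tanhHalf.pow p).integrable_of_hasCompactSupport
          (HasCompactSupport.of_compactSpace _))
      conv_rhs => rw [(hs l).2]
      rw [integral_dens, ← integral_add (hi _) (hi _), ← integral_const_mul]
      congr 1
      funext u
      simp only [Polynomial.eval_monomial]
      ring
  have hdense : f ∈ (Algebra.adjoin ℝ {T}).topologicalClosure := by
    rw [ContinuousMap.subalgebra_topologicalClosure_eq_top_of_separatesPoints]
    · trivial
    · intro u v huv
      exact ⟨tanhHalf, ⟨T, Algebra.self_mem_adjoin_singleton ℝ T, rfl⟩,
        fun h => huv (tanhHalf_strictMono.injective h)⟩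
  have hcauchy : CauchySeq (fun l => ∫ u, f u ∂(a l)) := by
    rw [Metric.cauchySeq_iff]
    intro ε hε
    obtain ⟨g, hg, hfg⟩ := Metric.mem_closure_iff.1 hdense (ε / 3) (by positivity)
    rw [SetLike.mem_coe, Algebra.adjoin_singleton_eq_range_aeval] at hg
    obtain ⟨p, rfl⟩ := hg
    have hgp : ∀ u, (Polynomial.aeval T p) u = p.eval (tanhHalf u) :=
      fun u => Polynomial.aeval_continuousMap_apply p T u
    obtain ⟨L, hL⟩ := hpoly p
    obtain ⟨N, hN⟩ := Metric.cauchySeq_iff.1 hL.cauchySeq (ε / 3) (by positivity)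
    refine ⟨N, fun m hm n hn => ?_⟩
    have hclose : ∀ l, dist (∫ u, f u ∂(a l)) (∫ u, p.eval (tanhHalf u) ∂(a l)) ≤
        dist f (Polynomial.aeval T p) := by
      intro l
      have i1 : Integrable f (a l) := f.continuous.integrable_of_hasCompactSupport
          (HasCompactSupport.of_compactSpace _)
      have i2 : Integrable (fun u => p.eval (tanhHalf u)) (a l) :=
        (((p.continuous).comp continuous_tanhHalf).integrable_of_hasCompactSupport
          (HasCompactSupport.of_compactSpace _))
      rw [dist_eq_norm, ← integral_sub i1 i2]
      refine (norm_integral_le_of_norm_le_const (C := dist f (Polynomial.aeval T p))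
        (ae_of_all _ fun u => ?_)).trans (by simp)
      rw [← hgp, ← dist_eq_norm]
      exact ContinuousMap.dist_apply_le_dist u
    have h1 := hclose m
    have h2 := hclose n
    have h3 := hN m hm n hn
    rw [dist_comm] at h2
    have hfg' : dist f (Polynomial.aeval T p) < ε / 3 := hfg
    have := dist_triangle4 (∫ u, f u ∂(a m)) (∫ u, p.eval (tanhHalf u) ∂(a m))
      (∫ u, p.eval (tanhHalf u) ∂(a n)) (∫ u, f u ∂(a n))
    linarith
  exact cauchySeq_tendsto_of_complete hcauchy

lemma integral_tendsto_of_probabilityMeasure {S ι : Type*} [TopologicalSpace S] [CompactSpace S]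
    [MeasurableSpace S] [OpensMeasurableSpace S] {F : Filter ι} {μ : ι → ProbabilityMeasure S}
    {ν : ProbabilityMeasure S} :
    Tendsto μ F (𝓝 ν) ↔ ∀ f : C(S, ℝ),
      Tendsto (fun i => ∫ s, f s ∂(μ i : Measure S)) F (𝓝 (∫ s, f s ∂(ν : Measure S))) := by
  rw [ProbabilityMeasure.tendsto_iff_forall_integral_tendsto]
  exact ⟨fun h f => h (BoundedContinuousFunction.mkOfCompact f), fun h f => h f.toContinuousMap⟩

/-- Compactness of the space of probability measures provides a cluster point, and convergence of
all integrals leaves it no alternative. -/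
lemma exists_weakTendsto {a : ℕ → Measure EReal} (hp : ∀ l, IsProbabilityMeasure (a l))
    (h : ∀ f : C(EReal, ℝ), ∃ L, Tendsto (fun l => ∫ u, f u ∂(a l)) atTop (𝓝 L)) :
    ∃ μ : ProbabilityMeasure EReal, WeakTendsto a μ := by
  let P : ℕ → ProbabilityMeasure EReal := fun l => ⟨a l, hp l⟩
  obtain ⟨μ, hμ⟩ := exists_clusterPt_of_compactSpace (map P atTop)
  refine ⟨μ, fun f => ?_⟩
  obtain ⟨L, hL⟩ := h f
  have hc : Tendsto (fun ν : ProbabilityMeasure EReal => ∫ u, f u ∂(ν : Measure EReal)) (𝓝 μ)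
      (𝓝 (∫ u, f u ∂(μ : Measure EReal))) :=
    (integral_tendsto_of_probabilityMeasure (μ := fun ν => ν)).1 tendsto_id f
  have hcl : MapClusterPt (∫ u, f u ∂(μ : Measure EReal)) atTop (fun l => ∫ u, f u ∂(a l)) :=
    MapClusterPt.tendsto_comp (u := P) hc hμ
  have : ∫ u, f u ∂(μ : Measure EReal) = L := by
    by_contra hne
    obtain ⟨U, V, hU, hV, h1, h2, hUV⟩ := t2_separation hne
    have e1 := mapClusterPt_iff_frequently.1 hcl U (hU.mem_nhds h1)
    have e2 := hL.eventually (hV.mem_nhds h2)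
    obtain ⟨l, hl, hl'⟩ := (e1.and_eventually e2).exists
    exact Set.disjoint_left.1 hUV hl hl'
  rw [this]
  exact hL

/-! ### Weak continuity of the operators on symmetric densities -/

lemma integrable_continuousMap {S : Type*} [TopologicalSpace S] [CompactSpace S]
    [MeasurableSpace S] [OpensMeasurableSpace S] (f : C(S, ℝ)) (μ : Measure S)
    [IsFiniteMeasure μ] : Integrable f μ :=
  f.continuous.integrable_of_hasCompactSupport (HasCompactSupport.of_compactSpace _)

lemma WeakTendsto.unique {S : Type*} [TopologicalSpace S] [CompactSpace S] [MeasurableSpace S]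
    [BorelSpace S] [HasOuterApproxClosed S] {a : ℕ → Measure S} {μ ν : Measure S}
    [IsFiniteMeasure μ] [IsFiniteMeasure ν] (h : WeakTendsto a μ) (h' : WeakTendsto a ν) :
    μ = ν :=
  ext_of_forall_integral_eq_of_IsFiniteMeasure fun f =>
    tendsto_nhds_unique (h f.toContinuousMap) (h' f.toContinuousMap)

lemma WeakTendsto.prod {a c : ℕ → Measure EReal} {μ ν : Measure EReal}
    (ha : ∀ l, IsProbabilityMeasure (a l)) (hc : ∀ l, IsProbabilityMeasure (c l))
    (hμ : IsProbabilityMeasure μ) (hν : IsProbabilityMeasure ν)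
    (h : WeakTendsto a μ) (h' : WeakTendsto c ν) :
    WeakTendsto (fun l => (a l).prod (c l)) (μ.prod ν) := by
  let P : ℕ → ProbabilityMeasure EReal := fun l => ⟨a l, ha l⟩
  let Q : ℕ → ProbabilityMeasure EReal := fun l => ⟨c l, hc l⟩
  let P' : ProbabilityMeasure EReal := ⟨μ, hμ⟩
  let Q' : ProbabilityMeasure EReal := ⟨ν, hν⟩
  have h1 : Tendsto P atTop (𝓝 P') := integral_tendsto_of_probabilityMeasure.2 h
  have h2 : Tendsto Q atTop (𝓝 Q') := integral_tendsto_of_probabilityMeasure.2 h'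
  have := (ProbabilityMeasure.continuous_prod.tendsto _).comp (h1.prodMk_nhds h2)
  exact integral_tendsto_of_probabilityMeasure.1 this

lemma integral_reflect (s : ℤˣ) (a : Measure EReal) (f : C(EReal, ℝ)) :
    ∫ u, f u ∂(reflect s a) = ∫ u, (f.comp ⟨signMul s, continuous_signMul s⟩) u ∂a := by
  rw [reflect, integral_map (by fun_prop) f.continuous.aestronglyMeasurable]
  rfl

lemma WeakTendsto.reflect {a : ℕ → Measure EReal} {μ : Measure EReal} (h : WeakTendsto a μ)
    (s : ℤˣ) : WeakTendsto (fun l => reflect s (a l)) (reflect s μ) := by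
  intro f
  simp only [integral_reflect]
  exact h _

lemma exists_abs_le {S : Type*} [TopologicalSpace S] [CompactSpace S] (f : C(S, ℝ)) :
    ∃ C, ∀ x, |f x| ≤ C := ⟨‖f‖, f.norm_coe_le_norm⟩

lemma WeakTendsto.evenPart {a : ℕ → Measure EReal} {μ : Measure EReal}
    (ha : ∀ l, IsProbabilityMeasure (a l)) (hμ : IsProbabilityMeasure μ) (h : WeakTendsto a μ) :
    WeakTendsto (fun l => evenPart (a l)) (evenPart μ) := by
  intro f
  obtain ⟨C, hC⟩ := exists_abs_le f
  simp only [integral_evenPart _ f.continuous.measurable hC]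
  exact ((h f).add (h (f.comp ⟨fun u => -u, continuous_neg⟩))).const_mul _

/-- Symmetry is closed: it says that integrals of continuous f equal integrals of the continuous
function (1 + t) f against the even part, and both sides pass to weak limits. -/
lemma isSymm_of_weakTendsto {a : ℕ → Measure EReal} {μ : Measure EReal}
    (hs : ∀ l, IsSymm (a l)) (hμ : IsProbabilityMeasure μ) (h : WeakTendsto a μ) :
    IsSymm μ := by
  have he := evenProb_evenPart μ
  refine ⟨he, ?_⟩
  have := isProbabilityMeasure_dens he
  refine WeakTendsto.unique h fun f => ?_
  have := h.evenPart (fun l => (hs l).prob) hμ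
    (⟨fun u => 1 + tanhHalf u, continuous_tanhHalf.const_add 1⟩ * f)
  rw [integral_dens]
  refine this.congr fun l => ?_
  conv_rhs => rw [(hs l).2, integral_dens]
  rfl

/-- Weak convergence of symmetric densities. -/
structure SymmTendsto (a : ℕ → Measure EReal) (μ : Measure EReal) : Prop where
  symm : ∀ l, IsSymm (a l)
  lim : IsSymm μ
  weak : WeakTendsto a μ

lemma SymmTendsto.evenPart {a : ℕ → Measure EReal} {μ : Measure EReal} (h : SymmTendsto a μ) :
    WeakTendsto (fun l => evenPart (a l)) (evenPart μ) :=
  h.weak.evenPart (fun l => (h.symm l).prob) h.lim.prob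

lemma SymmTendsto.const {a : Measure EReal} (h : IsSymm a) : SymmTendsto (fun _ => a) a :=
  ⟨fun _ => h, h, fun _ => tendsto_const_nhds⟩

/-- The continuous integrand which computes variable-node convolutions of symmetric densities. -/
def addTest (f : C(EReal, ℝ)) : C(EReal × EReal, ℝ) where
  toFun p := (1 + tanhHalf p.1) * (1 + tanhHalf p.2) * f (p.1 + p.2)
  continuous_toFun := by
    have hT := continuous_tanhHalf
    rw [continuous_iff_continuousAt]
    have hg : Continuous fun p : EReal × EReal => (1 + tanhHalf p.1) * (1 + tanhHalf p.2) := by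
      fun_prop
    obtain ⟨C, hC⟩ := exists_abs_le f
    rintro ⟨u, v⟩
    -- Where the weight vanishes, boundedness of f squeezes the product to zero although addition
    -- may jump. Elsewhere neither argument is ⊥ and addition is continuous.
    by_cases h : (1 + tanhHalf u) * (1 + tanhHalf v) = 0
    · have h0 : Tendsto (fun p : EReal × EReal => (1 + tanhHalf p.1) * (1 + tanhHalf p.2))
          (𝓝 (u, v)) (𝓝 0) := by
        have := hg.tendsto (u, v)
        rwa [h] at this
      have : Tendsto (fun p : EReal × EReal =>
          (1 + tanhHalf p.1) * (1 + tanhHalf p.2) * f (p.1 + p.2)) (𝓝 (u, v)) (𝓝 0) := by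
        refine squeeze_zero_norm (fun p => ?_) (by simpa using h0.norm.mul_const C)
        rw [norm_mul, Real.norm_eq_abs, abs_mul]
        gcongr
        exact hC (p.1 + p.2)
      rw [ContinuousAt]
      simp only [h, zero_mul]
      exact this
    · have h1 : u ≠ ⊥ := by rintro rfl; simp at h
      have h2 : v ≠ ⊥ := by rintro rfl; simp at h
      exact hg.continuousAt.mul (f.continuous.continuousAt.comp
        (EReal.continuousAt_add (Or.inr h2) (Or.inl h1)))

lemma integral_varConv_eq {a c : Measure EReal} (ha : IsSymm a) (hc : IsSymm c)
    (f : C(EReal, ℝ)) : ∫ u, f u ∂(varConv a c) =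
      ∫ p, addTest f p ∂((evenPart a).prod (evenPart c)) := by
  have := ha.1.prob
  have := hc.1.prob
  have hfm := f.continuous.measurable
  rw [varConv, integral_map (by fun_prop) f.continuous.aestronglyMeasurable]
  conv_lhs => rw [ha.2, hc.2, dens, dens]
  rw [prod_withDensity (by fun_prop) (by fun_prop),
    integral_withDensity_eq_integral_toReal_smul (by fun_prop) (by
      refine ae_of_all _ fun p => ?_
      exact ENNReal.mul_lt_top ENNReal.ofReal_lt_top ENNReal.ofReal_lt_top)]
  refine integral_congr_ae (ae_of_all _ fun p => ?_)
  simp only [ENNReal.toReal_mul, ENNReal.toReal_ofReal (one_add_tanhHalf_nonneg _), smul_eq_mul]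
  rfl

lemma SymmTendsto.varConv {a c : ℕ → Measure EReal} {μ ν : Measure EReal}
    (h : SymmTendsto a μ) (h' : SymmTendsto c ν) :
    SymmTendsto (fun l => varConv (a l) (c l)) (varConv μ ν) := by
  refine ⟨fun l => (h.symm l).varConv (h'.symm l), h.lim.varConv h'.lim, fun f => ?_⟩
  rw [integral_varConv_eq h.lim h'.lim]
  simp only [fun l => integral_varConv_eq (h.symm l) (h'.symm l) f]
  exact WeakTendsto.prod (fun l => (h.symm l).1.prob) (fun l => (h'.symm l).1.prob) h.lim.1.prob
    h'.lim.1.prob h.evenPart h'.evenPart _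

lemma SymmTendsto.chkConv {a c : ℕ → Measure EReal} {μ ν : Measure EReal}
    (h : SymmTendsto a μ) (h' : SymmTendsto c ν) :
    SymmTendsto (fun l => chkConv (a l) (c l)) (chkConv μ ν) := by
  refine ⟨fun l => (h.symm l).chkConv (h'.symm l), h.lim.chkConv h'.lim, fun f => ?_⟩
  have e : ∀ a c : Measure EReal, ∫ u, f u ∂(GMAC.chkConv a c) = ∫ p, (f.comp
      ⟨fun p : EReal × EReal => twoArtanh (tanhHalf p.1 * tanhHalf p.2),
        continuous_twoArtanh.comp ((continuous_tanhHalf.comp continuous_fst).mul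
          (continuous_tanhHalf.comp continuous_snd))⟩) p ∂(a.prod c) := by
    intro a c
    rw [GMAC.chkConv, integral_map (by fun_prop) f.continuous.aestronglyMeasurable]
    rfl
  simp only [e]
  exact WeakTendsto.prod (fun l => (h.symm l).prob) (fun l => (h'.symm l).prob) h.lim.prob
    h'.lim.prob h.weak h'.weak _

lemma SymmTendsto.varPow {a : ℕ → Measure EReal} {μ : Measure EReal} (h : SymmTendsto a μ)
    (k : ℕ) : SymmTendsto (fun l => varPow (a l) k) (varPow μ k) := by
  induction k with
  | zero => exact SymmTendsto.const isSymm_dirac_zero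
  | succ k ih => exact ih.varConv h

lemma SymmTendsto.chkPow {a : ℕ → Measure EReal} {μ : Measure EReal} (h : SymmTendsto a μ)
    (k : ℕ) : SymmTendsto (fun l => chkPow (a l) k) (chkPow μ k) := by
  induction k with
  | zero => exact SymmTendsto.const isSymm_dirac_top
  | succ k ih => exact ih.chkConv h

lemma SymmTendsto.sum {ι : Type*} (t : Finset ι) (w : ι → ℝ≥0) (hw : ∑ i ∈ t, w i = 1)
    {a : ι → ℕ → Measure EReal} {μ : ι → Measure EReal} (h : ∀ i, SymmTendsto (a i) (μ i)) :
    SymmTendsto (fun l => ∑ i ∈ t, w i • a i l) (∑ i ∈ t, w i • μ i) := by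
  refine ⟨fun l => isSymm_sum _ _ _ hw fun i _ => (h i).symm l,
    isSymm_sum _ _ _ hw fun i _ => (h i).lim, fun f => ?_⟩
  have := fun i l => ((h i).symm l).prob
  have := fun i => (h i).lim.prob
  rw [integral_sum_smul _ _ _ fun i _ => integrable_continuousMap f _]
  simp only [fun l => integral_sum_smul t w (fun i => a i l)
    fun i _ => integrable_continuousMap f _]
  exact tendsto_finsetSum _ fun i _ => ((h i).weak f).const_mul _

lemma SymmTendsto.varToFun (hd : IsDegreePair lam rho) {a : ℕ → Measure EReal}
    {μ : Measure EReal} (h : SymmTendsto a μ) :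
    SymmTendsto (fun l => varToFun lam rho (a l)) (varToFun lam rho μ) :=
  SymmTendsto.sum _ _ hd.sum_nodeFrac fun i =>
    (SymmTendsto.sum _ _ hd.rho_sum fun j => h.chkPow (j - 1)).varPow i

lemma SymmTendsto.lamRho (hd : IsDegreePair lam rho) {a : ℕ → Measure EReal}
    {μ : Measure EReal} (h : SymmTendsto a μ) :
    SymmTendsto (fun l => lamOp lam (rhoOp rho (a l))) (lamOp lam (rhoOp rho μ)) :=
  SymmTendsto.sum _ _ hd.lam_sum fun i =>
    (SymmTendsto.sum _ _ hd.rho_sum fun j => h.chkPow (j - 1)).varPow (i - 1)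

lemma continuous_chanTest (A α : ℝ) (b : Bool) (x : Input) (f : C(EReal, ℝ)) :
    Continuous fun m => ∫ y, f (funMsg A α b m y) ∂(chLaw A α x) := by
  obtain ⟨C, hC⟩ := exists_abs_le f
  have h2 : Continuous fun p : EReal × ℝ => f (funMsg A α b p.1 p.2) :=
    f.continuous.comp (continuous_funMsg A α b)
  generalize funMsg A α b = g at h2
  refine continuous_of_dominated (bound := fun _ => C) (fun m => ?_)
    (fun m => ae_of_all _ fun y => hC _) (integrable_const _) (ae_of_all _ fun y => ?_)
  · exact (h2.comp (Continuous.prodMk_right m)).aestronglyMeasurable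
  · exact h2.comp (Continuous.prodMk_left y)

/-- The expectation of a test function of the message from a function node, given the message
of the other user. -/
def chanTest (A α : ℝ) (b : Bool) (x : Input) (f : C(EReal, ℝ)) : C(EReal, ℝ) :=
  ⟨fun m => ∫ y, f (funMsg A α b m y) ∂(chLaw A α x), continuous_chanTest A α b x f⟩

lemma SymmTendsto.fLaw {a : ℕ → Measure EReal} {μ : Measure EReal} (h : SymmTendsto a μ)
    (A α : ℝ) (b : Bool) :
    SymmTendsto (fun l => fLaw A α b 1 (a l)) (fLaw A α b 1 μ) := by
  refine ⟨fun l => (h.symm l).fLaw A α b, h.lim.fLaw A α b, fun f => ?_⟩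
  have e : ∀ ν : Measure EReal, IsProbabilityMeasure ν → ∫ u, f u ∂(GMAC.fLaw A α b 1 ν) =
      ∑ r : ℤˣ, ((1 / 2 : ℝ≥0) : ℝ) *
        ∫ m, chanTest A α b (inp b 1 r) f m ∂(GMAC.reflect r ν) := by
    intro ν hν
    have hp : ∀ r : ℤˣ, IsProbabilityMeasure (((GMAC.reflect r ν).prod
        (chLaw A α (inp b 1 r))).map (fun p => funMsg A α b p.1 p.2)) :=
      fun r => Measure.isProbabilityMeasure_map (by fun_prop)
    rw [GMAC.fLaw, integral_sum_smul _ _ _ fun i _ => integrable_continuousMap f _]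
    refine Finset.sum_congr rfl fun r _ => ?_
    rw [integral_map (by fun_prop) f.continuous.aestronglyMeasurable, integral_prod]
    · rfl
    · obtain ⟨C, hC⟩ := exists_abs_le f
      have hfm := f.continuous.measurable
      exact integrable_of_abs_le (by fun_prop) fun p => hC _
  rw [e μ h.lim.prob]
  simp only [fun l => e (a l) (h.symm l).prob]
  exact tendsto_finsetSum _ fun r _ => ((h.weak.reflect r) _).const_mul _

lemma SymmTendsto.deNext (hd : IsDegreePair lam rho) (A α : ℝ) {a : ℕ → Bool → Measure EReal}
    {μ : Bool → Measure EReal} (h : ∀ b, SymmTendsto (fun l => a l b) (μ b)) (b : Bool) :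
    SymmTendsto (fun l => deNext A α lam rho (a l) b) (deNext A α lam rho μ b) :=
  (((h !b).varToFun hd).fLaw A α b).varConv ((h b).lamRho hd)

lemma exists_deSeq_limit (hd : IsDegreePair lam rho) (A α : ℝ) (b : Bool) :
    ∃ μ : ProbabilityMeasure EReal, WeakTendsto (fun l => deSeq A α lam rho l b) μ :=
  exists_weakTendsto (fun l => (isSymm_deSeq hd A α l b).prob) fun f =>
    exists_tendsto_integral (fun l => isSymm_deSeq hd A α l b)
      (fun l => degraded_deSeq_succ hd A α l b) f

lemma isFixedPoint_iff (A α : ℝ) (a b : Measure EReal)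
    (ha : IsProbabilityMeasure (varToFun lam rho a))
    (hb : IsProbabilityMeasure (varToFun lam rho b)) :
    IsFixedPoint A α lam rho a b ↔ ∀ c : Bool, (bif c then a else b) =
      deNext A α lam rho (fun c => bif c then a else b) c := by
  rw [Bool.forall_bool, and_comm, IsFixedPoint]
  simp only [deNext, Bool.not_true, Bool.not_false, cond_true, cond_false]
  rw [← fOp_eq, ← fOp_eq]
  rfl

/-- Density evolution converges to a fixed point. -/
theorem exists_isReachedFixedPoint (hd : IsDegreePair lam rho) (A α : ℝ) :
    ∃ a b : ProbabilityMeasure EReal,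
      IsReachedFixedPoint A α lam rho (a : Measure EReal) (b : Measure EReal) := by
  obtain ⟨a, ha⟩ := exists_deSeq_limit hd A α true
  obtain ⟨b, hb⟩ := exists_deSeq_limit hd A α false
  let μ : Bool → Measure EReal := fun c => bif c then (a : Measure EReal) else b
  have hμp : ∀ c, IsProbabilityMeasure (μ c) := by
    intro c; cases c
    · exact b.2
    · exact a.2
  have hw : ∀ c, WeakTendsto (fun l => deSeq A α lam rho l c) (μ c) := by
    intro c; cases c
    · exact hb
    · exact ha
  have hs : ∀ c, SymmTendsto (fun l => deSeq A α lam rho l c) (μ c) := fun c =>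
    ⟨fun l => isSymm_deSeq hd A α l c,
      isSymm_of_weakTendsto (fun l => isSymm_deSeq hd A α l c) (hμp c) (hw c), hw c⟩
  refine ⟨a, b, (isFixedPoint_iff A α (a : Measure EReal) (b : Measure EReal)
    ((hs true).lim.varToFun hd).prob
    ((hs false).lim.varToFun hd).prob).2 fun c => ?_, ?_, ?_⟩
  · change μ c = deNext A α lam rho μ c
    have h := SymmTendsto.deNext hd A α hs c
    have := hμp c
    have := h.lim.prob
    -- The image sequence is the original one shifted by one index, so it tends both to the limit
    -- and to the image of the limit.
    have h' : WeakTendsto (fun l => deNext A α lam rho (deSeq A α lam rho l) c) (μ c) :=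
      fun f => (hw c f).comp (tendsto_add_atTop_nat 1)
    exact WeakTendsto.unique h' h.weak
  · simpa only [deIter_eq hd] using ha
  · simpa only [deIter_eq hd] using hb

lemma WeakTendsto.F (hd : IsDegreePair lam rho) {a b : ℕ → Measure EReal} {μ ν : Measure EReal}
    (h : SymmTendsto a μ) (h' : SymmTendsto b ν) (x : Input) :
    WeakTendsto (fun l => F lam rho x (a l) (b l)) (F lam rho x μ ν) := by
  have i1 := fun l => ((h.symm l).varToFun hd).prob
  have i2 := fun l => ((h'.symm l).varToFun hd).prob
  have i3 := (h.lim.varToFun hd).prob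
  have i4 := (h'.lim.varToFun hd).prob
  exact WeakTendsto.prod (fun l => inferInstance) (fun l => inferInstance) inferInstance
    inferInstance ((h.varToFun hd).weak.reflect _) ((h'.varToFun hd).weak.reflect _)

/-! ### The GEXIT kernel -/

/-- The derivative of the mean of the channel output with respect to the gain. -/
def chSlope (A : ℝ) (x : Input) : ℝ := bit x.1 + A * bit x.2

lemma chMean_eq (A α : ℝ) (x : Input) : chMean A α x = α * chSlope A x := by
  simp only [chMean, chSlope]; ring

lemma hasDerivAt_chDensity (A α : ℝ) (x : Input) (y : ℝ) :
    HasDerivAt (fun t => chDensity A t x y)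
      (chSlope A x * (y - chMean A α x) * chDensity A α x y) α := by
  have h1 : HasDerivAt (fun t => y - t * chSlope A x) (-chSlope A x) α := by
    simpa using ((hasDerivAt_id α).mul_const (chSlope A x)).const_sub y
  have h2 : HasDerivAt (fun t => -(y - t * chSlope A x) ^ 2 / (2 * ((1 : ℝ≥0) : ℝ)))
      (chSlope A x * (y - α * chSlope A x)) α := by
    refine (((h1.fun_pow 2).fun_neg).div_const (2 * ((1 : ℝ≥0) : ℝ))).congr_deriv ?_
    simp only [NNReal.coe_one]
    ring
  have h3 := (h2.exp).const_mul (√(2 * Real.pi * ((1 : ℝ≥0) : ℝ)))⁻¹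
  simp only [chDensity, gaussianPDFReal, chMean_eq]
  refine h3.congr_deriv ?_
  ring

lemma deriv_chDensity (A α : ℝ) (x : Input) (y : ℝ) :
    deriv (fun t => chDensity A t x y) α =
      chSlope A x * (y - chMean A α x) * chDensity A α x y :=
  (hasDerivAt_chDensity A α x y).deriv

lemma integrable_mul_chDensity {A α : ℝ} {x : Input} {f : ℝ → ℝ}
    (hf : Integrable f (chLaw A α x)) : Integrable (fun y => f y * chDensity A α x y) := by
  rw [chLaw, gaussianReal_of_var_ne_zero _ one_ne_zero,
    integrable_withDensity_iff_integrable_smul' (measurable_gaussianPDF _ _)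
      (ae_of_all _ fun y => by simp [gaussianPDF])] at hf
  refine hf.congr (ae_of_all _ fun y => ?_)
  simp [gaussianPDF, ENNReal.toReal_ofReal (gaussianPDFReal_nonneg _ _ _), chDensity, mul_comm]

lemma integral_mul_chDensity (A α : ℝ) (x : Input) (f : ℝ → ℝ) :
    ∫ y, f y * chDensity A α x y = ∫ y, f y ∂(chLaw A α x) := by
  rw [chLaw, integral_gaussianReal_eq_integral_smul one_ne_zero]
  simp [chDensity, mul_comm]

lemma integral_deriv_chDensity (A α : ℝ) (x : Input) :
    ∫ y, chSlope A x * (y - chMean A α x) * chDensity A α x y = 0 := by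
  rw [integral_mul_chDensity A α x (fun y => chSlope A x * (y - chMean A α x)),
    integral_const_mul]
  have h1 : ∫ y, y ∂(chLaw A α x) = chMean A α x := integral_id_gaussianReal
  have hi : Integrable (fun y : ℝ => y) (chLaw A α x) :=
    (memLp_id_gaussianReal 1).integrable le_rfl
  rw [integral_sub hi (integrable_const _), h1]
  simp

/-- The logarithm of the ratio of the channel densities, an affine function of the output. -/
def logRatio (A α : ℝ) (x x' : Input) (y : ℝ) : ℝ :=
  ((y - chMean A α x) ^ 2 - (y - chMean A α x') ^ 2) / 2

lemma chDensity_div (A α : ℝ) (x x' : Input) (y : ℝ) :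
    chDensity A α x' y / chDensity A α x y = Real.exp (logRatio A α x x' y) := by
  have hc : (√(2 * Real.pi * ((1 : ℝ≥0) : ℝ)))⁻¹ ≠ 0 := by positivity
  simp only [chDensity, gaussianPDFReal, logRatio]
  rw [mul_div_mul_left _ _ hc, ← Real.exp_sub]
  congr 1
  simp
  ring

/-- The posterior density of the output relative to the input `x`. -/
def estRatio (A α : ℝ) (x : Input) (p : EReal × EReal) (y : ℝ) : ℝ :=
  ∑ x' : Input, estimate p x' * Real.exp (logRatio A α x x' y)

lemma estimate_nonneg (p : EReal × EReal) (x : Input) : 0 ≤ estimate p x :=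
  mul_nonneg (symProb_nonneg _ _) (symProb_nonneg _ _)

lemma sum_estimate (p : EReal × EReal) : ∑ x, estimate p x = 1 := by
  simp only [estimate]
  rw [Fintype.sum_prod_type]
  simp only [← Finset.mul_sum, sum_units, symProb_add, mul_one]

/-- A bound on all logarithmic density ratios. -/
def ratioBound (A α : ℝ) (x : Input) (y : ℝ) : ℝ := ∑ x' : Input, |logRatio A α x x' y|

lemma abs_logRatio_le (A α : ℝ) (x x' : Input) (y : ℝ) :
    |logRatio A α x x' y| ≤ ratioBound A α x y :=
  Finset.single_le_sum (f := fun x' => |logRatio A α x x' y|) (fun _ _ => abs_nonneg _)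
    (Finset.mem_univ x')

/-- A convex combination of likelihood ratios lies between their extremes. The bounds do not depend
on the estimate, which gives uniform control up to infinite log-likelihood ratios. -/
lemma estRatio_mem (A α : ℝ) (x : Input) (p : EReal × EReal) (y : ℝ) :
    Real.exp (-ratioBound A α x y) ≤ estRatio A α x p y ∧
      estRatio A α x p y ≤ Real.exp (ratioBound A α x y) := by
  have hs := sum_estimate p
  have h := fun x' => abs_le.1 (abs_logRatio_le A α x x' y)
  constructor
  · calc Real.exp (-ratioBound A α x y) =
        ∑ x', estimate p x' * Real.exp (-ratioBound A α x y) := by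
          rw [← Finset.sum_mul, hs, one_mul]
      _ ≤ _ := Finset.sum_le_sum fun x' _ => mul_le_mul_of_nonneg_left
          (Real.exp_le_exp.2 (h x').1) (estimate_nonneg p x')
  · calc _ ≤ ∑ x', estimate p x' * Real.exp (ratioBound A α x y) :=
          Finset.sum_le_sum fun x' _ => mul_le_mul_of_nonneg_left
          (Real.exp_le_exp.2 (h x').2) (estimate_nonneg p x')
      _ = _ := by rw [← Finset.sum_mul, hs, one_mul]

lemma estRatio_pos (A α : ℝ) (x : Input) (p : EReal × EReal) (y : ℝ) :
    0 < estRatio A α x p y := (Real.exp_pos _).trans_le (estRatio_mem A α x p y).1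

lemma abs_logb_estRatio_le (A α : ℝ) (x : Input) (p : EReal × EReal) (y : ℝ) :
    |Real.logb 2 (estRatio A α x p y)| ≤ ratioBound A α x y / Real.log 2 := by
  have hp := estRatio_pos A α x p y
  obtain ⟨h1, h2⟩ := estRatio_mem A α x p y
  have hl : 0 < Real.log 2 := Real.log_pos (by norm_num)
  rw [Real.logb, abs_div, abs_of_pos hl]
  refine div_le_div_of_nonneg_right (abs_le.2 ⟨?_, ?_⟩) hl.le
  · rw [Real.le_log_iff_exp_le hp]; exact h1
  · rw [Real.log_le_iff_le_exp hp]; exact h2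

/-- The GEXIT kernel without the factor `u[x]`, which does not contribute to the integral. -/
def kernelExt (A α : ℝ) (x : Input) (p : EReal × EReal) : ℝ :=
  ∫ y : ℝ, chSlope A x * (y - chMean A α x) * chDensity A α x y *
    Real.logb 2 (estRatio A α x p y)

/-- An integrable bound for the integrand of the GEXIT kernel. -/
def kernelBound (A α : ℝ) (x : Input) (y : ℝ) : ℝ :=
  |chSlope A x * (y - chMean A α x)| * (ratioBound A α x y / Real.log 2) * chDensity A α x y

lemma logRatio_eq (A α : ℝ) (x x' : Input) (y : ℝ) :
    logRatio A α x x' y = (chMean A α x' - chMean A α x) * y +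
      (chMean A α x ^ 2 - chMean A α x' ^ 2) / 2 := by
  unfold logRatio; ring

/-- The log-ratios are affine in y, since the squares cancel. The bound is therefore a product of
two functions that are square integrable under the Gaussian law. -/
lemma integrable_kernelBound (A α : ℝ) (x : Input) : Integrable (kernelBound A α x) := by
  refine integrable_mul_chDensity (f := fun y => |chSlope A x * (y - chMean A α x)| *
    (ratioBound A α x y / Real.log 2)) ?_
  have h2 : ∀ c d : ℝ, MemLp (fun y => |c * y + d|) 2 (chLaw A α x) := fun c d =>
    (((memLp_id_gaussianReal 2).const_mul c).add (memLp_const d)).abs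
  have h3 : MemLp (fun y => |chSlope A x * (y - chMean A α x)|) 2 (chLaw A α x) := by
    convert h2 (chSlope A x) (-(chSlope A x * chMean A α x)) using 3
    ring
  have h4 : MemLp (fun y => ratioBound A α x y / Real.log 2) 2 (chLaw A α x) := by
    have : MemLp (fun y => ∑ x' : Input, |logRatio A α x x' y|) 2 (chLaw A α x) := by
      simp only [logRatio_eq]
      exact memLp_finsetSum _ fun x' _ => h2 _ _
    simpa [div_eq_inv_mul, ratioBound] using this.const_mul (Real.log 2)⁻¹
  exact h3.integrable_mul h4

lemma continuous_logRatio (A α : ℝ) (x x' : Input) : Continuous (logRatio A α x x') := by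
  unfold logRatio; fun_prop

lemma continuous_estRatio (A α : ℝ) (x : Input) :
    Continuous (fun q : (EReal × EReal) × ℝ => estRatio A α x q.1 q.2) := by
  refine continuous_finsetSum _ fun x' _ => ?_
  have h1 := continuous_symProb x'.1
  have h2 := continuous_symProb x'.2
  have h3 := continuous_logRatio A α x x'
  unfold estimate
  fun_prop

lemma continuous_kernelIntegrand (A α : ℝ) (x : Input) :
    Continuous (fun q : (EReal × EReal) × ℝ => chSlope A x * (q.2 - chMean A α x) *
      chDensity A α x q.2 * Real.logb 2 (estRatio A α x q.1 q.2)) := by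
  have h1 := continuous_chDensity A α x
  have h2 : Continuous fun q : (EReal × EReal) × ℝ => Real.logb 2 (estRatio A α x q.1 q.2) := by
    unfold Real.logb
    exact ((continuous_estRatio A α x).log fun q => (estRatio_pos ..).ne').div_const _
  fun_prop

lemma norm_kernelIntegrand_le (A α : ℝ) (x : Input) (p : EReal × EReal) (y : ℝ) :
    ‖chSlope A x * (y - chMean A α x) * chDensity A α x y *
      Real.logb 2 (estRatio A α x p y)‖ ≤ kernelBound A α x y := by
  rw [norm_mul, norm_mul, Real.norm_eq_abs, Real.norm_eq_abs, Real.norm_eq_abs,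
    abs_of_pos (chDensity_pos ..), kernelBound, mul_right_comm]
  have := abs_logb_estRatio_le A α x p y
  have := (chDensity_pos A α x y).le
  gcongr

lemma continuous_kernelExt (A α : ℝ) (x : Input) : Continuous (kernelExt A α x) := by
  have hc := continuous_kernelIntegrand A α x
  refine continuous_of_dominated (bound := kernelBound A α x) (fun p => ?_)
    (fun p => ae_of_all _ fun y => norm_kernelIntegrand_le A α x p y)
    (integrable_kernelBound A α x) (ae_of_all _ fun y => ?_)
  · exact (hc.comp (Continuous.prodMk_right p)).aestronglyMeasurable
  · exact hc.comp (Continuous.prodMk_left y)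

/-- The derivative of a probability density integrates to zero, so subtracting log u[x] changes
nothing. If u[x] = 0, the quotient is a division by zero and the logarithm takes its default value
0. -/
lemma kernel_eq (A α : ℝ) (x : Input) (p : EReal × EReal) :
    kernel A α x p = if estimate p x = 0 then 0 else kernelExt A α x p := by
  unfold kernel kernelVec
  split_ifs with h
  · simp [h]
  · have hpos : 0 < estimate p x := lt_of_le_of_ne (estimate_nonneg p x) (Ne.symm h)
    have hi : Integrable fun y => chSlope A x * (y - chMean A α x) * chDensity A α x y *
        Real.logb 2 (estRatio A α x p y) :=
      (integrable_kernelBound A α x).mono'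
        ((continuous_kernelIntegrand A α x).comp
          (Continuous.prodMk_right p)).aestronglyMeasurable
        (ae_of_all _ fun y => norm_kernelIntegrand_le A α x p y)
    have hi' : Integrable fun y => chSlope A x * (y - chMean A α x) * chDensity A α x y := by
      refine integrable_mul_chDensity (f := fun y => chSlope A x * (y - chMean A α x)) ?_
      exact (((memLp_id_gaussianReal 1).integrable le_rfl).sub (integrable_const _)).const_mul _
    have e : ∀ y, deriv (fun t => chDensity A t x y) α *
        Real.logb 2 ((∑ x', estimate p x' * chDensity A α x' y) /
          (estimate p x * chDensity A α x y)) =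
        chSlope A x * (y - chMean A α x) * chDensity A α x y * Real.logb 2 (estRatio A α x p y) -
        chSlope A x * (y - chMean A α x) * chDensity A α x y * Real.logb 2 (estimate p x) := by
      intro y
      have : (∑ x', estimate p x' * chDensity A α x' y) / (estimate p x * chDensity A α x y) =
          estRatio A α x p y / estimate p x := by
        simp only [estRatio, ← chDensity_div]
        rw [Finset.sum_div, Finset.sum_div]
        refine Finset.sum_congr rfl fun x' _ => ?_
        have := (chDensity_pos A α x y).ne'
        field_simp
      rw [this, Real.logb_div (estRatio_pos ..).ne' h, deriv_chDensity, mul_sub]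
    simp only [e]
    rw [integral_sub hi (hi'.mul_const _), integral_mul_const, integral_deriv_chDensity,
      zero_mul, sub_zero]
    rfl

lemma continuous_estimate (x : Input) : Continuous (fun p => estimate p x) := by
  have h1 := continuous_symProb x.1
  have h2 := continuous_symProb x.2
  unfold estimate
  fun_prop

lemma measurable_kernel (A α : ℝ) (x : Input) : Measurable (kernel A α x) := by
  rw [funext (kernel_eq A α x)]
  exact Measurable.ite ((continuous_estimate x).measurable (measurableSet_singleton 0))
    measurable_const (continuous_kernelExt A α x).measurable

lemma exists_abs_kernel_le (A α : ℝ) (x : Input) : ∃ C, ∀ p, |kernel A α x p| ≤ C := by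
  obtain ⟨C, hC⟩ := exists_abs_le ⟨kernelExt A α x, continuous_kernelExt A α x⟩
  refine ⟨C, fun p => ?_⟩
  rw [kernel_eq]
  split_ifs
  · simpa using (abs_nonneg _).trans (hC p)
  · exact hC p

lemma integrable_kernel (A α : ℝ) (x : Input) (μ : Measure (EReal × EReal)) [IsFiniteMeasure μ] :
    Integrable (kernel A α x) μ := by
  obtain ⟨C, hC⟩ := exists_abs_kernel_le A α x
  exact integrable_of_abs_le (measurable_kernel A α x) hC

/-- A zero estimate of the symbol s means that the message, turned to the orientation of +1, is ⊥,
and a symmetric density does not charge this point. -/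
lemma IsSymm.reflect_symProb_zero {a : Measure EReal} (ha : IsSymm a) (s : ℤˣ) :
    ∀ᵐ u ∂(reflect s a), symProb s u ≠ 0 := by
  have hm : MeasurableSet {u : EReal | symProb s u ≠ 0} :=
    (measurable_symProb s) (measurableSet_singleton 0).compl
  rw [reflect, ae_map_iff (by fun_prop) hm, ae_iff]
  convert ha.bot using 2
  ext u
  have e : symProb s (signMul s u) = (1 + tanhHalf u) / 2 := by
    rw [symProb_signMul, Int.units_mul_self, symProb_eq, bit_one, one_mul]
  simp only [Set.mem_ofPred_eq, not_not, Set.mem_singleton_iff, ← tanhHalf_eq_neg_one, e]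
  constructor <;> intro h <;> linarith

lemma integral_kernel_F (hd : IsDegreePair lam rho) (A α : ℝ) (x : Input) {a b : Measure EReal}
    (ha : IsSymm a) (hb : IsSymm b) :
    ∫ p, kernel A α x p ∂(F lam rho x a b) = ∫ p, kernelExt A α x p ∂(F lam rho x a b) := by
  have := (ha.varToFun hd).prob
  have := (hb.varToFun hd).prob
  refine integral_congr_ae ?_
  have h1 : ∀ᵐ p ∂(F lam rho x a b), symProb x.1 p.1 ≠ 0 :=
    Measure.quasiMeasurePreserving_fst.ae ((ha.varToFun hd).reflect_symProb_zero x.1)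
  have h2 : ∀ᵐ p ∂(F lam rho x a b), symProb x.2 p.2 ≠ 0 :=
    Measure.quasiMeasurePreserving_snd.ae ((hb.varToFun hd).reflect_symProb_zero x.2)
  filter_upwards [h1, h2] with p hp1 hp2
  have h : estimate p x ≠ 0 := mul_ne_zero hp1 hp2
  rw [kernel_eq, if_neg h]

/-- Weak convergence cannot be applied to `kernel`, which may jump; it is applied to the continuous
`kernelExt`, which has the same integrals under symmetric densities. -/
lemma tendsto_gexitValue (hd : IsDegreePair lam rho) (A α : ℝ) {a b : ℕ → Measure EReal}
    {μ ν : Measure EReal} (h : SymmTendsto a μ) (h' : SymmTendsto b ν) :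
    Tendsto (fun l => gexitValue A α lam rho (a l) (b l)) atTop
      (𝓝 (gexitValue A α lam rho μ ν)) := by
  unfold gexitValue
  refine tendsto_finsetSum _ fun x _ => Tendsto.const_mul _ ?_
  simp only [fun l => integral_kernel_F hd A α x (h.symm l) (h'.symm l)]
  rw [integral_kernel_F hd A α x h.lim h'.lim]
  exact WeakTendsto.F hd h h' x ⟨kernelExt A α x, continuous_kernelExt A α x⟩

/-! ### Totally positive sequences of order two -/

/-- A nonnegative log-concave sequence without internal zeros. -/
structure IsPF2 (f : ℤ → ℝ) : Prop where
  nonneg : ∀ n, 0 ≤ f n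
  le : ∀ x y h, x ≤ y → 0 ≤ h → f x * f (y + h) ≤ f (x + h) * f y

lemma IsPF2.neg {f : ℤ → ℝ} (hf : IsPF2 f) : IsPF2 (fun n => f (-n)) := by
  refine ⟨fun n => hf.nonneg _, fun x y h hxy hh => ?_⟩
  have := hf.le (-y - h) (-x - h) h (by linarith) hh
  simp only [sub_add_cancel] at this
  rw [show -(y + h) = -y - h by ring, show -(x + h) = -x - h by ring]
  linarith

lemma IsPF2.two_mul {f : ℤ → ℝ} (hf : IsPF2 f) : IsPF2 (fun n => f (2 * n)) := by
  refine ⟨fun n => hf.nonneg _, fun x y h hxy hh => ?_⟩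
  simp only [mul_add]
  exact hf.le _ _ _ (by linarith) (by linarith)

/-- The Cauchy–Binet formula for two-by-two minors of a product of Toeplitz matrices shows that
convolution preserves total positivity of order two. -/
lemma IsPF2.conv {a b f : ℤ → ℝ} (ha : IsPF2 a) (hb : IsPF2 b) (K : ℤ)
    (hf : ∀ (n : ℤ) (s : Finset ℤ), Finset.Icc 0 K ⊆ s → f n = ∑ k ∈ s, a (n - k) * b k) :
    IsPF2 f := by
  refine ⟨fun n => ?_, fun x y h hxy hh => ?_⟩
  · rw [hf n _ subset_rfl]
    exact Finset.sum_nonneg fun k _ => mul_nonneg (ha.nonneg _) (hb.nonneg _)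
  set s := Finset.Icc 0 (K + h)
  have h0 : ∀ n, f n = ∑ k ∈ s, a (n - k) * b k := fun n =>
    hf n s (Finset.Icc_subset_Icc_right (by linarith))
  -- The summation index is shifted by h; the window [0, K + h] covers the required range both
  -- before and after the shift.
  have h1 : ∀ n, f n = ∑ k ∈ s, a (n + h - k) * b (k - h) := by
    intro n
    rw [hf n (s.map (Equiv.subRight h).toEmbedding), Finset.sum_map]
    · refine Finset.sum_congr rfl fun k _ => ?_
      simp only [Equiv.coe_toEmbedding, Equiv.subRight_apply]
      congr 2; ring
    · intro k hk
      rw [Finset.mem_Icc] at hk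
      rw [Finset.mem_map]
      refine ⟨k + h, Finset.mem_Icc.2 ⟨by linarith, by linarith⟩, by simp⟩
  have e1 : f (x + h) * f y =
      ∑ k ∈ s, ∑ l ∈ s, a (x + h - k) * a (y + h - l) * (b k * b (l - h)) := by
    rw [h0, h1, Finset.sum_mul_sum]
    exact Finset.sum_congr rfl fun k _ => Finset.sum_congr rfl fun l _ => by ring
  have e2 : f x * f (y + h) =
      ∑ k ∈ s, ∑ l ∈ s, a (x + h - k) * a (y + h - l) * (b (k - h) * b l) := by
    rw [h1 x, h0 (y + h), Finset.sum_mul_sum]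
    exact Finset.sum_congr rfl fun k _ => Finset.sum_congr rfl fun l _ => by ring
  have e3 : f (x + h) * f y - f x * f (y + h) =
      ∑ k ∈ s, ∑ l ∈ s, a (x + h - k) * a (y + h - l) * (b k * b (l - h) - b (k - h) * b l) := by
    rw [e1, e2, ← Finset.sum_sub_distrib]
    refine Finset.sum_congr rfl fun k _ => ?_
    rw [← Finset.sum_sub_distrib]
    exact Finset.sum_congr rfl fun l _ => by ring
  have e4 : f (x + h) * f y - f x * f (y + h) =
      ∑ k ∈ s, ∑ l ∈ s, a (x + h - l) * a (y + h - k) * (b l * b (k - h) - b (l - h) * b k) := by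
    rw [e3, Finset.sum_comm]
  -- Averaging over the exchange of k and l turns each term into a product of a minor of a and a
  -- minor of b. The two have the same sign, determined by the order of k and l.
  have e5 : 2 * (f (x + h) * f y - f x * f (y + h)) = ∑ k ∈ s, ∑ l ∈ s,
      (a (x + h - k) * a (y + h - l) - a (x + h - l) * a (y + h - k)) *
        (b k * b (l - h) - b (k - h) * b l) := by
    rw [_root_.two_mul]
    conv_lhs => rw [e3]
    conv_lhs => enter [2]; rw [← e3, e4]
    rw [← Finset.sum_add_distrib]
    refine Finset.sum_congr rfl fun k _ => ?_
    rw [← Finset.sum_add_distrib]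
    exact Finset.sum_congr rfl fun l _ => by ring
  have key : ∀ k l, k ≤ l → a (x + h - l) * a (y + h - k) ≤ a (x + h - k) * a (y + h - l) ∧
      b (k - h) * b l ≤ b k * b (l - h) := by
    intro k l hkl
    constructor
    · have := ha.le (x + h - l) (y + h - l) (l - k) (by linarith) (by linarith)
      rwa [show y + h - l + (l - k) = y + h - k by ring,
        show x + h - l + (l - k) = x + h - k by ring] at this
    · have := hb.le (k - h) (l - h) h (by linarith) hh
      rwa [sub_add_cancel, sub_add_cancel] at this
  have : 0 ≤ 2 * (f (x + h) * f y - f x * f (y + h)) := by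
    rw [e5]
    refine Finset.sum_nonneg fun k _ => Finset.sum_nonneg fun l _ => ?_
    rcases le_total k l with hkl | hkl
    · obtain ⟨h1, h2⟩ := key k l hkl
      exact mul_nonneg (by linarith) (by linarith)
    · obtain ⟨h1, h2⟩ := key l k hkl
      exact mul_nonneg_of_nonpos_of_nonpos (by linarith) (by linarith)
  linarith

/-- The coefficients of a polynomial, extended by zero to the integers. -/
def intCoeff (p : Polynomial ℝ) (n : ℤ) : ℝ := if 0 ≤ n then p.coeff n.toNat else 0

@[simp] lemma intCoeff_natCast (p : Polynomial ℝ) (n : ℕ) : intCoeff p n = p.coeff n := by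
  simp [intCoeff]

lemma intCoeff_sum {ι : Type*} (t : Finset ι) (p : ι → Polynomial ℝ) (n : ℤ) :
    intCoeff (∑ i ∈ t, p i) n = ∑ i ∈ t, intCoeff (p i) n := by
  unfold intCoeff
  split_ifs <;> simp [Polynomial.finsetSum_coeff]

lemma intCoeff_mul_monomial (p : Polynomial ℝ) (k : ℕ) (c : ℝ) (n : ℤ) :
    intCoeff (p * Polynomial.monomial k c) n = intCoeff p (n - k) * c := by
  unfold intCoeff
  rcases lt_or_ge n 0 with hn | hn
  · rw [if_neg (by omega), if_neg (by omega), zero_mul]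
  rw [if_pos hn, ← Polynomial.C_mul_X_pow_eq_monomial, ← mul_assoc, Polynomial.coeff_mul_X_pow']
  rcases le_or_gt (k : ℤ) n with hk | hk
  · rw [if_pos (by omega), if_pos (by omega), Polynomial.coeff_mul_C]
    congr 2; omega
  · rw [if_neg (by omega), if_neg (by omega), zero_mul]

lemma intCoeff_eq_zero_of_gt (p : Polynomial ℝ) {n : ℤ} (hn : (p.natDegree : ℤ) < n) :
    intCoeff p n = 0 := by
  unfold intCoeff
  split_ifs
  · exact Polynomial.coeff_eq_zero_of_natDegree_lt (by omega)
  · rfl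

lemma intCoeff_eq_zero_of_neg (p : Polynomial ℝ) {n : ℤ} (hn : n < 0) : intCoeff p n = 0 :=
  if_neg (by omega)

lemma sum_Icc_natCast (K : ℕ) (g : ℤ → ℝ) :
    ∑ k ∈ Finset.Icc (0 : ℤ) K, g k = ∑ k ∈ Finset.range (K + 1), g k := by
  refine (Finset.sum_bij (fun (k : ℕ) _ => (k : ℤ)) ?_ ?_ ?_ ?_).symm
  · intro k hk
    rw [Finset.mem_range] at hk
    rw [Finset.mem_Icc]; omega
  · intro a _ b _ h
    exact_mod_cast h
  · intro k hk
    rw [Finset.mem_Icc] at hk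
    exact ⟨k.toNat, by rw [Finset.mem_range]; omega, by omega⟩
  · intro k _; rfl

lemma intCoeff_mul (p q : Polynomial ℝ) (n : ℤ) (s : Finset ℤ)
    (hs : Finset.Icc 0 (q.natDegree : ℤ) ⊆ s) :
    intCoeff (p * q) n = ∑ k ∈ s, intCoeff p (n - k) * intCoeff q k := by
  rw [← Finset.sum_subset hs, sum_Icc_natCast]
  · conv_lhs => rw [q.as_sum_range, Finset.mul_sum, intCoeff_sum]
    exact Finset.sum_congr rfl fun k _ => by rw [intCoeff_mul_monomial, intCoeff_natCast]
  · intro k _ hk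
    rw [Finset.mem_Icc, not_and_or, not_le, not_le] at hk
    rcases hk with hk | hk
    · rw [intCoeff_eq_zero_of_neg q hk, mul_zero]
    · rw [intCoeff_eq_zero_of_gt q hk, mul_zero]

lemma isPF2_mul {p q : Polynomial ℝ} (hp : IsPF2 (intCoeff p)) (hq : IsPF2 (intCoeff q)) :
    IsPF2 (intCoeff (p * q)) :=
  hp.conv hq q.natDegree fun n s hs => intCoeff_mul p q n s hs

lemma isPF2_of_eq_indicator {f : ℤ → ℝ} (a b : ℤ)
    (hf : ∀ n, f n = if a ≤ n ∧ n ≤ b then 1 else 0) : IsPF2 f := by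
  refine ⟨fun n => by rw [hf]; split_ifs <;> norm_num, fun x y h hxy hh => ?_⟩
  simp only [hf]
  by_cases h1 : a ≤ x ∧ x ≤ b
  · by_cases h2 : a ≤ y + h ∧ y + h ≤ b
    · rw [if_pos h1, if_pos h2, if_pos (by omega), if_pos (by omega)]
    · rw [if_neg h2, mul_zero]; split_ifs <;> norm_num
  · rw [if_neg h1, zero_mul]; split_ifs <;> norm_num

lemma isPF2_one : IsPF2 (intCoeff 1) := by
  refine isPF2_of_eq_indicator 0 0 fun n => ?_
  unfold intCoeff
  rw [Polynomial.coeff_one]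
  split_ifs <;> first | rfl | omega

lemma isPF2_prod {ι : Type*} (t : Finset ι) (p : ι → Polynomial ℝ)
    (hp : ∀ i ∈ t, IsPF2 (intCoeff (p i))) : IsPF2 (intCoeff (∏ i ∈ t, p i)) := by
  classical
  induction t using Finset.induction_on with
  | empty => exact isPF2_one
  | insert i t hi ih =>
    rw [Finset.prod_insert hi]
    exact isPF2_mul (hp i (Finset.mem_insert_self i t))
      (ih fun j hj => hp j (Finset.mem_insert_of_mem hj))

lemma isPF2_choose (d : ℕ) : IsPF2 (intCoeff ((1 + Polynomial.X) ^ d)) := by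
  have h : IsPF2 (intCoeff (1 + Polynomial.X)) := by
    refine isPF2_of_eq_indicator 0 1 fun n => ?_
    unfold intCoeff
    rw [Polynomial.coeff_add, Polynomial.coeff_one, Polynomial.coeff_X]
    split_ifs <;> first | omega | norm_num
  induction d with
  | zero => simpa using isPF2_one
  | succ d ih => rw [pow_succ]; exact isPF2_mul ih h

/-! ### Weight enumerators of even and odd words -/

/-- The enumerators `∑ C(d, 2v) Xᵛ` and `∑ C(d, 2v+1) Xᵛ` of even and odd words. -/
def parityPoly : ℕ → Polynomial ℝ × Polynomial ℝ
  | 0 => (1, 0)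
  | d + 1 => ((parityPoly d).1 + Polynomial.X * (parityPoly d).2,
      (parityPoly d).2 + (parityPoly d).1)

/-- The enumerator `∑ C(d, 2v) Xᵛ` of the even words of length `d`. -/
def evenPoly (d : ℕ) : Polynomial ℝ := (parityPoly d).1

lemma parityPoly_coeff (d v : ℕ) : (parityPoly d).1.coeff v = (d.choose (2 * v) : ℝ) ∧
    (parityPoly d).2.coeff v = (d.choose (2 * v + 1) : ℝ) := by
  induction d generalizing v with
  | zero =>
    constructor
    · rcases v with _ | v <;> simp [parityPoly, Polynomial.coeff_one, mul_add]
    · simp [parityPoly]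
  | succ d ih =>
    constructor
    · rcases v with _ | v
      · simp [parityPoly, (ih 0).1]
      · simp only [parityPoly, Polynomial.coeff_add, Polynomial.coeff_X_mul, (ih (v + 1)).1,
          (ih v).2]
        rw [show 2 * (v + 1) = 2 * v + 1 + 1 by ring, Nat.choose_succ_succ' d (2 * v + 1)]
        push_cast; ring
    · simp only [parityPoly, Polynomial.coeff_add, (ih v).1, (ih v).2]
      rw [Nat.choose_succ_succ' d (2 * v)]
      push_cast; ring

/-- The coefficients are the binomial coefficients of even index, and passing to every second term
preserves total positivity of order two. -/
lemma isPF2_evenPoly (d : ℕ) : IsPF2 (intCoeff (evenPoly d)) := by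
  convert (isPF2_choose d).two_mul using 1
  funext n
  unfold intCoeff
  by_cases hn : 0 ≤ n
  · rw [if_pos hn, if_pos (by omega), evenPoly, (parityPoly_coeff d _).1,
      Polynomial.coeff_one_add_X_pow]
    congr 2; omega
  · rw [if_neg hn, if_neg (by omega)]

lemma parityPoly_eval (d : ℕ) (z : ℝ) :
    (parityPoly d).1.eval (z * z) + z * (parityPoly d).2.eval (z * z) = (1 + z) ^ d := by
  induction d with
  | zero => simp [parityPoly]
  | succ d ih =>
    simp only [parityPoly, Polynomial.eval_add, Polynomial.eval_mul, Polynomial.eval_X]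
    rw [pow_succ, ← ih]; ring

lemma evenPoly_eval (d : ℕ) (z : ℝ) :
    (evenPoly d).eval (z * z) = ((1 + z) ^ d + (1 - z) ^ d) / 2 := by
  have h1 := parityPoly_eval d z
  have h2 := parityPoly_eval d (-z)
  rw [neg_mul_neg] at h2
  rw [evenPoly, ← h1, sub_eq_add_neg, ← h2]; ring

lemma evenPoly_eval_one {d : ℕ} (hd : d ≠ 0) : (evenPoly d).eval 1 = 2 ^ d / 2 := by
  have := evenPoly_eval d 1
  rw [mul_one] at this
  rw [this]; norm_num [hd]

lemma parityPoly_natDegree (d : ℕ) :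
    (parityPoly d).1.natDegree ≤ d ∧ (parityPoly d).2.natDegree ≤ d := by
  constructor <;> rw [Polynomial.natDegree_le_iff_coeff_eq_zero] <;> intro v hv
  · rw [(parityPoly_coeff d v).1, Nat.choose_eq_zero_of_lt (by omega)]; simp
  · rw [(parityPoly_coeff d v).2, Nat.choose_eq_zero_of_lt (by omega)]; simp

/-- The relative gain of the tilted enumerator over its mean. -/
def tiltGain (η : ℝ) : ℝ := (Real.cosh η - |Real.sinh η|) * |Real.sinh η| ^ 2

lemma abs_sinh_lt_cosh (η : ℝ) : |Real.sinh η| < Real.cosh η := by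
  rw [abs_lt]
  constructor
  · have := Real.exp_pos η
    rw [← Real.cosh_add_sinh] at this; linarith
  · have := Real.exp_pos (-η)
    rw [← Real.cosh_sub_sinh] at this; linarith

lemma tiltGain_pos {η : ℝ} (hη : η ≠ 0) : 0 < tiltGain η := by
  have := abs_sinh_lt_cosh η
  have h2 : 0 < |Real.sinh η| := abs_pos.2 (Real.sinh_eq_zero.not.2 hη)
  unfold tiltGain
  have : 0 < Real.cosh η - |Real.sinh η| := by linarith
  positivity

lemma tiltGain_neg (η : ℝ) : tiltGain (-η) = tiltGain η := by
  simp [tiltGain]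

/-- Let c = cosh η and s = |sinh η|, so (c - s)(c + s) = 1. For d ≥ 3 the worst sign gives c^d - s^d
≥ c³ - s³ = (c - s)(c² + cs + s²) ≥ 1 + (c - s)s², using c ≥ 1. For d = 2 the sign is favourable and
c² + s² = 1 + 2s². For d = 1 there is no uniform gain, which is why checks need degree at least two.
-/
lemma one_add_tiltGain_le (η : ℝ) {d : ℕ} (hd : 2 ≤ d) :
    1 + tiltGain η ≤ Real.cosh η ^ d + (-Real.sinh η) ^ d := by
  have h1 := abs_sinh_lt_cosh η
  have h2 := abs_nonneg (Real.sinh η)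
  have h3 := Real.cosh_sq η
  have hc := Real.one_le_cosh η
  have hs : |Real.sinh η| ^ 2 = Real.sinh η ^ 2 := sq_abs _
  have h4 : (Real.cosh η - |Real.sinh η|) * (Real.cosh η + |Real.sinh η|) = 1 := by
    linear_combination h3 - hs
  unfold tiltGain
  set s := |Real.sinh η|
  set c := Real.cosh η
  rcases hd.eq_or_lt with rfl | hd
  · rw [neg_sq, ← hs]
    rw [← hs] at h3
    nlinarith [sq_nonneg s, mul_nonneg h2 (sq_nonneg s)]
  · have h5 : c ^ d - s ^ d ≤ c ^ d + (-Real.sinh η) ^ d := by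
      have : -s ^ d ≤ (-Real.sinh η) ^ d := by
        have := neg_abs_le ((-Real.sinh η) ^ d)
        rwa [abs_pow, abs_neg] at this
      linarith
    refine le_trans ?_ h5
    obtain ⟨k, rfl⟩ := Nat.exists_eq_add_of_le (show 3 ≤ d from hd)
    have h6 : c ^ 3 - s ^ 3 ≤ c ^ (3 + k) - s ^ (3 + k) := by
      have h7 : s ^ k ≤ c ^ k := pow_le_pow_left₀ h2 h1.le k
      have h8 : 1 ≤ c ^ k := one_le_pow₀ hc
      have h9 : s ^ 3 ≤ c ^ 3 := pow_le_pow_left₀ h2 h1.le 3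
      rw [pow_add, pow_add]
      have : s ^ 3 * s ^ k ≤ s ^ 3 * c ^ k := by gcongr
      nlinarith
    refine le_trans ?_ h6
    have h10 : c ^ 3 - s ^ 3 = (c - s) * (c ^ 2 + c * s + s ^ 2) := by ring
    rw [h10]
    have h11 : c + s + s ^ 2 ≤ c ^ 2 + c * s + s ^ 2 := by nlinarith
    have := mul_le_mul_of_nonneg_left h11 (by linarith : 0 ≤ c - s)
    nlinarith

/-- The enumerator counts half the weight of an even word of length d, with mean d/4 when d ≥ 2, so
tilting by e^{4η} produces e^{ηd} at the mean. The excess appears by taking z = e^{2η} in the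
formula for the value at z², where 1 ± z becomes 2e^η cosh η or -2e^η sinh η. -/
lemma evenPoly_eval_exp_ge (η : ℝ) {d : ℕ} (hd : 2 ≤ d) :
    (evenPoly d).eval 1 * Real.exp (η * d) * (1 + tiltGain η) ≤
      (evenPoly d).eval (Real.exp (4 * η)) := by
  have e1 : Real.exp (4 * η) = Real.exp (2 * η) * Real.exp (2 * η) := by
    rw [← Real.exp_add]; ring_nf
  have e2 : 1 + Real.exp (2 * η) = Real.exp η * (2 * Real.cosh η) := by
    rw [Real.cosh_eq]
    have h1 : Real.exp (2 * η) = Real.exp η * Real.exp η := by rw [← Real.exp_add]; ring_nf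
    have h2 : Real.exp η * Real.exp (-η) = 1 := by rw [← Real.exp_add]; simp
    linear_combination h1 - h2
  have e3 : 1 - Real.exp (2 * η) = Real.exp η * (2 * -Real.sinh η) := by
    rw [Real.sinh_eq]
    have h1 : Real.exp (2 * η) = Real.exp η * Real.exp η := by rw [← Real.exp_add]; ring_nf
    have h2 : Real.exp η * Real.exp (-η) = 1 := by rw [← Real.exp_add]; simp
    linear_combination -h1 - h2
  rw [e1, evenPoly_eval, e2, e3, evenPoly_eval_one (by omega)]
  simp only [mul_pow]
  rw [← Real.exp_nat_mul, mul_comm (d : ℝ) η]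
  have := one_add_tiltGain_le η hd
  have hp : 0 ≤ 2 ^ d / 2 * Real.exp (η * d) := by positivity
  calc _ ≤ 2 ^ d / 2 * Real.exp (η * d) * (Real.cosh η ^ d + (-Real.sinh η) ^ d) :=
        mul_le_mul_of_nonneg_left this hp
    _ = _ := by ring

/-! ### Ratios of neighbouring coefficients -/

/-- By log-concavity the inequality at a persists to the left: f(x) ≤ qʰ f(x + h) for x ≤ a. Thus
f(x) qˣ does not decrease along steps of length h until x passes a, and there it is at most qᵃ times
the total mass. -/
lemma IsPF2.sum_tilt_le {f : ℤ → ℝ} (hf : IsPF2 f) (S : Finset ℤ) (hS : ∀ k ∉ S, f k = 0)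
    {q : ℝ} (hq0 : 0 < q) (hq1 : q < 1) {a : ℤ} {h : ℕ} (hh : 0 < h)
    (hlt : f a < q ^ h * f (a + h)) :
    ∑ k ∈ S, f k * q ^ k ≤ S.card * (q ^ a * ∑ k ∈ S, f k) := by
  have hsum : ∀ k, f k ≤ ∑ k ∈ S, f k := by
    intro k
    by_cases hk : k ∈ S
    · exact Finset.single_le_sum (fun k _ => hf.nonneg k) hk
    · rw [hS k hk]; exact Finset.sum_nonneg fun k _ => hf.nonneg k
  have hpos : 0 < f (a + h) := by
    have := hf.nonneg a
    by_contra hn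
    have h0 : f (a + h) = 0 := le_antisymm (not_lt.1 hn) (hf.nonneg _)
    rw [h0, mul_zero] at hlt
    linarith
  have hstep : ∀ x, x ≤ a → f x ≤ q ^ h * f (x + h) := by
    intro x hx
    have h1 := hf.le x a h hx (by positivity)
    have h2 := mul_le_mul_of_nonneg_left hlt.le (hf.nonneg (x + h))
    refine le_of_mul_le_mul_right ?_ hpos
    linarith
  have hbig : ∀ x, a ≤ x → f x * q ^ x ≤ q ^ a * ∑ k ∈ S, f k := by
    intro x hx
    have : q ^ x ≤ q ^ a := zpow_le_zpow_right_of_le_one₀ hq0 hq1.le hx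
    rw [mul_comm]
    exact mul_le_mul this (hsum x) (hf.nonneg x) (zpow_pos hq0 a).le
  have hall : ∀ (n : ℕ) (x : ℤ), a - x ≤ n → f x * q ^ x ≤ q ^ a * ∑ k ∈ S, f k := by
    intro n
    induction n with
    | zero => intro x hx; exact hbig x (by simpa using hx)
    | succ n ih =>
      intro x hx
      rcases le_total a x with h' | h'
      · exact hbig x h'
      · refine le_trans ?_ (ih (x + h) (by push_cast at hx ⊢; omega))
        rw [zpow_add₀ hq0.ne', zpow_natCast]
        have := mul_le_mul_of_nonneg_right (hstep x h') (zpow_pos hq0 x).le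
        linarith
  calc _ ≤ ∑ _k ∈ S, q ^ a * ∑ k ∈ S, f k :=
        Finset.sum_le_sum fun k _ => hall (a - k).toNat k (Int.self_le_toNat _)
    _ = _ := by rw [Finset.sum_const, nsmul_eq_mul]

lemma IsPF2.sum_tilt_le' {f : ℤ → ℝ} (hf : IsPF2 f) (S : Finset ℤ) (hS : ∀ k ∉ S, f k = 0)
    {q : ℝ} (hq0 : 0 < q) (hq1 : q < 1) {a : ℤ} {h : ℕ} (hh : 0 < h)
    (hlt : f a < q ^ h * f (a - h)) :
    ∑ k ∈ S, f k * q⁻¹ ^ k ≤ S.card * (q⁻¹ ^ a * ∑ k ∈ S, f k) := by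
  have := hf.neg.sum_tilt_le (S.map (Equiv.neg ℤ).toEmbedding) (fun k hk => hS _ fun hk' =>
    hk (Finset.mem_map.2 ⟨-k, hk', by simp⟩)) hq0 hq1 (a := -a) hh (by
      simpa [neg_add_eq_sub] using hlt)
  simpa [Finset.sum_map, inv_zpow'] using this

lemma eval_eq_sum_intCoeff (p : Polynomial ℝ) {N : ℕ} (hN : p.natDegree ≤ N) (w : ℝ) :
    ∑ k ∈ Finset.Icc (0 : ℤ) N, intCoeff p k * w ^ k = p.eval w := by
  rw [sum_Icc_natCast, Polynomial.eval_eq_sum_range' (Nat.lt_succ_of_le hN)]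
  simp

/-- If two nearby coefficients of a product of enumerators differ by a factor, the tilted
enumerator is small. -/
lemma eval_le_of_coeff_lt {p : Polynomial ℝ} (hp : IsPF2 (intCoeff p)) {N : ℕ}
    (hN : p.natDegree ≤ N) {q : ℝ} (hq0 : 0 < q) (hq1 : q < 1) {a a' D : ℕ}
    (haD : a ≤ a' + D) (haD' : a' ≤ a + D) (hlt : p.coeff a < q ^ D * p.coeff a') :
    ∃ w, (w = q ∨ w = q⁻¹) ∧ p.eval w ≤ (N + 1) * (w ^ a * p.eval 1) := by
  have hS : ∀ k ∉ Finset.Icc (0 : ℤ) N, intCoeff p k = 0 := by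
    intro k hk
    rw [Finset.mem_Icc, not_and_or, not_le, not_le] at hk
    rcases hk with hk | hk
    · exact intCoeff_eq_zero_of_neg p hk
    · exact intCoeff_eq_zero_of_gt p (by omega)
  have e1 := eval_eq_sum_intCoeff p hN 1
  simp only [one_zpow, mul_one] at e1
  have hcard : ((Finset.Icc (0 : ℤ) N).card : ℝ) = N + 1 := by simp
  have hpos : ∀ n : ℕ, 0 ≤ p.coeff n := fun n => by simpa using hp.nonneg n
  have hle : ∀ h : ℕ, h ≤ D → p.coeff a < q ^ h * p.coeff a' := fun h hh =>
    hlt.trans_le (mul_le_mul_of_nonneg_right (pow_le_pow_of_le_one hq0.le hq1.le hh) (hpos _))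
  rcases lt_trichotomy a a' with h | h | h
  · refine ⟨q, Or.inl rfl, ?_⟩
    have := hp.sum_tilt_le _ hS hq0 hq1 (a := a) (h := a' - a) (by omega) (by
      rw [show (a : ℤ) + ((a' - a : ℕ) : ℤ) = (a' : ℕ) by omega]
      simpa using hle (a' - a) (by omega))
    rwa [eval_eq_sum_intCoeff p hN, e1, hcard, zpow_natCast] at this
  · exfalso
    subst h
    have := mul_le_of_le_one_left (hpos a) (pow_le_one₀ hq0.le hq1.le : q ^ D ≤ 1)
    linarith
  · refine ⟨q⁻¹, Or.inr rfl, ?_⟩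
    have := hp.sum_tilt_le' _ hS hq0 hq1 (a := a) (h := a - a') (by omega) (by
      rw [show (a : ℤ) - ((a - a' : ℕ) : ℤ) = (a' : ℕ) by omega]
      simpa using hle (a - a') (by omega))
    rwa [eval_eq_sum_intCoeff p hN, e1, hcard, zpow_natCast] at this

/-- Neighbouring coefficients near the middle of a product of even enumerators have nearly equal
size. -/
theorem evenPoly_coeff_ratio (D : ℕ) {q : ℝ} (hq0 : 0 < q) (hq1 : q < 1) :
    ∃ δ > 0, ∃ V₀ : ℕ, ∀ {ι : Type} (B : Finset ι) (d : ι → ℕ),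
      (∀ c ∈ B, 2 ≤ d c ∧ d c ≤ D) → V₀ ≤ ∑ c ∈ B, d c →
      ∀ a a' : ℕ, |(a : ℝ) - (∑ c ∈ B, d c : ℕ) / 4| ≤ δ * (∑ c ∈ B, d c : ℕ) →
      a ≤ a' + D → a' ≤ a + D →
      q ^ D * (∏ c ∈ B, evenPoly (d c)).coeff a' ≤ (∏ c ∈ B, evenPoly (d c)).coeff a := by
  -- Chosen so that the tilting point e^{4η} is q.
  set η := Real.log q / 4
  have hη : η < 0 := div_neg_of_neg_of_pos (Real.log_neg hq0 hq1) (by norm_num)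
  set κ := tiltGain η
  have hκ : 0 < κ := tiltGain_pos hη.ne
  -- Every check gains a factor 1 + κ and has at most D sockets, so the total gain is at least
  -- e^{c₀V}.
  set c₀ := Real.log (1 + κ) / (D + 1)
  have hlog : 0 < Real.log (1 + κ) := Real.log_pos (by linarith)
  have hc₀ : 0 < c₀ := by positivity
  -- Half of the exponential gain will absorb the polynomial factor V + 1.
  have hev : ∀ᶠ x : ℝ in atTop, x + 1 < Real.exp (c₀ / 2 * x) := by
    have h1 : Tendsto (fun x : ℝ => x ^ 1 * Real.exp (-(c₀ / 2) * x)) atTop (𝓝 0) := by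
      have := Real.tendsto_pow_mul_exp_neg_atTop_nhds_zero 1
      have h2 : Tendsto (fun x : ℝ => c₀ / 2 * x) atTop atTop :=
        tendsto_id.const_mul_atTop (by positivity)
      have h3 := (this.comp h2).const_mul (c₀ / 2)⁻¹
      rw [mul_zero] at h3
      refine h3.congr fun x => ?_
      simp only [Function.comp, pow_one]
      rw [neg_mul]
      field_simp
    have h2 := h1.eventually (gt_mem_nhds (show (0 : ℝ) < 1 / 2 by norm_num))
    filter_upwards [h2, eventually_ge_atTop 1] with x hx hx1
    have : Real.exp (-(c₀ / 2) * x) * Real.exp (c₀ / 2 * x) = 1 := by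
      rw [← Real.exp_add]; simp
    have hp := Real.exp_pos (c₀ / 2 * x)
    rw [pow_one] at hx
    have h3 := mul_lt_mul_of_pos_right hx hp
    rw [mul_assoc, this, mul_one] at h3
    linarith
  obtain ⟨X, hX⟩ := hev.exists_forall_of_atTop
  -- With this δ the deviation of a from V/4 costs at most e^{4|η|δV} = e^{c₀V/2} in wᵃ, the other
  -- half of the gain.
  refine ⟨c₀ / (2 * (4 * |η|)), by have := abs_pos.2 hη.ne; positivity, ⌈X⌉₊, ?_⟩
  intro ι B d hd hV a a' ha haD haD'
  by_contra! hlt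
  set P := ∏ c ∈ B, evenPoly (d c)
  set V := ∑ c ∈ B, d c
  have hP : IsPF2 (intCoeff P) := isPF2_prod _ _ fun c _ => isPF2_evenPoly _
  have hN : P.natDegree ≤ V := (Polynomial.natDegree_prod_le _ _).trans
    (Finset.sum_le_sum fun c _ => (parityPoly_natDegree (d c)).1)
  obtain ⟨w, hw, hle⟩ := eval_le_of_coeff_lt hP hN hq0 hq1 haD haD' hlt
  obtain ⟨ζ, hζ, hζκ, hwζ⟩ : ∃ ζ, |ζ| = |η| ∧ tiltGain ζ = κ ∧ w = Real.exp (4 * ζ) := by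
    rcases hw with rfl | rfl
    · refine ⟨η, rfl, rfl, ?_⟩
      rw [show 4 * η = Real.log w by simp only [η]; ring, Real.exp_log hq0]
    · refine ⟨-η, abs_neg η, tiltGain_neg η, ?_⟩
      rw [show 4 * -η = -Real.log q by simp only [η]; ring, Real.exp_neg, Real.exp_log hq0]
  have hlow : P.eval 1 * Real.exp (ζ * V) * (1 + κ) ^ B.card ≤ P.eval w := by
    simp only [P, Polynomial.eval_prod]
    have : (∏ c ∈ B, (evenPoly (d c)).eval 1) * Real.exp (ζ * V) * (1 + κ) ^ B.card =
        ∏ c ∈ B, ((evenPoly (d c)).eval 1 * Real.exp (ζ * d c) * (1 + κ)) := by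
      rw [Finset.prod_mul_distrib, Finset.prod_mul_distrib, Finset.prod_const, ← Real.exp_sum,
        ← Finset.mul_sum]
      simp [V]
    rw [this]
    refine Finset.prod_le_prod (fun c hc => ?_) fun c hc => ?_
    · rw [evenPoly_eval_one (by have := (hd c hc).1; omega)]
      positivity
    · rw [hwζ, ← hζκ]
      exact evenPoly_eval_exp_ge ζ (hd c hc).1
  have hP1 : 0 < P.eval 1 := by
    simp only [P, Polynomial.eval_prod]
    refine Finset.prod_pos fun c hc => ?_
    rw [evenPoly_eval_one (by have := (hd c hc).1; omega)]
    positivity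
  have hcardV : (V : ℝ) ≤ B.card * (D + 1) := by
    have : V ≤ B.card * D := by
      have := Finset.sum_le_card_nsmul B d D fun c hc => (hd c hc).2
      simpa using this
    have h2 : (V : ℝ) ≤ B.card * D := by exact_mod_cast this
    have h3 : (0 : ℝ) ≤ B.card := by positivity
    linarith
  have hpow : Real.exp (c₀ * V) ≤ (1 + κ) ^ B.card := by
    rw [← Real.exp_log (by linarith : 0 < 1 + κ), ← Real.exp_nat_mul, Real.exp_le_exp]
    simp only [c₀]
    rw [div_mul_eq_mul_div, div_le_iff₀ (by positivity)]
    nlinarith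
  have hwa : w ^ a ≤ Real.exp (ζ * V) * Real.exp (c₀ / 2 * V) := by
    rw [hwζ, ← Real.exp_nat_mul, ← Real.exp_add, Real.exp_le_exp]
    have h1 : ζ * (a - V / 4) ≤ |η| * (c₀ / (2 * (4 * |η|)) * V) := by
      rw [← hζ]
      refine (le_abs_self _).trans ?_
      rw [abs_mul, hζ]
      gcongr
    have h2 : |η| * (c₀ / (2 * (4 * |η|)) * V) = c₀ / 8 * V := by
      have := (abs_pos.2 hη.ne).ne'
      field_simp
      ring
    rw [h2] at h1
    nlinarith
  have hXV := hX V ((Nat.le_ceil X).trans (by exact_mod_cast hV))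
  have hfin : P.eval 1 * Real.exp (ζ * V) * Real.exp (c₀ * V) ≤
      (V + 1) * (Real.exp (ζ * V) * Real.exp (c₀ / 2 * V) * P.eval 1) := by
    calc _ ≤ P.eval 1 * Real.exp (ζ * V) * (1 + κ) ^ B.card := by gcongr
      _ ≤ _ := hlow.trans hle
      _ ≤ _ := by gcongr
  have hE : Real.exp (c₀ * V) = Real.exp (c₀ / 2 * V) * Real.exp (c₀ / 2 * V) := by
    rw [← Real.exp_add]; ring_nf
  have hpos : 0 < P.eval 1 * Real.exp (ζ * V) * Real.exp (c₀ / 2 * V) := by positivity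
  rw [hE] at hfin
  have : Real.exp (c₀ / 2 * V) ≤ V + 1 := by
    refine le_of_mul_le_mul_left ?_ hpos
    linarith
  linarith

/-! ### Sign patterns at the checks -/

-- Splitting off the first sign reproduces the recursion of `parityPoly`. The expansion X ↦ X²
-- reflects that the number of entries -1 has the parity dictated by the product.
open Polynomial in
lemma sum_patterns (d : ℕ) (ε : ℤˣ) :
    ∑ p : Fin d → ℤˣ, (if ∏ j, p j = ε then
      (X : ℝ[X]) ^ (∑ j, if p j = -1 then 1 else 0) else 0) =
    if ε = 1 then expand ℝ 2 (parityPoly d).1 else X * expand ℝ 2 (parityPoly d).2 := by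
  induction d generalizing ε with
  | zero => rcases Int.units_eq_one_or ε with rfl | rfl <;> simp [parityPoly]
  | succ d ih =>
    rw [← (Fin.consEquiv fun _ => ℤˣ).sum_comp, Fintype.sum_prod_type, sum_units]
    have h1 := ih ε
    have h2 := ih (-ε)
    have e : ∀ p : Fin d → ℤˣ, (-1 * ∏ j, p j = ε) ↔ ∏ j, p j = -ε := fun p => by
      rw [neg_one_mul, neg_eq_iff_eq_neg]
    simp only [Fin.consEquiv_apply, Fin.prod_univ_succ, Fin.sum_univ_succ, Fin.cons_zero,
      Fin.cons_succ, one_mul, e, if_true, pow_add, pow_one]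
    rw [if_neg (by decide : ¬ (1 : ℤˣ) = -1)]
    simp only [pow_zero, one_mul]
    rw [h1]
    have h3 : ∑ p : Fin d → ℤˣ, (if ∏ j, p j = -ε then
        (X : ℝ[X]) * X ^ (∑ j, if p j = -1 then 1 else 0) else 0) =
        X * ∑ p : Fin d → ℤˣ, (if ∏ j, p j = -ε then
        (X : ℝ[X]) ^ (∑ j, if p j = -1 then 1 else 0) else 0) := by
      rw [Finset.mul_sum]
      exact Finset.sum_congr rfl fun p _ => by split_ifs <;> simp
    rw [h3, h2]
    rcases Int.units_eq_one_or ε with rfl | rfl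
    · rw [if_pos rfl, if_neg (by decide), if_pos rfl]
      simp only [parityPoly, map_add, map_mul, expand_X]
      ring
    · rw [if_neg (by decide), if_pos (by decide), if_neg (by decide)]
      simp only [parityPoly, map_add]
      ring

/-- The number of entries `-1` of a sign pattern. -/
def minusCount {d : ℕ} (p : Fin d → ℤˣ) : ℕ := ∑ j, if p j = -1 then 1 else 0

/-- The sign patterns which satisfy a check of degree `d`. -/
def evenPat (d : ℕ) : Finset (Fin d → ℤˣ) := Finset.univ.filter fun p => ∏ j, p j = 1

lemma mem_evenPat {d : ℕ} {p : Fin d → ℤˣ} : p ∈ evenPat d ↔ ∏ j, p j = 1 := by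
  simp [evenPat]

lemma minusCount_le {d : ℕ} (p : Fin d → ℤˣ) : minusCount p ≤ d := by
  refine (Finset.sum_le_card_nsmul _ _ 1 fun j _ => by split_ifs <;> simp).trans ?_
  simp

open Polynomial in
lemma sum_evenPat (d : ℕ) :
    ∑ p ∈ evenPat d, (X : ℝ[X]) ^ minusCount p = expand ℝ 2 (evenPoly d) := by
  have := sum_patterns d 1
  rwa [if_pos rfl, ← Finset.sum_filter] at this

lemma card_evenPat {d : ℕ} (hd : d ≠ 0) : ((evenPat d).card : ℝ) = 2 ^ (d - 1) := by
  have := congr_arg (Polynomial.eval 1) (sum_evenPat d)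
  rw [Polynomial.expand_eval, one_pow, evenPoly_eval_one hd, Polynomial.eval_finsetSum] at this
  simp only [Polynomial.eval_pow, Polynomial.eval_X, one_pow, Finset.sum_const, nsmul_eq_mul,
    mul_one] at this
  rw [this]
  obtain ⟨d, rfl⟩ := Nat.exists_eq_succ_of_ne_zero hd
  simp [pow_succ]

lemma minusCount_even {d : ℕ} {p : Fin d → ℤˣ} (hp : ∏ j, p j = 1) : Even (minusCount p) := by
  have h : ∀ j, p j = (-1) ^ (if p j = -1 then 1 else 0) := fun j => by
    rcases Int.units_eq_one_or (p j) with h | h <;> simp [h]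
  rw [Finset.prod_congr rfl fun j _ => h j, Finset.prod_pow_eq_pow_sum] at hp
  exact neg_one_pow_eq_one_iff_even (by decide) |>.1 hp

/-- Among the satisfying patterns with one prescribed entry there are half of all. -/
lemma card_evenPat_filter {d : ℕ} (hd : 2 ≤ d) (j : Fin d) (ε : ℤˣ) :
    (((evenPat d).filter fun p => p j = ε).card : ℝ) = 2 ^ (d - 2) := by
  obtain ⟨k, hk⟩ : ∃ k : Fin d, k ≠ j := by
    have : Nontrivial (Fin d) := Fin.nontrivial_iff_two_le.2 hd
    exact exists_ne j
  have key : ∀ ε : ℤˣ, ((evenPat d).filter fun p => p j = ε).card ≤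
      ((evenPat d).filter fun p => p j = -ε).card := by
    intro ε
    -- Flipping the entry j together with a second entry k preserves the product; k exists because d
    -- ≥ 2.
    refine Finset.card_le_card_of_injOn
      (fun p => p * (Pi.mulSingle j (-1) * Pi.mulSingle k (-1))) ?_ ?_
    · intro p hp
      simp only [Finset.coe_filter, Set.mem_ofPred_eq, mem_evenPat] at hp ⊢
      refine ⟨?_, ?_⟩
      · simp only [Pi.mul_apply, Finset.prod_mul_distrib, hp.1, Finset.prod_pi_mulSingle']
        simp
      · simp [hp.2, Pi.mulSingle_eq_of_ne hk.symm]
    · intro p _ p' _ h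
      exact mul_right_cancel h
  have h1 : ((evenPat d).filter fun p => p j = ε).card =
      ((evenPat d).filter fun p => p j = -ε).card :=
    le_antisymm (key ε) (by simpa using key (-ε))
  have h2 := Finset.card_filter_add_card_filter_not (s := evenPat d) (fun p => p j = ε)
  have h3 : ((evenPat d).filter fun p => ¬ p j = ε) = (evenPat d).filter fun p => p j = -ε := by
    refine Finset.filter_congr fun p _ => ?_
    rcases Int.units_eq_one_or (p j) with h | h <;> rcases Int.units_eq_one_or ε with rfl | rfl <;>
      simp [h]
  rw [h3, ← h1] at h2
  have h4 := card_evenPat (d := d) (by omega)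
  rw [← h2] at h4
  push_cast at h4
  rw [show d - 1 = (d - 2) + 1 by omega, pow_succ] at h4
  linarith

open Polynomial in
/-- The sign patterns of all checks with prescribed choices and prescribed total weight are
counted by a coefficient of the product of the enumerators. -/
lemma card_patterns_eq_coeff {m : ℕ} (d : Fin m → ℕ) (K : ∀ c, Finset (Fin (d c) → ℤˣ)) (W : ℕ) :
    (((Fintype.piFinset K).filter fun q => ∑ c, minusCount (q c) = W).card : ℝ) =
      (∏ c, ∑ e ∈ K c, (X : ℝ[X]) ^ minusCount e).coeff W := by
  rw [Finset.prod_univ_sum, finsetSum_coeff, Finset.card_filter]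
  push_cast
  refine Finset.sum_congr rfl fun q _ => ?_
  rw [Finset.prod_pow_eq_pow_sum, coeff_X_pow]
  simp only [eq_comm]

open Polynomial in
/-- The patterns which are prescribed on the checks in `Q` and even elsewhere. -/
lemma card_patterns_prescribed {m : ℕ} (d : Fin m → ℕ) (Q : Finset (Fin m))
    (r : ∀ c, Fin (d c) → ℤˣ) (a : ℕ) :
    (((Fintype.piFinset fun c => if c ∈ Q then {r c} else evenPat (d c)).filter
      fun q => ∑ c, minusCount (q c) = 2 * a + ∑ c ∈ Q, minusCount (r c)).card : ℝ) =
      (∏ c ∈ Qᶜ, evenPoly (d c)).coeff a := by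
  rw [card_patterns_eq_coeff, ← Finset.prod_mul_prod_compl Q]
  rw [Finset.prod_congr rfl fun c hc => by rw [if_pos hc, Finset.sum_singleton],
    Finset.prod_congr (s₁ := Qᶜ) rfl fun c hc => by
      rw [if_neg (Finset.mem_compl.1 hc), sum_evenPat],
    Finset.prod_pow_eq_pow_sum, ← map_prod, coeff_X_pow_mul, mul_comm,
    coeff_expand_mul (by norm_num)]

/-! ### Tanner graphs with a given codeword -/

/-- Two sign sequences of equal weight which agree on `P` differ by a permutation fixing `P`. -/
lemma exists_perm_of_card_eq {T : Type} [Fintype T] (P : T → Prop) (q q' : T → ℤˣ)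
    (hP : ∀ t, P t → q t = q' t)
    (hc : Nat.card {t // q t = -1} = Nat.card {t // q' t = -1}) :
    ∃ π : Equiv.Perm T, (∀ t, P t → π t = t) ∧ ∀ t, q' (π t) = q t := by
  classical
  simp only [Nat.card_eq_fintype_card, Fintype.card_subtype] at hc
  have hall : ∀ ε : ℤˣ, (Finset.univ.filter fun t => q t = ε).card =
      (Finset.univ.filter fun t => q' t = ε).card := by
    intro ε
    rcases Int.units_eq_one_or ε with rfl | rfl
    · have e : ∀ p : T → ℤˣ, (Finset.univ.filter fun t => p t = 1) =
          (Finset.univ.filter fun t => p t = -1)ᶜ := by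
        intro p
        ext t
        rcases Int.units_eq_one_or (p t) with h | h <;> simp [h]
      rw [e, e, Finset.card_compl, Finset.card_compl, hc]
    · exact hc
  have hcard : ∀ ε : ℤˣ, (Finset.univ.filter fun t => ¬ P t ∧ q t = ε).card =
      (Finset.univ.filter fun t => ¬ P t ∧ q' t = ε).card := by
    intro ε
    have e : ∀ p : T → ℤˣ, (Finset.univ.filter fun t => P t ∧ p t = ε).card +
        (Finset.univ.filter fun t => ¬ P t ∧ p t = ε).card =
        (Finset.univ.filter fun t => p t = ε).card := by
      intro p
      rw [← Finset.card_filter_add_card_filter_not (s := Finset.univ.filter fun t => p t = ε) P,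
        Finset.filter_filter, Finset.filter_filter]
      simp only [and_comm]
    have h1 : (Finset.univ.filter fun t => P t ∧ q t = ε) =
        Finset.univ.filter fun t => P t ∧ q' t = ε :=
      Finset.filter_congr fun t _ => and_congr_right fun h => by rw [hP t h]
    have h2 := e q
    have h3 := e q'
    rw [h1, hall] at h2
    omega
  -- Points of P are labelled by themselves and all others by their sign. A bijection matching the
  -- labels then fixes P and carries one sign sequence to the other.
  let f : (T → ℤˣ) → T → T ⊕ ℤˣ := fun p t => if P t then Sum.inl t else Sum.inr (p t)
  have hf : ∀ c : T ⊕ ℤˣ, Nonempty ({t // f q t = c} ≃ {t // f q' t = c}) := by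
    intro c
    refine ⟨Fintype.equivOfCardEq ?_⟩
    rw [Fintype.card_subtype, Fintype.card_subtype]
    rcases c with t₀ | ε
    · congr 1
      refine Finset.filter_congr fun t _ => ?_
      by_cases h : P t <;> simp [f, h]
    · have e : ∀ p : T → ℤˣ, (Finset.univ.filter fun t => f p t = Sum.inr ε) =
          Finset.univ.filter fun t => ¬ P t ∧ p t = ε := by
        intro p
        refine Finset.filter_congr fun t _ => ?_
        by_cases h : P t <;> simp [f, h]
      rw [e, e, hcard]
  refine ⟨Equiv.ofFiberEquiv fun c => (hf c).some, fun t ht => ?_, fun t => ?_⟩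
  · have := Equiv.ofFiberEquiv_map (fun c => (hf c).some) t
    simp only [f, if_pos ht] at this
    split_ifs at this with h
    exact Sum.inl_injective this
  · have := Equiv.ofFiberEquiv_map (fun c => (hf c).some) t
    by_cases ht : P t
    · simp only [f, if_pos ht] at this
      split_ifs at this with h
      have h2 := Sum.inl_injective this
      rw [h2, hP t ht]
    · simp only [f, if_neg ht] at this
      split_ifs at this with h
      exact Sum.inr_injective this

namespace Degrees

variable {E : Degrees}

/-- The symbol which the check socket `t` sees. -/
def signAt (x : Fin E.n → ℤˣ) (σ : E.Tanner) (t : E.CSock) : ℤˣ := x (σ.symm t).1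

/-- The number of sockets of variable nodes which carry the symbol `ε`. -/
def signCard (x : Fin E.n → ℤˣ) (ε : ℤˣ) : ℕ :=
  (Finset.univ.filter fun s : E.VSock => x s.1 = ε).card

open Classical in
/-- The Tanner graphs with codeword `x` which agree with `g` on the check sockets in `R`, and in
the symbols seen by the checks in `Q`. -/
def tannerClass (x : Fin E.n → ℤˣ) (g : E.Tanner) (R : Finset E.CSock) (Q : Finset (Fin E.m)) :
    Finset E.Tanner :=
  Finset.univ.filter fun σ => IsCodeword σ x ∧ (∀ t ∈ R, σ.symm t = g.symm t) ∧
    ∀ t : E.CSock, t.1 ∈ Q → signAt x σ t = signAt x g t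

lemma mem_tannerClass {x : Fin E.n → ℤˣ} {g σ : E.Tanner} {R : Finset E.CSock}
    {Q : Finset (Fin E.m)} : σ ∈ tannerClass x g R Q ↔ IsCodeword σ x ∧
      (∀ t ∈ R, σ.symm t = g.symm t) ∧
      ∀ t : E.CSock, t.1 ∈ Q → signAt x σ t = signAt x g t := by
  simp [tannerClass]

lemma card_signAt (x : Fin E.n → ℤˣ) (σ : E.Tanner) (ε : ℤˣ) :
    (Finset.univ.filter fun t => signAt x σ t = ε).card = signCard x ε := by
  classical
  refine Finset.card_bij (fun t _ => σ.symm t) ?_ ?_ ?_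
  · intro t ht; exact Finset.mem_filter.2 ⟨Finset.mem_univ _, (Finset.mem_filter.1 ht).2⟩
  · intro t _ t' _ h; exact σ.symm.injective h
  · intro s hs
    refine ⟨σ s, Finset.mem_filter.2 ⟨Finset.mem_univ _, ?_⟩, by simp⟩
    simpa [signAt] using (Finset.mem_filter.1 hs).2

lemma sum_minusCount (x : Fin E.n → ℤˣ) (σ : E.Tanner) :
    ∑ c, minusCount (fun j => signAt x σ ⟨c, j⟩) = signCard x (-1) := by
  rw [← card_signAt x σ, Finset.card_filter, Fintype.sum_sigma]
  rfl

open Classical in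
/-- The Tanner graphs which agree with `g` on `R` and where the check sockets see the symbols `q`.
-/
def patternFiber (x : Fin E.n → ℤˣ) (g : E.Tanner) (R : Finset E.CSock) (q : E.CSock → ℤˣ) :
    Finset E.Tanner :=
  Finset.univ.filter fun σ => (∀ t ∈ R, σ.symm t = g.symm t) ∧ signAt x σ = q

lemma mem_patternFiber {x : Fin E.n → ℤˣ} {g σ : E.Tanner} {R : Finset E.CSock}
    {q : E.CSock → ℤˣ} : σ ∈ patternFiber x g R q ↔
      (∀ t ∈ R, σ.symm t = g.symm t) ∧ signAt x σ = q := by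
  simp [patternFiber]

/-- Composing each graph with a permutation of check sockets that carries q to q' and fixes R is
injective. -/
lemma card_patternFiber_le {x : Fin E.n → ℤˣ} {g : E.Tanner} {R : Finset E.CSock}
    {q q' : E.CSock → ℤˣ} (hR : ∀ t ∈ R, q t = q' t)
    (hc : (Finset.univ.filter fun t => q t = -1).card =
      (Finset.univ.filter fun t => q' t = -1).card) :
    (patternFiber x g R q).card ≤ (patternFiber x g R q').card := by
  classical
  obtain ⟨π, h1, h2⟩ := exists_perm_of_card_eq (fun t => t ∈ R) q q' hR (by
    simpa [Nat.card_eq_fintype_card, Fintype.card_subtype] using hc)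
  refine Finset.card_le_card_of_injOn (fun σ => σ.trans π) ?_ ?_
  · intro σ hσ
    rw [Finset.mem_coe, mem_patternFiber] at hσ ⊢
    refine ⟨fun t ht => ?_, ?_⟩
    · rw [Equiv.symm_trans_apply, ← hσ.1 t ht]
      congr 1
      rw [Equiv.symm_apply_eq, h1 t ht]
    · funext t
      have h3 := h2 (π.symm t)
      rw [Equiv.apply_symm_apply] at h3
      rw [h3, ← hσ.2]
      rfl
  · intro σ _ σ' _ h
    ext s : 1
    have := Equiv.congr_fun h s
    simpa using this

lemma card_patternFiber {x : Fin E.n → ℤˣ} {g : E.Tanner} {R : Finset E.CSock}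
    {q : E.CSock → ℤˣ} (hR : ∀ t ∈ R, q t = signAt x g t)
    (hc : (Finset.univ.filter fun t => q t = -1).card = signCard x (-1)) :
    (patternFiber x g R q).card = (patternFiber x g R (signAt x g)).card := by
  have h : (Finset.univ.filter fun t => q t = -1).card =
      (Finset.univ.filter fun t => signAt x g t = -1).card := by rw [hc, card_signAt]
  exact le_antisymm (card_patternFiber_le hR h)
    (card_patternFiber_le (fun t ht => (hR t ht).symm) h.symm)

open Classical in
/-- The graphs of the class where the check `c` sees the pattern `p`. -/
def patternClass (x : Fin E.n → ℤˣ) (g : E.Tanner) (R : Finset E.CSock) (Q : Finset (Fin E.m))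
    (c : Fin E.m) (p : Fin (E.cdeg c) → ℤˣ) : Finset E.Tanner :=
  (tannerClass x g R Q).filter fun σ => (fun j => signAt x σ ⟨c, j⟩) = p

open Classical in
/-- The patterns realized by the graphs of the class. -/
def classPatterns (x : Fin E.n → ℤˣ) (g : E.Tanner) (Q : Finset (Fin E.m))
    (c : Fin E.m) (p : Fin (E.cdeg c) → ℤˣ) : Finset (∀ c, Fin (E.cdeg c) → ℤˣ) :=
  (Fintype.piFinset fun c' => if c' ∈ insert c Q then
    {Function.update (fun c j => signAt x g ⟨c, j⟩) c p c'} else evenPat (E.cdeg c')).filter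
      fun q => ∑ c, minusCount (q c) = signCard x (-1)

/-- Sort the graphs by the symbols they show at all check sockets. Every admissible assignment of
the right weight is realized equally often, so counting graphs becomes counting assignments. -/
lemma card_patternClass {x : Fin E.n → ℤˣ} {g : E.Tanner} (hg : IsCodeword g x)
    {R : Finset E.CSock} {Q : Finset (Fin E.m)} (hRQ : ∀ t ∈ R, t.1 ∈ Q)
    {c : Fin E.m} (hc : c ∉ Q) {p : Fin (E.cdeg c) → ℤˣ} (hp : p ∈ evenPat (E.cdeg c)) :
    (patternClass x g R Q c p).card =
      (classPatterns x g Q c p).card * (patternFiber x g R (signAt x g)).card := by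
  classical
  have hmem : ∀ q : ∀ c, Fin (E.cdeg c) → ℤˣ, q ∈ classPatterns x g Q c p ↔
      (q c = p ∧ (∀ c' ∈ Q, q c' = fun j => signAt x g ⟨c', j⟩) ∧ (∀ c', q c' ∈ evenPat _) ∧
        ∑ c, minusCount (q c) = signCard x (-1)) := by
    intro q
    rw [classPatterns, Finset.mem_filter, Fintype.mem_piFinset]
    constructor
    · rintro ⟨h1, h2⟩
      have hqc : q c = p := by simpa using h1 c
      have hqQ : ∀ c' ∈ Q, q c' = fun j => signAt x g ⟨c', j⟩ := by
        intro c' hc'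
        have := h1 c'
        have hne : c' ≠ c := fun h => hc (h ▸ hc')
        simpa [hc', hne] using this
      refine ⟨hqc, hqQ, fun c' => ?_, h2⟩
      by_cases h : c' ∈ insert c Q
      · rcases Finset.mem_insert.1 h with rfl | h
        · rwa [hqc]
        · rw [hqQ c' h, mem_evenPat]; exact hg c'
      · have := h1 c'
        rwa [if_neg h] at this
    · rintro ⟨h1, h2, h3, h4⟩
      refine ⟨fun c' => ?_, h4⟩
      split_ifs with h
      · rcases Finset.mem_insert.1 h with rfl | h
        · simp [h1]
        · have hne : c' ≠ c := fun h' => hc (h' ▸ h)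
          simp [hne, h2 c' h]
      · exact h3 c'
  rw [Finset.card_eq_sum_card_fiberwise (t := classPatterns x g Q c p)
    (f := fun σ c j => signAt x σ ⟨c, j⟩)]
  · rw [Finset.sum_const_nat]
    intro q hq
    rw [hmem] at hq
    obtain ⟨h1, h2, h3, h4⟩ := hq
    rw [← card_patternFiber (q := fun t => q t.1 t.2)]
    · congr 1
      ext σ
      rw [Finset.mem_filter, patternClass, Finset.mem_filter, mem_tannerClass, mem_patternFiber]
      constructor
      · rintro ⟨⟨⟨_, h5, _⟩, _⟩, h6⟩
        exact ⟨h5, by funext t; rw [← h6]⟩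
      · rintro ⟨h5, h6⟩
        have h7 : (fun c j => signAt x σ ⟨c, j⟩) = q := by rw [h6]
        refine ⟨⟨⟨fun c' => ?_, h5, fun t ht => ?_⟩, ?_⟩, h7⟩
        · have := mem_evenPat.1 (h3 c')
          rw [← h7] at this
          exact this
        · rw [h6]
          exact congr_fun (h2 _ ht) t.2
        · rw [← h1, ← h7]
    · intro t ht
      exact congr_fun (h2 _ (hRQ t ht)) t.2
    · rw [← h4, Finset.card_filter, Fintype.sum_sigma]
      rfl
  · intro σ hσ
    rw [Finset.mem_coe, patternClass, Finset.mem_filter, mem_tannerClass] at hσ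
    rw [Finset.mem_coe, hmem]
    refine ⟨hσ.2, fun c' hc' => ?_, fun c' => mem_evenPat.2 (hσ.1.1 c'), sum_minusCount x σ⟩
    funext j
    exact hσ.1.2.2 ⟨c', j⟩ hc'

lemma card_tannerClass_eq_sum (x : Fin E.n → ℤˣ) (g : E.Tanner) (R : Finset E.CSock)
    (Q : Finset (Fin E.m)) (c : Fin E.m) :
    (tannerClass x g R Q).card = ∑ p ∈ evenPat (E.cdeg c), (patternClass x g R Q c p).card := by
  classical
  refine Finset.card_eq_sum_card_fiberwise fun σ hσ => ?_
  rw [Finset.mem_coe, mem_tannerClass] at hσ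
  exact mem_evenPat.2 (hσ.1 c)

lemma card_classPatterns {x : Fin E.n → ℤˣ} {g : E.Tanner} {Q : Finset (Fin E.m)}
    {c : Fin E.m} {p : Fin (E.cdeg c) → ℤˣ} {a w : ℕ} (hw : w = ∑ c' ∈ insert c Q, minusCount
      (Function.update (fun c j => signAt x g ⟨c, j⟩) c p c'))
    (ha : signCard x (-1) = 2 * a + w) :
    ((classPatterns x g Q c p).card : ℝ) =
      (∏ c' ∈ (insert c Q)ᶜ, evenPoly (E.cdeg c')).coeff a := by
  classical
  rw [← card_patterns_prescribed E.cdeg (insert c Q)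
    (Function.update (fun c j => signAt x g ⟨c, j⟩) c p) a, ← hw, ← ha]
  rfl

lemma even_minusCount_update {x : Fin E.n → ℤˣ} {g : E.Tanner} (hg : IsCodeword g x)
    {c : Fin E.m} {p : Fin (E.cdeg c) → ℤˣ} (hp : p ∈ evenPat (E.cdeg c)) (c' : Fin E.m) :
    Even (minusCount (Function.update (fun c j => signAt x g ⟨c, j⟩) c p c')) := by
  rcases eq_or_ne c' c with rfl | h
  · rw [Function.update_self]; exact minusCount_even (mem_evenPat.1 hp)
  · rw [Function.update_of_ne h]; exact minusCount_even (hg c')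

lemma sum_minusCount_update {x : Fin E.n → ℤˣ} {g : E.Tanner} {Q : Finset (Fin E.m)}
    {c : Fin E.m} (hc : c ∉ Q) (p : Fin (E.cdeg c) → ℤˣ) :
    ∑ c' ∈ insert c Q, minusCount (Function.update (fun c j => signAt x g ⟨c, j⟩) c p c') =
      minusCount p + ∑ c' ∈ Q, minusCount (fun j => signAt x g ⟨c', j⟩) := by
  rw [Finset.sum_insert hc, Function.update_self]
  congr 1
  refine Finset.sum_congr rfl fun c' hc' => ?_
  have hne : c' ≠ c := by rintro rfl; exact hc hc'
  rw [Function.update_of_ne hne]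

/-- At a check which has not been seen all even patterns are asymptotically equally likely. -/
theorem card_patternClass_ge (D M : ℕ) {θ : ℝ} (hθ0 : 0 < θ) (hθ1 : θ < 1) :
    ∃ δ > 0, ∃ N₀ : ℕ, ∀ (E : Degrees) (x : Fin E.n → ℤˣ) (g : E.Tanner) (R : Finset E.CSock)
      (Q : Finset (Fin E.m)) (c : Fin E.m), (∀ c, 2 ≤ E.cdeg c ∧ E.cdeg c ≤ D) →
      IsCodeword g x → (∀ t ∈ R, t.1 ∈ Q) → c ∉ Q → Q.card ≤ M → N₀ ≤ ∑ c, E.cdeg c →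
      |(signCard x (-1) : ℝ) - (∑ c, E.cdeg c : ℕ) / 2| ≤ δ * (∑ c, E.cdeg c : ℕ) →
      ∀ p ∈ evenPat (E.cdeg c), θ * (tannerClass x g R Q).card ≤
        2 ^ (E.cdeg c - 1) * ((patternClass x g R Q c p).card : ℝ) := by
  -- By Bernoulli's inequality this q < 1 satisfies q^D ≥ θ.
  set q : ℝ := 1 + -((1 - θ) / (D + 1))
  have hq : (1 - θ) / (D + 1) < 1 := by
    rw [div_lt_one (by positivity)]
    have : (0 : ℝ) ≤ D := by positivity
    linarith
  have hq' : 0 < (1 - θ) / (D + 1) := div_pos (by linarith) (by positivity)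
  have hqD : θ ≤ q ^ D := by
    refine le_trans ?_ (one_add_mul_le_pow (by linarith) D)
    have : D * ((1 - θ) / (D + 1)) ≤ 1 - θ := by
      rw [mul_div_assoc', div_le_iff₀ (by positivity)]
      nlinarith
    linarith
  obtain ⟨δ₁, hδ₁, V₀, h⟩ := evenPoly_coeff_ratio D (q := q) (by simp only [q]; linarith)
    (by simp only [q]; linarith)
  set K := D * (M + 1)
  -- The seen checks and c have at most K sockets. The summands of N₀ in turn leave V₀ sockets at
  -- the other checks, make the prescribed weight at most the total one, and keep the remaining
  -- weight within δ₁V of the middle.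
  refine ⟨min δ₁ (1 / 4), by positivity, V₀ + K + 4 * K + ⌈(2 * K * (1 + δ₁) / δ₁ : ℝ)⌉₊, ?_⟩
  intro E x g R Q c hd hg hRQ hc hM hN hW p hp
  set N := ∑ c, E.cdeg c
  set V := ∑ c' ∈ (insert c Q)ᶜ, E.cdeg c'
  set W := signCard x (-1)
  have hQK : ∑ c' ∈ insert c Q, E.cdeg c' ≤ K := by
    refine (Finset.sum_le_card_nsmul _ _ D fun c _ => (hd c).2).trans ?_
    rw [smul_eq_mul, mul_comm, Finset.card_insert_of_notMem hc]
    exact Nat.mul_le_mul_left _ (by omega)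
  have hNV : ∑ c' ∈ insert c Q, E.cdeg c' + V = N := Finset.sum_add_sum_compl _ _
  have hNr : (2 * K * (1 + δ₁) / δ₁ : ℝ) ≤ N := Nat.ceil_le.1 (by omega)
  rw [div_le_iff₀ hδ₁] at hNr
  have hVr : (N : ℝ) - K ≤ V := by
    have : N ≤ V + K := by omega
    have : (N : ℝ) ≤ V + K := by exact_mod_cast this
    linarith
  have hVN : (V : ℝ) ≤ N := by exact_mod_cast (by omega : V ≤ N)
  have hN4 : 4 * (K : ℝ) ≤ N := by exact_mod_cast (by omega : 4 * K ≤ N)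
  have hδN : min δ₁ (1 / 4) * (N : ℝ) ≤ N / 4 := by
    have := mul_le_mul_of_nonneg_right (min_le_right δ₁ (1 / 4)) (Nat.cast_nonneg (α := ℝ) N)
    linarith
  have hδN' : min δ₁ (1 / 4) * (N : ℝ) ≤ δ₁ * N :=
    mul_le_mul_of_nonneg_right (min_le_left _ _) (by positivity)
  -- The unprescribed checks carry weight 2a, even because every check is satisfied; a is the
  -- coefficient to be compared.
  have hwt : ∀ p : Fin (E.cdeg c) → ℤˣ, p ∈ evenPat (E.cdeg c) → ∃ a : ℕ,
      W = 2 * a + ∑ c' ∈ insert c Q,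
        minusCount (Function.update (fun c j => signAt x g ⟨c, j⟩) c p c') := by
    intro p hp
    set w := ∑ c' ∈ insert c Q,
      minusCount (Function.update (fun c j => signAt x g ⟨c, j⟩) c p c')
    have hw : Even w := Finset.even_sum _ fun c' _ => even_minusCount_update hg hp c'
    have hWe : Even W := by
      rw [show W = _ from (sum_minusCount x g).symm]
      exact Finset.even_sum _ fun c' _ => minusCount_even (hg c')
    have hwK : w ≤ K := (Finset.sum_le_sum fun c' _ => minusCount_le _).trans hQK
    have hwW : w ≤ W := by
      have h1 := (abs_le.1 hW).1
      have h2 : (w : ℝ) ≤ K := by exact_mod_cast hwK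
      have : (w : ℝ) ≤ W := by linarith
      exact_mod_cast this
    obtain ⟨a, ha⟩ := (Nat.even_sub hwW).2 (by simp [hw, hWe])
    exact ⟨a, by omega⟩
  have hratio : ∀ p' ∈ evenPat (E.cdeg c), θ * ((patternClass x g R Q c p').card : ℝ) ≤
      (patternClass x g R Q c p).card := by
    intro p' hp'
    obtain ⟨a, ha⟩ := hwt p hp
    obtain ⟨a', ha'⟩ := hwt p' hp'
    rw [card_patternClass hg hRQ hc hp, card_patternClass hg hRQ hc hp']
    push_cast
    rw [card_classPatterns rfl ha, card_classPatterns rfl ha', ← mul_assoc]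
    refine mul_le_mul_of_nonneg_right ?_ (by positivity)
    set w := ∑ c' ∈ insert c Q,
      minusCount (Function.update (fun c j => signAt x g ⟨c, j⟩) c p c') with hw
    have hwK : w ≤ K := (Finset.sum_le_sum fun c' _ => minusCount_le _).trans hQK
    have e := sum_minusCount_update (x := x) (g := g) hc p
    have e' := sum_minusCount_update (x := x) (g := g) hc p'
    have hpD := (minusCount_le p).trans (hd c).2
    have hpD' := (minusCount_le p').trans (hd c).2
    refine le_trans ?_ (h (insert c Q)ᶜ E.cdeg (fun c _ => hd c) (by omega) a a' ?_ (by omega)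
      (by omega))
    · refine mul_le_mul_of_nonneg_right hqD ?_
      rw [← card_classPatterns rfl ha']
      positivity
    · have har : (W : ℝ) = 2 * a + w := by exact_mod_cast ha
      have hwr : (w : ℝ) ≤ K := by exact_mod_cast hwK
      have hw0 : (0 : ℝ) ≤ w := by positivity
      obtain ⟨h1, h2⟩ := abs_le.1 hW
      change |(a : ℝ) - (V : ℝ) / 4| ≤ δ₁ * V
      have h3 : δ₁ * ((N : ℝ) - K) ≤ δ₁ * V := mul_le_mul_of_nonneg_left hVr hδ₁.le
      rw [abs_le]
      constructor <;> nlinarith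
  -- The class is the union over 2^(d-1) even patterns, each at most 1/θ times as frequent as p.
  rw [card_tannerClass_eq_sum x g R Q c]
  push_cast
  rw [Finset.mul_sum, ← card_evenPat (by have := (hd c).1; omega), ← nsmul_eq_mul]
  exact Finset.sum_le_card_nsmul _ _ _ hratio

end Degrees

/-! ### Random configurations -/

/-- If the class `C` is stable under exchanging the partner of `t` with `s`, then `s` is the partner
of `t` in at least `1 / #K` of the matchings in `C`, where `K` contains the possible partners. -/
lemma card_le_of_swap {α β : Type*} [DecidableEq α] [DecidableEq β] (C : Finset (α ≃ β)) (t : β)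
    (s : α) (K : Finset α) (hK : ∀ σ ∈ C, σ.symm t ∈ K)
    (hC : ∀ σ ∈ C, (Equiv.swap (σ.symm t) s).trans σ ∈ C) :
    C.card ≤ K.card * (C.filter fun σ => σ.symm t = s).card := by
  rw [← Finset.card_product]
  refine Finset.card_le_card_of_injOn
    (fun σ => (σ.symm t, (Equiv.swap (σ.symm t) s).trans σ)) ?_ ?_
  · intro σ hσ
    simp only [Finset.coe_product, Set.mem_prod, Finset.mem_coe, Finset.mem_filter]
    exact ⟨hK σ hσ, hC σ hσ, by simp⟩
  · intro σ _ σ' _ h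
    simp only [Prod.mk.injEq] at h
    obtain ⟨h1, h2⟩ := h
    rw [h1] at h2
    ext a
    have := Equiv.congr_fun h2 (Equiv.swap (σ'.symm t) s a)
    simpa using this

/-- The average of a function over a finite set. -/
def avg {ι : Type*} (C : Finset ι) (G : ι → ℝ≥0∞) : ℝ≥0∞ := (C.card : ℝ≥0∞)⁻¹ * ∑ ω ∈ C, G ω

lemma avg_congr {ι : Type*} {C : Finset ι} {G G' : ι → ℝ≥0∞} (h : ∀ ω ∈ C, G ω = G' ω) :
    avg C G = avg C G' := by
  rw [avg, avg, Finset.sum_congr rfl h]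

lemma avg_const {ι : Type*} {C : Finset ι} (hC : C.Nonempty) (a : ℝ≥0∞) :
    avg C (fun _ => a) = a := by
  rw [avg, Finset.sum_const, nsmul_eq_mul, ← mul_assoc, ENNReal.inv_mul_cancel, one_mul]
  · simpa using hC.ne_empty
  · exact ENNReal.natCast_ne_top _

/-- An average dominates the weighted averages over disjoint parts. -/
lemma sum_avg_le {ι κ : Type*} (C : Finset ι) (O : Finset κ) (D : κ → Finset ι) (p : κ → ℝ≥0∞)
    (hD : ∀ o ∈ O, D o ⊆ C) (hdisj : Set.PairwiseDisjoint (O : Set κ) D)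
    (hp : ∀ o ∈ O, p o * C.card ≤ (D o).card) (G : ι → ℝ≥0∞) :
    ∑ o ∈ O, p o * avg (D o) G ≤ avg C G := by
  classical
  have h1 : ∀ o ∈ O, p o * avg (D o) G ≤ (C.card : ℝ≥0∞)⁻¹ * ∑ ω ∈ D o, G ω := by
    intro o ho
    rcases (D o).eq_empty_or_nonempty with h | h
    · simp [avg, h]
    rw [avg, ← mul_assoc]
    gcongr
    have hC : (C.card : ℝ≥0∞) ≠ 0 := by simpa using (h.mono (hD o ho)).ne_empty
    have hD0 : ((D o).card : ℝ≥0∞) ≠ 0 := by simpa using h.ne_empty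
    rw [← div_eq_mul_inv, ENNReal.div_le_iff hD0 (ENNReal.natCast_ne_top _), mul_comm,
      ← div_eq_mul_inv, ENNReal.le_div_iff_mul_le (Or.inl hC)
        (Or.inl (ENNReal.natCast_ne_top _))]
    exact hp o ho
  calc _ ≤ ∑ o ∈ O, (C.card : ℝ≥0∞)⁻¹ * ∑ ω ∈ D o, G ω := Finset.sum_le_sum h1
    _ = (C.card : ℝ≥0∞)⁻¹ * ∑ ω ∈ O.biUnion D, G ω := by
      rw [← Finset.mul_sum, Finset.sum_biUnion hdisj]
    _ ≤ _ := by
      rw [avg]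
      gcongr
      exact Finset.biUnion_subset.2 hD

/-- Resampling one coordinate does not change the law of independent noise. -/
lemma lintegral_noise_update {n : ℕ} (i : Fin n) {G : (Fin n → ℝ) → ℝ≥0∞} (hG : Measurable G) :
    ∫⁻ z, G z ∂(Degrees.noise n) =
      ∫⁻ a, ∫⁻ z, G (Function.update z i a) ∂(Degrees.noise n) ∂(gaussianReal 0 1) := by
  have hprob : IsProbabilityMeasure (Degrees.noise n) := by
    unfold Degrees.noise; infer_instance
  have hm : Measurable (fun p : ℝ × (Fin n → ℝ) => Function.update p.2 i p.1) := by
    refine measurable_pi_lambda _ fun j => ?_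
    rcases eq_or_ne j i with rfl | h
    · simpa using measurable_fst
    · simp only [Function.update_of_ne h]; fun_prop
  have : Degrees.noise n = ((gaussianReal 0 1).prod (Degrees.noise n)).map
      (fun p => Function.update p.2 i p.1) := by
    refine Measure.pi_eq (fun s hs => ?_)
    rw [Measure.map_apply hm (MeasurableSet.univ_pi hs)]
    have : (fun p : ℝ × (Fin n → ℝ) => Function.update p.2 i p.1) ⁻¹' Set.univ.pi s =
        s i ×ˢ Set.univ.pi (Function.update s i Set.univ) := by
      ext p
      simp only [Set.mem_preimage, Set.mem_univ_pi, Set.mem_prod]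
      constructor
      · refine fun h => ⟨by simpa using h i, fun j => ?_⟩
        rcases eq_or_ne j i with rfl | hj
        · simp
        · simpa [hj] using h j
      · rintro ⟨h1, h2⟩ j
        rcases eq_or_ne j i with rfl | hj
        · simpa using h1
        · simpa [hj] using h2 j
    rw [this, Measure.prod_prod, Degrees.noise, Measure.pi_pi,
      ← Finset.mul_prod_erase _ _ (Finset.mem_univ i),
      ← Finset.mul_prod_erase _ (fun j => gaussianReal 0 1 (s j)) (Finset.mem_univ i),
      Function.update_self, measure_univ, one_mul]
    congr 1
    refine Finset.prod_congr rfl fun j hj => ?_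
    rw [Function.update_of_ne (Finset.ne_of_mem_erase hj)]
  conv_lhs => rw [this]
  rw [lintegral_map hG hm]
  exact lintegral_prod _ (hG.comp hm).aemeasurable

namespace Degrees

variable {E : Degrees}

lemma signAt_swap {x : Fin E.n → ℤˣ} {σ : E.Tanner} {s s' : E.VSock} (h : x s.1 = x s'.1)
    (u : E.CSock) : signAt x ((Equiv.swap s s').trans σ) u = signAt x σ u := by
  simp only [signAt, Equiv.symm_trans_apply, Equiv.symm_swap]
  rcases eq_or_ne (σ.symm u) s with h1 | h1
  · rw [h1, Equiv.swap_apply_left, h]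
  rcases eq_or_ne (σ.symm u) s' with h2 | h2
  · rw [h2, Equiv.swap_apply_right, h]
  · rw [Equiv.swap_apply_of_ne_of_ne h1 h2]

/-- Given the symbol which the check socket `t` sees, a free variable socket with this symbol is
its partner with at least the uniform probability. -/
lemma card_tannerClass_le {x : Fin E.n → ℤˣ} {g : E.Tanner} {R : Finset E.CSock}
    {Q : Finset (Fin E.m)} {t : E.CSock} (htR : t ∉ R) (htQ : t.1 ∈ Q) {s : E.VSock}
    (hs : g s ∉ R) (hxs : x s.1 = signAt x g t) :
    (tannerClass x g R Q).card ≤ signCard x (signAt x g t) *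
      ((tannerClass x g R Q).filter fun σ => σ.symm t = s).card := by
  classical
  refine (card_le_of_swap _ t s (Finset.univ.filter fun s : E.VSock => x s.1 = signAt x g t)
    (fun σ hσ => ?_) fun σ hσ => ?_)
  · rw [mem_tannerClass] at hσ
    rw [Finset.mem_filter]
    exact ⟨Finset.mem_univ _, hσ.2.2 t htQ⟩
  · rw [mem_tannerClass] at hσ ⊢
    have h1 : x (σ.symm t).1 = x s.1 := by rw [hxs, ← hσ.2.2 t htQ]; rfl
    refine ⟨fun c => ?_, fun u hu => ?_, fun u hu => ?_⟩
    · rw [← hσ.1 c]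
      exact Finset.prod_congr rfl fun j _ => signAt_swap h1 ⟨c, j⟩
    · rw [Equiv.symm_trans_apply, Equiv.symm_swap, hσ.2.1 u hu]
      refine Equiv.swap_apply_of_ne_of_ne (fun h => ?_) (fun h => ?_)
      · rw [← hσ.2.1 u hu] at h
        exact htR (σ.symm.injective h ▸ hu)
      · apply hs
        rw [← h, Equiv.apply_symm_apply]
        exact hu
    · rw [signAt_swap h1, hσ.2.2 u hu]

lemma self_mem_tannerClass {x : Fin E.n → ℤˣ} {g : E.Tanner} (hg : IsCodeword g x)
    (R : Finset E.CSock) (Q : Finset (Fin E.m)) : g ∈ tannerClass x g R Q :=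
  mem_tannerClass.2 ⟨hg, fun _ _ => rfl, fun _ _ => rfl⟩

/-- Any member of a class may serve as its reference. -/
lemma tannerClass_subset {x : Fin E.n → ℤˣ} {g g' : E.Tanner} {R R' : Finset E.CSock}
    {Q Q' : Finset (Fin E.m)} (hg : g' ∈ tannerClass x g R Q) (hR : R ⊆ R') (hQ : Q ⊆ Q') :
    tannerClass x g' R' Q' ⊆ tannerClass x g R Q := by
  intro σ hσ
  rw [mem_tannerClass] at hg hσ ⊢
  exact ⟨hσ.1, fun t ht => (hσ.2.1 t (hR ht)).trans (hg.2.1 t ht),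
    fun t ht => (hσ.2.2 t (hQ ht)).trans (hg.2.2 t ht)⟩

/-- A configuration: a Tanner graph for each user and a matching of the variable nodes. -/
abbrev Conf (E : Degrees) : Type := (Bool → E.Tanner) × Equiv.Perm (Fin E.n)

/-- What has been seen of a random configuration and of the noise. The values are those of a
reference configuration: the partners of the check sockets in `R`, the symbols seen by the checks
in `Q`, the matching and the noise at the function nodes in `A`. -/
structure State (E : Degrees) where
  /-- reference Tanner graphs -/
  g : Bool → E.Tanner
  /-- reference matching -/
  τ : Equiv.Perm (Fin E.n)
  /-- reference noise -/
  z : Fin E.n → ℝ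
  /-- check sockets whose partner is known -/
  R : Bool → Finset E.CSock
  /-- checks whose symbols are known -/
  Q : Bool → Finset (Fin E.m)
  /-- function nodes which are known -/
  A : Finset (Fin E.n)

/-- The function node of the variable node `v` of user `b`. -/
def fnNode (b : Bool) (τ : Equiv.Perm (Fin E.n)) (v : Fin E.n) : Fin E.n :=
  if b then v else τ.symm v

/-- The variable node of the other user at the function node of the variable node `v` of `b`. -/
def mate (b : Bool) (τ : Equiv.Perm (Fin E.n)) (v : Fin E.n) : Fin E.n :=
  if b then τ v else τ.symm v

lemma fnNode_mate (b : Bool) (τ : Equiv.Perm (Fin E.n)) (v : Fin E.n) :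
    fnNode (!b) τ (mate b τ v) = fnNode b τ v := by
  cases b <;> simp [fnNode, mate]

namespace State

variable (S : State E) (x : Bool → Fin E.n → ℤˣ)

open Classical in
/-- The matchings which agree with the state. -/
def perms : Finset (Equiv.Perm (Fin E.n)) := Finset.univ.filter fun τ => ∀ i ∈ S.A, τ i = S.τ i

lemma mem_perms {S : State E} {τ : Equiv.Perm (Fin E.n)} :
    τ ∈ S.perms ↔ ∀ i ∈ S.A, τ i = S.τ i := by simp [perms]

/-- The configurations which agree with the state. -/
def confs : Finset E.Conf :=
  (Fintype.piFinset fun b => tannerClass (x b) (S.g b) (S.R b) (S.Q b)) ×ˢ S.perms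

variable {S x} in
lemma mem_confs {ω : E.Conf} : ω ∈ S.confs x ↔
    (∀ b, ω.1 b ∈ tannerClass (x b) (S.g b) (S.R b) (S.Q b)) ∧ ω.2 ∈ S.perms := by
  rw [confs, Finset.mem_product, Fintype.mem_piFinset]

/-- The noise, with the values which are known. -/
def fill (ζ : Fin E.n → ℝ) : Fin E.n → ℝ := fun i => if i ∈ S.A then S.z i else ζ i

@[fun_prop]
lemma measurable_fill : Measurable S.fill := by
  refine measurable_pi_lambda _ fun i => ?_
  by_cases h : i ∈ S.A
  · simp only [fill, if_pos h]; fun_prop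
  · simp only [fill, if_neg h]; fun_prop

/-- The conditional expectation, given the state. -/
def mean (G : E.Conf → (Fin E.n → ℝ) → ℝ≥0∞) : ℝ≥0∞ :=
  avg (S.confs x) fun ω => ∫⁻ ζ, G ω (S.fill ζ) ∂(noise E.n)

variable {S x}

lemma mean_congr {G G' : E.Conf → (Fin E.n → ℝ) → ℝ≥0∞}
    (h : ∀ ω ∈ S.confs x, ∀ z : Fin E.n → ℝ, (∀ i ∈ S.A, z i = S.z i) → G ω z = G' ω z) :
    S.mean x G = S.mean x G' :=
  avg_congr fun ω hω => lintegral_congr fun ζ => h ω hω _ fun i hi => by simp [fill, hi]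

variable (S) in
/-- The state after more has been learned about the graph of user `b`. -/
def setUser (b : Bool) (g : E.Tanner) (R : Finset E.CSock) (Q : Finset (Fin E.m)) : State E where
  g := Function.update S.g b g
  τ := S.τ
  z := S.z
  R := Function.update S.R b R
  Q := Function.update S.Q b Q
  A := S.A

lemma mem_confs_setUser {b : Bool} {g : E.Tanner} {R : Finset E.CSock} {Q : Finset (Fin E.m)}
    {ω : E.Conf} : ω ∈ (S.setUser b g R Q).confs x ↔
      ω.1 b ∈ tannerClass (x b) g R Q ∧
      ω.1 (!b) ∈ tannerClass (x !b) (S.g !b) (S.R !b) (S.Q !b) ∧ ω.2 ∈ S.perms := by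
  rw [mem_confs]
  have : (S.setUser b g R Q).perms = S.perms := rfl
  rw [this]
  cases b <;> simp [setUser, and_comm, and_left_comm]

lemma card_confs_setUser (b : Bool) (g : E.Tanner) (R : Finset E.CSock) (Q : Finset (Fin E.m)) :
    ((S.setUser b g R Q).confs x).card = (tannerClass (x b) g R Q).card *
      ((tannerClass (x !b) (S.g !b) (S.R !b) (S.Q !b)).card * S.perms.card) := by
  have : (S.setUser b g R Q).perms = S.perms := rfl
  rw [confs, Finset.card_product, Fintype.card_piFinset, Fintype.prod_bool, this]
  cases b <;> simp [setUser] <;> ring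

lemma setUser_self (b : Bool) : S.setUser b (S.g b) (S.R b) (S.Q b) = S := by
  cases S; simp [setUser]

/-- Learning more about the graph of one user. -/
lemma sum_mean_setUser_le {κ : Type*} (b : Bool) (O : Finset κ) (g : κ → E.Tanner)
    (R : κ → Finset E.CSock) (Q : κ → Finset (Fin E.m)) (p : κ → ℝ≥0∞)
    (hg : ∀ o ∈ O, g o ∈ tannerClass (x b) (S.g b) (S.R b) (S.Q b))
    (hR : ∀ o ∈ O, S.R b ⊆ R o) (hQ : ∀ o ∈ O, S.Q b ⊆ Q o)
    (hdisj : Set.PairwiseDisjoint (O : Set κ) fun o => tannerClass (x b) (g o) (R o) (Q o))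
    (hp : ∀ o ∈ O, p o * (tannerClass (x b) (S.g b) (S.R b) (S.Q b)).card ≤
      (tannerClass (x b) (g o) (R o) (Q o)).card) (G : E.Conf → (Fin E.n → ℝ) → ℝ≥0∞) :
    ∑ o ∈ O, p o * (S.setUser b (g o) (R o) (Q o)).mean x G ≤ S.mean x G := by
  have h : ∀ o, (S.setUser b (g o) (R o) (Q o)).mean x G =
      avg ((S.setUser b (g o) (R o) (Q o)).confs x)
        fun ω => ∫⁻ ζ, G ω (S.fill ζ) ∂(noise E.n) := fun o => rfl
  simp only [h]
  refine sum_avg_le (S.confs x) O (fun o => (S.setUser b (g o) (R o) (Q o)).confs x) p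
    (fun o ho => ?_) ?_ (fun o ho => ?_) _
  · intro ω hω
    rw [mem_confs_setUser] at hω
    have := mem_confs_setUser (S := S) (x := x) (b := b) (g := S.g b) (R := S.R b) (Q := S.Q b)
      (ω := ω)
    rw [setUser_self] at this
    exact this.2 ⟨tannerClass_subset (hg o ho) (hR o ho) (hQ o ho) hω.1, hω.2⟩
  · intro o ho o' ho' hne
    rw [Function.onFun, Finset.disjoint_left]
    intro ω hω hω'
    rw [mem_confs_setUser] at hω hω'
    exact Finset.disjoint_left.1 (hdisj ho ho' hne) hω.1 hω'.1
  · have := card_confs_setUser (S := S) (x := x) b (S.g b) (S.R b) (S.Q b)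
    rw [setUser_self] at this
    rw [this, card_confs_setUser]
    push_cast
    rw [← mul_assoc]
    gcongr
    exact hp o ho

variable (S) in
/-- The state after the function node `i`, its partner `w` and the noise `a` there are seen. -/
def setNode (i w : Fin E.n) (a : ℝ) : State E where
  g := S.g
  τ := (Equiv.swap (S.τ.symm w) i).trans S.τ
  z := Function.update S.z i a
  R := S.R
  Q := S.Q
  A := insert i S.A

lemma mem_perms_setNode {i w : Fin E.n} (hi : i ∉ S.A) (hw : S.τ.symm w ∉ S.A) {a : ℝ}
    {τ : Equiv.Perm (Fin E.n)} : τ ∈ (S.setNode i w a).perms ↔ τ ∈ S.perms ∧ τ i = w := by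
  have h : ∀ j ∈ S.A, (S.setNode i w a).τ j = S.τ j := by
    intro j hj
    change S.τ (Equiv.swap _ _ j) = _
    rw [Equiv.swap_apply_of_ne_of_ne]
    · rintro rfl; exact hw hj
    · rintro rfl; exact hi hj
  have h' : (S.setNode i w a).τ i = w := by
    change S.τ (Equiv.swap _ _ i) = _
    simp
  rw [mem_perms, mem_perms]
  change (∀ j ∈ insert i S.A, _) ↔ _
  simp only [Finset.mem_insert, forall_eq_or_imp, h']
  rw [and_comm]
  exact and_congr_left fun _ => forall₂_congr fun j hj => by rw [h j hj]

lemma card_perms_le {i w : Fin E.n} (hi : i ∉ S.A) (hw : S.τ.symm w ∉ S.A) (a : ℝ) :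
    S.perms.card ≤ E.n * (S.setNode i w a).perms.card := by
  classical
  refine (card_le_of_swap S.perms w i Finset.univ (fun _ _ => Finset.mem_univ _)
    fun τ hτ => ?_).trans_eq ?_
  · rw [mem_perms] at hτ ⊢
    intro j hj
    rw [Equiv.trans_apply, Equiv.swap_apply_of_ne_of_ne, hτ j hj]
    · rintro rfl
      have := hτ _ hj
      rw [Equiv.apply_symm_apply] at this
      rw [this, Equiv.symm_apply_apply] at hw
      exact hw hj
    · rintro rfl; exact hi hj
  · rw [Finset.card_univ, Fintype.card_fin]
    congr 2
    ext τ
    rw [Finset.mem_filter, mem_perms_setNode hi hw, Equiv.symm_apply_eq, eq_comm (a := w)]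

lemma fill_setNode {i w : Fin E.n} (hi : i ∉ S.A) (a : ℝ) (ζ : Fin E.n → ℝ) :
    (S.setNode i w a).fill ζ = S.fill (Function.update ζ i a) := by
  funext j
  rcases eq_or_ne j i with rfl | h
  · simp [fill, setNode, hi]
  · simp [fill, setNode, h]

/-- Looking at one of several function nodes, no two of which can be seen together. -/
lemma sum_mean_setNode_le {κ : Type*} (O : Finset κ) (i w : κ → Fin E.n)
    (hi : ∀ o ∈ O, i o ∉ S.A) (hw : ∀ o ∈ O, S.τ.symm (w o) ∉ S.A)
    (hne : ∀ o ∈ O, ∀ o' ∈ O, ∀ τ : Equiv.Perm (Fin E.n),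
      τ (i o) = w o → τ (i o') = w o' → o = o')
    {G : E.Conf → (Fin E.n → ℝ) → ℝ≥0∞} (hG : ∀ ω, Measurable (G ω)) :
    ∑ o ∈ O, (E.n : ℝ≥0∞)⁻¹ * ∫⁻ a, (S.setNode (i o) (w o) a).mean x G ∂(gaussianReal 0 1) ≤
      S.mean x G := by
  have hconf : ∀ o a, (S.setNode (i o) (w o) a).confs x = (S.setNode (i o) (w o) 0).confs x :=
    fun o a => rfl
  -- Averaging over the revealed noise value restores the full noise, since resampling one
  -- coordinate does not change the product law.
  have key : ∀ o ∈ O, ∫⁻ a, (S.setNode (i o) (w o) a).mean x G ∂(gaussianReal 0 1) =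
      avg ((S.setNode (i o) (w o) 0).confs x) fun ω => ∫⁻ ζ, G ω (S.fill ζ) ∂(noise E.n) := by
    intro o ho
    have hm : ∀ ω, Measurable fun p : ℝ × (Fin E.n → ℝ) =>
        G ω (S.fill (Function.update p.2 (i o) p.1)) := by
      intro ω
      refine (hG ω).comp (S.measurable_fill.comp (measurable_pi_lambda _ fun j => ?_))
      rcases eq_or_ne j (i o) with rfl | h
      · simpa using measurable_fst
      · simp only [Function.update_of_ne h]; fun_prop
    have hprob : IsProbabilityMeasure (noise E.n) := by unfold noise; infer_instance
    simp only [mean, avg, hconf, fill_setNode (hi o ho)]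
    rw [lintegral_const_mul, lintegral_finsetSum]
    · congr 1
      refine Finset.sum_congr rfl fun ω _ => ?_
      exact (lintegral_noise_update (i o) ((hG ω).comp S.measurable_fill)).symm
    · exact fun ω _ => (hm ω).lintegral_prod_right'
    · exact Finset.measurable_sum _ fun ω _ => (hm ω).lintegral_prod_right'
  rw [Finset.sum_congr rfl fun o ho => by rw [key o ho]]
  refine sum_avg_le _ O (fun o => (S.setNode (i o) (w o) 0).confs x) _ (fun o ho => ?_) ?_
    (fun o ho => ?_) _
  · intro ω hω
    rw [mem_confs, mem_perms_setNode (hi o ho) (hw o ho)] at hω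
    exact mem_confs.2 ⟨hω.1, hω.2.1⟩
  · intro o ho o' ho' h
    rw [Function.onFun, Finset.disjoint_left]
    intro ω hω hω'
    rw [mem_confs, mem_perms_setNode (hi o ho) (hw o ho)] at hω
    rw [mem_confs, mem_perms_setNode (hi o' ho') (hw o' ho')] at hω'
    exact h (hne o ho o' ho' ω.2 hω.2.2 hω'.2.2)
  · have hn : (E.n : ℝ≥0∞) ≠ 0 := by
      have := (i o).pos
      simpa using this.ne'
    rw [mul_comm, ← div_eq_mul_inv, ENNReal.div_le_iff hn (ENNReal.natCast_ne_top _)]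
    rw [confs, confs, Finset.card_product, Finset.card_product]
    have := card_perms_le (hi o ho) (hw o ho) 0
    calc _ ≤ (((Fintype.piFinset fun b => tannerClass (x b) (S.g b) (S.R b) (S.Q b)).card *
          (E.n * (S.setNode (i o) (w o) 0).perms.card) : ℕ) : ℝ≥0∞) := by
          exact_mod_cast Nat.mul_le_mul_left _ this
      _ = _ := by push_cast; simp only [setNode]; ring

end State

end Degrees

/-! ### Simulation of messages by independent random variables -/

namespace Degrees

variable {E : Degrees}

namespace State

/-- A socket waiting to be explored: a variable socket or a check socket of one of the users. -/
abbrev Item (E : Degrees) : Type := Bool × (E.VSock ⊕ E.CSock)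

/-- The function node of the variable node `v` of user `b` has been seen. -/
def Used (S : State E) (b : Bool) (v : Fin E.n) : Prop := fnNode b S.τ v ∈ S.A

/-- The socket belongs to a node which has been seen, but its partner has not been seen. -/
def Open (S : State E) : Item E → Prop
  | (b, Sum.inl s) => S.Used b s.1 ∧ S.g b s ∉ S.R b
  | (b, Sum.inr t) => t.1 ∈ S.Q b ∧ t ∉ S.R b

/-- A state which arises by exploring at most `M` nodes. -/
structure Valid (x : Bool → Fin E.n → ℤˣ) (M : ℕ) (S : State E) : Prop where
  codeword : ∀ b, IsCodeword (S.g b) (x b)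
  check : ∀ b, ∀ t ∈ S.R b, t.1 ∈ S.Q b
  used : ∀ b, ∀ t ∈ S.R b, S.Used b ((S.g b).symm t).1
  card_node : S.A.card ≤ M
  card_check : ∀ b, (S.Q b).card ≤ M

lemma Valid.mono {x : Bool → Fin E.n → ℤˣ} {M M' : ℕ} {S : State E} (h : S.Valid x M)
    (hM : M ≤ M') : S.Valid x M' :=
  ⟨h.codeword, h.check, h.used, h.card_node.trans hM, fun b => (h.card_check b).trans hM⟩

/-- The state `S'` extends `S` by an exploration from the sockets in `X`. -/
structure Ext (x : Bool → Fin E.n → ℤˣ) (S S' : State E) (X : Set (Item E)) : Prop where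
  item : ∀ it ∉ X, S.Open it → S'.Open it
  check : ∀ b, S.Q b ⊆ S'.Q b
  sign : ∀ b, ∀ t : E.CSock, t.1 ∈ S.Q b → signAt (x b) (S'.g b) t = signAt (x b) (S.g b) t

variable {x : Bool → Fin E.n → ℤˣ} {S S' S'' : State E} {X X' : Set (Item E)}

lemma Ext.refl (S : State E) (X : Set (Item E)) : Ext x S S X :=
  ⟨fun _ _ h => h, fun _ => subset_rfl, fun _ _ _ => rfl⟩

lemma Ext.mono (h : Ext x S S' X) (hX : ∀ it ∈ X, S.Open it → it ∈ X') : Ext x S S' X' :=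
  ⟨fun it hit ho => h.item it (fun h' => hit (hX it h' ho)) ho, h.check, h.sign⟩

lemma Ext.trans (h : Ext x S S' X) (h' : Ext x S' S'' X') : Ext x S S'' (X ∪ X') :=
  ⟨fun it hit ho => h'.item it (fun h2 => hit (Or.inr h2))
    (h.item it (fun h2 => hit (Or.inl h2)) ho),
    fun b => (h.check b).trans (h'.check b),
    fun b t ht => (h'.sign b t (h.check b ht)).trans (h.sign b t ht)⟩

/-- Given the state, the random variable `f` dominates a sample from `ν`: after an exploration from
the sockets in `X` which leads to a state of size at most `M`, the value of `f` is known, and the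
law of this value is at least `ν`. The exploration is described through its effect on the
conditional expectation of an arbitrary function of the value and of the configuration. -/
def Sim (x : Bool → Fin E.n → ℤˣ) (S : State E) (M : ℕ) (X : Set (Item E)) {T : Type}
    [MeasurableSpace T] (f : E.Conf → (Fin E.n → ℝ) → T) (ν : Measure T) : Prop :=
  ∀ (H : T → E.Conf → (Fin E.n → ℝ) → ℝ≥0∞) (c : T → ℝ≥0∞),
    (∀ ω, Measurable fun p : T × (Fin E.n → ℝ) => H p.1 ω p.2) → Measurable c →
    (∀ S', Valid x M S' → Ext x S S' X → ∀ m, c m ≤ S'.mean x (H m)) →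
    ∫⁻ m, c m ∂ν ≤ S.mean x fun ω z => H (f ω z) ω z

variable {M M' : ℕ} {T T' T'' : Type} [MeasurableSpace T] [MeasurableSpace T']
  [MeasurableSpace T''] {f : E.Conf → (Fin E.n → ℝ) → T} {ν : Measure T}

lemma Sim.mono (h : Sim x S M X f ν) {ν' : Measure T} (hν : ν' ≤ ν) (hM : M ≤ M')
    (hX : ∀ it ∈ X, S.Open it → it ∈ X') : Sim x S M' X' f ν' := by
  intro H c hH hc hb
  exact (lintegral_mono' hν le_rfl).trans
    (h H c hH hc fun S' hS' he => hb S' (hS'.mono hM) (he.mono hX))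

lemma Sim.congr (h : Sim x S M X f ν) {f' : E.Conf → (Fin E.n → ℝ) → T}
    (hf : ∀ ω ∈ S.confs x, ∀ z : Fin E.n → ℝ, (∀ i ∈ S.A, z i = S.z i) → f' ω z = f ω z) :
    Sim x S M X f' ν := by
  intro H c hH hc hb
  refine (h H c hH hc hb).trans_eq (mean_congr fun ω hω z hz => ?_)
  rw [hf ω hω z hz]

lemma Valid.nonempty_confs (h : S.Valid x M) : (S.confs x).Nonempty :=
  ⟨(S.g, S.τ), mem_confs.2 ⟨fun b => self_mem_tannerClass (h.codeword b) _ _,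
    mem_perms.2 fun _ _ => rfl⟩⟩

lemma sim_const (h : S.Valid x M) (m : T) : Sim x S M X (fun _ _ => m) (Measure.dirac m) := by
  intro H c hH hc hb
  rw [lintegral_dirac' m hc]
  exact hb S h (Ext.refl S X) m

lemma Sim.map (h : Sim x S M X f ν) {φ : T → T'} (hφ : Measurable φ) :
    Sim x S M X (fun ω z => φ (f ω z)) (ν.map φ) := by
  intro H c hH hc hb
  rw [lintegral_map hc hφ]
  exact h (fun m => H (φ m)) (fun m => c (φ m))
    (fun ω => (hH ω).comp (by fun_prop : Measurable fun p : T × (Fin E.n → ℝ) => (φ p.1, p.2)))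
    (hc.comp hφ) fun S' hS' he m => hb S' hS' he (φ m)

/-- Two explorations in a row. -/
lemma Sim.bind {g : E.Conf → (Fin E.n → ℝ) → T'} {ν' : Measure T'} [SFinite ν'] {φ : T → T' → T''}
    (hφ : Measurable fun p : T × T' => φ p.1 p.2) (hf : Sim x S M X f ν)
    (hg : ∀ S', Valid x M S' → Ext x S S' X → Sim x S' M' X' g ν')
    (hgm : ∀ ω, Measurable (g ω)) :
    Sim x S M' (X ∪ X') (fun ω z => φ (f ω z) (g ω z))
      ((ν.prod ν').map fun p => φ p.1 p.2) := by
  intro H c hH hc hb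
  rw [lintegral_map hc hφ]
  refine (lintegral_prod _ (hc.comp hφ).aemeasurable).trans_le ?_
  refine hf (fun m ω z => H (φ m (g ω z)) ω z) (fun m => ∫⁻ m', c (φ m m') ∂ν') (fun ω => ?_) ?_ ?_
  · have h1 : Measurable fun p : T × (Fin E.n → ℝ) => (φ p.1 (g ω p.2), p.2) :=
      (hφ.comp (measurable_fst.prodMk ((hgm ω).comp measurable_snd))).prodMk measurable_snd
    exact (hH ω).comp h1
  · exact (hc.comp hφ).lintegral_prod_right'
  · intro S' hS' he m
    have hφm : Measurable (φ m) := hφ.comp measurable_prodMk_left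
    exact hg S' hS' he (fun m' => H (φ m m')) (fun m' => c (φ m m'))
      (fun ω => (hH ω).comp ((hφm.comp measurable_fst).prodMk measurable_snd))
      (hc.comp hφm) fun S'' hS'' he' m' => hb S'' hS'' (he.trans he') (φ m m')

/-- Explorations from a finite family of sockets, whose values are accumulated by `φ`. -/
lemma sim_finset {ι : Type} [DecidableEq ι] {φ : T → T' → T}
    (hφ : Measurable fun p : T × T' => φ p.1 p.2) (C : ℕ) (κ : ℝ≥0∞)
    (it : ι → Item E) (g : ι → E.Conf → (Fin E.n → ℝ) → T')
    (hgm : ∀ k ω, Measurable (g k ω)) (ν : ι → Measure T') [∀ k, IsFiniteMeasure (ν k)]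
    (hκ : κ ≠ ∞)
    (F : Finset ι → E.Conf → (Fin E.n → ℝ) → T) (μ : Finset ι → Measure T)
    [∀ K, IsFiniteMeasure (μ K)] (m₀ : T)
    (hF0 : F ∅ = fun _ _ => m₀) (hμ0 : μ ∅ = Measure.dirac m₀)
    (hF : ∀ k K, k ∉ K → F (insert k K) = fun ω z => φ (F K ω z) (g k ω z))
    (hμ : ∀ k K, k ∉ K → μ (insert k K) = ((μ K).prod (ν k)).map fun p => φ p.1 p.2)
    (K : Finset ι) {S : State E} {M : ℕ} (hS : S.Valid x M)
    (hg : ∀ k ∈ K, ∀ (S' : State E) (j : ℕ), S'.Valid x (M + j * C) → j < K.card →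
      Ext x S S' {y | ∃ k' ∈ K, k' ≠ k ∧ y = it k'} →
      Sim x S' (M + j * C + C) {it k} (g k) (κ • ν k)) :
    Sim x S (M + K.card * C) {y | ∃ k ∈ K, y = it k} (F K) (κ ^ K.card • μ K) := by
  induction K using Finset.induction_on with
  | empty =>
    rw [hF0, hμ0]
    simpa using sim_const (X := {y | ∃ k ∈ (∅ : Finset ι), y = it k}) hS m₀
  | insert k K hk ih =>
    have h1 := ih fun k' hk' S' j hS' hj he => hg k' (Finset.mem_insert_of_mem hk') S' j hS'
      (hj.trans (Finset.card_lt_card (Finset.ssubset_insert hk)))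
      (he.mono fun y hy _ => by
        obtain ⟨k'', h1, h2⟩ := hy
        exact ⟨k'', Finset.mem_insert_of_mem h1, h2⟩)
    have hfin : IsFiniteMeasure (κ • ν k) := by
      refine ⟨?_⟩
      rw [Measure.smul_apply, smul_eq_mul]
      exact ENNReal.mul_lt_top (lt_top_iff_ne_top.2 hκ) (measure_lt_top _ _)
    have h2 := h1.bind (M' := M + K.card * C + C) hφ (fun S' hS' he =>
      hg k (Finset.mem_insert_self k K) S' K.card hS'
        (Finset.card_lt_card (Finset.ssubset_insert hk)) (he.mono fun y hy _ => by
          obtain ⟨k', h1, h2⟩ := hy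
          exact ⟨k', Finset.mem_insert_of_mem h1, fun h => hk (h ▸ h1), h2⟩)) (hgm k)
    rw [hF k K hk, hμ k K hk, Finset.card_insert_of_notMem hk]
    refine h2.mono ?_ (by rw [Nat.succ_mul, add_assoc]) fun y hy _ => ?_
    · rw [Measure.prod_smul_left, Measure.prod_smul_right, smul_smul, Measure.map_smul, pow_succ]
    · rcases hy with ⟨k', h1, h2⟩ | rfl
      · exact ⟨k', Finset.mem_insert_of_mem h1, h2⟩
      · exact ⟨k, Finset.mem_insert_self k K, rfl⟩

end State

end Degrees

/-! ### The messages of the joint decoder -/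

namespace Degrees

variable {E : Degrees}

/-- The variable-to-check messages after `l` iterations, with the users as values of an index. -/
def userMsg (A α : ℝ) (x : Bool → Fin E.n → ℤˣ) :
    ℕ → Bool → E.Conf → (Fin E.n → ℝ) → E.VSock → EReal
  | 0 => fun _ _ _ _ => 0
  | l + 1 => fun b ω z e => varMsg (ω.1 b) (userMsg A α x l b ω z)
      (funMsg A α b (toFunMsg (ω.1 !b) (userMsg A α x l (!b) ω z) (mate b ω.2 e.1))
        (received A α (x true) (x false) ω.2 z (fnNode b ω.2 e.1))) e

lemma bpMsg_eq (A α : ℝ) (x : Bool → Fin E.n → ℤˣ) (ω : E.Conf) (z : Fin E.n → ℝ) (l : ℕ) :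
    bpMsg A α (ω.1 true) (ω.1 false) ω.2 (received A α (x true) (x false) ω.2 z) l =
      (userMsg A α x l true ω z, userMsg A α x l false ω z) := by
  induction l with
  | zero => rfl
  | succ l ih =>
    rw [bpMsg, ih]
    rfl

lemma received_fnNode (A α : ℝ) (x : Bool → Fin E.n → ℤˣ) (τ : Equiv.Perm (Fin E.n))
    (z : Fin E.n → ℝ) (b : Bool) (v : Fin E.n) :
    received A α (x true) (x false) τ z (fnNode b τ v) =
      chMean A α (inp b (x b v) (x (!b) (mate b τ v))) + z (fnNode b τ v) := by
  cases b <;> simp [received, inputAt, inp, fnNode, mate]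

lemma measurable_checkMsg {Ω : Type*} [MeasurableSpace Ω] (σ : E.Tanner)
    {μ : Ω → E.VSock → EReal} (hμ : ∀ e, Measurable fun ω => μ ω e) (e : E.VSock) :
    Measurable fun ω => checkMsg σ (μ ω) e := by
  have h : Measurable fun ω => ∏ e' ∈ Finset.univ.filter
      (fun e' => (σ e').1 = (σ e).1 ∧ e' ≠ e), tanhHalf (μ ω e') :=
    Finset.measurable_prod _ fun e' _ => by have := hμ e'; fun_prop
  unfold checkMsg
  fun_prop

lemma measurable_toFunMsg {Ω : Type*} [MeasurableSpace Ω] (σ : E.Tanner)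
    {μ : Ω → E.VSock → EReal} (hμ : ∀ e, Measurable fun ω => μ ω e) (v : Fin E.n) :
    Measurable fun ω => toFunMsg σ (μ ω) v :=
  Finset.measurable_sum _ fun _ _ => measurable_checkMsg σ hμ _

lemma measurable_userMsg (A α : ℝ) (x : Bool → Fin E.n → ℤˣ) (l : ℕ) (b : Bool) (ω : E.Conf)
    (e : E.VSock) : Measurable fun z => userMsg A α x l b ω z e := by
  induction l generalizing b e with
  | zero => exact measurable_const
  | succ l ih =>
    have h1 := measurable_toFunMsg (ω.1 !b) (fun e => ih (!b) e) (mate b ω.2 e.1)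
    have h2 : Measurable fun z =>
        received A α (x true) (x false) ω.2 z (fnNode b ω.2 e.1) := by
      unfold received; fun_prop
    have h3 : Measurable fun z => ∑ j ∈ Finset.univ.filter (fun j => j ≠ e.2),
        checkMsg (ω.1 b) (userMsg A α x l b ω z) ⟨e.1, j⟩ :=
      Finset.measurable_sum _ fun _ _ => measurable_checkMsg _ (fun e => ih b e) _
    exact ((measurable_funMsg A α b).comp (h1.prodMk h2)).add h3

lemma checkMsg_eq {σ : E.Tanner} (μ : E.VSock → EReal) {e : E.VSock} {c : Fin E.m}
    {j : Fin (E.cdeg c)} (h : σ.symm ⟨c, j⟩ = e) :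
    checkMsg σ μ e =
      twoArtanh (∏ k ∈ Finset.univ.erase j, tanhHalf (μ (σ.symm ⟨c, k⟩))) := by
  have he : σ e = ⟨c, j⟩ := by rw [← h, Equiv.apply_symm_apply]
  rw [checkMsg]
  congr 1
  symm
  refine Finset.prod_bij (fun k _ => σ.symm ⟨c, k⟩) ?_ ?_ ?_ fun _ _ => rfl
  · intro k hk
    rw [Finset.mem_filter]
    refine ⟨Finset.mem_univ _, by rw [Equiv.apply_symm_apply, he], fun h' => ?_⟩
    rw [← h] at h'
    have := σ.symm.injective h'
    exact Finset.ne_of_mem_erase hk (by simpa using this)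
  · intro k _ k' _ hkk
    simpa using σ.symm.injective hkk
  · intro e' he'
    obtain ⟨_, h1, h2⟩ := Finset.mem_filter.1 he'
    rw [he] at h1
    generalize ht : σ e' = t at h1
    obtain ⟨c', k⟩ := t
    dsimp only at h1
    subst h1
    have hk : σ.symm ⟨c', k⟩ = e' := by rw [← ht, Equiv.symm_apply_apply]
    refine ⟨k, Finset.mem_erase.2 ⟨?_, Finset.mem_univ _⟩, hk⟩
    rintro rfl
    exact h2 (hk.symm.trans h)

/-! ### Exploring a check -/

/-- Learning one more partner leads again to a class of the same kind, with any compatible graph as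
reference; the exploration can therefore be iterated. -/
lemma filter_tannerClass {x : Fin E.n → ℤˣ} {g g' : E.Tanner} {R : Finset E.CSock}
    {Q : Finset (Fin E.m)} [DecidableEq E.CSock] (hg : g' ∈ tannerClass x g R Q) (t : E.CSock) :
    ((tannerClass x g R Q).filter fun σ => σ.symm t = g'.symm t) =
      tannerClass x g' (insert t R) Q := by
  ext σ
  rw [mem_tannerClass] at hg
  rw [Finset.mem_filter, mem_tannerClass, mem_tannerClass]
  constructor
  · rintro ⟨⟨h1, h2, h3⟩, h4⟩
    refine ⟨h1, fun u hu => ?_, fun u hu => (h3 u hu).trans (hg.2.2 u hu).symm⟩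
    rcases Finset.mem_insert.1 hu with rfl | hu
    · exact h4
    · exact (h2 u hu).trans (hg.2.1 u hu).symm
  · rintro ⟨h1, h2, h3⟩
    exact ⟨⟨h1, fun u hu => (h2 u (Finset.mem_insert_of_mem hu)).trans (hg.2.1 u hu),
      fun u hu => (h3 u hu).trans (hg.2.2 u hu)⟩, h2 t (Finset.mem_insert_self t R)⟩

/-- The analogue for the symbols at one more check. -/
lemma patternClass_eq {x : Fin E.n → ℤˣ} {g g' : E.Tanner} {R : Finset E.CSock}
    {Q : Finset (Fin E.m)} {c : Fin E.m} {p : Fin (E.cdeg c) → ℤˣ}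
    (hg : g' ∈ patternClass x g R Q c p) :
    patternClass x g R Q c p = tannerClass x g' R (insert c Q) := by
  classical
  rw [patternClass, Finset.mem_filter, mem_tannerClass] at hg
  ext σ
  rw [patternClass, Finset.mem_filter, mem_tannerClass, mem_tannerClass]
  constructor
  · rintro ⟨⟨h1, h2, h3⟩, h4⟩
    refine ⟨h1, fun u hu => (h2 u hu).trans (hg.1.2.1 u hu).symm, fun u hu => ?_⟩
    obtain ⟨c', j⟩ := u
    rcases Finset.mem_insert.1 hu with h | hu
    · dsimp only at h
      subst h
      exact (congr_fun h4 j).trans (congr_fun hg.2 j).symm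
    · exact (h3 _ hu).trans (hg.1.2.2 _ hu).symm
  · rintro ⟨h1, h2, h3⟩
    refine ⟨⟨h1, fun u hu => (h2 u hu).trans (hg.1.2.1 u hu),
      fun u hu => (h3 u (Finset.mem_insert_of_mem hu)).trans (hg.1.2.2 u hu)⟩, ?_⟩
    rw [← hg.2]
    funext j
    exact h3 ⟨c, j⟩ (Finset.mem_insert_self c Q)

/-- A graph of the class which sends the variable socket `s` to a given socket of a new check, with
given symbols at this check, and the number of such graphs. -/
lemma exists_mem_tannerClass_check {x : Fin E.n → ℤˣ} {g : E.Tanner} {R : Finset E.CSock}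
    {Q : Finset (Fin E.m)} [DecidableEq E.CSock] (hg : IsCodeword g x) (hRQ : ∀ t ∈ R, t.1 ∈ Q)
    {c : Fin E.m} (hc : c ∉ Q) {p : Fin (E.cdeg c) → ℤˣ} {θ : ℝ≥0∞} (hθ : θ ≠ 0)
    (hp : θ * (tannerClass x g R Q).card ≤
        2 ^ (E.cdeg c - 1) * ((patternClass x g R Q c p).card : ℝ≥0∞))
    {s : E.VSock} (hs : g s ∉ R) (j : Fin (E.cdeg c)) (hxs : p j = x s.1) :
    ∃ g' ∈ tannerClass x g R Q, (∀ k, signAt x g' ⟨c, k⟩ = p k) ∧ g'.symm ⟨c, j⟩ = s ∧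
      θ * (tannerClass x g R Q).card ≤ 2 ^ (E.cdeg c - 1) * (signCard x (x s.1) : ℝ≥0∞) *
        (tannerClass x g' (insert ⟨c, j⟩ R) (insert c Q)).card := by
  classical
  have hpos : ((tannerClass x g R Q).card : ℝ≥0∞) ≠ 0 := by
    simpa using (Finset.nonempty_of_ne_empty (Finset.ne_empty_of_mem
      (self_mem_tannerClass hg R Q))).ne_empty
  have hne : (patternClass x g R Q c p).Nonempty := by
    rw [Finset.nonempty_iff_ne_empty]
    intro h
    rw [h, Finset.card_empty, Nat.cast_zero, mul_zero, nonpos_iff_eq_zero, mul_eq_zero] at hp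
    exact hp.elim hθ hpos
  obtain ⟨g₁, hg₁⟩ := hne
  have heq := patternClass_eq hg₁
  have hg₁' := hg₁
  rw [patternClass, Finset.mem_filter] at hg₁'
  have htR : (⟨c, j⟩ : E.CSock) ∉ R := fun h => hc (hRQ _ h)
  have hsign : signAt x g₁ ⟨c, j⟩ = x s.1 := by rw [← hxs, ← hg₁'.2]
  have hR : ∀ t ∈ R, g₁.symm t = g.symm t := (mem_tannerClass.1 hg₁'.1).2.1
  have hs₁ : g₁ s ∉ R := by
    intro h
    have h1 := hR _ h
    rw [Equiv.symm_apply_apply] at h1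
    apply hs
    rw [h1, Equiv.apply_symm_apply]
    exact h
  have hB := card_tannerClass_le (x := x) (g := g₁) (R := R) (Q := insert c Q) htR
    (Finset.mem_insert_self c Q) hs₁ hsign.symm
  rw [hsign, ← heq] at hB
  have hne2 : ((patternClass x g R Q c p).filter fun σ => σ.symm ⟨c, j⟩ = s).Nonempty := by
    rw [← Finset.card_pos]
    by_contra h
    rw [Nat.eq_zero_of_not_pos h, mul_zero] at hB
    exact absurd (Finset.card_pos.2 ⟨g₁, hg₁⟩) (by omega)
  obtain ⟨g₂, hg₂⟩ := hne2
  rw [Finset.mem_filter] at hg₂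
  have hg₂' := hg₂.1
  rw [patternClass, Finset.mem_filter] at hg₂'
  refine ⟨g₂, hg₂'.1, fun k => congr_fun hg₂'.2 k, hg₂.2, hp.trans ?_⟩
  rw [mul_assoc]
  gcongr
  rw [heq] at hg₂ hB
  rw [heq, ← filter_tannerClass hg₂.1, hg₂.2]
  exact_mod_cast hB

end Degrees

/-! ### Revealing an edge, typical counts, and the exploration of a check -/

namespace Degrees

variable {E : Degrees}

namespace State

variable {x : Bool → Fin E.n → ℤˣ} {S : State E} {M M' : ℕ}

lemma apply_notMem_of_mem_tannerClass {x : Fin E.n → ℤˣ} {g g' : E.Tanner} {R : Finset E.CSock}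
    {Q : Finset (Fin E.m)} (hg : g' ∈ tannerClass x g R Q) {s : E.VSock} (hs : g s ∉ R) :
    g' s ∉ R := by
  intro h
  have h1 := (mem_tannerClass.1 hg).2.1 _ h
  rw [Equiv.symm_apply_apply] at h1
  apply hs
  rw [h1, Equiv.apply_symm_apply]
  exact h

lemma valid_setUser [DecidableEq E.CSock] (hS : S.Valid x M) {b : Bool} {g : E.Tanner}
    {t : E.CSock}
    {Q : Finset (Fin E.m)} (hg : g ∈ tannerClass (x b) (S.g b) (S.R b) (S.Q b))
    (hu : S.Used b (g.symm t).1) (hQ : S.Q b ⊆ Q) (ht : t.1 ∈ Q) (hc : Q.card ≤ M')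
    (hM : M ≤ M') : (S.setUser b g (insert t (S.R b)) Q).Valid x M' := by
  have hg' := mem_tannerClass.1 hg
  constructor
  · intro b'
    rcases eq_or_ne b' b with rfl | h
    · simpa [setUser] using hg'.1
    · simpa [setUser, h] using hS.codeword b'
  · intro b'
    rcases eq_or_ne b' b with rfl | h
    · simp only [setUser, Function.update_self]
      intro u hu'
      rcases Finset.mem_insert.1 hu' with rfl | hu'
      · exact ht
      · exact hQ (hS.check b' u hu')
    · simpa only [setUser, Function.update_of_ne h] using hS.check b'
  · intro b'
    change ∀ u ∈ Function.update S.R b (insert t (S.R b)) b',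
      S.Used b' ((Function.update S.g b g b').symm u).1
    rcases eq_or_ne b' b with rfl | h
    · simp only [Function.update_self]
      intro u hu'
      rcases Finset.mem_insert.1 hu' with rfl | hu'
      · exact hu
      · rw [hg'.2.1 u hu']
        exact hS.used b' u hu'
    · simpa only [Function.update_of_ne h] using hS.used b'
  · exact hS.card_node.trans hM
  · intro b'
    rcases eq_or_ne b' b with rfl | h
    · simpa only [setUser, Function.update_self] using hc
    · simpa only [setUser, Function.update_of_ne h] using (hS.card_check b').trans hM

/-- Only the two ends of the revealed edge can stop being open. -/
lemma ext_setUser [DecidableEq E.CSock] {b : Bool} {g : E.Tanner} {t : E.CSock}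
    {Q : Finset (Fin E.m)} (hg : g ∈ tannerClass (x b) (S.g b) (S.R b) (S.Q b))
    (hQ : S.Q b ⊆ Q) : Ext x S (S.setUser b g (insert t (S.R b)) Q)
      {(b, Sum.inl (g.symm t)), (b, Sum.inr t)} := by
  have hg' := mem_tannerClass.1 hg
  constructor
  · rintro ⟨b', s | u⟩ hit ho
    · refine ⟨ho.1, ?_⟩
      have ho2 : S.g b' s ∉ S.R b' := ho.2
      change Function.update S.g b g b' s ∉ Function.update S.R b (insert t (S.R b)) b'
      rcases eq_or_ne b' b with rfl | h
      · simp only [Function.update_self, Finset.mem_insert, not_or]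
        refine ⟨fun h => hit ?_, apply_notMem_of_mem_tannerClass hg ho2⟩
        rw [← h, Equiv.symm_apply_apply]
        exact Or.inl rfl
      · simpa only [Function.update_of_ne h] using ho2
    · have ho1 : u.1 ∈ S.Q b' := ho.1
      have ho2 : u ∉ S.R b' := ho.2
      change u.1 ∈ Function.update S.Q b Q b' ∧ u ∉ Function.update S.R b (insert t (S.R b)) b'
      rcases eq_or_ne b' b with rfl | h
      · simp only [Function.update_self, Finset.mem_insert, not_or]
        refine ⟨hQ ho1, fun h => hit ?_, ho2⟩
        rw [← h]
        exact Or.inr rfl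
      · simpa only [Function.update_of_ne h] using ⟨ho1, ho2⟩
  · intro b'
    rcases eq_or_ne b' b with rfl | h
    · simpa only [setUser, Function.update_self] using hQ
    · simp only [setUser, Function.update_of_ne h]; exact subset_rfl
  · intro b' u hu
    rcases eq_or_ne b' b with rfl | h
    · simpa only [setUser, Function.update_self] using hg'.2.2 u hu
    · simp only [setUser, Function.update_of_ne h]

end State

/-- Up to the factor `θ`, the counts which govern the exploration of at most `M` nodes have their
asymptotic values. -/
structure Typical (lam rho : ℕ →₀ ℝ≥0) (E : Degrees) (x : Bool → Fin E.n → ℤˣ) (D M : ℕ)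
    (θ : ℝ≥0∞) : Prop where
  vdeg_le : ∀ v, E.vdeg v ≤ D
  cdeg_le : ∀ c, E.cdeg c ≤ D
  two_le : ∀ c, 2 ≤ E.cdeg c
  pattern : ∀ (b : Bool) (g : E.Tanner) (R : Finset E.CSock) (Q : Finset (Fin E.m)) (c : Fin E.m),
    IsCodeword g (x b) → (∀ t ∈ R, t.1 ∈ Q) → c ∉ Q → Q.card ≤ M → ∀ p ∈ evenPat (E.cdeg c),
      θ * (tannerClass (x b) g R Q).card ≤
        2 ^ (E.cdeg c - 1) * ((patternClass (x b) g R Q c p).card : ℝ≥0∞)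
  check : ∀ (b : Bool) (ε : ℤˣ) (Q : Finset (Fin E.m)), Q.card ≤ M → ∀ j ∈ rho.support,
    θ * rho j * (2 * signCard (x b) ε) ≤
      ((Finset.univ.filter fun t : E.CSock => t.1 ∉ Q).filter fun t => E.cdeg t.1 = j).card
  sock : ∀ (b : Bool) (ε : ℤˣ) (U : Finset (Fin E.n)), U.card ≤ M → ∀ i ∈ lam.support,
    θ * lam i * signCard (x b) ε ≤
      ((Finset.univ.filter fun s : E.VSock => s.1 ∉ U ∧ x b s.1 = ε).filter
        fun s => E.vdeg s.1 = i).card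
  node : ∀ (b : Bool) (ε : ℤˣ) (U : Finset (Fin E.n)), U.card ≤ M → ∀ i ∈ lam.support,
    θ * (nodeFrac lam i / 2) * E.n ≤
      ((Finset.univ.filter fun w : Fin E.n => w ∉ U ∧ x b w = ε).filter
        fun w => E.vdeg w = i).card

/-- Nodes whose degree lies outside J are dropped, as is allowed in a lower bound. -/
lemma sum_card_mul_le {ι : Type*} (T : Finset ι) (deg : ι → ℕ) (J : Finset ℕ) (h : ℕ → ℝ≥0∞) :
    ∑ j ∈ J, ((T.filter fun t => deg t = j).card : ℝ≥0∞) * h j ≤ ∑ t ∈ T, h (deg t) := by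
  have : ∀ j ∈ J, ((T.filter fun t => deg t = j).card : ℝ≥0∞) * h j =
      ∑ t ∈ T.filter (fun t => deg t = j), h (deg t) := by
    intro j _
    rw [← nsmul_eq_mul, ← Finset.sum_const]
    exact Finset.sum_congr rfl fun t ht => by rw [(Finset.mem_filter.1 ht).2]
  rw [Finset.sum_congr rfl this, Finset.sum_fiberwise_eq_sum_filter]
  exact Finset.sum_le_sum_of_subset (Finset.filter_subset _ _)

variable (lam rho) in
/-- The messages into the open check sockets can be simulated. -/
def SimIntoCheck (A α : ℝ) (E : Degrees) (x : Bool → Fin E.n → ℤˣ) (M : ℕ) (θ : ℝ≥0∞)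
    (l C e : ℕ) : Prop :=
  ∀ (S : State E) (M' : ℕ) (b : Bool) (t : E.CSock), S.Valid x M' → M' + C ≤ M →
    S.Open (b, Sum.inr t) →
    State.Sim x S (M' + C) {(b, Sum.inr t)}
      (fun ω z => userMsg A α x l b ω z ((ω.1 b).symm t))
      (θ ^ e • reflect (signAt (x b) (S.g b) t) (deSeq A α lam rho l b))

variable (lam rho) in
/-- The messages into the open variable sockets can be simulated. -/
def SimIntoVar (A α : ℝ) (E : Degrees) (x : Bool → Fin E.n → ℤˣ) (M : ℕ) (θ : ℝ≥0∞)
    (l C e : ℕ) : Prop :=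
  ∀ (S : State E) (M' : ℕ) (b : Bool) (s : E.VSock), S.Valid x M' → M' + C ≤ M →
    S.Open (b, Sum.inl s) →
    State.Sim x S (M' + C) {(b, Sum.inl s)}
      (fun ω z => checkMsg (ω.1 b) (userMsg A α x l b ω z) s)
      (θ ^ e • reflect (x b s.1) (rhoOp rho (deSeq A α lam rho l b)))

/-- The output of a check whose symbols are known. -/
lemma sim_check_output {A α : ℝ} {x : Bool → Fin E.n → ℤˣ} {M : ℕ} {θ : ℝ≥0∞} (hθ : θ ≠ ∞)
    {l C e : ℕ} (hd : IsDegreePair lam rho) (h : SimIntoCheck lam rho A α E x M θ l C e)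
    {S : State E} {M' : ℕ} {b : Bool} {c : Fin E.m} {j : Fin (E.cdeg c)} (hS : S.Valid x M')
    (hM : M' + (E.cdeg c - 1) * C ≤ M) (ho : ∀ k, k ≠ j → S.Open (b, Sum.inr ⟨c, k⟩))
    (hj : (⟨c, j⟩ : E.CSock) ∈ S.R b) :
    State.Sim x S (M' + (E.cdeg c - 1) * C) {y | ∃ k ≠ j, y = (b, Sum.inr ⟨c, k⟩)}
      (fun ω z => checkMsg (ω.1 b) (userMsg A α x l b ω z) ((S.g b).symm ⟨c, j⟩))
      ((θ ^ e) ^ (E.cdeg c - 1) • reflect (x b ((S.g b).symm ⟨c, j⟩).1)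
        (chkPow (deSeq A α lam rho l b) (E.cdeg c - 1))) := by
  classical
  set a := deSeq A α lam rho l b
  have ha : IsSymm a := isSymm_deSeq hd A α l b
  have hap := ha.prob
  set p : Fin (E.cdeg c) → ℤˣ := fun k => signAt (x b) (S.g b) ⟨c, k⟩
  have hcard : (Finset.univ.erase j).card = E.cdeg c - 1 := by simp
  -- The check is satisfied, so the symbols at the other sockets multiply to the symbol at j: the
  -- output has the sign required by `reflect`.
  have hprod : ∏ k ∈ Finset.univ.erase j, p k = x b ((S.g b).symm ⟨c, j⟩).1 := by
    have h1 := hS.codeword b c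
    rw [← Finset.mul_prod_erase _ _ (Finset.mem_univ j)] at h1
    have h2 := eq_inv_of_mul_eq_one_right h1
    rwa [Int.units_inv_eq_self] at h2
  have key := State.sim_finset (x := x) (φ := fun u v => twoArtanh (tanhHalf u * tanhHalf v))
    (by fun_prop) C (θ ^ e) (fun k => (b, Sum.inr ⟨c, k⟩))
    (fun k ω z => userMsg A α x l b ω z ((ω.1 b).symm ⟨c, k⟩))
    (fun k ω => measurable_userMsg A α x l b ω _) (fun k => reflect (p k) a)
    (ENNReal.pow_ne_top hθ)
    (fun K ω z => twoArtanh (∏ k ∈ K, tanhHalf (userMsg A α x l b ω z ((ω.1 b).symm ⟨c, k⟩))))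
    (fun K => reflect (∏ k ∈ K, p k) (chkPow a K.card)) ⊤
    (by simp [twoArtanh]) (by simp [chkPow, reflect_one]) ?_ ?_
    (Finset.univ.erase j) hS ?_
  · rw [hcard, hprod] at key
    refine (key.mono le_rfl le_rfl fun y hy _ => ?_).congr fun ω hω z _ => ?_
    · obtain ⟨k, hk, rfl⟩ := hy
      exact ⟨k, Finset.ne_of_mem_erase hk, rfl⟩
    · refine checkMsg_eq _ ?_
      exact (mem_tannerClass.1 ((State.mem_confs.1 hω).1 b)).2.1 _ hj
  · intro k K hk
    funext ω z
    rw [Finset.prod_insert hk, tanhHalf_twoArtanh, mul_comm]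
    rw [Set.mem_Icc, ← abs_le, Finset.abs_prod]
    exact Finset.prod_le_one (fun _ _ => abs_nonneg _) fun _ _ => abs_tanhHalf_le _
  · intro k K hk
    rw [Finset.prod_insert hk, Finset.card_insert_of_notMem hk, chkPow, mul_comm,
      reflect_chkConv]
    rfl
  · intro k hk S' i hS' hi he
    have hk' := Finset.ne_of_mem_erase hk
    have hopen : S'.Open (b, Sum.inr ⟨c, k⟩) := he.item _ (by
      rintro ⟨k', _, hne, h2⟩
      simp at h2
      exact hne h2.symm) (ho k hk')
    rw [hcard] at hi
    have hle : M' + i * C + C ≤ M := by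
      have : (i + 1) * C ≤ (E.cdeg c - 1) * C := Nat.mul_le_mul_right _ hi
      rw [Nat.succ_mul] at this
      omega
    have := h S' (M' + i * C) b ⟨c, k⟩ hS' hle hopen
    rwa [he.sign b ⟨c, k⟩ (ho k hk').1] at this

lemma signCard_ne_zero (x : Fin E.n → ℤˣ) (s : E.VSock) : signCard x (x s.1) ≠ 0 := by
  rw [signCard, Finset.card_ne_zero]
  exact ⟨s, Finset.mem_filter.2 ⟨Finset.mem_univ _, rfl⟩⟩

lemma lintegral_reflect_rhoOp (ε : ℤˣ) (a : Measure EReal) (c : EReal → ℝ≥0∞) :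
    ∫⁻ m, c m ∂(reflect ε (rhoOp rho a)) =
      ∑ j ∈ rho.support, rho j * ∫⁻ m, c m ∂(reflect ε (chkPow a (j - 1))) := by
  rw [rhoOp, reflect_sum, lintegral_finsetSum_measure]
  simp only [reflect_smul, lintegral_smul_measure]
  rfl

/-- Exploring a variable socket: its check, the symbols there and the subtrees. -/
theorem simIntoVar_of_simIntoCheck {A α : ℝ} {x : Bool → Fin E.n → ℤˣ} {D M : ℕ} {θ : ℝ≥0∞}
    (hθ0 : θ ≠ 0) (hθ1 : θ ≤ 1) {l C e : ℕ} (hd : IsDegreePair lam rho)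
    (hE : Typical lam rho E x D M θ) (h : SimIntoCheck lam rho A α E x M θ l C e) :
    SimIntoVar lam rho A α E x M θ l (1 + D * C) (2 + D * e) := by
  classical
  intro S M' b s hS hM ho H c hH hc hb
  have hθt : θ ≠ ∞ := ne_top_of_le_ne_top ENNReal.one_ne_top hθ1
  set a := deSeq A α lam rho l b
  set ε := x b s.1 with hε
  set N : ℝ≥0∞ := ((signCard (x b) ε : ℕ) : ℝ≥0∞)
  have hN0 : N ≠ 0 := by simpa [N] using signCard_ne_zero (x b) s
  have hNt : N ≠ ∞ := ENNReal.natCast_ne_top _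
  set I : ℕ → ℝ≥0∞ := fun d => ∫⁻ m, c m ∂(reflect ε (chkPow a (d - 1)))
  set T := Finset.univ.filter fun t : E.CSock => t.1 ∉ S.Q b
  -- The outcomes kept: a socket t of an unseen check as partner of s, and an even pattern there
  -- that shows the symbol of s at t.
  set O := T.sigma fun t => (evenPat (E.cdeg t.1)).filter fun p => p t.2 = ε
  set f : E.Conf → (Fin E.n → ℝ) → EReal := fun ω z =>
    checkMsg (ω.1 b) (userMsg A α x l b ω z) s
  have hex : ∀ o : (Σ t : E.CSock, Fin (E.cdeg t.1) → ℤˣ), ∃ g', o ∈ O →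
      g' ∈ tannerClass (x b) (S.g b) (S.R b) (S.Q b) ∧
      (∀ k, signAt (x b) g' ⟨o.1.1, k⟩ = o.2 k) ∧ g'.symm o.1 = s ∧
      θ * (tannerClass (x b) (S.g b) (S.R b) (S.Q b)).card ≤ 2 ^ (E.cdeg o.1.1 - 1) * N *
        (tannerClass (x b) g' (insert o.1 (S.R b)) (insert o.1.1 (S.Q b))).card := by
    rintro ⟨⟨c', j⟩, p⟩
    by_cases ho' : (⟨⟨c', j⟩, p⟩ : (Σ t : E.CSock, Fin (E.cdeg t.1) → ℤˣ)) ∈ O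
    · simp only [O, T, Finset.mem_sigma, Finset.mem_filter, Finset.mem_univ, true_and] at ho'
      obtain ⟨g', h1, h2, h3, h4⟩ := exists_mem_tannerClass_check (hS.codeword b) (hS.check b)
        ho'.1 hθ0 (hE.pattern b (S.g b) (S.R b) (S.Q b) c' (hS.codeword b) (hS.check b) ho'.1
          ((hS.card_check b).trans (by omega)) p ho'.2.1) ho.2 j ho'.2.2
      exact ⟨g', fun _ => ⟨h1, h2, h3, h4⟩⟩
    · exact ⟨S.g b, fun h => absurd h ho'⟩
  choose g' hg' using hex
  have hmemO : ∀ o ∈ O, o.1.1 ∉ S.Q b ∧ o.2 ∈ evenPat (E.cdeg o.1.1) ∧ o.2 o.1.2 = ε := by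
    intro o ho'
    simpa only [O, T, Finset.mem_sigma, Finset.mem_filter, Finset.mem_univ, true_and] using ho'
  -- The outcome has conditional probability at least θ 2^(-(d-1)) / N: nearly uniform even
  -- patterns, then one of the N variable sockets with symbol ε as partner of t.
  have hreveal := State.sum_mean_setUser_le (S := S) (x := x) b O g'
    (fun o => insert o.1 (S.R b)) (fun o => insert o.1.1 (S.Q b))
    (fun o => θ / (2 ^ (E.cdeg o.1.1 - 1) * N)) (fun o ho' => (hg' o ho').1)
    (fun o _ => Finset.subset_insert _ _) (fun o _ => Finset.subset_insert _ _) ?_ ?_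
    (fun ω z => H (f ω z) ω z)
  rotate_left
  · rintro ⟨t, p⟩ ho₁ ⟨t', p'⟩ ho₂ hne
    rw [Function.onFun, Finset.disjoint_left]
    intro σ hσ hσ'
    rw [mem_tannerClass] at hσ hσ'
    apply hne
    have h1 := hσ.2.1 t (Finset.mem_insert_self _ _)
    have h2 := hσ'.2.1 t' (Finset.mem_insert_self _ _)
    rw [(hg' _ ho₁).2.2.1] at h1
    rw [(hg' _ ho₂).2.2.1] at h2
    obtain rfl : t = t' := σ.symm.injective (h1.trans h2.symm)
    congr 1
    funext k
    have e1 : signAt (x b) (g' ⟨t, p⟩) ⟨t.1, k⟩ = p k := (hg' _ ho₁).2.1 k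
    have e2 : signAt (x b) (g' ⟨t, p'⟩) ⟨t.1, k⟩ = p' k := (hg' _ ho₂).2.1 k
    rw [← e1, ← e2, ← hσ.2.2 ⟨t.1, k⟩ (Finset.mem_insert_self _ _),
      ← hσ'.2.2 ⟨t.1, k⟩ (Finset.mem_insert_self _ _)]
  · intro o ho'
    have h2 : (2 : ℝ≥0∞) ^ (E.cdeg o.1.1 - 1) ≠ 0 := pow_ne_zero _ two_ne_zero
    have h2' : (2 : ℝ≥0∞) ^ (E.cdeg o.1.1 - 1) ≠ ∞ := ENNReal.pow_ne_top ENNReal.ofNat_ne_top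
    rw [div_eq_mul_inv, mul_right_comm, ← div_eq_mul_inv,
      ENNReal.div_le_iff (mul_ne_zero h2 hN0) (ENNReal.mul_ne_top h2' hNt), mul_comm _ (_ * N)]
    exact (hg' o ho').2.2.2
  refine le_trans ?_ hreveal
  have hsub : ∀ o ∈ O, θ ^ (D * e) * I (E.cdeg o.1.1) ≤
      (S.setUser b (g' o) (insert o.1 (S.R b)) (insert o.1.1 (S.Q b))).mean x
        fun ω z => H (f ω z) ω z := by
    intro o ho'
    obtain ⟨hc1, hc2, hc3⟩ := hmemO o ho'
    obtain ⟨h1, h2, h3, -⟩ := hg' o ho'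
    have hcD := hE.cdeg_le o.1.1
    have hDC : (E.cdeg o.1.1 - 1) * C ≤ D * C := Nat.mul_le_mul_right _ (by omega)
    set S' := S.setUser b (g' o) (insert o.1 (S.R b)) (insert o.1.1 (S.Q b)) with hS'def
    have hS' : S'.Valid x (M' + 1) := by
      refine State.valid_setUser hS h1 ?_ (Finset.subset_insert _ _) (Finset.mem_insert_self _ _)
        ?_ (by omega)
      · rw [h3]; exact ho.1
      · rw [Finset.card_insert_of_notMem hc1]
        exact Nat.succ_le_succ (hS.card_check b)
    have hgb : S'.g b = g' o := Function.update_self ..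
    have hRb : S'.R b = insert o.1 (S.R b) := Function.update_self ..
    have hQb : S'.Q b = insert o.1.1 (S.Q b) := Function.update_self ..
    have hE' : State.Ext x S S' {(b, Sum.inl s), (b, Sum.inr o.1)} := by
      have := State.ext_setUser (x := x) (t := o.1) h1 (Finset.subset_insert o.1.1 (S.Q b))
      rwa [h3] at this
    have key := sim_check_output (j := o.1.2) (c := o.1.1) hθt hd h hS' (by omega) (fun k hk => by
      refine ⟨?_, ?_⟩
      · rw [hQb]; exact Finset.mem_insert_self _ _
      · rw [hRb, Finset.mem_insert, not_or]
        refine ⟨fun h' => hk ?_, fun h' => hc1 (hS.check b ⟨o.1.1, k⟩ h')⟩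
        obtain ⟨⟨c', j⟩, p⟩ := o
        simpa using h') (by rw [hRb]; exact Finset.mem_insert_self _ _)
    have hs : (S'.g b).symm ⟨o.1.1, o.1.2⟩ = s := by rw [hgb]; exact h3
    rw [hs] at key
    have := key H c hH hc (fun S'' hS'' he m => ?_)
    · refine le_trans ?_ this
      rw [lintegral_smul_measure, smul_eq_mul, ← pow_mul]
      refine mul_le_mul_left ?_ _
      refine pow_le_pow_right_of_le_one' hθ1 ?_
      rw [mul_comm]
      exact Nat.mul_le_mul_right _ (by omega)
    · refine hb S'' (hS''.mono (by omega)) ((hE'.trans he).mono ?_) m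
      rintro y ((rfl | rfl) | ⟨k, -, rfl⟩) hy
      · rfl
      · exact absurd hy.1 hc1
      · exact absurd hy.1 hc1
  rw [lintegral_smul_measure, smul_eq_mul, lintegral_reflect_rhoOp]
  -- At each socket t there are 2^(d-2) patterns with the prescribed entry, so its outcomes have
  -- total weight θ/(2N). As 2N is asymptotically the number of sockets, the degree of the check
  -- follows ρ at the cost of another θ; the remaining power pays for at most D subtrees.
  calc θ ^ (2 + D * e) * ∑ j ∈ rho.support, rho j * I j
      = θ ^ (1 + D * e) / (2 * N) * ∑ j ∈ rho.support, (θ * rho j * (2 * N)) * I j := by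
        rw [Finset.mul_sum, Finset.mul_sum]
        refine Finset.sum_congr rfl fun j _ => ?_
        have h2N : (2 * N) * (2 * N)⁻¹ = 1 := ENNReal.mul_inv_cancel
          (mul_ne_zero two_ne_zero hN0) (ENNReal.mul_ne_top ENNReal.ofNat_ne_top hNt)
        calc θ ^ (2 + D * e) * (rho j * I j)
            = θ ^ (1 + D * e) * (θ * rho j) * I j * ((2 * N) * (2 * N)⁻¹) := by
              rw [h2N, show 2 + D * e = 1 + D * e + 1 by ring, pow_succ]; ring
          _ = _ := by rw [div_eq_mul_inv]; ring
    _ ≤ θ ^ (1 + D * e) / (2 * N) * ∑ j ∈ rho.support,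
          ((T.filter fun t => E.cdeg t.1 = j).card : ℝ≥0∞) * I j := by
        gcongr with j hj
        exact hE.check b ε (S.Q b) ((hS.card_check b).trans (by omega)) j hj
    _ ≤ θ ^ (1 + D * e) / (2 * N) * ∑ t ∈ T, I (E.cdeg t.1) := by
        gcongr
        exact sum_card_mul_le T (fun t => E.cdeg t.1) rho.support I
    _ = ∑ o ∈ O, θ / (2 ^ (E.cdeg o.1.1 - 1) * N) * (θ ^ (D * e) * I (E.cdeg o.1.1)) := by
        rw [Finset.sum_sigma, Finset.mul_sum]
        refine Finset.sum_congr rfl fun t _ => ?_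
        have h2 := card_evenPat_filter (hE.two_le t.1) t.2 ε
        have h3 : ((((evenPat (E.cdeg t.1)).filter fun p => p t.2 = ε).card : ℕ) : ℝ≥0∞) =
            2 ^ (E.cdeg t.1 - 2) := by
          exact_mod_cast (by exact_mod_cast h2 :
            ((evenPat (E.cdeg t.1)).filter fun p => p t.2 = ε).card = 2 ^ (E.cdeg t.1 - 2))
        dsimp only
        rw [Finset.sum_const, nsmul_eq_mul, h3,
          show E.cdeg t.1 - 1 = (E.cdeg t.1 - 2) + 1 by have := hE.two_le t.1; omega]
        have h4 : (2 : ℝ≥0∞) ^ (E.cdeg t.1 - 2) * (2 ^ (E.cdeg t.1 - 2))⁻¹ = 1 :=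
          ENNReal.mul_inv_cancel (pow_ne_zero _ two_ne_zero)
            (ENNReal.pow_ne_top ENNReal.ofNat_ne_top)
        rw [div_eq_mul_inv, div_eq_mul_inv, pow_succ, mul_assoc _ 2 N,
          ENNReal.mul_inv (Or.inl (pow_ne_zero _ two_ne_zero))
            (Or.inl (ENNReal.pow_ne_top ENNReal.ofNat_ne_top)), pow_add, pow_one]
        calc θ * θ ^ (D * e) * (2 * N)⁻¹ * I (E.cdeg t.1)
            = θ * θ ^ (D * e) * (2 * N)⁻¹ * I (E.cdeg t.1) *
                (2 ^ (E.cdeg t.1 - 2) * (2 ^ (E.cdeg t.1 - 2))⁻¹) := by rw [h4, mul_one]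
          _ = _ := by ring
    _ ≤ _ := by
        refine Finset.sum_le_sum fun o ho' => ?_
        gcongr
        exact hsub o ho'

end Degrees

/-! ### Exploring a variable node and its function node -/

lemma measurable_funMsg_left (A α : ℝ) (b : Bool) (y : ℝ) :
    Measurable fun m => funMsg A α b m y := by
  have := measurable_funMsg A α b
  fun_prop

/-- Negation is additive away from the indeterminate sum. -/
lemma reflect_varConv {a b : Measure EReal} (ha : IsSymm a) (hb : IsSymm b) (s : ℤˣ) :
    reflect s (varConv a b) = varConv (reflect s a) (reflect s b) := by
  have hap := ha.prob
  have hbp := hb.prob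
  have h1 : (reflect s a).prod (reflect s b) = (a.prod b).map (Prod.map (signMul s) (signMul s)) :=
    Measure.map_prod_map _ _ (measurable_signMul s) (measurable_signMul s)
  rw [varConv, varConv, h1, Measure.map_map (by fun_prop) (by fun_prop), reflect,
    Measure.map_map (measurable_signMul s) (by fun_prop)]
  refine Measure.map_congr ?_
  have h2 : ∀ᵐ p ∂(a.prod b), p.1 ≠ ⊥ :=
    Measure.quasiMeasurePreserving_fst.ae
    (by simpa [ae_iff] using ha.bot : ∀ᵐ u ∂a, u ≠ ⊥)
  have h3 : ∀ᵐ p ∂(a.prod b), p.2 ≠ ⊥ :=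
    Measure.quasiMeasurePreserving_snd.ae
    (by simpa [ae_iff] using hb.bot : ∀ᵐ u ∂b, u ≠ ⊥)
  filter_upwards [h2, h3] with p hp1 hp2
  rcases Int.units_eq_one_or s with rfl | rfl
  · simp
  · simp only [Function.comp, Prod.map_fst, Prod.map_snd, signMul_neg_one]
    rw [EReal.neg_add (Or.inl hp1) (Or.inr hp2), sub_eq_add_neg]

namespace Degrees

variable {E : Degrees}

lemma simIntoCheck_zero (A α : ℝ) (x : Bool → Fin E.n → ℤˣ) (M : ℕ) (θ : ℝ≥0∞) :
    SimIntoCheck lam rho A α E x M θ 0 0 0 := by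
  intro S M' b t hS _ _
  have h : reflect (signAt (x b) (S.g b) t) (deSeq A α lam rho 0 b) = Measure.dirac 0 := by
    simp [reflect, deSeq, Measure.map_dirac' (measurable_signMul _), signMul]
  rw [h, pow_zero, one_smul]
  exact State.sim_const hS 0

/-- The sum of messages into a variable node. -/
lemma sim_sum_checkMsg {A α : ℝ} {x : Bool → Fin E.n → ℤˣ} {M : ℕ} {θ : ℝ≥0∞} (hθ : θ ≠ ∞)
    {l C e : ℕ} (hd : IsDegreePair lam rho) (h : SimIntoVar lam rho A α E x M θ l C e)
    {S : State E} {M' : ℕ} {b : Bool} {v : Fin E.n} (K : Finset (Fin (E.vdeg v)))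
    (hS : S.Valid x M') (hM : M' + K.card * C ≤ M)
    (ho : ∀ j ∈ K, S.Open (b, Sum.inl ⟨v, j⟩)) :
    State.Sim x S (M' + K.card * C) {y | ∃ j ∈ K, y = (b, Sum.inl ⟨v, j⟩)}
      (fun ω z => ∑ j ∈ K, checkMsg (ω.1 b) (userMsg A α x l b ω z) ⟨v, j⟩)
      ((θ ^ e) ^ K.card • reflect (x b v)
        (varPow (rhoOp rho (deSeq A α lam rho l b)) K.card)) := by
  classical
  set a := rhoOp rho (deSeq A α lam rho l b)
  have ha : IsSymm a := (isSymm_deSeq hd A α l b).rhoOp hd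
  have hap := ha.prob
  refine State.sim_finset (x := x) (φ := fun u v => u + v)
    (by fun_prop) C (θ ^ e) (fun j => (b, Sum.inl ⟨v, j⟩))
    (fun j ω z => checkMsg (ω.1 b) (userMsg A α x l b ω z) ⟨v, j⟩)
    (fun j ω => measurable_checkMsg _ (fun e => measurable_userMsg A α x l b ω e) _)
    (fun _ => reflect (x b v) a) (ENNReal.pow_ne_top hθ)
    (fun K ω z => ∑ j ∈ K, checkMsg (ω.1 b) (userMsg A α x l b ω z) ⟨v, j⟩)
    (fun K => reflect (x b v) (varPow a K.card)) 0
    (by simp) ?_ ?_ ?_ K hS ?_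
  · simp [varPow, reflect, Measure.map_dirac' (measurable_signMul _), signMul]
  · intro k K hk
    funext ω z
    rw [Finset.sum_insert hk, add_comm]
  · intro k K hk
    rw [Finset.card_insert_of_notMem hk, varPow,
      reflect_varConv (ha.varPow _) ha]
    rfl
  · intro k hk S' i hS' hi he
    have hopen : S'.Open (b, Sum.inl ⟨v, k⟩) := he.item _ (by
      rintro ⟨k', _, hne, h2⟩
      simp at h2
      exact hne h2.symm) (ho k hk)
    have hle : M' + i * C + C ≤ M := by
      have : (i + 1) * C ≤ K.card * C := Nat.mul_le_mul_right _ hi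
      rw [Nat.succ_mul] at this
      omega
    exact h S' (M' + i * C) b ⟨v, k⟩ hS' hle hopen

/-- The message from a function node of which everything but the subtrees is known, plus the
messages from the checks. -/
lemma sim_varMsg {A α : ℝ} {x : Bool → Fin E.n → ℤˣ} {D M : ℕ} {θ : ℝ≥0∞} (hθ1 : θ ≤ 1)
    {l C e : ℕ} (hd : IsDegreePair lam rho) (hdeg : ∀ v, E.vdeg v ≤ D)
    (h : SimIntoVar lam rho A α E x M θ l C e)
    {S : State E} {M' : ℕ} {b : Bool} {s : E.VSock} {u : Fin E.n}
    (hS : S.Valid x M') (hM : M' + 2 * D * C ≤ M)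
    (hu : mate b S.τ s.1 = u) (hA : fnNode b S.τ s.1 ∈ S.A)
    (ho : ∀ j ≠ s.2, S.Open (b, Sum.inl ⟨s.1, j⟩)) (ho' : ∀ j, S.Open (!b, Sum.inl ⟨u, j⟩))
    {y : ℝ} (hy : chMean A α (inp b (x b s.1) (x (!b) u)) + S.z (fnNode b S.τ s.1) = y) :
    State.Sim x S (M' + 2 * D * C)
      {y | (∃ j ≠ s.2, y = (b, Sum.inl ⟨s.1, j⟩)) ∨ ∃ j, y = (!b, Sum.inl ⟨u, j⟩)}
      (fun ω z => userMsg A α x (l + 1) b ω z s)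
      (θ ^ (2 * D * e) • varConv
        ((reflect (x (!b) u) (varPow (rhoOp rho (deSeq A α lam rho l !b)) (E.vdeg u))).map
          fun m => funMsg A α b m y)
        (reflect (x b s.1) (varPow (rhoOp rho (deSeq A α lam rho l b)) (E.vdeg s.1 - 1)))) := by
  classical
  have hθ : θ ≠ ∞ := ne_top_of_le_ne_top ENNReal.one_ne_top hθ1
  have hp1 : IsProbabilityMeasure (rhoOp rho (deSeq A α lam rho l b)) :=
    ((isSymm_deSeq hd A α l b).rhoOp hd).prob
  have hp2 : IsProbabilityMeasure (rhoOp rho (deSeq A α lam rho l !b)) :=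
    ((isSymm_deSeq hd A α l !b).rhoOp hd).prob
  have hcard1 : (Finset.univ : Finset (Fin (E.vdeg u))).card = E.vdeg u := by simp
  have hcard2 : (Finset.univ.filter fun j => j ≠ s.2).card = E.vdeg s.1 - 1 := by
    rw [Finset.filter_ne' , Finset.card_erase_of_mem (Finset.mem_univ _), Finset.card_univ,
      Fintype.card_fin]
  have hDu : E.vdeg u * C ≤ D * C := Nat.mul_le_mul_right _ (hdeg u)
  have hDs : (E.vdeg s.1 - 1) * C ≤ D * C :=
    Nat.mul_le_mul_right _ ((Nat.sub_le _ _).trans (hdeg s.1))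
  have h2D : 2 * D * C = D * C + D * C := by ring
  have h1 := (sim_sum_checkMsg hθ hd h (b := !b) (v := u) Finset.univ hS
    (by rw [hcard1]; omega) fun j _ => ho' j).map (measurable_funMsg_left A α b y)
  have hfin : IsFiniteMeasure ((θ ^ e) ^ (Finset.univ.filter fun j => j ≠ s.2).card •
      reflect (x b s.1) (varPow (rhoOp rho (deSeq A α lam rho l b))
        (Finset.univ.filter fun j => j ≠ s.2).card)) := by
    refine ⟨?_⟩
    rw [Measure.smul_apply, smul_eq_mul]
    exact ENNReal.mul_lt_top (lt_top_iff_ne_top.2 (ENNReal.pow_ne_top (ENNReal.pow_ne_top hθ)))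
      (measure_lt_top _ _)
  have h2 := h1.bind (M' := M' + E.vdeg u * C + (E.vdeg s.1 - 1) * C)
    (φ := fun a b => a + b) (by fun_prop) (fun S' hS' he => by
      have := sim_sum_checkMsg hθ hd h (b := b) (v := s.1) (Finset.univ.filter fun j => j ≠ s.2)
        hS' (by rw [hcard1, hcard2]; omega) fun j hj => he.item _ (by
          rintro ⟨j', -, hj'⟩
          simp at hj') (ho j (Finset.mem_filter.1 hj).2)
      refine this.mono le_rfl ?_ fun _ hy _ => hy
      rw [hcard1, hcard2]) fun ω => Finset.measurable_sum _ fun j _ =>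
        measurable_checkMsg _ (fun e => measurable_userMsg A α x l b ω e) _
  rw [hcard1, hcard2] at h2
  refine (h2.mono ?_ (by omega) fun y' hy' _ => ?_).congr fun ω hω z hz => ?_
  · rw [Measure.map_smul, Measure.prod_smul_left, Measure.prod_smul_right, smul_smul,
      Measure.map_smul, varConv, ← pow_mul, ← pow_mul, ← pow_add]
    refine Measure.le_iff.2 fun B _ => ?_
    rw [Measure.smul_apply, Measure.smul_apply, smul_eq_mul, smul_eq_mul]
    refine mul_le_mul_left ?_ _
    refine pow_le_pow_right_of_le_one' hθ1 ?_
    rw [← mul_add, mul_comm]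
    refine Nat.mul_le_mul_right _ ?_
    have := hdeg u
    have := hdeg s.1
    omega
  · rcases hy' with ⟨j, -, rfl⟩ | ⟨j, hj, rfl⟩
    · exact Or.inr ⟨j, rfl⟩
    · exact Or.inl ⟨j, (Finset.mem_filter.1 hj).2, rfl⟩
  · have hτ := State.mem_perms.1 (State.mem_confs.1 hω).2
    have hτ' : fnNode b ω.2 s.1 = fnNode b S.τ s.1 ∧ mate b ω.2 s.1 = u := by
      rw [← hu]
      cases b
      · simp only [fnNode, mate, Bool.false_eq_true, if_false, and_self] at hA ⊢
        rw [Equiv.symm_apply_eq, hτ _ hA, Equiv.apply_symm_apply]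
      · simp only [fnNode, mate, if_true, true_and] at hA ⊢
        exact hτ _ hA
    change funMsg A α b (toFunMsg (ω.1 !b) (userMsg A α x l (!b) ω z) (mate b ω.2 s.1))
      (received A α (x true) (x false) ω.2 z (fnNode b ω.2 s.1)) + _ = _
    rw [received_fnNode, hτ'.1, hτ'.2, hz _ hA, hy]
    rfl

end Degrees

/-- The law of the message to a variable node of degree `i` from its function node, where the other
variable node has degree `i'` and the noise is `a`, plus the messages from all checks but one. -/
def branchLaw (A α : ℝ) (b : Bool) (ε r : ℤˣ) (ν' ν : Measure EReal) (i i' : ℕ) (a : ℝ) :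
    Measure EReal :=
  varConv ((reflect r (varPow ν' i')).map fun m => funMsg A α b m (chMean A α (inp b ε r) + a))
    (reflect ε (varPow ν (i - 1)))

lemma lintegral_branchLaw (A α : ℝ) (b : Bool) (ε r : ℤˣ) (ν' ν : Measure EReal)
    [IsProbabilityMeasure ν] (i i' : ℕ) (a : ℝ) {c : EReal → ℝ≥0∞} (hc : Measurable c) :
    ∫⁻ m, c m ∂(branchLaw A α b ε r ν' ν i i' a) =
      ∫⁻ u, ∫⁻ v, c (funMsg A α b u (chMean A α (inp b ε r) + a) + v)
        ∂(reflect ε (varPow ν (i - 1))) ∂(reflect r (varPow ν' i')) := by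
  rw [branchLaw, lintegral_varConv _ _ hc, lintegral_map _ (measurable_funMsg_left A α b _)]
  fun_prop

/-- One step of density evolution written as the choices of the exploration: the degree i seen along
an edge, the other user's symbol r, the degree i' of the other variable node, and the noise a. -/
lemma lintegral_deNext {A α : ℝ} {b : Bool} {ε : ℤˣ} {ν' ν : Measure EReal} (hν' : IsSymm ν')
    (hν : IsSymm ν) (hd : IsDegreePair lam rho) {c : EReal → ℝ≥0∞} (hc : Measurable c) :
    ∫⁻ m, c m ∂(reflect ε (varConv (fLaw A α b 1 (nodeOp lam ν')) (lamOp lam ν))) =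
      ∑ i ∈ lam.support, lam i * ∑ r : ℤˣ, ∑ i' ∈ lam.support, (nodeFrac lam i' / 2) *
        ∫⁻ a, ∫⁻ m, c m ∂(branchLaw A α b ε r ν' ν i i' a) ∂(gaussianReal 0 1) := by
  have hνp := hν.prob
  have hνp' := hν'.prob
  have h1 := hν'.nodeOp hd
  have h1p := h1.prob
  rw [reflect_varConv (h1.fLaw A α b) (hν.lamOp hd), reflect_fLaw, lamOp, reflect_sum]
  simp only [reflect_smul]
  rw [varConv_sum _ _ _ _ fun _ _ => inferInstance, lintegral_finsetSum_measure]
  refine Finset.sum_congr rfl fun i _ => ?_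
  rw [lintegral_smul_measure, lintegral_varConv _ _ hc, fLaw, lintegral_finsetSum_measure]
  change (lam i : ℝ≥0∞) * _ = _
  congr 1
  refine Finset.sum_congr rfl fun r _ => ?_
  have hfun := measurable_funMsg A α b
  have hm : Measurable fun p : EReal × ℝ => ∫⁻ v, c (funMsg A α b p.1 p.2 + v)
      ∂(reflect ε (varPow ν (i - 1))) := by fun_prop
  rw [lintegral_smul_measure, lintegral_map (by fun_prop) (by fun_prop),
    lintegral_prod_symm _ hm.aemeasurable, chLaw_eq_map, lintegral_map _ (by fun_prop)]
  · have h2 : ∀ a : ℝ, ∫⁻ u, ∫⁻ v, c (funMsg A α b u (chMean A α (inp b ε r) + a) + v)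
        ∂(reflect ε (varPow ν (i - 1))) ∂(reflect r (nodeOp lam ν')) =
        ∑ i' ∈ lam.support, (nodeFrac lam i' : ℝ≥0∞) *
          ∫⁻ m, c m ∂(branchLaw A α b ε r ν' ν i i' a) := by
      intro a
      rw [nodeOp, reflect_sum]
      simp only [reflect_smul]
      rw [lintegral_finsetSum_measure]
      refine Finset.sum_congr rfl fun i' _ => ?_
      rw [lintegral_smul_measure, lintegral_branchLaw _ _ _ _ _ _ _ _ _ _ hc]
      rfl
    simp only [h2]
    have hm2 : ∀ i', Measurable fun a => ∫⁻ m, c m ∂(branchLaw A α b ε r ν' ν i i' a) := by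
      intro i'
      simp only [lintegral_branchLaw _ _ _ _ _ _ _ _ _ _ hc]
      have : Measurable fun q : ℝ × EReal => ∫⁻ v, c (funMsg A α b q.2
          (chMean A α (inp b ε r) + q.1) + v) ∂(reflect ε (varPow ν (i - 1))) := by fun_prop
      exact this.lintegral_prod_right'
    rw [lintegral_finsetSum _ fun i' _ => (hm2 i').const_mul _]
    change ((1 / 2 : ℝ≥0) : ℝ≥0∞) * _ = _
    rw [Finset.mul_sum]
    refine Finset.sum_congr rfl fun i' _ => ?_
    rw [lintegral_const_mul _ (hm2 i'), ← mul_assoc, mul_comm ((1 / 2 : ℝ≥0) : ℝ≥0∞)]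
    congr 2
    rw [ENNReal.coe_div two_ne_zero]
    simp
  · exact hm.lintegral_prod_left'

/-! ### Revealing a function node and a new variable node -/

namespace Degrees

variable {E : Degrees}

namespace State

variable {x : Bool → Fin E.n → ℤˣ} {S : State E} {M : ℕ}

/-- The state after the function node of the variable node `v` of user `b` is seen: the variable
node `u` of the other user is there, and the noise is `a`. -/
def setMate (S : State E) (b : Bool) (v u : Fin E.n) (a : ℝ) : State E :=
  S.setNode (if b then v else u) (if b then u else v) a

/-- A variable node has only one mate, so the outcomes for different u exclude each other; being
unseen makes each of them have probability at least 1/n. -/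
lemma sum_mean_setMate_le (b : Bool) (v : Fin E.n) (O : Finset (Fin E.n)) (hv : ¬ S.Used b v)
    (hO : ∀ u ∈ O, ¬ S.Used (!b) u)
    {G : E.Conf → (Fin E.n → ℝ) → ℝ≥0∞} (hG : ∀ ω, Measurable (G ω)) :
    ∑ u ∈ O, (E.n : ℝ≥0∞)⁻¹ * ∫⁻ a, (S.setMate b v u a).mean x G ∂(gaussianReal 0 1) ≤
      S.mean x G := by
  refine sum_mean_setNode_le O (fun u => if b then v else u) (fun u => if b then u else v)
    (fun u hu => ?_) (fun u hu => ?_) (fun u _ u' _ τ h h' => ?_) hG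
  · have := hO u hu
    cases b <;> simpa [Used, fnNode] using (by assumption)
  · have := hO u hu
    cases b <;> simpa [Used, fnNode] using (by assumption)
  · cases b
    · simp only [Bool.false_eq_true, if_false] at h h'
      exact τ.injective (h.trans h'.symm)
    · simp only [if_true] at h h'
      exact h.symm.trans h'

lemma setMate_τ (b : Bool) {v u : Fin E.n} (hv : ¬ S.Used b v) (hu : ¬ S.Used (!b) u) (a : ℝ) :
    (∀ i ∈ S.A, (S.setMate b v u a).τ i = S.τ i) ∧
      (S.setMate b v u a).τ (if b then v else u) = if b then u else v := by
  have h1 : (if b then v else u) ∉ S.A := by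
    cases b <;> simpa [Used, fnNode] using (by assumption)
  have h2 : S.τ.symm (if b then u else v) ∉ S.A := by
    cases b <;> simpa [Used, fnNode] using (by assumption)
  exact ⟨mem_perms.1 ((mem_perms_setNode h1 h2 (a := a)).1
    (mem_perms.2 fun _ _ => rfl)).1, ((mem_perms_setNode h1 h2 (a := a)).1
    (mem_perms.2 fun _ _ => rfl)).2⟩

lemma mate_setMate {b : Bool} {v u : Fin E.n} (hv : ¬ S.Used b v) (hu : ¬ S.Used (!b) u) (a : ℝ) :
    mate b (S.setMate b v u a).τ v = u ∧
      fnNode b (S.setMate b v u a).τ v = if b then v else u := by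
  have h := (setMate_τ b hv hu a).2
  cases b
  · simp only [Bool.false_eq_true, if_false] at h
    simp [mate, fnNode, Equiv.symm_apply_eq, h]
  · simp only [if_true] at h
    simp [mate, fnNode, h]

lemma used_setMate {b : Bool} {v u : Fin E.n} (hv : ¬ S.Used b v) (hu : ¬ S.Used (!b) u) (a : ℝ) :
    (S.setMate b v u a).Used b v ∧ (S.setMate b v u a).Used (!b) u ∧
      ∀ b' w, S.Used b' w → (S.setMate b v u a).Used b' w := by
  have h := mate_setMate hv hu a
  have hA : (S.setMate b v u a).A = insert (if b then v else u) S.A := rfl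
  refine ⟨?_, ?_, ?_⟩
  · rw [Used, h.2, hA]; exact Finset.mem_insert_self _ _
  · have h2 := fnNode_mate b (S.setMate b v u a).τ v
    rw [h.1, h.2] at h2
    rw [Used, h2, hA]; exact Finset.mem_insert_self _ _
  · intro b' w hw
    rw [Used, hA]
    refine Finset.mem_insert_of_mem ?_
    cases b'
    · simp only [Used, fnNode, Bool.false_eq_true, if_false] at hw ⊢
      have := (setMate_τ b hv hu a).1 _ hw
      rw [Equiv.apply_symm_apply] at this
      rwa [← this, Equiv.symm_apply_apply]
    · exact hw

lemma valid_setMate (hS : S.Valid x M) {b : Bool} {v u : Fin E.n} (hv : ¬ S.Used b v)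
    (hu : ¬ S.Used (!b) u) (a : ℝ) : (S.setMate b v u a).Valid x (M + 1) where
  codeword := hS.codeword
  check := hS.check
  used := fun b' t ht => (used_setMate hv hu a).2.2 b' _ (hS.used b' t ht)
  card_node := (Finset.card_insert_le _ _).trans (Nat.succ_le_succ hS.card_node)
  card_check := fun b => (hS.card_check b).trans (Nat.le_succ _)

lemma ext_setMate {b : Bool} {v u : Fin E.n} (hv : ¬ S.Used b v)
    (hu : ¬ S.Used (!b) u) (a : ℝ) : Ext x S (S.setMate b v u a) ∅ where
  item := by
    rintro ⟨b', s | t⟩ _ ho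
    · exact ⟨(used_setMate hv hu a).2.2 b' _ ho.1, ho.2⟩
    · exact ho
  check := fun _ => subset_rfl
  sign := fun _ _ _ => rfl

open Classical in
lemma card_used_le (S : State E) (b : Bool) :
    (Finset.univ.filter fun v => S.Used b v).card ≤ S.A.card := by
  refine Finset.card_le_card_of_injOn (fun v => fnNode b S.τ v) (fun v hv => ?_) fun v _ w _ h => ?_
  · exact (Finset.mem_filter.1 hv).2
  · cases b
    · simpa [fnNode] using h
    · simpa [fnNode] using h

lemma notMem_of_not_used (hS : S.Valid x M) {b : Bool} {v : Fin E.n} (hv : ¬ S.Used b v)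
    (j : Fin (E.vdeg v)) : S.g b ⟨v, j⟩ ∉ S.R b := by
  intro h
  have := hS.used b _ h
  rw [Equiv.symm_apply_apply] at this
  exact hv this

end State

/-- The swap count for a check socket whose symbol is already known. Positivity of the class also
supplies a graph realizing the outcome, which becomes the new reference. -/
lemma exists_mem_tannerClass_sock {x : Fin E.n → ℤˣ} {g : E.Tanner} {R : Finset E.CSock}
    {Q : Finset (Fin E.m)} [DecidableEq E.CSock] (hg : IsCodeword g x) {t : E.CSock} (htR : t ∉ R)
    (htQ : t.1 ∈ Q) {s : E.VSock} (hs : g s ∉ R) (hxs : x s.1 = signAt x g t) :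
    ∃ g' ∈ tannerClass x g R Q, g'.symm t = s ∧
      (tannerClass x g R Q).card ≤ signCard x (signAt x g t) *
        (tannerClass x g' (insert t R) Q).card := by
  have hB := card_tannerClass_le htR htQ hs hxs
  have hne : ((tannerClass x g R Q).filter fun σ => σ.symm t = s).Nonempty := by
    rw [← Finset.card_pos]
    by_contra h
    rw [Nat.eq_zero_of_not_pos h, mul_zero] at hB
    exact absurd (Finset.card_pos.2 ⟨g, self_mem_tannerClass hg R Q⟩) (by omega)
  obtain ⟨g', hg'⟩ := hne
  rw [Finset.mem_filter] at hg'
  refine ⟨g', hg'.1, hg'.2, ?_⟩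
  rw [← filter_tannerClass hg'.1, hg'.2]
  exact hB

end Degrees

/-! ### Exploring a check socket, and the induction on the depth -/

namespace Degrees

variable {E : Degrees}

/-- A uniformly drawn variable node has degree i and symbol r with asymptotic probability L_i / 2.
Avoiding the few nodes already seen is absorbed in θ. -/
lemma sum_node_le {x : Bool → Fin E.n → ℤˣ} {D M : ℕ} {θ : ℝ≥0∞}
    (hE : Typical lam rho E x D M θ) (hn : E.n ≠ 0) (b : Bool) {U : Finset (Fin E.n)}
    (hU : U.card ≤ M) (h : ℕ → ℤˣ → ℝ≥0∞) :
    θ * ∑ r : ℤˣ, ∑ i ∈ lam.support, (nodeFrac lam i / 2) * h i r ≤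
      ∑ w ∈ Finset.univ.filter (fun w => w ∉ U), (E.n : ℝ≥0∞)⁻¹ * h (E.vdeg w) (x b w) := by
  have hn' : (E.n : ℝ≥0∞) * (E.n : ℝ≥0∞)⁻¹ = 1 :=
    ENNReal.mul_inv_cancel (by simpa using hn) (ENNReal.natCast_ne_top _)
  rw [← Finset.mul_sum, ← Finset.sum_fiberwise _ (fun w => x b w), Finset.mul_sum, Finset.mul_sum]
  refine Finset.sum_le_sum fun r _ => ?_
  rw [Finset.filter_filter]
  calc θ * ∑ i ∈ lam.support, nodeFrac lam i / 2 * h i r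
      = (E.n : ℝ≥0∞)⁻¹ * ∑ i ∈ lam.support, (θ * (nodeFrac lam i / 2) * E.n) * h i r := by
        rw [Finset.mul_sum, Finset.mul_sum]
        refine Finset.sum_congr rfl fun i _ => ?_
        calc θ * (nodeFrac lam i / 2 * h i r)
            = θ * (nodeFrac lam i / 2 * h i r) * ((E.n : ℝ≥0∞) * (E.n : ℝ≥0∞)⁻¹) := by
              rw [hn', mul_one]
          _ = _ := by ring
    _ ≤ (E.n : ℝ≥0∞)⁻¹ * ∑ i ∈ lam.support, (((Finset.univ.filter fun w => w ∉ U ∧ x b w = r).filter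
          fun w => E.vdeg w = i).card : ℝ≥0∞) * h i r := by
        gcongr with i hi
        exact hE.node b r U hU i hi
    _ ≤ (E.n : ℝ≥0∞)⁻¹ * ∑ w ∈ Finset.univ.filter (fun w => w ∉ U ∧ x b w = r),
          h (E.vdeg w) r := by
        gcongr
        exact sum_card_mul_le _ E.vdeg lam.support fun i => h i r
    _ = _ := by
        congr 1
        exact Finset.sum_congr rfl fun w hw => by rw [(Finset.mem_filter.1 hw).2.2]

/-- The edge version: among the sockets with a fixed symbol the node degree follows λ, because a
node of degree i owns i sockets. -/
lemma sum_sock_le {x : Bool → Fin E.n → ℤˣ} {D M : ℕ} {θ : ℝ≥0∞}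
    (hE : Typical lam rho E x D M θ) (b : Bool) (ε : ℤˣ) (hN : signCard (x b) ε ≠ 0)
    {U : Finset (Fin E.n)} (hU : U.card ≤ M) (h : ℕ → ℝ≥0∞) :
    θ * ∑ i ∈ lam.support, lam i * h i ≤
      ∑ s ∈ Finset.univ.filter (fun s : E.VSock => s.1 ∉ U ∧ x b s.1 = ε),
        (signCard (x b) ε : ℝ≥0∞)⁻¹ * h (E.vdeg s.1) := by
  have hn' : (signCard (x b) ε : ℝ≥0∞) * (signCard (x b) ε : ℝ≥0∞)⁻¹ = 1 :=
    ENNReal.mul_inv_cancel (by simpa using hN) (ENNReal.natCast_ne_top _)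
  rw [← Finset.mul_sum]
  calc θ * ∑ i ∈ lam.support, lam i * h i
      = (signCard (x b) ε : ℝ≥0∞)⁻¹ *
          ∑ i ∈ lam.support, (θ * lam i * signCard (x b) ε) * h i := by
        rw [Finset.mul_sum, Finset.mul_sum]
        refine Finset.sum_congr rfl fun i _ => ?_
        calc θ * (lam i * h i)
            = θ * (lam i * h i) * ((signCard (x b) ε : ℝ≥0∞) * (signCard (x b) ε : ℝ≥0∞)⁻¹) := by
              rw [hn', mul_one]
          _ = _ := by ring
    _ ≤ (signCard (x b) ε : ℝ≥0∞)⁻¹ * ∑ i ∈ lam.support,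
          (((Finset.univ.filter fun s : E.VSock => s.1 ∉ U ∧ x b s.1 = ε).filter
            fun s => E.vdeg s.1 = i).card : ℝ≥0∞) * h i := by
        gcongr with i hi
        exact hE.sock b ε U hU i hi
    _ ≤ _ := by
        gcongr
        exact sum_card_mul_le _ (fun s : E.VSock => E.vdeg s.1) lam.support h

/-- Exploring a check socket: its variable node, the function node there and the subtrees. -/
theorem simIntoCheck_succ {A α : ℝ} {x : Bool → Fin E.n → ℤˣ} {D M : ℕ} {θ : ℝ≥0∞}
    (hθ1 : θ ≤ 1) {l C e : ℕ} (hd : IsDegreePair lam rho)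
    (hE : Typical lam rho E x D M θ) (h : SimIntoVar lam rho A α E x M θ l C e) :
    SimIntoCheck lam rho A α E x M θ (l + 1) (1 + 2 * D * C) (2 + 2 * D * e) := by
  classical
  intro S M' b t hS hM ho H c hH hc hb
  have hθt : θ ≠ ∞ := ne_top_of_le_ne_top ENNReal.one_ne_top hθ1
  have hn : E.n ≠ 0 := by
    have := ((S.g b).symm t).1.pos
    omega
  obtain ⟨htQ, htR⟩ : t.1 ∈ S.Q b ∧ t ∉ S.R b := ho
  set ν := rhoOp rho (deSeq A α lam rho l b)
  set ν' := rhoOp rho (deSeq A α lam rho l !b)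
  have hν : IsSymm ν := (isSymm_deSeq hd A α l b).rhoOp hd
  have hν' : IsSymm ν' := (isSymm_deSeq hd A α l !b).rhoOp hd
  set ε := signAt (x b) (S.g b) t with hε
  have hN0 : signCard (x b) ε ≠ 0 := signCard_ne_zero (x b) ((S.g b).symm t)
  set K : ℕ → ℕ → ℤˣ → ℝ≥0∞ := fun i i' r =>
    ∫⁻ a, ∫⁻ m, c m ∂(branchLaw A α b ε r ν' ν i i' a) ∂(gaussianReal 0 1)
  set U : Bool → Finset (Fin E.n) := fun b => Finset.univ.filter fun v => S.Used b v
  have hUc : ∀ b, (U b).card ≤ M := fun b =>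
    (S.card_used_le b).trans (hS.card_node.trans (by omega))
  have hU : ∀ b v, v ∉ U b ↔ ¬ S.Used b v := fun b v => by simp [U]
  set O := Finset.univ.filter fun s : E.VSock => s.1 ∉ U b ∧ x b s.1 = ε
  set f : E.Conf → (Fin E.n → ℝ) → EReal := fun ω z =>
    userMsg A α x (l + 1) b ω z ((ω.1 b).symm t)
  have hfm : ∀ ω, Measurable fun z => H (f ω z) ω z := fun ω =>
    (hH ω).comp ((measurable_userMsg A α x (l + 1) b ω _).prodMk measurable_id)
  have hex : ∀ s : E.VSock, ∃ g', s ∈ O →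
      g' ∈ tannerClass (x b) (S.g b) (S.R b) (S.Q b) ∧ g'.symm t = s ∧
      (tannerClass (x b) (S.g b) (S.R b) (S.Q b)).card ≤ signCard (x b) ε *
        (tannerClass (x b) g' (insert t (S.R b)) (S.Q b)).card := by
    intro s
    by_cases hs : s ∈ O
    · obtain ⟨-, h1, h2⟩ := Finset.mem_filter.1 hs
      obtain ⟨g', h⟩ := exists_mem_tannerClass_sock (hS.codeword b) htR htQ
        (State.notMem_of_not_used hS ((hU b s.1).1 h1) s.2) h2
      exact ⟨g', fun _ => h⟩
    · exact ⟨S.g b, fun h => absurd h hs⟩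
  choose g' hg' using hex
  have hreveal := State.sum_mean_setUser_le (S := S) (x := x) b O g'
    (fun _ => insert t (S.R b)) (fun _ => S.Q b) (fun _ => (signCard (x b) ε : ℝ≥0∞)⁻¹)
    (fun s hs => (hg' s hs).1) (fun _ _ => Finset.subset_insert _ _) (fun _ _ => subset_rfl) ?_ ?_
    (fun ω z => H (f ω z) ω z)
  rotate_left
  · intro s hs s' hs' hne
    rw [Function.onFun, Finset.disjoint_left]
    intro σ hσ hσ'
    rw [mem_tannerClass] at hσ hσ'
    apply hne
    rw [← (hg' s hs).2.1, ← (hg' s' hs').2.1, ← hσ.2.1 t (Finset.mem_insert_self _ _),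
      ← hσ'.2.1 t (Finset.mem_insert_self _ _)]
  · intro s hs
    rw [mul_comm, ← div_eq_mul_inv, ENNReal.div_le_iff (by simpa using hN0)
      (ENNReal.natCast_ne_top _), mul_comm]
    exact_mod_cast (hg' s hs).2.2
  refine le_trans ?_ hreveal
  have hsub : ∀ s ∈ O, ∀ u, u ∉ U (!b) → ∀ a : ℝ,
      θ ^ (2 * D * e) * ∫⁻ m, c m ∂(branchLaw A α b ε (x (!b) u) ν' ν (E.vdeg s.1) (E.vdeg u) a) ≤
      ((S.setUser b (g' s) (insert t (S.R b)) (S.Q b)).setMate b s.1 u a).mean x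
        fun ω z => H (f ω z) ω z := by
    intro s hs u hu a
    obtain ⟨-, hsU, hsε⟩ := Finset.mem_filter.1 hs
    obtain ⟨h1, h2, -⟩ := hg' s hs
    rw [hU] at hsU hu
    set S₁ := S.setMate b s.1 u a with hS₁
    set S₂ := S₁.setUser b (g' s) (insert t (S.R b)) (S.Q b) with hS₂
    -- The two revelations commute. Validity is easier in the other order, since a known edge must
    -- end at a variable node whose function node has been seen.
    have hcomm : (S.setUser b (g' s) (insert t (S.R b)) (S.Q b)).setMate b s.1 u a = S₂ := rfl
    rw [hcomm]
    have hu₁ := State.used_setMate hsU hu a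
    have hv₁ : S₁.Valid x (M' + 1) := State.valid_setMate hS hsU hu a
    have hv₂ : S₂.Valid x (M' + 1) := State.valid_setUser (t := t) hv₁ h1 (by rw [h2]; exact hu₁.1)
      subset_rfl htQ ((hS.card_check b).trans (by omega)) le_rfl
    have he₂ : State.Ext x S S₂ {(b, Sum.inr t)} := by
      have := (State.ext_setMate (x := x) hsU hu a).trans
        (State.ext_setUser (x := x) (S := S₁) (t := t) h1 subset_rfl)
      rw [h2] at this
      refine this.mono ?_
      rintro y (h' | rfl | rfl) hy
      · exact absurd h' (Set.notMem_empty y)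
      · exact absurd hy.1 hsU
      · rfl
    have hgb : S₂.g b = g' s := Function.update_self ..
    have hRb : S₂.R b = insert t (S.R b) := Function.update_self ..
    have hgb' : S₂.g (!b) = S.g (!b) := Function.update_of_ne (by simp) ..
    have hRb' : S₂.R (!b) = S.R (!b) := Function.update_of_ne (by simp) ..
    have hmate := State.mate_setMate hsU hu a
    have key := sim_varMsg (s := s) (u := u) hθ1 hd hE.vdeg_le h hv₂ (by omega) hmate.1 hu₁.1
      (fun j hj => ⟨hu₁.1, by
        rw [hgb, hRb, Finset.mem_insert, not_or]
        refine ⟨fun h' => hj ?_, State.apply_notMem_of_mem_tannerClass h1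
          (State.notMem_of_not_used hS hsU j)⟩
        rw [← h', Equiv.symm_apply_apply] at h2
        have h3 : (⟨s.1, j⟩ : E.VSock) = ⟨s.1, s.2⟩ := h2
        exact eq_of_heq (Sigma.mk.inj h3).2⟩)
      (fun j => ⟨hu₁.2.1, by rw [hgb', hRb']; exact State.notMem_of_not_used hS hu j⟩)
      (y := chMean A α (inp b ε (x (!b) u)) + a) (by
        rw [hsε]
        change _ + Function.update S.z (if b then s.1 else u) a (fnNode b S₁.τ s.1) = _
        rw [hmate.2, Function.update_self])
    rw [hsε] at key
    have key' := key.congr (f' := f) fun ω hω z _ => by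
      have h3 := (mem_tannerClass.1 ((State.mem_confs.1 hω).1 b)).2.1 t
        (by rw [hRb]; exact Finset.mem_insert_self _ _)
      rw [hgb, h2] at h3
      simp only [f]
      rw [h3]
    have := key' H c hH hc (fun S'' hS'' he m => ?_)
    · rwa [lintegral_smul_measure] at this
    · refine hb S'' (hS''.mono (by omega)) ((he₂.trans he).mono ?_) m
      rintro y (h' | ⟨j, -, rfl⟩ | ⟨j, rfl⟩) hy
      · exact h'
      · exact absurd hy.1 hsU
      · exact absurd hy.1 hu
  have hsub2 : ∀ s ∈ O, θ ^ (2 * D * e) * (θ * ∑ r : ℤˣ, ∑ i' ∈ lam.support,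
      (nodeFrac lam i' / 2) * K (E.vdeg s.1) i' r) ≤
      (S.setUser b (g' s) (insert t (S.R b)) (S.Q b)).mean x fun ω z => H (f ω z) ω z := by
    intro s hs
    obtain ⟨-, hsU, hsε⟩ := Finset.mem_filter.1 hs
    refine le_trans ?_ (State.sum_mean_setMate_le (x := x) b s.1
      (Finset.univ.filter fun u => u ∉ U (!b))
      (S := S.setUser b (g' s) (insert t (S.R b)) (S.Q b)) ((hU b s.1).1 hsU)
      (fun u hu => (hU (!b) u).1 (Finset.mem_filter.1 hu).2) hfm)
    calc θ ^ (2 * D * e) * (θ * ∑ r : ℤˣ, ∑ i' ∈ lam.support,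
          (nodeFrac lam i' / 2) * K (E.vdeg s.1) i' r)
        ≤ θ ^ (2 * D * e) * ∑ u ∈ Finset.univ.filter (fun u => u ∉ U (!b)),
          (E.n : ℝ≥0∞)⁻¹ * K (E.vdeg s.1) (E.vdeg u) (x (!b) u) := by
          gcongr
          exact sum_node_le hE hn (!b) (hUc !b) fun i' r => K (E.vdeg s.1) i' r
      _ = ∑ u ∈ Finset.univ.filter (fun u => u ∉ U (!b)),
          (E.n : ℝ≥0∞)⁻¹ * (θ ^ (2 * D * e) * K (E.vdeg s.1) (E.vdeg u) (x (!b) u)) := by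
          rw [Finset.mul_sum]
          exact Finset.sum_congr rfl fun u _ => mul_left_comm _ _ _
      _ ≤ _ := by
          refine Finset.sum_le_sum fun u hu => ?_
          gcongr
          simp only [K]
          rw [← lintegral_const_mul' _ _ (ENNReal.pow_ne_top hθt)]
          exact lintegral_mono fun a => hsub s hs u (Finset.mem_filter.1 hu).2 a
  have hlaw := lintegral_deNext (A := A) (α := α) (b := b) (ε := ε) hν' hν hd hc
  rw [lintegral_smul_measure, smul_eq_mul]
  change θ ^ (2 + 2 * D * e) *
    ∫⁻ m, c m ∂(reflect ε (varConv (fLaw A α b 1 (nodeOp lam ν')) (lamOp lam ν))) ≤ _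
  rw [hlaw]
  set L : ℕ → ℝ≥0∞ := fun i => ∑ r : ℤˣ, ∑ i' ∈ lam.support, (nodeFrac lam i' / 2) * K i i' r
  -- One θ pays for the socket partner, one for the mate, and θ^(2De) for the subtrees at the two
  -- variable nodes.
  calc θ ^ (2 + 2 * D * e) * ∑ i ∈ lam.support, lam i * L i
      = θ ^ (1 + 2 * D * e) * (θ * ∑ i ∈ lam.support, lam i * L i) := by
        rw [show 2 + 2 * D * e = 1 + 2 * D * e + 1 by ring, pow_succ, mul_assoc]
    _ ≤ θ ^ (1 + 2 * D * e) * ∑ s ∈ O, (signCard (x b) ε : ℝ≥0∞)⁻¹ * L (E.vdeg s.1) := by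
        gcongr
        exact sum_sock_le hE b ε hN0 (hUc b) L
    _ = ∑ s ∈ O, (signCard (x b) ε : ℝ≥0∞)⁻¹ * (θ ^ (2 * D * e) * (θ * L (E.vdeg s.1))) := by
        rw [Finset.mul_sum]
        refine Finset.sum_congr rfl fun s _ => ?_
        rw [pow_add, pow_one]
        ring
    _ ≤ _ := by
        refine Finset.sum_le_sum fun s hs => ?_
        gcongr
        exact hsub2 s hs

/-- The number of nodes explored in the computation of a message of depth `l`. -/
def depthCost (D : ℕ) : ℕ → ℕ
  | 0 => 0
  | l + 1 => 2 + 2 * D * (2 + D * depthCost D l)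

lemma SimIntoCheck.mono_cost {A α : ℝ} {x : Bool → Fin E.n → ℤˣ} {M : ℕ} {θ : ℝ≥0∞} (hθ1 : θ ≤ 1)
    {l C e C' e' : ℕ} (h : SimIntoCheck lam rho A α E x M θ l C e) (hC : C ≤ C') (he : e ≤ e') :
    SimIntoCheck lam rho A α E x M θ l C' e' := by
  intro S M' b t hS hM ho
  refine (h S M' b t hS (by omega) ho).mono (Measure.le_iff.2 fun B _ => ?_) (by omega)
    fun _ hy _ => hy
  rw [Measure.smul_apply, Measure.smul_apply, smul_eq_mul, smul_eq_mul]
  exact mul_le_mul_left (pow_le_pow_right_of_le_one' hθ1 he) _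

lemma SimIntoVar.mono_cost {A α : ℝ} {x : Bool → Fin E.n → ℤˣ} {M : ℕ} {θ : ℝ≥0∞} (hθ1 : θ ≤ 1)
    {l C e C' e' : ℕ} (h : SimIntoVar lam rho A α E x M θ l C e) (hC : C ≤ C') (he : e ≤ e') :
    SimIntoVar lam rho A α E x M θ l C' e' := by
  intro S M' b t hS hM ho
  refine (h S M' b t hS (by omega) ho).mono (Measure.le_iff.2 fun B _ => ?_) (by omega)
    fun _ hy _ => hy
  rw [Measure.smul_apply, Measure.smul_apply, smul_eq_mul, smul_eq_mul]
  exact mul_le_mul_left (pow_le_pow_right_of_le_one' hθ1 he) _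

/-- Checks and variable nodes alternate in an induction on the depth. A single number bounds both
the nodes seen and the exponent of θ, and it does not depend on the block length. -/
theorem simIntoVar {A α : ℝ} {x : Bool → Fin E.n → ℤˣ} {D M : ℕ} {θ : ℝ≥0∞}
    (hθ0 : θ ≠ 0) (hθ1 : θ ≤ 1) (hd : IsDegreePair lam rho)
    (hE : Typical lam rho E x D M θ) (l : ℕ) :
    SimIntoVar lam rho A α E x M θ l (2 + D * depthCost D l) (2 + D * depthCost D l) := by
  have h : SimIntoCheck lam rho A α E x M θ l (depthCost D l) (depthCost D l) := by
    induction l with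
    | zero => exact simIntoCheck_zero A α x M θ
    | succ l ih =>
      exact (simIntoCheck_succ hθ1 hd hE ((simIntoVar_of_simIntoCheck hθ0 hθ1 hd hE ih).mono_cost
        (C' := 2 + D * depthCost D l) hθ1 (by omega) le_rfl)).mono_cost hθ1
          (by rw [depthCost]; omega) le_rfl
  exact (simIntoVar_of_simIntoCheck hθ0 hθ1 hd hE h).mono_cost hθ1 (by omega) le_rfl

end Degrees

/-! ### The root of the exploration -/

lemma lintegral_F {a b : Measure EReal} (hd : IsDegreePair lam rho) (ha : IsSymm a) (hb : IsSymm b)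
    (p : Input) {c : EReal × EReal → ℝ≥0∞} (hc : Measurable c) :
    ∫⁻ m, c m ∂(F lam rho p a b) = ∑ i ∈ lam.support, (nodeFrac lam i : ℝ≥0∞) *
      ∑ i' ∈ lam.support, (nodeFrac lam i' : ℝ≥0∞) *
        ∫⁻ m, c m ∂((reflect p.1 (varPow (rhoOp rho a) i)).prod
          (reflect p.2 (varPow (rhoOp rho b) i'))) := by
  have h1 := (ha.rhoOp hd).prob
  have h2 := (hb.rhoOp hd).prob
  have h3 := (hb.varToFun hd).prob
  rw [F, lintegral_prod _ hc.aemeasurable, varToFun, nodeOp, reflect_sum]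
  simp only [reflect_smul]
  rw [lintegral_finsetSum_measure]
  refine Finset.sum_congr rfl fun i _ => ?_
  rw [lintegral_smul_measure]
  change (nodeFrac lam i : ℝ≥0∞) * _ = _
  congr 1
  have h4 : ∀ u, ∫⁻ v, c (u, v) ∂(reflect p.2 (varToFun lam rho b)) =
      ∑ i' ∈ lam.support, (nodeFrac lam i' : ℝ≥0∞) *
        ∫⁻ v, c (u, v) ∂(reflect p.2 (varPow (rhoOp rho b) i')) := by
    intro u
    rw [varToFun, nodeOp, reflect_sum]
    simp only [reflect_smul]
    rw [lintegral_finsetSum_measure]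
    exact Finset.sum_congr rfl fun i' _ => lintegral_smul_measure ..
  simp only [h4]
  rw [lintegral_finsetSum _ fun i' _ => hc.lintegral_prod_right'.const_mul _]
  refine Finset.sum_congr rfl fun i' _ => ?_
  rw [lintegral_const_mul _ hc.lintegral_prod_right', lintegral_prod _ hc.aemeasurable]

namespace Degrees

variable {E : Degrees}

/-- The state in which nothing has been seen. -/
def initState (g : Bool → E.Tanner) : State E where
  g := g
  τ := Equiv.refl _
  z := 0
  R := fun _ => ∅
  Q := fun _ => ∅
  A := ∅

lemma mem_confs_initState {x : Bool → Fin E.n → ℤˣ} {g : Bool → E.Tanner} {ω : E.Conf} :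
    ω ∈ (initState g).confs x ↔ ∀ b, IsCodeword (ω.1 b) (x b) := by
  simp [State.mem_confs, initState, mem_tannerClass, State.mem_perms]

open Classical in
lemma sum_sample (x : Bool → Fin E.n → ℤˣ) (g : Bool → E.Tanner)
    {M : Type*} [AddCommMonoid M] (f : E.Conf → Fin E.n → M) :
    ∑ s : Sample (x true) (x false), f (fun b => if b then s.1.1 else s.2.1.1, s.2.2.1) s.2.2.2 =
      ∑ i, ∑ ω ∈ (initState g).confs x, f ω i := by
  rw [Finset.sum_comm, ← Finset.sum_product']
  refine Finset.sum_bij' (fun s _ => ((fun b => if b then s.1.1 else s.2.1.1, s.2.2.1), s.2.2.2))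
    (fun q hq => (⟨q.1.1 true, ?_⟩, ⟨q.1.1 false, ?_⟩, q.1.2, q.2)) ?_ ?_ ?_ ?_ ?_
  · exact mem_confs_initState.1 (Finset.mem_product.1 hq).1 true
  · exact mem_confs_initState.1 (Finset.mem_product.1 hq).1 false
  · intro s _
    refine Finset.mem_product.2 ⟨mem_confs_initState.2 fun b => ?_, Finset.mem_univ _⟩
    cases b
    · exact s.2.1.2
    · exact s.1.2
  · intro q _
    exact Finset.mem_univ _
  · intro s _
    rfl
  · intro q _
    refine Prod.ext (Prod.ext (funext fun b => ?_) rfl) rfl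
    cases b <;> rfl
  · intro s _
    rfl

lemma sum_node_sign_le {x : Bool → Fin E.n → ℤˣ} {D M : ℕ} {θ : ℝ≥0∞}
    (hE : Typical lam rho E x D M θ) (hn : E.n ≠ 0) (b : Bool) (r : ℤˣ) (h : ℕ → ℝ≥0∞) :
    θ * ∑ i ∈ lam.support, (nodeFrac lam i / 2) * h i ≤
      ∑ w ∈ Finset.univ.filter (fun w => x b w = r), (E.n : ℝ≥0∞)⁻¹ * h (E.vdeg w) := by
  have := sum_node_le hE hn b (U := ∅) (by simp) fun i r' => if r' = r then h i else 0
  rw [Finset.sum_comm] at this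
  simpa [mul_ite, Finset.sum_filter, Int.units_eq_one_or r] using this

/-- The two variable nodes at the root are explored one after the other. Since the second simulation
starts from whatever state the first one reaches, the joint law dominates a product. -/
lemma sim_root {A α : ℝ} {x : Bool → Fin E.n → ℤˣ} {D M : ℕ} {θ : ℝ≥0∞}
    (hθ0 : θ ≠ 0) (hθ1 : θ ≤ 1) (hd : IsDegreePair lam rho) (hE : Typical lam rho E x D M θ)
    (l : ℕ) (hM : 1 + 2 * D * (2 + D * depthCost D l) ≤ M) {g : Bool → E.Tanner}
    (hg : ∀ b, IsCodeword (g b) (x b)) (i w : Fin E.n) (a : ℝ) :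
    State.Sim x ((initState g).setMate true i w a) M Set.univ
      (fun ω z => (toFunMsg (ω.1 true) (userMsg A α x l true ω z) i,
        toFunMsg (ω.1 false) (userMsg A α x l false ω z) (ω.2 i)))
      (θ ^ (2 * D * (2 + D * depthCost D l)) •
        (reflect (x true i) (varPow (rhoOp rho (deSeq A α lam rho l true)) (E.vdeg i))).prod
          (reflect (x false w) (varPow (rhoOp rho (deSeq A α lam rho l false)) (E.vdeg w)))) := by
  set C := 2 + D * depthCost D l
  have hθ : θ ≠ ∞ := ne_top_of_le_ne_top ENNReal.one_ne_top hθ1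
  have hp1 : IsProbabilityMeasure (rhoOp rho (deSeq A α lam rho l true)) :=
    ((isSymm_deSeq hd A α l true).rhoOp hd).prob
  have hp2 : IsProbabilityMeasure (rhoOp rho (deSeq A α lam rho l false)) :=
    ((isSymm_deSeq hd A α l false).rhoOp hd).prob
  have h : SimIntoVar lam rho A α E x M θ l C C := simIntoVar hθ0 hθ1 hd hE l
  have hu : ∀ b v, ¬ (initState g).Used b v := fun b v hv => Finset.notMem_empty _ hv
  have hS₀ : (initState g).Valid x 0 := by
    refine ⟨hg, ?_, ?_, le_rfl, fun b => le_rfl⟩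
    · intro b t ht; exact absurd ht (Finset.notMem_empty t)
    · intro b t ht; exact absurd ht (Finset.notMem_empty t)
  have hS := State.valid_setMate hS₀ (hu true i) (hu (!true) w) a
  have hused := State.used_setMate (hu true i) (hu (!true) w) a
  set S := (initState g).setMate true i w a
  have hnot : ∀ b (s : E.VSock), S.g b s ∉ S.R b := fun b s => Finset.notMem_empty _
  have hDi : E.vdeg i * C ≤ D * C := Nat.mul_le_mul_right _ (hE.vdeg_le i)
  have hDw : E.vdeg w * C ≤ D * C := Nat.mul_le_mul_right _ (hE.vdeg_le w)
  have h2D : 2 * D * C = D * C + D * C := by ring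
  have hci : (Finset.univ : Finset (Fin (E.vdeg i))).card = E.vdeg i := by simp
  have hcw : (Finset.univ : Finset (Fin (E.vdeg w))).card = E.vdeg w := by simp
  have h1 := sim_sum_checkMsg hθ hd h (b := true) (v := i) Finset.univ hS (by rw [hci]; omega)
    fun j _ => ⟨hused.1, hnot true _⟩
  have hfin : IsFiniteMeasure ((θ ^ C) ^ (Finset.univ : Finset (Fin (E.vdeg w))).card •
      reflect (x false w) (varPow (rhoOp rho (deSeq A α lam rho l false))
        (Finset.univ : Finset (Fin (E.vdeg w))).card)) := by
    refine ⟨?_⟩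
    rw [Measure.smul_apply, smul_eq_mul]
    exact ENNReal.mul_lt_top (lt_top_iff_ne_top.2 (ENNReal.pow_ne_top (ENNReal.pow_ne_top hθ)))
      (measure_lt_top _ _)
  have h2 := h1.bind (M' := 0 + 1 + E.vdeg i * C + E.vdeg w * C)
    (φ := fun a b => (a, b)) (by fun_prop) (fun S' hS' he => by
      have := sim_sum_checkMsg hθ hd h (b := false) (v := w) Finset.univ
        hS' (by rw [hci, hcw]; omega) fun j hj => he.item _ (by
          rintro ⟨j', -, hj'⟩
          simp at hj') ⟨hused.2.1, hnot false _⟩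
      refine this.mono le_rfl ?_ fun _ hy _ => hy
      rw [hci, hcw]) fun ω => Finset.measurable_sum _ fun j _ =>
        measurable_checkMsg _ (fun e => measurable_userMsg A α x l false ω e) _
  rw [hci, hcw] at h2
  refine (h2.mono ?_ (by omega) fun _ _ _ => Set.mem_univ _).congr fun ω hω z hz => ?_
  · rw [Measure.prod_smul_left, Measure.prod_smul_right, smul_smul,
      ← pow_mul, ← pow_mul, ← pow_add]
    change _ ≤ Measure.map (fun p => p) _
    rw [Measure.map_id']
    refine Measure.le_iff.2 fun B _ => ?_
    rw [Measure.smul_apply, Measure.smul_apply, smul_eq_mul, smul_eq_mul]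
    refine mul_le_mul_left ?_ _
    refine pow_le_pow_right_of_le_one' hθ1 ?_
    rw [← mul_add, mul_comm]
    refine Nat.mul_le_mul_right _ ?_
    have := hE.vdeg_le i
    have := hE.vdeg_le w
    omega
  · have hτ := State.mem_perms.1 (State.mem_confs.1 hω).2 i (Finset.mem_insert_self _ _)
    have hw := (State.setMate_τ true (hu true i) (hu (!true) w) a).2
    simp only [if_true] at hw
    rw [hτ, hw]
    rfl

open Classical in
/-- The joint law of the input and the extrinsic estimate at a random function node is at least
its limit, up to a factor. -/
theorem lintegral_F_le {A α : ℝ} {x : Bool → Fin E.n → ℤˣ} {D M : ℕ} {θ : ℝ≥0∞}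
    (hθ0 : θ ≠ 0) (hθ1 : θ ≤ 1) (hd : IsDegreePair lam rho) (hE : Typical lam rho E x D M θ)
    (hn : E.n ≠ 0) (l : ℕ) (hM : 1 + 2 * D * (2 + D * depthCost D l) ≤ M)
    (hx : ∀ b, ∃ σ : E.Tanner, IsCodeword σ (x b)) (p : Input) {c : EReal × EReal → ℝ≥0∞}
    (hc : Measurable c) :
    θ ^ (2 + 2 * D * (2 + D * depthCost D l)) / 4 *
      ∫⁻ m, c m ∂(F lam rho p (deIter A α lam rho l).1 (deIter A α lam rho l).2) ≤
    (Fintype.card (Sample (x true) (x false)) : ℝ≥0∞)⁻¹ *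
      ∑ s ∈ samplesWith (x true) (x false) p, ∫⁻ z, c (extrinsic A α s.1.1 s.2.1.1 s.2.2.1
        (received A α (x true) (x false) s.2.2.1 z) l s.2.2.2) ∂(noise E.n) := by
  classical
  choose g hg using hx
  have hθ : θ ≠ ∞ := ne_top_of_le_ne_top ENNReal.one_ne_top hθ1
  set e := 2 * D * (2 + D * depthCost D l)
  set S₀ := initState g
  set a := deSeq A α lam rho l true
  set b := deSeq A α lam rho l false
  set f : E.Conf → (Fin E.n → ℝ) → Fin E.n → EReal × EReal := fun ω z i =>
    (toFunMsg (ω.1 true) (userMsg A α x l true ω z) i,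
      toFunMsg (ω.1 false) (userMsg A α x l false ω z) (ω.2 i))
  set G : Fin E.n → E.Conf → (Fin E.n → ℝ) → ℝ≥0∞ := fun i ω z =>
    if inputAt (x true) (x false) ω.2 i = p then c (f ω z i) else 0
  have hfm : ∀ ω i, Measurable fun z => f ω z i := fun ω i =>
    (measurable_toFunMsg _ (fun e => measurable_userMsg A α x l true ω e) i).prodMk
      (measurable_toFunMsg _ (fun e => measurable_userMsg A α x l false ω e) (ω.2 i))
  have hGm : ∀ i ω, Measurable (G i ω) := by
    intro i ω
    by_cases h : inputAt (x true) (x false) ω.2 i = p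
    · simp only [G, if_pos h]; exact hc.comp (hfm ω i)
    · simp only [G, if_neg h]; exact measurable_const
  have hconf : (S₀.confs x).Nonempty := ⟨(g, 1), mem_confs_initState.2 hg⟩
  have hcard : (Fintype.card (Sample (x true) (x false)) : ℝ≥0∞) =
      E.n * ((S₀.confs x).card : ℝ≥0∞) := by
    have := sum_sample x g (fun _ _ => (1 : ℕ))
    simp only [Finset.sum_const, Finset.card_univ, smul_eq_mul, mul_one, Fintype.card_fin] at this
    exact_mod_cast this
  have hsum : ∑ s ∈ samplesWith (x true) (x false) p, ∫⁻ z, c (extrinsic A α s.1.1 s.2.1.1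
        s.2.2.1 (received A α (x true) (x false) s.2.2.1 z) l s.2.2.2) ∂(noise E.n) =
      ∑ i, ∑ ω ∈ S₀.confs x, ∫⁻ z, G i ω z ∂(noise E.n) := by
    rw [← sum_sample x g (fun ω i => ∫⁻ z, G i ω z ∂(noise E.n)), samplesWith, Finset.sum_filter]
    refine Finset.sum_congr rfl fun s _ => ?_
    by_cases h : inputAt (x true) (x false) s.2.2.1 s.2.2.2 = p
    · rw [if_pos h]
      simp only [G, if_pos h]
      refine lintegral_congr fun z => ?_
      have := bpMsg_eq A α x (fun b => if b then s.1.1 else s.2.1.1, s.2.2.1) z l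
      simp only [if_true, Bool.false_eq_true, if_false] at this
      rw [extrinsic, this]
      rfl
    · rw [if_neg h]
      simp only [G, if_neg h, lintegral_zero]
  have hmean : (Fintype.card (Sample (x true) (x false)) : ℝ≥0∞)⁻¹ *
      ∑ s ∈ samplesWith (x true) (x false) p, ∫⁻ z, c (extrinsic A α s.1.1 s.2.1.1
        s.2.2.1 (received A α (x true) (x false) s.2.2.1 z) l s.2.2.2) ∂(noise E.n) =
      ∑ i, (E.n : ℝ≥0∞)⁻¹ * S₀.mean x (G i) := by
    rw [hsum, hcard, ENNReal.mul_inv (Or.inl (by simpa using hn))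
      (Or.inl (ENNReal.natCast_ne_top _)), mul_assoc, Finset.mul_sum, Finset.mul_sum]
    refine Finset.sum_congr rfl fun i _ => ?_
    rw [State.mean, avg]
    have hfill : ∀ ζ, S₀.fill ζ = ζ := fun ζ => funext fun j =>
      if_neg (Finset.notMem_empty j)
    simp only [hfill]
  rw [hmean]
  have hu : ∀ b v, ¬ S₀.Used b v := fun b v hv => Finset.notMem_empty _ hv
  set J : ℕ → ℕ → ℝ≥0∞ := fun i i' => ∫⁻ m, c m ∂((reflect p.1 (varPow (rhoOp rho a) i)).prod
    (reflect p.2 (varPow (rhoOp rho b) i')))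
  -- Once the two variable nodes at the root are known, so is the channel input, and only the
  -- messages remain to be simulated.
  have hstep : ∀ i w, x true i = p.1 → x false w = p.2 → ∀ y : ℝ,
      θ ^ e * J (E.vdeg i) (E.vdeg w) ≤ (S₀.setMate true i w y).mean x (G i) := by
    intro i w hi hw y
    have hsim := sim_root (A := A) (α := α) hθ0 hθ1 hd hE l hM hg i w y
    have := hsim (fun m _ _ => c m) c (fun ω => hc.comp measurable_fst) hc (fun S' hS' _ m => ?_)
    · rw [lintegral_smul_measure, hi, hw] at this
      refine this.trans_eq (State.mean_congr fun ω hω z _ => ?_)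
      have hτ := State.mem_perms.1 (State.mem_confs.1 hω).2 i (Finset.mem_insert_self _ _)
      have hw' := (State.setMate_τ true (hu true i) (hu (!true) w) y).2
      simp only [if_true] at hw'
      have hin : inputAt (x true) (x false) ω.2 i = p := by
        rw [inputAt, hτ]
        refine Prod.ext hi ?_
        change x false _ = _
        rw [← hw]
        exact congr_arg _ hw'
      simp only [G, if_pos hin]
      rfl
    · have hprob : IsProbabilityMeasure (noise E.n) := by unfold noise; infer_instance
      rw [State.mean]
      simp only [lintegral_const, measure_univ, mul_one]
      rw [avg_const hS'.nonempty_confs]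
  have hnode : ∀ i, x true i = p.1 → θ ^ e * (θ * ∑ i' ∈ lam.support,
      (nodeFrac lam i' / 2) * J (E.vdeg i) i') ≤ S₀.mean x (G i) := by
    intro i hi
    refine le_trans ?_ (State.sum_mean_setMate_le (x := x) true i
      (Finset.univ.filter fun w => x false w = p.2) (hu true i) (fun w _ => hu (!true) w) (hGm i))
    calc θ ^ e * (θ * ∑ i' ∈ lam.support, (nodeFrac lam i' / 2) * J (E.vdeg i) i')
        ≤ θ ^ e * ∑ w ∈ Finset.univ.filter (fun w => x false w = p.2),
            (E.n : ℝ≥0∞)⁻¹ * J (E.vdeg i) (E.vdeg w) := by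
          gcongr
          exact sum_node_sign_le hE hn false p.2 fun i' => J (E.vdeg i) i'
      _ = ∑ w ∈ Finset.univ.filter (fun w => x false w = p.2),
            (E.n : ℝ≥0∞)⁻¹ * (θ ^ e * J (E.vdeg i) (E.vdeg w)) := by
          rw [Finset.mul_sum]
          exact Finset.sum_congr rfl fun w _ => mul_left_comm _ _ _
      _ ≤ _ := by
          refine Finset.sum_le_sum fun w hw => ?_
          gcongr
          calc θ ^ e * J (E.vdeg i) (E.vdeg w)
              = ∫⁻ _, θ ^ e * J (E.vdeg i) (E.vdeg w) ∂(gaussianReal 0 1) := by simp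
            _ ≤ _ := lintegral_mono fun y => hstep i w hi (Finset.mem_filter.1 hw).2 y
  have hde := deIter_eq (lam := lam) (rho := rho) hd A α l
  rw [hde, lintegral_F hd (isSymm_deSeq hd A α l true) (isSymm_deSeq hd A α l false) p hc]
  set L : ℕ → ℝ≥0∞ := fun i => ∑ i' ∈ lam.support, (nodeFrac lam i' / 2) * J i i'
  -- The factor 1/4 is the product of the two halves with which the prescribed symbols occur; the
  -- two factors θ pay for the degree counts of the two variable nodes.
  calc θ ^ (2 + e) / 4 * ∑ i ∈ lam.support, (nodeFrac lam i : ℝ≥0∞) *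
        ∑ i' ∈ lam.support, (nodeFrac lam i' : ℝ≥0∞) * J i i'
      = θ ^ (1 + e) * (θ * ∑ i ∈ lam.support, (nodeFrac lam i / 2) * L i) := by
        have h4 : (4 : ℝ≥0∞)⁻¹ = 2⁻¹ * 2⁻¹ := by
          rw [← ENNReal.mul_inv (by simp) (by simp)]; norm_num
        have hL : ∀ i, L i = 2⁻¹ * ∑ i' ∈ lam.support, (nodeFrac lam i' : ℝ≥0∞) * J i i' := by
          intro i
          simp only [L, Finset.mul_sum]
          refine Finset.sum_congr rfl fun i' _ => ?_
          rw [div_eq_mul_inv]; ring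
        simp only [hL, Finset.mul_sum _ _ (2⁻¹ : ℝ≥0∞)]
        rw [div_eq_mul_inv, h4, show 2 + e = 1 + e + 1 by ring, pow_succ, Finset.mul_sum,
          Finset.mul_sum, Finset.mul_sum]
        refine Finset.sum_congr rfl fun i _ => ?_
        rw [← Finset.mul_sum, div_eq_mul_inv]
        ring
    _ ≤ θ ^ (1 + e) * ∑ i ∈ Finset.univ.filter (fun i => x true i = p.1),
          (E.n : ℝ≥0∞)⁻¹ * L (E.vdeg i) := by
        gcongr
        exact sum_node_sign_le hE hn true p.1 L
    _ = ∑ i ∈ Finset.univ.filter (fun i => x true i = p.1),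
          (E.n : ℝ≥0∞)⁻¹ * (θ ^ e * (θ * L (E.vdeg i))) := by
        rw [Finset.mul_sum]
        refine Finset.sum_congr rfl fun i _ => ?_
        rw [pow_add, pow_one]; ring
    _ ≤ ∑ i ∈ Finset.univ.filter (fun i => x true i = p.1), (E.n : ℝ≥0∞)⁻¹ * S₀.mean x (G i) := by
        refine Finset.sum_le_sum fun i hi => ?_
        gcongr
        exact hnode i (Finset.mem_filter.1 hi).2
    _ ≤ _ := Finset.sum_le_sum_of_subset (Finset.filter_subset _ _)

end Degrees

/-! ### Typical counts in a sequence of ensembles -/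

lemma card_sigma_filter {m : ℕ} (d : Fin m → ℕ) (P : Fin m → Prop) [DecidablePred P] :
    (Finset.univ.filter fun s : Σ v, Fin (d v) => P s.1).card =
      ∑ v, if P v then d v else 0 := by
  rw [Finset.card_filter, Fintype.sum_sigma]
  refine Finset.sum_congr rfl fun v _ => ?_
  by_cases h : P v <;> simp [h]

/-- Excluding at most M nodes removes at most DM sockets. -/
lemma card_sigma_filter_ge {m D M : ℕ} (d : Fin m → ℕ) (hd : ∀ v, d v ≤ D) (P : Fin m → Prop)
    [DecidablePred P] (i : ℕ) (U : Finset (Fin m)) (hU : U.card ≤ M) :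
    i * (Finset.univ.filter fun v => d v = i ∧ P v).card ≤
      ((Finset.univ.filter fun s : Σ v, Fin (d v) => s.1 ∉ U ∧ P s.1).filter
        fun s => d s.1 = i).card + D * M := by
  rw [Finset.filter_filter, card_sigma_filter d fun v => (v ∉ U ∧ P v) ∧ d v = i]
  have h1 : ∑ v, (if v ∈ U then d v else 0) ≤ D * M := by
    rw [← Finset.sum_filter]
    refine (Finset.sum_le_card_nsmul _ _ D fun v _ => hd v).trans ?_
    rw [smul_eq_mul, mul_comm]
    exact Nat.mul_le_mul_left _ (by simpa using hU)
  refine le_trans ?_ (Nat.add_le_add_left h1 _)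
  rw [← Finset.sum_add_distrib, Finset.card_filter, Finset.mul_sum]
  refine Finset.sum_le_sum fun v _ => ?_
  by_cases h2 : v ∈ U <;> by_cases h3 : P v <;> by_cases h4 : d v = i <;> simp [h2, h3, h4]

lemma card_filter_ge {m M : ℕ} (d : Fin m → ℕ) (P : Fin m → Prop)
    [DecidablePred P] (i : ℕ) (U : Finset (Fin m)) (hU : U.card ≤ M) :
    (Finset.univ.filter fun v => d v = i ∧ P v).card ≤
      ((Finset.univ.filter fun v => v ∉ U ∧ P v).filter fun v => d v = i).card + M := by
  have h := Finset.card_le_card_sdiff_add_card (t := U)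
    (s := Finset.univ.filter fun v => d v = i ∧ P v)
  refine h.trans (Nat.add_le_add (Finset.card_le_card fun v hv => ?_) hU)
  rw [Finset.mem_sdiff, Finset.mem_filter] at hv
  rw [Finset.mem_filter, Finset.mem_filter]
  exact ⟨⟨Finset.mem_univ _, hv.2, hv.1.2.2⟩, hv.1.2.1⟩

lemma sum_eq_sum_mul_card {m D : ℕ} (d : Fin m → ℕ) (hd : ∀ v, d v ≤ D) (P : Fin m → Prop)
    [DecidablePred P] : ∑ v, (if P v then d v else 0) =
      ∑ i ∈ Finset.range (D + 1), i * (Finset.univ.filter fun v => d v = i ∧ P v).card := by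
  rw [← Finset.sum_filter, ← Finset.sum_fiberwise_of_maps_to (g := d) (t := Finset.range (D + 1))
    fun v _ => Finset.mem_range.2 (Nat.lt_succ_of_le (hd v))]
  refine Finset.sum_congr rfl fun i _ => ?_
  rw [Finset.sum_congr rfl fun v hv => (Finset.mem_filter.1 hv).2, Finset.sum_const, smul_eq_mul,
    mul_comm, Finset.filter_filter]
  simp only [and_comm]

/-- A strict inequality between limiting densities eventually absorbs any constant. This is how the
nodes already seen are neglected. -/
lemma eventually_add_le {n a b : ℕ → ℝ} (hn : Tendsto n atTop atTop) {A B : ℝ}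
    (ha : Tendsto (fun k => a k / n k) atTop (𝓝 A)) (hb : Tendsto (fun k => b k / n k) atTop (𝓝 B))
    (hAB : A < B) (c : ℝ) : ∀ᶠ k in atTop, a k + c ≤ b k := by
  have hc : Tendsto (fun k => c / n k) atTop (𝓝 0) := hn.const_div_atTop c
  have h := (ha.add hc).eventually_lt hb (by simpa using hAB)
  filter_upwards [h, hn.eventually_gt_atTop 0] with k hk hk0
  rw [← add_div] at hk
  exact ((div_lt_div_iff_of_pos_right hk0).1 hk).le

namespace Degrees

/-- The number of variable nodes of degree `i` with the symbol `ε`. -/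
def typeCard {E : Degrees} (x : Fin E.n → ℤˣ) (i : ℕ) (ε : ℤˣ) : ℕ :=
  (Finset.univ.filter fun v => E.vdeg v = i ∧ x v = ε).card

lemma typeCard_add {E : Degrees} (x : Fin E.n → ℤˣ) (i : ℕ) :
    typeCard x i 1 + typeCard x i (-1) =
      (Finset.univ.filter fun v => E.vdeg v = i).card := by
  have h := Finset.card_filter_add_card_filter_not
    (s := Finset.univ.filter fun v => E.vdeg v = i) (fun v : Fin E.n => x v = 1)
  rw [← h, typeCard, typeCard, Finset.filter_filter, Finset.filter_filter]
  congr 2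
  refine Finset.filter_congr fun v _ => and_congr_right fun _ => ?_
  rcases Int.units_eq_one_or (x v) with h | h <;> rw [h] <;> decide

end Degrees

section Limits

variable {E : ℕ → Degrees} {x : ∀ k, Fin (E k).n → ℤˣ}

lemma Realizes.tendsto_length (hE : Realizes E lam rho) :
    Tendsto (fun k => ((E k).n : ℝ)) atTop atTop :=
  tendsto_natCast_atTop_atTop.comp hE.length

lemma TypeOneHalf.tendsto_typeCard (hE : Realizes E lam rho) (hx : TypeOneHalf E lam x) (i : ℕ)
    (ε : ℤˣ) : Tendsto (fun k => (Degrees.typeCard (x k) i ε : ℝ) / (E k).n) atTop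
      (𝓝 ((nodeFrac lam i : ℝ) / 2)) := by
  rcases Int.units_eq_one_or ε with rfl | rfl
  · exact hx.half i
  · have h := (hE.vfrac i).sub (hx.half i)
    rw [show (nodeFrac lam i : ℝ) - nodeFrac lam i / 2 = nodeFrac lam i / 2 by ring] at h
    refine h.congr fun k => ?_
    rw [← Degrees.typeCard_add (x k) i, ← sub_div]
    congr 1
    push_cast
    exact add_sub_cancel_left _ _

/-- The inverse of the average degree of the variable nodes. -/
def degSum (lam : ℕ →₀ ℝ≥0) : ℝ := ((lam.sum fun j w => w / j : ℝ≥0) : ℝ)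

/-- The passage from node to edge perspective; it holds at i = 0 because λ has no mass there. -/
lemma mul_nodeFrac (hd : IsDegreePair lam rho) (i : ℕ) :
    (i : ℝ) * nodeFrac lam i = lam i / degSum lam := by
  rw [nodeFrac, degSum]
  rcases eq_or_ne i 0 with rfl | hi
  · simp [hd.lam_zero]
  · have : (i : ℝ) ≠ 0 := by exact_mod_cast hi
    push_cast
    field_simp

lemma degSum_pos (hd : IsDegreePair lam rho) : 0 < degSum lam := by
  have := hd.invMean_pos
  exact_mod_cast this

/-- Add i · L_i / 2 over the bounded degrees. Degrees above the bound never occur, so λ vanishes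
there and the λ_i in the range sum to one. -/
lemma tendsto_signCard (hd : IsDegreePair lam rho) (hE : Realizes E lam rho)
    (hx : TypeOneHalf E lam x) (ε : ℤˣ) :
    Tendsto (fun k => (Degrees.signCard (x k) ε : ℝ) / (E k).n) atTop
      (𝓝 ((degSum lam)⁻¹ / 2)) := by
  obtain ⟨D, hD⟩ := hE.bounded
  have h1 : ∀ k, (Degrees.signCard (x k) ε : ℝ) / (E k).n =
      ∑ i ∈ Finset.range (D + 1), (i : ℝ) * (Degrees.typeCard (x k) i ε / (E k).n) := by
    intro k
    rw [Degrees.signCard, card_sigma_filter (E k).vdeg fun v => x k v = ε,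
      sum_eq_sum_mul_card _ (hD k).1]
    push_cast
    rw [Finset.sum_div]
    exact Finset.sum_congr rfl fun i _ => mul_div_assoc _ _ _
  have h2 := tendsto_finsetSum (Finset.range (D + 1)) fun i _ =>
    (hx.tendsto_typeCard hE i ε).const_mul (i : ℝ)
  have h3 : ∑ i ∈ Finset.range (D + 1), (i : ℝ) * ((nodeFrac lam i : ℝ) / 2) =
      (degSum lam)⁻¹ / 2 := by
    have h4 : ∀ i, D < i → lam i = 0 := by
      intro i hi
      have h5 : (nodeFrac lam i : ℝ) = 0 := by
        refine tendsto_nhds_unique (hE.vfrac i) ?_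
        refine tendsto_const_nhds.congr fun k => ?_
        rw [Finset.filter_false_of_mem fun v _ => by have := (hD k).1 v; omega]
        simp
      have h6 := mul_nodeFrac hd i
      rw [h5, mul_zero, eq_comm, div_eq_zero_iff] at h6
      have := h6.resolve_right (degSum_pos hd).ne'
      exact_mod_cast this
    have h7 : ∑ i ∈ Finset.range (D + 1), (lam i : ℝ) = 1 := by
      rw [← NNReal.coe_sum, ← Finsupp.sum_of_support_subset lam (s := Finset.range (D + 1))
        (fun i hi => ?_) (fun _ w => w) (by simp), hd.lam_sum, NNReal.coe_one]
      rw [Finset.mem_range]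
      by_contra h
      exact Finsupp.mem_support_iff.1 hi (h4 i (by omega))
    simp only [← mul_div_assoc, mul_nodeFrac hd]
    rw [← Finset.sum_div, ← Finset.sum_div, h7, one_div]
  rw [h3] at h2
  exact h2.congr fun k => (h1 k).symm

/-- A Tanner graph exists, so there are as many check sockets as variable sockets, and each of the
latter carries one of the two symbols. -/
lemma card_sock_eq (k : ℕ) (hx : TypeOneHalf E lam x) :
    ∑ c, (E k).cdeg c = Degrees.signCard (x k) 1 + Degrees.signCard (x k) (-1) := by
  obtain ⟨σ, -⟩ := hx.codeword k
  have h1 : Fintype.card (E k).VSock = Fintype.card (E k).CSock := Fintype.card_congr σ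
  have h2 : Fintype.card (E k).CSock = ∑ c, (E k).cdeg c := by simp
  rw [← h2, ← h1, ← Finset.card_univ, Degrees.signCard, Degrees.signCard,
    ← Finset.card_filter_add_card_filter_not (fun s : (E k).VSock => x k s.1 = 1)]
  congr 2
  refine Finset.filter_congr fun s _ => ?_
  rcases Int.units_eq_one_or (x k s.1) with h | h <;> rw [h] <;> decide

lemma tendsto_sock (hd : IsDegreePair lam rho) (hE : Realizes E lam rho)
    (hx : TypeOneHalf E lam x) :
    Tendsto (fun k => ((∑ c, (E k).cdeg c : ℕ) : ℝ) / (E k).n) atTop (𝓝 (degSum lam)⁻¹) := by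
  have h := (tendsto_signCard hd hE hx 1).add (tendsto_signCard hd hE hx (-1))
  rw [add_halves] at h
  refine h.congr fun k => ?_
  rw [card_sock_eq k hx, ← add_div]
  push_cast
  rfl

lemma tendsto_sock_atTop (hd : IsDegreePair lam rho) (hE : Realizes E lam rho)
    (hx : TypeOneHalf E lam x) :
    Tendsto (fun k => ((∑ c, (E k).cdeg c : ℕ) : ℝ)) atTop atTop := by
  have h := (tendsto_sock hd hE hx).pos_mul_atTop (inv_pos.2 (degSum_pos hd)) hE.tendsto_length
  refine h.congr' ?_
  filter_upwards [hE.tendsto_length.eventually_gt_atTop 0] with k hk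
  field_simp

lemma tendsto_signCard_div (hd : IsDegreePair lam rho) (hE : Realizes E lam rho)
    (hx : TypeOneHalf E lam x) (ε : ℤˣ) :
    Tendsto (fun k => (Degrees.signCard (x k) ε : ℝ) / (∑ c, (E k).cdeg c : ℕ)) atTop
      (𝓝 (1 / 2)) := by
  have hS := (inv_pos.2 (degSum_pos hd)).ne'
  have h := (tendsto_signCard hd hE hx ε).div (tendsto_sock hd hE hx) hS
  rw [show (degSum lam)⁻¹ / 2 / (degSum lam)⁻¹ = 1 / 2 by
    rw [div_right_comm, div_self hS]] at h
  refine h.congr' ?_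
  filter_upwards [hE.tendsto_length.eventually_gt_atTop 0] with k hk
  exact div_div_div_cancel_right₀ hk.ne' _ _

end Limits

/-- Long ensembles are typical. -/
theorem eventually_typical (hd : IsDegreePair lam rho) {E : ℕ → Degrees}
    (hE : Realizes E lam rho) {x : ∀ k, Bool → Fin (E k).n → ℤˣ}
    (hx : ∀ b, TypeOneHalf E lam fun k => x k b) {D : ℕ}
    (hD : ∀ k, (∀ v, (E k).vdeg v ≤ D) ∧ (∀ c, (E k).cdeg c ≤ D)) (M : ℕ) {θ : ℝ} (hθ0 : 0 < θ)
    (hθ1 : θ < 1) :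
    ∀ᶠ k in atTop, Degrees.Typical lam rho (E k) (x k) D M (ENNReal.ofReal θ) := by
  obtain ⟨δ, hδ, N₀, hpat⟩ := Degrees.card_patternClass_ge D M hθ0 hθ1
  have hN := tendsto_sock_atTop hd hE (hx true)
  have hS := degSum_pos hd
  have e1 : ∀ b : Bool, ∀ᶠ k in atTop,
      |(Degrees.signCard (x k b) (-1) : ℝ) - (∑ c, (E k).cdeg c : ℕ) / 2| ≤
        δ * (∑ c, (E k).cdeg c : ℕ) := by
    intro b
    have h := tendsto_signCard_div hd hE (hx b) (-1)
    filter_upwards [Metric.tendsto_nhds.1 h δ hδ, hN.eventually_gt_atTop 0] with k hk hk0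
    rw [Real.dist_eq] at hk
    have h2 : (Degrees.signCard (x k b) (-1) : ℝ) - (∑ c, (E k).cdeg c : ℕ) / 2 =
        ((Degrees.signCard (x k b) (-1) : ℝ) / (∑ c, (E k).cdeg c : ℕ) - 1 / 2) *
          (∑ c, (E k).cdeg c : ℕ) := by
      field_simp
    rw [h2, abs_mul, abs_of_pos hk0]
    exact mul_le_mul_of_nonneg_right hk.le hk0.le
  have e2 : ∀ᶠ k in atTop, (N₀ : ℝ) ≤ ((∑ c, (E k).cdeg c : ℕ) : ℝ) :=
    hN.eventually_ge_atTop _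
  have e3 : ∀ (b : Bool) (ε : ℤˣ), ∀ j ∈ rho.support, ∀ᶠ k in atTop,
      θ * rho j * (2 * Degrees.signCard (x k b) ε) + (D * M : ℕ) ≤
        ((j * (Finset.univ.filter fun c => (E k).cdeg c = j).card : ℕ) : ℝ) := by
    intro b ε j hj
    have hj0 : (0 : ℝ) < rho j := by
      have := pos_iff_ne_zero.2 (Finsupp.mem_support_iff.1 hj)
      exact_mod_cast this
    -- Since θ < 1 and ρ_j > 0, the limits θρ_j < ρ_j leave room for the at most DM sockets of the
    -- checks already seen.
    refine eventually_add_le hN (A := θ * rho j * (2 * (1 / 2))) ?_ (hE.cfrac j) ?_ _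
    · refine (((tendsto_signCard_div hd hE (hx b) ε).const_mul 2).const_mul (θ * rho j)).congr
        fun k => ?_
      rw [mul_div_assoc, mul_div_assoc]
    · nlinarith
  have e4 : ∀ (b : Bool) (ε : ℤˣ), ∀ i ∈ lam.support, ∀ᶠ k in atTop,
      θ * lam i * Degrees.signCard (x k b) ε + (D * M : ℕ) ≤
        ((i * Degrees.typeCard (x k b) i ε : ℕ) : ℝ) := by
    intro b ε i hi
    have hi0 : (0 : ℝ) < lam i := by
      have := pos_iff_ne_zero.2 (Finsupp.mem_support_iff.1 hi)
      exact_mod_cast this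
    refine eventually_add_le hE.tendsto_length (A := θ * lam i * ((degSum lam)⁻¹ / 2))
      (B := i * (nodeFrac lam i / 2)) ?_ ?_ ?_ _
    · refine ((tendsto_signCard hd hE (hx b) ε).const_mul (θ * lam i)).congr fun k => ?_
      rw [mul_div_assoc]
    · refine (((hx b).tendsto_typeCard hE i ε).const_mul (i : ℝ)).congr fun k => ?_
      push_cast
      rw [mul_div_assoc]
    · have h1 := mul_nodeFrac hd i
      rw [div_eq_mul_inv] at h1
      have h2 : 0 < (lam i : ℝ) * (degSum lam)⁻¹ := by positivity
      have h3 : (i : ℝ) * (nodeFrac lam i / 2) = lam i * (degSum lam)⁻¹ / 2 := by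
        rw [← h1, mul_div_assoc]
      rw [h3]
      nlinarith
  have e5 : ∀ (b : Bool) (ε : ℤˣ), ∀ i ∈ lam.support, ∀ᶠ k in atTop,
      θ * (nodeFrac lam i / 2) * (E k).n + (M : ℕ) ≤ (Degrees.typeCard (x k b) i ε : ℝ) := by
    intro b ε i hi
    have hi0 : (0 : ℝ) < lam i := by
      have := pos_iff_ne_zero.2 (Finsupp.mem_support_iff.1 hi)
      exact_mod_cast this
    have hn0 : 0 < (nodeFrac lam i : ℝ) := by
      have h1 := mul_nodeFrac hd i
      have h2 : 0 < (lam i : ℝ) / degSum lam := by positivity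
      rw [← h1] at h2
      exact pos_of_mul_pos_right h2 (by positivity)
    refine eventually_add_le hE.tendsto_length (A := θ * (nodeFrac lam i / 2)) ?_
      ((hx b).tendsto_typeCard hE i ε) (by nlinarith) _
    refine tendsto_const_nhds.congr' ?_
    filter_upwards [hE.tendsto_length.eventually_gt_atTop 0] with k hk
    rw [mul_div_cancel_right₀ _ hk.ne']
  have e1' := eventually_all.2 e1
  have e3' := eventually_all.2 fun b => eventually_all.2 fun ε =>
    (Finset.eventually_all rho.support).2 (e3 b ε)
  have e4' := eventually_all.2 fun b => eventually_all.2 fun ε =>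
    (Finset.eventually_all lam.support).2 (e4 b ε)
  have e5' := eventually_all.2 fun b => eventually_all.2 fun ε =>
    (Finset.eventually_all lam.support).2 (e5 b ε)
  have hconv : ∀ (a : ℝ) (m : ℕ), a ≤ m → ENNReal.ofReal a ≤ (m : ℝ≥0∞) := fun a m h =>
    (ENNReal.ofReal_le_ofReal h).trans_eq (ENNReal.ofReal_natCast m)
  filter_upwards [e1', e2, e3', e4', e5'] with k h1 h2 h3 h4 h5
  constructor
  · exact (hD k).1
  · exact (hD k).2
  · exact hE.two_le k
  · intro b g R Q c hg hRQ hc hQ p hp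
    have h := hpat (E k) (x k b) g R Q c (fun c => ⟨hE.two_le k c, (hD k).2 c⟩) hg hRQ hc hQ
      (by exact_mod_cast h2) (h1 b) p hp
    have h' := hconv _ (2 ^ ((E k).cdeg c - 1) * (Degrees.patternClass (x k b) g R Q c p).card)
      (by push_cast; exact h)
    rw [ENNReal.ofReal_mul hθ0.le, ENNReal.ofReal_natCast] at h'
    push_cast at h'
    exact h'
  · intro b ε Q hQ j hj
    have hge := card_sigma_filter_ge (E k).cdeg (hD k).2 (fun _ => True) j Q hQ
    simp only [and_true] at hge
    have h := h3 b ε j hj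
    have hge' := (Nat.cast_le (α := ℝ)).2 hge
    rw [Nat.cast_add] at hge'
    have h' := hconv _ _ (by linarith : θ * rho j * (2 * Degrees.signCard (x k b) ε) ≤ _)
    rw [ENNReal.ofReal_mul (by positivity), ENNReal.ofReal_mul hθ0.le, ENNReal.ofReal_coe_nnreal,
      ENNReal.ofReal_mul (by norm_num), ENNReal.ofReal_natCast, ENNReal.ofReal_ofNat] at h'
    exact h'
  · intro b ε U hU i hi
    have hge := card_sigma_filter_ge (E k).vdeg (hD k).1 (fun v => x k b v = ε) i U hU
    have h := h4 b ε i hi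
    have hge' := (Nat.cast_le (α := ℝ)).2 hge
    rw [Nat.cast_add] at hge'
    have h' := hconv _ _ (by rw [Degrees.typeCard] at h; linarith :
      θ * lam i * Degrees.signCard (x k b) ε ≤ _)
    rw [ENNReal.ofReal_mul (by positivity), ENNReal.ofReal_mul hθ0.le, ENNReal.ofReal_coe_nnreal,
      ENNReal.ofReal_natCast] at h'
    exact h'
  · intro b ε U hU i hi
    have hge := card_filter_ge (E k).vdeg (fun v => x k b v = ε) i U hU
    have h := h5 b ε i hi
    have hge' := (Nat.cast_le (α := ℝ)).2 hge
    rw [Nat.cast_add] at hge'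
    have h' := hconv _ ((Finset.univ.filter fun v => v ∉ U ∧ x k b v = ε).filter
      fun v => (E k).vdeg v = i).card (by rw [Degrees.typeCard] at h; linarith :
      θ * (nodeFrac lam i / 2) * (E k).n ≤ _)
    rw [ENNReal.ofReal_mul (by positivity), ENNReal.ofReal_mul hθ0.le,
      ENNReal.ofReal_div_of_pos two_pos, ENNReal.ofReal_coe_nnreal,
      ENNReal.ofReal_natCast, ENNReal.ofReal_ofNat] at h'
    exact h'

/-! ### Convergence of the extrinsic estimates -/

section Domination

variable {S : Type*} [MeasurableSpace S] {μ ν : Measure S}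

lemma le_of_smul_le_smul [IsProbabilityMeasure ν] (hμ : μ Set.univ ≤ 1) {p q : ℝ} (hp : 0 ≤ p)
    (h : ENNReal.ofReal q • ν ≤ ENNReal.ofReal p • μ) : q ≤ p := by
  have h1 := h Set.univ
  rw [Measure.smul_apply, Measure.smul_apply, smul_eq_mul, smul_eq_mul, measure_univ,
    mul_one] at h1
  exact (ENNReal.ofReal_le_ofReal_iff hp).1 (h1.trans (mul_le_of_le_one_right' hμ))

lemma mul_integral_le_of_smul_le_smul [IsFiniteMeasure μ] {p q : ℝ} (hp : 0 ≤ p) (hq : 0 ≤ q)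
    (h : ENNReal.ofReal q • ν ≤ ENNReal.ofReal p • μ) {f : S → ℝ} (hf : Integrable f μ)
    (hf0 : ∀ s, 0 ≤ f s) : q * ∫ s, f s ∂ν ≤ p * ∫ s, f s ∂μ := by
  have h1 := integral_mono_measure h (Eventually.of_forall hf0)
    (hf.smul_measure ENNReal.ofReal_ne_top)
  rwa [integral_smul_measure, integral_smul_measure, ENNReal.toReal_ofReal hp,
    ENNReal.toReal_ofReal hq, smul_eq_mul, smul_eq_mul] at h1

/-- The domination is applied to the nonnegative functions C + f and C - f, which bounds the
difference from both sides by the excess mass. -/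
lemma abs_mul_integral_sub_le [IsProbabilityMeasure ν] (hμ : μ Set.univ ≤ 1) {p q : ℝ}
    (hp : 0 ≤ p) (hq : 0 ≤ q) (h : ENNReal.ofReal q • ν ≤ ENNReal.ofReal p • μ) {f : S → ℝ}
    (hf : Measurable f) {C : ℝ} (hC : ∀ s, |f s| ≤ C) :
    |p * ∫ s, f s ∂μ - q * ∫ s, f s ∂ν| ≤ C * (p - q) := by
  have : IsFiniteMeasure μ := ⟨hμ.trans_lt ENNReal.one_lt_top⟩
  have hC0 : 0 ≤ C := by
    obtain ⟨s⟩ := nonempty_of_isProbabilityMeasure ν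
    exact (abs_nonneg _).trans (hC s)
  have hm : μ.real Set.univ ≤ 1 := by
    rw [measureReal_def]
    exact ENNReal.toReal_le_of_le_ofReal zero_le_one (by simpa using hμ)
  have iμ : Integrable f μ := integrable_of_abs_le hf hC
  have iν : Integrable f ν := integrable_of_abs_le hf hC
  have h1 := mul_integral_le_of_smul_le_smul hp hq h (f := fun s => C + f s)
    ((integrable_const C).add iμ) fun s => by linarith [(abs_le.1 (hC s)).1]
  have h2 := mul_integral_le_of_smul_le_smul hp hq h (f := fun s => C - f s)
    ((integrable_const C).sub iμ) fun s => by linarith [(abs_le.1 (hC s)).2]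
  rw [integral_add (integrable_const C) iμ, integral_add (integrable_const C) iν,
    integral_const, integral_const, probReal_univ, smul_eq_mul, smul_eq_mul] at h1
  rw [integral_sub (integrable_const C) iμ, integral_sub (integrable_const C) iν,
    integral_const, integral_const, probReal_univ, smul_eq_mul, smul_eq_mul] at h2
  have h3 : p * (μ.real Set.univ * C) ≤ p * C :=
    mul_le_mul_of_nonneg_left (mul_le_of_le_one_left hC0 hm) hp
  rw [abs_le]
  constructor <;> nlinarith

/-- Weighted measures, the weights of which have sum at most one, converge to a uniform mixture
when they are eventually at least any smaller multiple of it. -/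
lemma tendsto_mul_integral {ι : Type*} [Fintype ι] {μ : ℕ → ι → Measure S}
    {ν : ι → Measure S} {p : ℕ → ι → ℝ} (hν : ∀ i, IsProbabilityMeasure (ν i))
    (hμ : ∀ k i, μ k i Set.univ ≤ 1) (hp : ∀ k i, 0 ≤ p k i) (hsum : ∀ k, ∑ i, p k i ≤ 1) {r : ℝ}
    (hr : 0 < r) (hcard : Fintype.card ι * r = 1)
    (h : ∀ η, 0 < η → η < 1 → ∀ i, ∀ᶠ k in atTop,
      ENNReal.ofReal (η * r) • ν i ≤ ENNReal.ofReal (p k i) • μ k i) (i : ι) {f : S → ℝ}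
    (hf : Measurable f) {C : ℝ} (hC : ∀ s, |f s| ≤ C) :
    Tendsto (fun k => p k i * ∫ s, f s ∂(μ k i)) atTop (𝓝 (r * ∫ s, f s ∂(ν i))) := by
  have hC0 : 0 ≤ C := by
    have := hν i
    obtain ⟨s⟩ := nonempty_of_isProbabilityMeasure (ν i)
    exact (abs_nonneg _).trans (hC s)
  have key : ∀ η, 0 < η → η < 1 → ∀ᶠ k in atTop,
      |p k i * ∫ s, f s ∂(μ k i) - r * ∫ s, f s ∂(ν i)| ≤ (C * (1 + r)) * (1 - η) := by
    intro η h0 h1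
    filter_upwards [eventually_all.2 (h η h0 h1)] with k hk
    have hle : ∀ j, η * r ≤ p k j := fun j => by
      have := hν j
      exact le_of_smul_le_smul (hμ k j) (hp k j) (hk j)
    -- All the other weights also exceed ηr and the sum is at most one, so no weight exceeds ηr by
    -- more than 1 - η.
    have hup : p k i - η * r ≤ 1 - η := by
      have h2 : p k i - η * r ≤ ∑ j, (p k j - η * r) :=
        Finset.single_le_sum (f := fun j => p k j - η * r) (fun j _ => sub_nonneg.2 (hle j))
          (Finset.mem_univ i)
      rw [Finset.sum_sub_distrib, Finset.sum_const, Finset.card_univ, nsmul_eq_mul,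
        mul_left_comm, hcard] at h2
      linarith [hsum k]
    have := hν i
    have h3 := abs_mul_integral_sub_le (hμ k i) (hp k i) (by positivity) (hk i) hf hC
    have h4 : |∫ s, f s ∂(ν i)| ≤ C := by
      have := norm_integral_le_of_norm_le_const (μ := ν i) (f := f) (C := C)
        (Eventually.of_forall hC)
      simpa using this
    have h5 : |(1 - η) * r * ∫ s, f s ∂(ν i)| ≤ (1 - η) * r * C := by
      rw [abs_mul, abs_of_nonneg (by nlinarith : 0 ≤ (1 - η) * r)]
      exact mul_le_mul_of_nonneg_left h4 (by nlinarith)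
    have h6 : C * (p k i - η * r) ≤ C * (1 - η) := mul_le_mul_of_nonneg_left hup hC0
    rw [abs_le] at h3 h5 ⊢
    constructor <;> nlinarith [h3.1, h3.2, h5.1, h5.2]
  rw [Metric.tendsto_nhds]
  intro ε hε
  set K := C * (1 + r)
  have hK : 0 ≤ K := by positivity
  obtain ⟨δ, hδ0, hδ1, hδ⟩ : ∃ δ : ℝ, 0 < δ ∧ δ < 1 ∧ K * δ < ε := by
    refine ⟨min (1 / 2) (ε / (K + 1) / 2), by positivity, (min_le_left _ _).trans_lt
      (by norm_num), ?_⟩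
    calc K * min (1 / 2) (ε / (K + 1) / 2) ≤ K * (ε / (K + 1) / 2) :=
          mul_le_mul_of_nonneg_left (min_le_right _ _) hK
      _ < ε := by
          rw [div_div, ← mul_div_assoc, div_lt_iff₀ (by positivity)]
          nlinarith
  filter_upwards [key (1 - δ) (by linarith) (by linarith)] with k hk
  rw [Real.dist_eq]
  refine hk.trans_lt ?_
  rwa [sub_sub_cancel]

end Domination

namespace Degrees

variable {E : Degrees}

lemma measurable_extrinsic (A α : ℝ) (x₁ x₂ : Fin E.n → ℤˣ) (σ₁ σ₂ : E.Tanner)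
    (τ : Equiv.Perm (Fin E.n)) (l : ℕ) (i : Fin E.n) :
    Measurable fun z => extrinsic A α σ₁ σ₂ τ (received A α x₁ x₂ τ z) l i := by
  set x : Bool → Fin E.n → ℤˣ := fun b => bif b then x₁ else x₂
  set ω : E.Conf := (fun b => bif b then σ₁ else σ₂, τ)
  have h : (fun z => extrinsic A α σ₁ σ₂ τ (received A α x₁ x₂ τ z) l i) = fun z =>
      (toFunMsg σ₁ (userMsg A α x l true ω z) i,
        toFunMsg σ₂ (userMsg A α x l false ω z) (τ i)) := by
    funext z
    have h1 : bpMsg A α σ₁ σ₂ τ (received A α x₁ x₂ τ z) l =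
      (userMsg A α x l true ω z, userMsg A α x l false ω z) := bpMsg_eq A α x ω z l
    rw [extrinsic, h1]
  rw [h]
  exact (measurable_toFunMsg _ (fun e => measurable_userMsg A α x l true ω e) i).prodMk
    (measurable_toFunMsg _ (fun e => measurable_userMsg A α x l false ω e) (τ i))

instance (n : ℕ) : IsProbabilityMeasure (noise n) := by unfold noise; infer_instance

lemma extrinsicLaw_univ_le (A α : ℝ) (x₁ x₂ : Fin E.n → ℤˣ) (l : ℕ) (p : Input) :
    extrinsicLaw A α x₁ x₂ l p Set.univ ≤ 1 := by
  rw [extrinsicLaw, Measure.smul_apply, Measure.finsetSum_apply, smul_eq_mul,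
    Finset.sum_congr rfl fun s _ => by
      rw [Measure.map_apply (measurable_extrinsic A α x₁ x₂ _ _ _ l _) MeasurableSet.univ,
        Set.preimage_univ, measure_univ],
    Finset.sum_const, nsmul_eq_mul, mul_one]
  exact ENNReal.inv_mul_le_one _

lemma inputProb_nonneg (x₁ x₂ : Fin E.n → ℤˣ) (p : Input) : 0 ≤ inputProb x₁ x₂ p := by
  unfold inputProb; positivity

lemma sum_inputProb_le (x₁ x₂ : Fin E.n → ℤˣ) : ∑ p, inputProb x₁ x₂ p ≤ 1 := by
  classical
  simp only [inputProb]
  rw [← Finset.sum_div, ← Nat.cast_sum]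
  refine div_le_one_of_le₀ ?_ (by positivity)
  rw [← Finset.card_univ, Finset.card_eq_sum_card_fiberwise (t := (Finset.univ : Finset Input))
    (f := fun s : Sample x₁ x₂ => inputAt x₁ x₂ s.2.2.1 s.2.2.2)
    fun _ _ => Finset.mem_coe.2 (Finset.mem_univ _)]
  refine le_of_eq ?_
  congr 1

-- The input probability times the conditional law is the joint law; this also holds when no sample
-- has the input p, as both sides are then zero.
open Classical in
lemma smul_extrinsicLaw_apply (A α : ℝ) (x₁ x₂ : Fin E.n → ℤˣ) (l : ℕ) (p : Input)
    {T : Set (EReal × EReal)} (hT : MeasurableSet T) :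
    (ENNReal.ofReal (inputProb x₁ x₂ p) • extrinsicLaw A α x₁ x₂ l p) T =
      (Fintype.card (Sample x₁ x₂) : ℝ≥0∞)⁻¹ * ∑ s ∈ samplesWith x₁ x₂ p,
        ∫⁻ z, T.indicator 1 (extrinsic A α s.1.1 s.2.1.1 s.2.2.1
          (received A α x₁ x₂ s.2.2.1 z) l s.2.2.2) ∂(noise E.n) := by
  rw [extrinsicLaw, Measure.smul_apply, Measure.smul_apply, Measure.finsetSum_apply, smul_eq_mul,
    smul_eq_mul]
  have h : ∀ s : Sample x₁ x₂, ∫⁻ z, T.indicator 1 (extrinsic A α s.1.1 s.2.1.1 s.2.2.1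
      (received A α x₁ x₂ s.2.2.1 z) l s.2.2.2) ∂(noise E.n) =
      (noise E.n).map (fun z => extrinsic A α s.1.1 s.2.1.1 s.2.2.1
        (received A α x₁ x₂ s.2.2.1 z) l s.2.2.2) T := by
    intro s
    rw [← lintegral_indicator_one hT, lintegral_map (measurable_one.indicator hT)
      (measurable_extrinsic A α x₁ x₂ _ _ _ l _)]
  simp only [h]
  rw [← mul_assoc]
  rcases (samplesWith x₁ x₂ p).eq_empty_or_nonempty with h0 | h0
  · rw [h0]; simp
  · have hc : (samplesWith x₁ x₂ p).card ≠ 0 := h0.card_pos.ne'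
    have hS : 0 < Fintype.card (Sample x₁ x₂) :=
      Fintype.card_pos_iff.2 ⟨h0.choose⟩
    congr 1
    rw [inputProb, ENNReal.ofReal_div_of_pos (by exact_mod_cast hS), ENNReal.ofReal_natCast,
      ENNReal.ofReal_natCast, div_eq_mul_inv, mul_right_comm,
      ENNReal.mul_inv_cancel (by exact_mod_cast hc) (ENNReal.natCast_ne_top _), one_mul]

end Degrees

lemma isProbabilityMeasure_F (hd : IsDegreePair lam rho) (p : Input) {a b : Measure EReal}
    (ha : IsSymm a) (hb : IsSymm b) : IsProbabilityMeasure (F lam rho p a b) := by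
  have h1 := (ha.varToFun hd).prob
  have h2 := (hb.varToFun hd).prob
  unfold F
  infer_instance

lemma isSymm_deIter (hd : IsDegreePair lam rho) (A α : ℝ) (l : ℕ) :
    IsSymm (deIter A α lam rho l).1 ∧ IsSymm (deIter A α lam rho l).2 := by
  rw [deIter_eq hd]
  exact ⟨isSymm_deSeq hd A α l true, isSymm_deSeq hd A α l false⟩

section Convergence

variable {E : ℕ → Degrees} {x₁ x₂ : ∀ k, Fin (E k).n → ℤˣ}

lemma eventually_smul_le (hd : IsDegreePair lam rho) (hE : Realizes E lam rho)
    (hx₁ : TypeOneHalf E lam x₁) (hx₂ : TypeOneHalf E lam x₂) (A α : ℝ) (l : ℕ) {η : ℝ}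
    (hη0 : 0 < η) (hη1 : η < 1) (p : Input) :
    ∀ᶠ k in atTop, ENNReal.ofReal (η * (1 / 4)) •
        F lam rho p (deIter A α lam rho l).1 (deIter A α lam rho l).2 ≤
      ENNReal.ofReal (Degrees.inputProb (x₁ k) (x₂ k) p) •
        Degrees.extrinsicLaw A α (x₁ k) (x₂ k) l p := by
  obtain ⟨D, hD⟩ := hE.bounded
  set e := 2 + 2 * D * (2 + D * Degrees.depthCost D l)
  set x : ∀ k, Bool → Fin (E k).n → ℤˣ := fun k b => bif b then x₁ k else x₂ k
  have hx : ∀ b, TypeOneHalf E lam fun k => x k b := by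
    intro b; cases b
    · exact hx₂
    · exact hx₁
  -- The exponent e depends only on l and the degree bound, so θ can be chosen before the block
  -- length, close enough to 1 that the total loss stays above η.
  obtain ⟨θ, hθ0, hθ1, hθe⟩ : ∃ θ : ℝ, 0 < θ ∧ θ < 1 ∧ η ≤ θ ^ e := by
    have hc : Tendsto (fun t : ℝ => t ^ e) (𝓝[<] 1) (𝓝 1) := by
      have := (continuous_pow e).tendsto (1 : ℝ)
      rw [one_pow] at this
      exact this.mono_left nhdsWithin_le_nhds
    have h1 := hc.eventually_const_le hη1
    have h2 : ∀ᶠ t : ℝ in 𝓝[<] 1, t ∈ Set.Ioo 0 1 := Ioo_mem_nhdsLT one_pos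
    obtain ⟨θ, h3, h4⟩ := (h1.and h2).exists
    exact ⟨θ, h4.1, h4.2, h3⟩
  filter_upwards [eventually_typical hd hE hx hD
    (1 + 2 * D * (2 + D * Degrees.depthCost D l)) hθ0 hθ1, hE.length.eventually_ne_atTop 0]
    with k hk hn
  refine Measure.le_iff.2 fun T hT => ?_
  rw [Degrees.smul_extrinsicLaw_apply A α _ _ l p hT, Measure.smul_apply, smul_eq_mul]
  have h := Degrees.lintegral_F_le (A := A) (α := α) (ENNReal.ofReal_pos.2 hθ0).ne'
    (ENNReal.ofReal_le_one.2 hθ1.le) hd hk hn l le_rfl (fun b => (hx b).codeword k) p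
    ((measurable_one (α := ℝ≥0∞)).indicator hT)
  rw [lintegral_indicator_one hT] at h
  refine le_trans (mul_le_mul_left ?_ _) h
  rw [ENNReal.ofReal_mul hη0.le, ENNReal.ofReal_div_of_pos (by norm_num), ENNReal.ofReal_one,
    one_div, ENNReal.ofReal_ofNat, div_eq_mul_inv, ← ENNReal.ofReal_pow hθ0.le]
  exact mul_le_mul_left (ENNReal.ofReal_le_ofReal hθe) _

/-- Domination gives more than weak convergence: f need only be bounded and measurable. At finite
length the law of the estimate is not known to avoid the jumps of `kernel`, so this generality is
needed. -/
lemma tendsto_inputProb_mul_integral (hd : IsDegreePair lam rho) (hE : Realizes E lam rho)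
    (hx₁ : TypeOneHalf E lam x₁) (hx₂ : TypeOneHalf E lam x₂) (A α : ℝ) (l : ℕ) (p : Input)
    {f : EReal × EReal → ℝ} (hf : Measurable f) {C : ℝ} (hC : ∀ s, |f s| ≤ C) :
    Tendsto (fun k => Degrees.inputProb (x₁ k) (x₂ k) p *
        ∫ s, f s ∂(Degrees.extrinsicLaw A α (x₁ k) (x₂ k) l p)) atTop
      (𝓝 (1 / 4 * ∫ s, f s ∂(F lam rho p (deIter A α lam rho l).1 (deIter A α lam rho l).2))) := by
  have hs := isSymm_deIter hd A α l
  exact tendsto_mul_integral (μ := fun k p => Degrees.extrinsicLaw A α (x₁ k) (x₂ k) l p)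
    (p := fun k p => Degrees.inputProb (x₁ k) (x₂ k) p)
    (ν := fun p => F lam rho p (deIter A α lam rho l).1 (deIter A α lam rho l).2)
    (fun p => isProbabilityMeasure_F hd p hs.1 hs.2)
    (fun k p => Degrees.extrinsicLaw_univ_le A α _ _ l p)
    (fun k p => Degrees.inputProb_nonneg _ _ p) (fun k => Degrees.sum_inputProb_le _ _)
    (by norm_num) (by simp [Fintype.card_prod, Fintype.card_units_int])
    (fun η h0 h1 p => eventually_smul_le hd hE hx₁ hx₂ A α l h0 h1 p) p hf hC

lemma inputProb_mul_extrinsicLaw_univ {E : Degrees} (A α : ℝ) (x₁ x₂ : Fin E.n → ℤˣ) (l : ℕ)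
    (p : Input) : Degrees.inputProb x₁ x₂ p *
      (Degrees.extrinsicLaw A α x₁ x₂ l p).real Set.univ = Degrees.inputProb x₁ x₂ p := by
  rcases (Degrees.samplesWith x₁ x₂ p).eq_empty_or_nonempty with h0 | h0
  · simp [Degrees.inputProb, h0]
  · have hc : (Degrees.samplesWith x₁ x₂ p).card ≠ 0 := h0.card_pos.ne'
    rw [measureReal_def, Degrees.extrinsicLaw, Measure.smul_apply, Measure.finsetSum_apply,
      smul_eq_mul, Finset.sum_congr rfl fun s _ => by
        rw [Measure.map_apply (Degrees.measurable_extrinsic A α x₁ x₂ _ _ _ l _)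
          MeasurableSet.univ, Set.preimage_univ, measure_univ],
      Finset.sum_const, nsmul_eq_mul, mul_one,
      ENNReal.inv_mul_cancel (by exact_mod_cast hc) (ENNReal.natCast_ne_top _),
      ENNReal.toReal_one, mul_one]

/-- The case f = 1, at iteration zero and with gains zero, since the input does not depend on the
channel. -/
lemma tendsto_inputProb (hd : IsDegreePair lam rho) (hE : Realizes E lam rho)
    (hx₁ : TypeOneHalf E lam x₁) (hx₂ : TypeOneHalf E lam x₂) (p : Input) :
    Tendsto (fun k => Degrees.inputProb (x₁ k) (x₂ k) p) atTop (𝓝 (1 / 4)) := by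
  have h := tendsto_inputProb_mul_integral hd hE hx₁ hx₂ 0 0 0 p (f := fun _ => 1)
    measurable_const (C := 1) fun _ => by simp
  have hs := isSymm_deIter hd 0 0 0
  have := isProbabilityMeasure_F hd p hs.1 hs.2
  simpa only [integral_const, smul_eq_mul, mul_one, probReal_univ,
    inputProb_mul_extrinsicLaw_univ] using h

/-- The extrinsic estimates at a fixed iteration converge to independent messages of density
evolution. -/
theorem weakTendsto_extrinsicLaw (hd : IsDegreePair lam rho) (hE : Realizes E lam rho)
    (hx₁ : TypeOneHalf E lam x₁) (hx₂ : TypeOneHalf E lam x₂) (A α : ℝ) (l : ℕ) (p : Input) :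
    WeakTendsto (fun k => Degrees.extrinsicLaw A α (x₁ k) (x₂ k) l p)
      (F lam rho p (deIter A α lam rho l).1 (deIter A α lam rho l).2) := by
  intro f
  obtain ⟨C, hC⟩ := exists_abs_le f
  have h1 := tendsto_inputProb hd hE hx₁ hx₂ p
  have h := (tendsto_inputProb_mul_integral hd hE hx₁ hx₂ A α l p f.continuous.measurable hC).div
    h1 (by norm_num)
  rw [mul_div_cancel_left₀ _ (by norm_num)] at h
  refine h.congr' ?_
  filter_upwards [h1.eventually_ne (by norm_num : (1 / 4 : ℝ) ≠ 0)] with k hk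
  exact mul_div_cancel_left₀ _ hk

lemma tendsto_bpGexit (hd : IsDegreePair lam rho) (hE : Realizes E lam rho)
    (hx₁ : TypeOneHalf E lam x₁) (hx₂ : TypeOneHalf E lam x₂) (A α : ℝ) (l : ℕ) :
    Tendsto (fun k => Degrees.bpGexit A α (x₁ k) (x₂ k) l) atTop
      (𝓝 (gexitValue A α lam rho (deIter A α lam rho l).1 (deIter A α lam rho l).2)) := by
  unfold Degrees.bpGexit gexitValue
  refine tendsto_finsetSum _ fun p _ => ?_
  obtain ⟨C, hC⟩ := exists_abs_kernel_le A α p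
  exact tendsto_inputProb_mul_integral hd hE hx₁ hx₂ A α l p (measurable_kernel A α p) hC

end Convergence

lemma symmTendsto_of_isReachedFixedPoint (hd : IsDegreePair lam rho) {A α : ℝ}
    {a b : ProbabilityMeasure EReal}
    (h : IsReachedFixedPoint A α lam rho (a : Measure EReal) (b : Measure EReal)) :
    SymmTendsto (fun l => (deIter A α lam rho l).1) (a : Measure EReal) ∧
      SymmTendsto (fun l => (deIter A α lam rho l).2) (b : Measure EReal) := by
  have hs := fun l => isSymm_deIter hd A α l
  exact ⟨⟨fun l => (hs l).1, isSymm_of_weakTendsto (fun l => (hs l).1) a.2 h.2.1, h.2.1⟩,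
    ⟨fun l => (hs l).2, isSymm_of_weakTendsto (fun l => (hs l).2) b.2 h.2.2, h.2.2⟩⟩

end GMAC

end

/-! ### Assembly of the three pieces -/

theorem lemma2 (A : ℝ) (hA : 0 ≤ A) (lam rho : ℕ →₀ ℝ≥0)
    (hlam0 : lam 0 = 0) (hlam : lam.sum (fun _ w => w) = 1)
    (hrho0 : rho 0 = 0) (hrho1 : rho 1 = 0) (hrho : rho.sum (fun _ w => w) = 1)
    (E : ℕ → GMAC.Degrees) (hE : GMAC.Realizes E lam rho)
    (x₁ x₂ : ∀ k, Fin (E k).n → ℤˣ)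
    (hx₁ : GMAC.TypeOneHalf E lam x₁) (hx₂ : GMAC.TypeOneHalf E lam x₂)
    (α : ℝ) (hα : 0 ≤ α) :
    (∃ a b : ProbabilityMeasure EReal,
      GMAC.IsReachedFixedPoint A α lam rho (a : Measure EReal) (b : Measure EReal)) ∧
    ∀ a b : ProbabilityMeasure EReal,
      GMAC.IsReachedFixedPoint A α lam rho (a : Measure EReal) (b : Measure EReal) →
      (∀ (l : ℕ) (x : GMAC.Input),
        GMAC.WeakTendsto (fun k => GMAC.Degrees.extrinsicLaw A α (x₁ k) (x₂ k) l x)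
          (GMAC.F lam rho x (GMAC.deIter A α lam rho l).1 (GMAC.deIter A α lam rho l).2)) ∧
      (∀ x : GMAC.Input,
        GMAC.WeakTendsto
          (fun l => GMAC.F lam rho x (GMAC.deIter A α lam rho l).1 (GMAC.deIter A α lam rho l).2)
          (GMAC.F lam rho x (a : Measure EReal) (b : Measure EReal))) ∧
      (∀ x : GMAC.Input, Integrable (GMAC.kernel A α x)
        (GMAC.F lam rho x (a : Measure EReal) (b : Measure EReal))) ∧
      (∀ (k l : ℕ) (x : GMAC.Input), Integrable (GMAC.kernel A α x)
        (GMAC.Degrees.extrinsicLaw A α (x₁ k) (x₂ k) l x)) ∧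
      GMAC.HasAsymptoticBPGexit A α E x₁ x₂
        (GMAC.gexitValue A α lam rho (a : Measure EReal) (b : Measure EReal)) := by
  have hd : GMAC.IsDegreePair lam rho := ⟨hlam0, hlam, hrho0, hrho1, hrho⟩
  refine ⟨GMAC.exists_isReachedFixedPoint hd A α, fun a b hab => ?_⟩
  obtain ⟨ha, hb⟩ := GMAC.symmTendsto_of_isReachedFixedPoint hd hab
  refine ⟨fun l x => GMAC.weakTendsto_extrinsicLaw hd hE hx₁ hx₂ A α l x,
    fun x => GMAC.WeakTendsto.F hd ha hb x, fun x => ?_, fun k l x => ?_,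
    _, fun l => GMAC.tendsto_bpGexit hd hE hx₁ hx₂ A α l,
    GMAC.tendsto_gexitValue hd A α ha hb⟩
  · have := GMAC.isProbabilityMeasure_F hd x ha.lim hb.lim
    exact GMAC.integrable_kernel A α x _
  · have : IsFiniteMeasure (GMAC.Degrees.extrinsicLaw A α (x₁ k) (x₂ k) l x) :=
      ⟨(GMAC.Degrees.extrinsicLaw_univ_le A α _ _ l x).trans_lt ENNReal.one_lt_top⟩
    exact GMAC.integrable_kernel A α x _
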